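/- Let $\mathbb T=\mathbb R/2\pi\mathbb Z$. Let $\Phi\in C^\infty(\mathbb T^2)$ be even, $\Phi(-x)=\Phi(x)$, and let $\Psi\in C^\infty(\mathbb T)$ be of the form $\Psi(\theta)=\sin(\theta)\,\psi(\theta)$ with $0\le\psi\in C^\infty(\mathbb T)$ and $\int_{-\pi}^{\pi}\Psi\,d\theta=0$. Let $v\in C^\infty([0,\infty))$ take values in $(1/2,1]$, let $\kappa,\nu\in(0,1]$, and let $0<f_0\in C^\infty(\mathbb T^3)$ with $\int_{\mathbb T^3} f_0\,dx\,d\theta=1$. Let $f=f(t,x,\theta)$ be a global classical solution on $[0,\infty)\times\mathbb T^2\times\mathbb T$ of $$\partial_t f+v(t)\,\mathbf p(\theta)\cdot\nabla_x f+\kappa\,\partial_\theta\big(f\,L[f]\big)=\nu\,\partial_\theta^2 f,\qquad f(0,\cdot)=f_0,\qquad \mathbf p(\theta)=(\cos\theta,\sin\theta),$$ $$L[f](t,x,\theta)=\int_{\mathbb T}\int_{\mathbb T^2}\Phi(y-x)\,\Psi(\eta-\theta)\,f(t,y,\eta)\,dy\,d\eta .$$ Write $\langle f\rangle(t,\theta)=(2\pi)^{-2}\int_{\mathbb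 T^2}f(t,x,\theta)\,dx$, $f_{\neq}=f-\langle f\rangle$, and $f_{0;\neq}=f_0-\langle f_0\rangle$. There are universal constants $C_1\ge1$ and $\delta\in(0,1)$ such that the following two claims hold. **a) Enhanced dissipation.** There are a threshold $\mathfrak a=\mathfrak a(\Phi,\Psi,\|f_0\|_{L^2})>0$ and a constant $C_2=C_2(\Phi,\Psi)>0$ such that, if $0<\kappa\le\nu^{5/6+\widetilde\gamma}\le\mathfrak a$ for some $\widetilde\gamma>0$, then for all $t\ge0$ $$\|f_{\neq}(t)\|_{L^2}\le C_1\,\|f_{0;\neq}\|_{L^2}\,e^{-\delta\nu^{1/2}t},\qquad \|\langle f\rangle(t)\|_{L^2}\le C_2\,\big(1+\|\langle f_0\rangle\|_{L^2}\big)\Big(1+\frac{\kappa^{1/2}}{\nu^{1/2}}\Big).$$ **b) Mixing.** If $v\equiv1$ and $0<\kappa\le C_\dagger\nu$ for some constant $C_\dagger\ge1$, then $$\|f_{\neq}(t)\|_{\dot H^{-1}}\le C_3\,\frac{\|f_{0;\neq}\|_{H^1}}{t^{1/2}},\qquad 0<t\le\delta^{-1}\nu^{-1/2},$$ where $C_3=C_3(\Phi,\Psi,\delta^{-1},C_\dagger,\|\langle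 f_0\rangle\|_{L^2})$. -/

import Mathlib

open scoped Real ContDiff ENNReal

noncomputable section

namespace Vicsek

/-- Functions of `(x₁, x₂, θ)`. Functions on the torus `𝕋³ = (ℝ/2πℤ)³` are represented by functions
on `ℝ³` that are `2π`-periodic in each variable. -/
abbrev Fun3 := ℝ → ℝ → ℝ → ℝ

/-- `2π`-periodicity in each of the three variables. -/
def Periodic3 (h : Fun3) : Prop :=
  ∀ x₁ x₂ θ : ℝ, h (x₁ + 2 * π) x₂ θ = h x₁ x₂ θ ∧ h x₁ (x₂ + 2 * π) θ = h x₁ x₂ θ ∧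
    h x₁ x₂ (θ + 2 * π) = h x₁ x₂ θ

/-- `C^∞` functions on the torus `𝕋³`. -/
structure SmoothTorus (h : Fun3) : Prop where
  periodic : Periodic3 h
  smooth : ContDiff ℝ ∞ (fun q : ℝ × ℝ × ℝ => h q.1 q.2.1 q.2.2)

/-- Integration over `𝕋³`. -/
def integral3 (h : Fun3) : ℝ :=
  ∫ x₁ in (-π)..π, ∫ x₂ in (-π)..π, ∫ θ in (-π)..π, h x₁ x₂ θ

/-- Norm of `L²(𝕋³)`. -/
def normL2 (h : Fun3) : ℝ :=
  Real.sqrt (integral3 fun x₁ x₂ θ => (h x₁ x₂ θ) ^ 2)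

/-- Norm of `L²(𝕋)` (functions of the angle alone). -/
def normL2Angle (g : ℝ → ℝ) : ℝ :=
  Real.sqrt (∫ θ in (-π)..π, (g θ) ^ 2)

/-- The partial derivative in `x₁`. -/
def dx₁ (h : Fun3) : Fun3 := fun x₁ x₂ θ => deriv (fun s => h s x₂ θ) x₁

/-- The partial derivative in `x₂`. -/
def dx₂ (h : Fun3) : Fun3 := fun x₁ x₂ θ => deriv (fun s => h x₁ s θ) x₂

/-- The partial derivative in `θ`. -/
def dθ (h : Fun3) : Fun3 := fun x₁ x₂ θ => deriv (fun s => h x₁ x₂ s) θ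

/-- `‖∇h‖_{L²(𝕋³)}`, the homogeneous Sobolev (semi)norm of `Ḣ¹(𝕋³)`, for smooth `h`. -/
def normGrad (h : Fun3) : ℝ :=
  Real.sqrt (normL2 (dx₁ h) ^ 2 + normL2 (dx₂ h) ^ 2 + normL2 (dθ h) ^ 2)

/-- Norm of `H¹(𝕋³)`, for smooth `h`. -/
def normH1 (h : Fun3) : ℝ :=
  Real.sqrt (normL2 h ^ 2 + normGrad h ^ 2)

/-- Norm of `Ḣ⁻¹(𝕋³)`, the dual of `Ḣ¹(𝕋³)`: the supremum of `|∫ h φ|` over the smooth test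
functions `φ` on `𝕋³` with `‖∇φ‖_{L²} ≤ 1` (it is `∞` when the mean of `h` is not zero). -/
def normHneg1 (h : Fun3) : ℝ≥0∞ :=
  ⨆ (φ : Fun3) (_ : SmoothTorus φ ∧ normGrad φ ≤ 1),
    ENNReal.ofReal |integral3 fun x₁ x₂ θ => h x₁ x₂ θ * φ x₁ x₂ θ|

/-- The `x`-average `⟨h⟩(θ) = (2π)⁻² ∫_{𝕋²} h(x, θ) dx`. -/
def avg (h : Fun3) : ℝ → ℝ := fun θ =>
  1 / (2 * π) ^ 2 * ∫ x₁ in (-π)..π, ∫ x₂ in (-π)..π, h x₁ x₂ θ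

/-- The remainder `h_≠ = h - ⟨h⟩`. -/
def rem (h : Fun3) : Fun3 := fun x₁ x₂ θ => h x₁ x₂ θ - avg h θ

/-- Spatial influence functions: `Φ ∈ C^∞(𝕋²)`, even. -/
structure SpatialInfluence (Φ : ℝ → ℝ → ℝ) : Prop where
  periodic : ∀ x₁ x₂ : ℝ, Φ (x₁ + 2 * π) x₂ = Φ x₁ x₂ ∧ Φ x₁ (x₂ + 2 * π) = Φ x₁ x₂
  smooth : ContDiff ℝ ∞ (fun q : ℝ × ℝ => Φ q.1 q.2)
  even : ∀ x₁ x₂ : ℝ, Φ (-x₁) (-x₂) = Φ x₁ x₂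

/-- Angular influence functions: `Ψ = sin · ψ` with `0 ≤ ψ ∈ C^∞(𝕋)`, and `∫ Ψ = 0`. -/
structure AngularInfluence (Ψ : ℝ → ℝ) : Prop where
  factor : ∃ ψ : ℝ → ℝ, Function.Periodic ψ (2 * π) ∧ ContDiff ℝ ∞ ψ ∧ (∀ θ, 0 ≤ ψ θ) ∧
    ∀ θ, Ψ θ = Real.sin θ * ψ θ
  integral_eq_zero : ∫ θ in (-π)..π, Ψ θ = 0

/-- The alignment operator
`L[h](x, θ) = ∫_𝕋 ∫_{𝕋²} Φ(y - x) Ψ(η - θ) h(y, η) dy dη`. -/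
def alignment (Φ : ℝ → ℝ → ℝ) (Ψ : ℝ → ℝ) (h : Fun3) : Fun3 := fun x₁ x₂ θ =>
  ∫ η in (-π)..π, ∫ y₁ in (-π)..π, ∫ y₂ in (-π)..π,
    Φ (y₁ - x₁) (y₂ - x₂) * Ψ (η - θ) * h y₁ y₂ η

/-- Initial data: smooth, positive, of total mass one. -/
structure InitialDatum (f₀ : Fun3) : Prop where
  smooth : SmoothTorus f₀
  pos : ∀ x₁ x₂ θ, 0 < f₀ x₁ x₂ θ
  mass : integral3 f₀ = 1

/-- Speed profiles: `v ∈ C^∞([0,∞))` with values in `(1/2, 1]`. -/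
structure SpeedProfile (v : ℝ → ℝ) : Prop where
  smooth : ContDiffOn ℝ ∞ v (Set.Ici 0)
  range : ∀ t, 0 ≤ t → 1 / 2 < v t ∧ v t ≤ 1

/-- Global classical solutions of
`∂ₜ f + v(t) p(θ) · ∇ₓ f + κ ∂_θ (f L[f]) = ν ∂_θ² f`, `p(θ) = (cos θ, sin θ)`, on `[0,∞) × 𝕋³`
with `f(0) = f₀`: continuous up to `t = 0`, and for `t > 0` continuously differentiable in all
variables and twice continuously differentiable in `θ`. -/
structure ClassicalSolution (Φ : ℝ → ℝ → ℝ) (Ψ : ℝ → ℝ) (v : ℝ → ℝ) (κ ν : ℝ)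
    (f₀ : Fun3) (f : ℝ → Fun3) : Prop where
  periodic : ∀ t, 0 ≤ t → Periodic3 (f t)
  continuous : ContinuousOn (fun q : ℝ × ℝ × ℝ × ℝ => f q.1 q.2.1 q.2.2.1 q.2.2.2)
    (Set.Ici 0 ×ˢ Set.univ)
  contDiff : ContDiffOn ℝ 1 (fun q : ℝ × ℝ × ℝ × ℝ => f q.1 q.2.1 q.2.2.1 q.2.2.2)
    (Set.Ioi 0 ×ˢ Set.univ)
  differentiable_dθ : ∀ t, 0 < t → ∀ x₁ x₂, Differentiable ℝ (fun θ => dθ (f t) x₁ x₂ θ)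
  continuous_dθdθ :
    ContinuousOn (fun q : ℝ × ℝ × ℝ × ℝ => dθ (dθ (f q.1)) q.2.1 q.2.2.1 q.2.2.2)
      (Set.Ioi 0 ×ˢ Set.univ)
  equation : ∀ t, 0 < t → ∀ x₁ x₂ θ,
    deriv (fun s => f s x₁ x₂ θ) t
      + v t * (Real.cos θ * dx₁ (f t) x₁ x₂ θ + Real.sin θ * dx₂ (f t) x₁ x₂ θ)
      + κ * dθ (fun y₁ y₂ η => f t y₁ y₂ η * alignment Φ Ψ (f t) y₁ y₂ η) x₁ x₂ θ
      = ν * dθ (dθ (f t)) x₁ x₂ θ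
  initial : ∀ x₁ x₂ θ, f 0 x₁ x₂ θ = f₀ x₁ x₂ θ

end Vicsek

end

/-!
The solution is expanded in Fourier series in `x`. For `k ≠ 0`, after a rotation of the angle, the
mode `k` is a complex-valued function `u(t, θ)` on the circle with `∂ₜ u = ν u'' + i v q cos θ u +
∂_θ p`, `q = |k| ≥ 1`, where `p` is `-κ` times the mode `k` of the alignment flux. It is handled
through its real and imaginary parts, the integrals against `cos (k · x)` and `sin (k · x)`.
Parseval's identity (`hasSum_modeSq`) turns estimates that are uniform in `k` into estimates for
`f_≠`. The flux of the average alone does not depend on `x`, so the forcing is controlled by `κ²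
(1 + ‖⟨f⟩‖²) ‖f_≠‖²` (`integral3_sq_fluxRem_le`).

*Enhanced dissipation.* The shear `q cos θ` degenerates only at its critical points `θ ∈ πℤ`. The
relevant distance from them is `d = (ν / q)^{1/4}`, at which `ν d⁻² = q d² = (νq)^{1/2}`. Adding
to `‖u‖²` a small multiple of a cross term between the translates `u(θ ± d)`, with weight `d sin θ
/ (sin² θ + d²)`, makes the transport term damp `‖u‖²` at the rate `(νq)^{1/2}` away from these
points, because `cos (θ - d) - cos (θ + d) = 2 sin θ sin d`; near them the mass of `u` is
controlled by the mass further away and by the diffusion (`integral_sq_le_farWeight`). No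
derivative of the data enters (`ModeData.deriv_functional_le`). Summing over `k`, `‖f_≠‖²` decays
at the rate `ν^{1/2}` as long as `κ² (1 + ‖⟨f⟩‖²) / ν` is small compared with `ν^{1/2}`
(`ClassicalSolution.remSq_le_exp`). For the averages, positivity and conservation of mass give
Nash's inequality `‖⟨f⟩‖⁶ ≤ 16 ‖∂_θ ⟨f⟩‖²` when `‖⟨f⟩‖² ≥ 2`, so the dissipation dominates the
quadratic alignment term as soon as `‖⟨f⟩‖²` exceeds a multiple of `1 + (κ/ν)^{1/2}`. For small
`κ` with `κ⁶ ≤ ν⁵` the two estimates close by continuity in time (`ClassicalSolution.bootstrap`).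

*Mixing.* When `v = 1` and `κ ≤ Cd ν`, the averages are bounded uniformly in `ν`, and on `νt² ≤
δ⁻²` the mode is compared with a solution of the unforced equation having the same data; the
difference costs `O((νt)^{1/2}) = O(t^{-1/2})` in `L²`. For the unforced equation the vector field
`∂_θ + i t q sin θ` commutes with the inviscid flow. It is controlled together with the norm of
`u` weighted by `s² / (sin² θ + s²)`, `s = t^{-1/2}`, which localizes to the critical layers; an
integration by parts away from the layers then bounds the pairing of `u(t)` with an `H¹` function
by `t^{-1/2}` (`LinearFlow.sq_pairing_le`). The unforced solution is not constructed:
trigonometric polynomials that satisfy the equation up to a small residual, obtained by truncating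
the frequencies in `θ`, suffice (`exists_linearFlow`). Summing over `k` gives the bound in `Ḣ⁻¹`.
For `t < 1` it follows from the bound on `‖f_≠‖`.
-/

namespace Vicsek

open Set Filter Topology MeasureTheory

/-! ### Parametric integrals and periodic functions -/

theorem continuousOn_integral_param {Y : Type*} [TopologicalSpace Y] {S : Set Y} {F : Y → ℝ → ℝ}
    (hF : ContinuousOn (fun p : Y × ℝ => F p.1 p.2) (S ×ˢ univ)) (a b : ℝ) :
    ContinuousOn (fun y => ∫ x in a..b, F y x) S := by
  rw [continuousOn_iff_continuous_domRestrict]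
  refine intervalIntegral.continuous_parametric_intervalIntegral_of_continuous'
    (f := fun (y : S) x => F y x) (μ := volume) ?_ a b
  exact hF.comp_continuous (f := fun p : S × ℝ => ((p.1 : Y), p.2)) (by fun_prop) (fun p => by simp)

theorem hasDerivAt_integral_param {U : Set ℝ} (hU : IsOpen U) {F F' : ℝ → ℝ → ℝ}
    (hF : ContinuousOn (fun p : ℝ × ℝ => F p.1 p.2) (U ×ˢ univ))
    (hF' : ContinuousOn (fun p : ℝ × ℝ => F' p.1 p.2) (U ×ˢ univ))
    (hd : ∀ t ∈ U, ∀ x, HasDerivAt (fun s => F s x) (F' t x) t) (a b : ℝ) {t : ℝ} (ht : t ∈ U) :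
    HasDerivAt (fun s => ∫ x in a..b, F s x) (∫ x in a..b, F' t x) t := by
  have hsec : ∀ {G : ℝ → ℝ → ℝ}, ContinuousOn (fun p : ℝ × ℝ => G p.1 p.2) (U ×ˢ univ) →
      ∀ s ∈ U, Continuous (G s) := fun hG s hs =>
    hG.comp_continuous (f := fun x : ℝ => (s, x)) (by fun_prop) (fun x => by simp [hs])
  obtain ⟨ε, hε, hball⟩ := Metric.isOpen_iff.1 hU t ht
  have hsub : Metric.closedBall t (ε / 2) ⊆ U :=
    (Metric.closedBall_subset_ball (by linarith)).trans hball
  have hcomp : IsCompact (Metric.closedBall t (ε / 2) ×ˢ uIcc a b) :=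
    (isCompact_closedBall _ _).prod isCompact_uIcc
  obtain ⟨M, hM⟩ := hcomp.exists_bound_of_continuousOn
    (hF'.mono (prod_mono hsub (subset_univ _)))
  refine (intervalIntegral.hasDerivAt_integral_of_dominated_loc_of_deriv_le
    (bound := fun _ => M) (s := Metric.closedBall t (ε / 2))
    (Metric.closedBall_mem_nhds _ (by linarith)) ?_ ?_ ?_ ?_ ?_ ?_).2
  · filter_upwards [hU.mem_nhds ht] with s hs using (hsec hF s hs).aestronglyMeasurable
  · exact (hsec hF t ht).intervalIntegrable _ _
  · exact (hsec hF' t ht).aestronglyMeasurable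
  · exact ae_of_all _ fun x hx s hs => hM (s, x) ⟨hs, uIoc_subset_uIcc hx⟩
  · exact intervalIntegrable_const
  · exact ae_of_all _ fun x _ s hs => hd s (hsub hs) x

theorem integral_swap {F : ℝ → ℝ → ℝ} (hF : Continuous fun p : ℝ × ℝ => F p.1 p.2)
    {a b c d : ℝ} (hab : a ≤ b) (hcd : c ≤ d) :
    ∫ x in a..b, ∫ y in c..d, F x y = ∫ y in c..d, ∫ x in a..b, F x y := by
  simp only [intervalIntegral.integral_of_le hab, intervalIntegral.integral_of_le hcd]
  refine integral_integral_swap ?_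
  rw [Measure.prod_restrict]
  exact (hF.continuousOn.integrableOn_compact (isCompact_Icc.prod isCompact_Icc)).mono_set
    (prod_mono Ioc_subset_Icc_self Ioc_subset_Icc_self)

theorem integral_mono_of_continuous {f g : ℝ → ℝ} (hf : Continuous f) (hg : Continuous g)
    {a b : ℝ} (hab : a ≤ b) (h : ∀ x, f x ≤ g x) : ∫ x in a..b, f x ≤ ∫ x in a..b, g x :=
  intervalIntegral.integral_mono hab (hf.intervalIntegrable _ _) (hg.intervalIntegrable _ _) h

theorem integral_nonneg_of_forall {f : ℝ → ℝ} {a b : ℝ} (hab : a ≤ b) (h : ∀ x, 0 ≤ f x) :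
    0 ≤ ∫ x in a..b, f x :=
  intervalIntegral.integral_nonneg hab fun x _ => h x

theorem integral_add_of_continuous {f g : ℝ → ℝ} (hf : Continuous f) (hg : Continuous g)
    (a b : ℝ) : ∫ x in a..b, (f x + g x) = (∫ x in a..b, f x) + ∫ x in a..b, g x :=
  intervalIntegral.integral_add (hf.intervalIntegrable _ _) (hg.intervalIntegrable _ _)

theorem integral_sub_of_continuous {f g : ℝ → ℝ} (hf : Continuous f) (hg : Continuous g)
    (a b : ℝ) : ∫ x in a..b, (f x - g x) = (∫ x in a..b, f x) - ∫ x in a..b, g x :=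
  intervalIntegral.integral_sub (hf.intervalIntegrable _ _) (hg.intervalIntegrable _ _)

/-- The Cauchy–Schwarz inequality. -/
theorem sq_integral_mul_le {f g : ℝ → ℝ} (hf : Continuous f) (hg : Continuous g)
    {a b : ℝ} (hab : a ≤ b) :
    (∫ x in a..b, f x * g x) ^ 2 ≤ (∫ x in a..b, f x ^ 2) * ∫ x in a..b, g x ^ 2 := by
  have key : ∀ t : ℝ, 0 ≤ (∫ x in a..b, f x ^ 2) * (t * t) + (2 * ∫ x in a..b, f x * g x) * t
      + ∫ x in a..b, g x ^ 2 := by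
    intro t
    have h0 : 0 ≤ ∫ x in a..b, (t * f x + g x) ^ 2 :=
      integral_nonneg_of_forall hab fun x => sq_nonneg _
    have h1 : ∫ x in a..b, (t * f x + g x) ^ 2
        = ∫ x in a..b, ((t * t) * f x ^ 2 + (2 * t) * (f x * g x) + g x ^ 2) := by
      congr 1; ext x; ring
    rw [h1, integral_add_of_continuous (by fun_prop) (by fun_prop),
      integral_add_of_continuous (by fun_prop) (by fun_prop),
      intervalIntegral.integral_const_mul, intervalIntegral.integral_const_mul] at h0
    linarith
  have := discrim_le_zero key
  rw [discrim] at this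
  linarith

theorem abs_integral_mul_le {f g : ℝ → ℝ} (hf : Continuous f) (hg : Continuous g)
    {a b : ℝ} (hab : a ≤ b) :
    |∫ x in a..b, f x * g x| ≤ √(∫ x in a..b, f x ^ 2) * √(∫ x in a..b, g x ^ 2) := by
  rw [← Real.sqrt_mul (integral_nonneg_of_forall hab fun x => sq_nonneg _)]
  exact Real.abs_le_sqrt (sq_integral_mul_le hf hg hab)

theorem neg_pi_le_pi : -π ≤ π := by linarith [Real.pi_pos]

theorem integral_deriv_eq_zero {f f' : ℝ → ℝ} (hf : ∀ x, HasDerivAt f (f' x) x)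
    (hf' : Continuous f') (hp : Function.Periodic f (2 * π)) : ∫ x in (-π)..π, f' x = 0 := by
  rw [intervalIntegral.integral_eq_sub_of_hasDerivAt (fun x _ => hf x)
    (hf'.intervalIntegrable _ _), sub_eq_zero]
  have := hp (-π)
  rwa [show -π + 2 * π = π by ring] at this

theorem integral_comp_add {f : ℝ → ℝ} (hp : Function.Periodic f (2 * π)) (a : ℝ) :
    ∫ x in (-π)..π, f (x + a) = ∫ x in (-π)..π, f x := by
  rw [intervalIntegral.integral_comp_add_right]
  have := hp.intervalIntegral_add_eq (-π + a) (-π)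
  rwa [show -π + a + 2 * π = π + a by ring, show -π + 2 * π = π by ring] at this

theorem integral_comp_sub {f : ℝ → ℝ} (hp : Function.Periodic f (2 * π)) (a : ℝ) :
    ∫ x in (-π)..π, f (x - a) = ∫ x in (-π)..π, f x := by
  simpa [sub_eq_add_neg] using integral_comp_add hp (-a)

/-- A function in `H¹` of the circle is Lipschitz in `L²` with respect to translations. -/
theorem integral_sq_shift_le {c c' : ℝ → ℝ} (hc : ∀ x, HasDerivAt c (c' x) x)
    (hc' : Continuous c') (hp' : Function.Periodic c' (2 * π)) {h : ℝ} (hh : 0 ≤ h) :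
    ∫ x in (-π)..π, (c (x + h) - c (x - h)) ^ 2 ≤ 4 * h ^ 2 * ∫ x in (-π)..π, c' x ^ 2 := by
  have hcc : Continuous c := continuous_iff_continuousAt.2 fun x => (hc x).continuousAt
  have h1 : ∀ x, (c (x + h) - c (x - h)) ^ 2 ≤ 2 * h * ∫ y in (-h)..h, c' (x + y) ^ 2 := by
    intro x
    have e : c (x + h) - c (x - h) = ∫ y in (-h)..h, 1 * c' (x + y) := by
      simp only [one_mul]
      rw [intervalIntegral.integral_comp_add_left (fun y => c' y) x,
        intervalIntegral.integral_eq_sub_of_hasDerivAt (fun x _ => hc x)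
        (hc'.intervalIntegrable _ _), sub_eq_add_neg x h]
    rw [e]
    refine (sq_integral_mul_le continuous_const (by fun_prop) (by linarith)).trans_eq ?_
    simp only [one_pow, intervalIntegral.integral_const, smul_eq_mul, mul_one]
    ring
  have h2 : Continuous fun x => ∫ y in (-h)..h, c' (x + y) ^ 2 :=
    intervalIntegral.continuous_parametric_intervalIntegral_of_continuous' (by fun_prop) _ _
  refine (integral_mono_of_continuous (by fun_prop) (by fun_prop) neg_pi_le_pi h1).trans_eq ?_
  rw [intervalIntegral.integral_const_mul,
    integral_swap (F := fun x y => c' (x + y) ^ 2) (by fun_prop) neg_pi_le_pi (by linarith)]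
  have h3 : ∀ y, ∫ x in (-π)..π, c' (x + y) ^ 2 = ∫ x in (-π)..π, c' x ^ 2 := fun y =>
    integral_comp_add (f := fun x => c' x ^ 2) (fun x => by simp only [hp' x]) y
  simp only [h3, intervalIntegral.integral_const, smul_eq_mul]
  ring

/-! ### Enhanced dissipation of a single Fourier mode -/

/-- The weight `sin² / (sin² + d²)`, which vanishes at the critical points of `cos` and is of order
one at distance `d` from them. -/
noncomputable def farWeight (d θ : ℝ) : ℝ := Real.sin θ ^ 2 / (Real.sin θ ^ 2 + d ^ 2)

/-- The weight `d sin / (sin² + d²)` of the cross term between the two translates of a mode. -/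
noncomputable def crossWeight (d θ : ℝ) : ℝ := d * Real.sin θ / (Real.sin θ ^ 2 + d ^ 2)

theorem sin_sq_add_pos {d : ℝ} (hd : 0 < d) (θ : ℝ) : 0 < Real.sin θ ^ 2 + d ^ 2 := by positivity

theorem continuous_farWeight {d : ℝ} (hd : 0 < d) : Continuous (farWeight d) := by
  unfold farWeight
  exact (by fun_prop : Continuous fun θ => Real.sin θ ^ 2).div (by fun_prop)
    fun θ => (sin_sq_add_pos hd θ).ne'

theorem continuous_crossWeight {d : ℝ} (hd : 0 < d) : Continuous (crossWeight d) := by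
  unfold crossWeight
  exact (by fun_prop : Continuous fun θ => d * Real.sin θ).div (by fun_prop)
    fun θ => (sin_sq_add_pos hd θ).ne'

theorem farWeight_nonneg {d : ℝ} (θ : ℝ) : 0 ≤ farWeight d θ := by unfold farWeight; positivity

theorem farWeight_le_one {d : ℝ} (hd : 0 < d) (θ : ℝ) : farWeight d θ ≤ 1 := by
  unfold farWeight
  rw [div_le_one (sin_sq_add_pos hd θ)]
  nlinarith [sq_nonneg d]

theorem crossWeight_mul_sin {d : ℝ} (θ : ℝ) :
    crossWeight d θ * Real.sin θ = d * farWeight d θ := by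
  unfold crossWeight farWeight; ring

theorem abs_crossWeight_le {d : ℝ} (hd : 0 < d) (θ : ℝ) : |crossWeight d θ| ≤ 1 / 2 := by
  unfold crossWeight
  rw [abs_div, abs_of_pos (sin_sq_add_pos hd θ), div_le_iff₀ (sin_sq_add_pos hd θ), abs_le]
  constructor <;> nlinarith [sq_nonneg (Real.sin θ - d), sq_nonneg (Real.sin θ + d)]

theorem hasDerivAt_crossWeight {d : ℝ} (hd : 0 < d) (θ : ℝ) :
    HasDerivAt (crossWeight d)
      (d * Real.cos θ * (d ^ 2 - Real.sin θ ^ 2) / (Real.sin θ ^ 2 + d ^ 2) ^ 2) θ := by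
  have h0 := (sin_sq_add_pos hd θ).ne'
  have := ((Real.hasDerivAt_sin θ).const_mul d).div
    (((Real.hasDerivAt_sin θ).pow 2).add_const (d ^ 2)) h0
  refine this.congr_deriv ?_
  simp only [Nat.cast_ofNat, Nat.add_one_sub_one, pow_one, Pi.pow_apply]
  field_simp
  ring

theorem abs_deriv_crossWeight_le {d : ℝ} (hd : 0 < d) (θ : ℝ) :
    |d * Real.cos θ * (d ^ 2 - Real.sin θ ^ 2) / (Real.sin θ ^ 2 + d ^ 2) ^ 2| ≤ 1 / d := by
  have hp := sin_sq_add_pos hd θ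
  rw [abs_div, abs_of_pos (pow_pos hp 2), div_le_div_iff₀ (pow_pos hp 2) hd, abs_mul, abs_mul,
    abs_of_pos hd]
  have h1 := Real.abs_cos_le_one θ
  have h2 : |d ^ 2 - Real.sin θ ^ 2| ≤ Real.sin θ ^ 2 + d ^ 2 := by
    rw [abs_le]; constructor <;> nlinarith [sq_nonneg (Real.sin θ), sq_nonneg d]
  have h3 : d ^ 2 ≤ Real.sin θ ^ 2 + d ^ 2 := by nlinarith [sq_nonneg (Real.sin θ)]
  calc d * |Real.cos θ| * |d ^ 2 - Real.sin θ ^ 2| * d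
      = d ^ 2 * (|Real.cos θ| * |d ^ 2 - Real.sin θ ^ 2|) := by ring
    _ ≤ (Real.sin θ ^ 2 + d ^ 2) * (1 * (Real.sin θ ^ 2 + d ^ 2)) := by gcongr
    _ = 1 * (Real.sin θ ^ 2 + d ^ 2) ^ 2 := by ring

/-- The spectral inequality behind enhanced dissipation: mass near the critical points of `cos`
costs gradient. It follows by integrating `(ξ c²)'` with `ξ = d² sin cos / (sin² + d²)`, for which
`d² / (sin² + d²) ≤ ξ' + 4 sin² / (sin² + d²)`. -/
theorem integral_sq_le_farWeight {c c' : ℝ → ℝ} (hc : ∀ x, HasDerivAt c (c' x) x)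
    (hc' : Continuous c') (hp : Function.Periodic c (2 * π)) {d : ℝ} (hd : 0 < d) (hd1 : d ≤ 1) :
    ∫ x in (-π)..π, c x ^ 2 ≤ 10 * (∫ x in (-π)..π, farWeight d x * c x ^ 2)
      + 4 * d ^ 2 * ∫ x in (-π)..π, c' x ^ 2 := by
  have hcc : Continuous c := continuous_iff_continuousAt.2 fun x => (hc x).continuousAt
  have hw := continuous_farWeight hd
  set ξ : ℝ → ℝ := fun θ => d ^ 2 * (Real.sin θ * Real.cos θ) / (Real.sin θ ^ 2 + d ^ 2) with hξ
  set ξ' : ℝ → ℝ := fun θ => d ^ 2 * (d ^ 2 - Real.sin θ ^ 2 - 2 * Real.sin θ ^ 2 * d ^ 2)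
    / (Real.sin θ ^ 2 + d ^ 2) ^ 2 with hξ'
  have hder : ∀ θ, HasDerivAt ξ (ξ' θ) θ := by
    intro θ
    have h0 := (sin_sq_add_pos hd θ).ne'
    have := (((Real.hasDerivAt_sin θ).mul (Real.hasDerivAt_cos θ)).const_mul (d ^ 2)).div
      (((Real.hasDerivAt_sin θ).pow 2).add_const (d ^ 2)) h0
    refine this.congr_deriv ?_
    simp only [hξ', Nat.cast_ofNat, Nat.add_one_sub_one, pow_one, Pi.mul_apply, Pi.pow_apply]
    congr 1
    have := Real.cos_sq' θ
    linear_combination (-(Real.sin θ ^ 2) + d ^ 2) * d ^ 2 * this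
  have hξc : Continuous ξ := continuous_iff_continuousAt.2 fun x => (hder x).continuousAt
  have hξ'c : Continuous ξ' := by
    refine Continuous.div (by fun_prop) (by fun_prop) fun θ => ?_
    exact (pow_pos (sin_sq_add_pos hd θ) 2).ne'
  have hzero : ∫ x in (-π)..π, (ξ' x * c x ^ 2 + ξ x * (2 * c x * c' x)) = 0 := by
    refine integral_deriv_eq_zero (f := fun x => ξ x * c x ^ 2) (fun x => ?_) (by fun_prop) ?_
    · exact ((hder x).mul ((hc x).pow 2)).congr_deriv (by simp)
    · intro x
      simp only [hξ, hp x, Real.sin_add_two_pi, Real.cos_add_two_pi]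
  have hpt : ∀ x, c x ^ 2 ≤ 2 * (ξ' x * c x ^ 2 + ξ x * (2 * c x * c' x))
      + 10 * (farWeight d x * c x ^ 2) + 4 * d ^ 2 * c' x ^ 2 := by
    intro x
    have hpos := sin_sq_add_pos hd x
    have hsin : Real.sin x ^ 2 ≤ 1 := Real.sin_sq_le_one x
    have h1 : 1 ≤ ξ' x + 5 * farWeight d x := by
      have : ξ' x + 5 * farWeight d x - 1 = (2 * Real.sin x ^ 2 * d ^ 2 * (1 - d ^ 2)
          + 4 * (Real.sin x ^ 2) ^ 2) / (Real.sin x ^ 2 + d ^ 2) ^ 2 := by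
        simp only [hξ', farWeight]
        field_simp
        ring
      have h2 : 0 ≤ 1 - d ^ 2 := by nlinarith
      have : 0 ≤ ξ' x + 5 * farWeight d x - 1 := by rw [this]; positivity
      linarith
    have h2 : ξ x ^ 2 ≤ d ^ 2 := by
      simp only [hξ]
      rw [div_pow, div_le_iff₀ (by positivity), mul_pow, mul_pow, Real.cos_sq']
      have hA : Real.sin x ^ 2 * (1 - Real.sin x ^ 2) ≤ Real.sin x ^ 2 := by
        nlinarith [sq_nonneg (Real.sin x)]
      have hB : d ^ 2 * Real.sin x ^ 2 ≤ (Real.sin x ^ 2 + d ^ 2) ^ 2 := by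
        nlinarith [sq_nonneg (Real.sin x), sq_nonneg d, mul_nonneg (sq_nonneg (Real.sin x)) (sq_nonneg d),
          sq_nonneg (Real.sin x ^ 2), sq_nonneg (d ^ 2)]
      calc (d ^ 2) ^ 2 * (Real.sin x ^ 2 * (1 - Real.sin x ^ 2))
          ≤ (d ^ 2) ^ 2 * Real.sin x ^ 2 := by gcongr
        _ = d ^ 2 * (d ^ 2 * Real.sin x ^ 2) := by ring
        _ ≤ _ := by gcongr
    have h3 : c x ^ 2 ≤ (ξ' x + 5 * farWeight d x) * c x ^ 2 := by
      nlinarith [sq_nonneg (c x)]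
    have h4 : -(ξ x * (2 * c x * c' x)) ≤ c x ^ 2 / 2 + 2 * d ^ 2 * c' x ^ 2 := by
      have : ξ x ^ 2 * c' x ^ 2 ≤ d ^ 2 * c' x ^ 2 := by gcongr
      nlinarith [sq_nonneg (c x + 2 * (ξ x * c' x))]
    nlinarith
  have := integral_mono_of_continuous (by fun_prop) (by fun_prop) neg_pi_le_pi hpt
  rw [integral_add_of_continuous (by fun_prop) (by fun_prop),
    integral_add_of_continuous (by fun_prop) (by fun_prop)] at this
  simp only [intervalIntegral.integral_const_mul] at this
  rw [hzero] at this
  linarith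

theorem abs_mul_four_le {k : ℝ} (hk : 0 < k) (x₁ x₂ x₃ x₄ y₁ y₂ y₃ y₄ : ℝ) :
    |x₁ * y₁ + x₂ * y₂ - x₃ * y₃ - x₄ * y₄| ≤ (k * (x₁ ^ 2 + x₂ ^ 2 + x₃ ^ 2 + x₄ ^ 2)
      + (y₁ ^ 2 + y₂ ^ 2 + y₃ ^ 2 + y₄ ^ 2) / k) / 2 := by
  have key : ∀ x y : ℝ, |x * y| ≤ (k * x ^ 2 + y ^ 2 / k) / 2 := by
    intro x y
    have e1 : (k * x ^ 2 + y ^ 2 / k) / 2 - x * y = (k * x - y) ^ 2 / (2 * k) := by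
      field_simp; ring
    have e2 : (k * x ^ 2 + y ^ 2 / k) / 2 + x * y = (k * x + y) ^ 2 / (2 * k) := by
      field_simp; ring
    rw [abs_le]
    constructor
    · have : 0 ≤ (k * x + y) ^ 2 / (2 * k) := by positivity
      linarith
    · have : 0 ≤ (k * x - y) ^ 2 / (2 * k) := by positivity
      linarith
  have e : (k * (x₁ ^ 2 + x₂ ^ 2 + x₃ ^ 2 + x₄ ^ 2) + (y₁ ^ 2 + y₂ ^ 2 + y₃ ^ 2 + y₄ ^ 2) / k) / 2
      = (k * x₁ ^ 2 + y₁ ^ 2 / k) / 2 + (k * x₂ ^ 2 + y₂ ^ 2 / k) / 2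
        + (k * x₃ ^ 2 + y₃ ^ 2 / k) / 2 + (k * x₄ ^ 2 + y₄ ^ 2 / k) / 2 := by ring
  rw [e]
  have h1 := abs_le.1 (key x₁ y₁)
  have h2 := abs_le.1 (key x₂ y₂)
  have h3 := abs_le.1 (key x₃ y₃)
  have h4 := abs_le.1 (key x₄ y₄)
  rw [abs_le]
  constructor <;> linarith [h1.1, h1.2, h2.1, h2.2, h3.1, h3.2, h4.1, h4.2]

theorem mul_le_of_abs_le_of_abs_le {a A z Z : ℝ} (ha : |a| ≤ A) (hz : |z| ≤ Z) : -(a * z) ≤ A * Z :=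
  (neg_le_abs _).trans (by
    rw [abs_mul]; exact mul_le_mul ha hz (abs_nonneg _) ((abs_nonneg _).trans ha))

/-- Data of a pair `(c, s)` of smooth functions on the circle, with first and second derivatives,
and of a forcing in divergence form, `(P', R')`. -/
structure ModeData (c s c₁ s₁ c₂ s₂ P R P₁ R₁ : ℝ → ℝ) : Prop where
  hc : ∀ x, HasDerivAt c (c₁ x) x
  hs : ∀ x, HasDerivAt s (s₁ x) x
  hc₁ : ∀ x, HasDerivAt c₁ (c₂ x) x
  hs₁ : ∀ x, HasDerivAt s₁ (s₂ x) x
  hc₂ : Continuous c₂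
  hs₂ : Continuous s₂
  hP : ∀ x, HasDerivAt P (P₁ x) x
  hR : ∀ x, HasDerivAt R (R₁ x) x
  hP₁ : Continuous P₁
  hR₁ : Continuous R₁
  pc : Function.Periodic c (2 * π)
  ps : Function.Periodic s (2 * π)
  pc₁ : Function.Periodic c₁ (2 * π)
  ps₁ : Function.Periodic s₁ (2 * π)
  pP : Function.Periodic P (2 * π)
  pR : Function.Periodic R (2 * π)

set_option maxHeartbeats 1000000 in
/-- Differential inequality for the functional `∫ (c² + s²) + λ ∫ a (c⁻ s⁺ - s⁻ c⁺)`, `λ = 1/100`,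
where `a` is `crossWeight d` and `±` denotes translation by `± d`, along
`∂ₜ c = ν c'' - μ cos s + P'`, `∂ₜ s = ν s'' + μ cos c + R'`, at the scale `d⁴ = ν / q`. The
transport term produces `sin² / (sin² + d²)` times the energy because
`cos (θ - d) - cos (θ + d) = 2 sin θ sin d`. -/
theorem ModeData.deriv_functional_le {c s c₁ s₁ c₂ s₂ P R P₁ R₁ : ℝ → ℝ}
    (M : ModeData c s c₁ s₁ c₂ s₂ P R P₁ R₁) {ν μ q d : ℝ} (hd : 0 < d) (hd1 : d ≤ 1)
    (hν : 0 < ν) (hq : 0 < q) (hqd : q * d ^ 4 = ν) (hμ : q / 2 ≤ μ) (hμ' : μ ≤ q)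
    {ct st : ℝ → ℝ} (hct : ∀ x, ct x = ν * c₂ x - μ * Real.cos x * s x + P₁ x)
    (hst : ∀ x, st x = ν * s₂ x + μ * Real.cos x * c x + R₁ x) :
    (∫ x in (-π)..π, (2 * (c x * ct x + s x * st x) + 1 / 100 * (crossWeight d x *
      (ct (x - d) * s (x + d) + c (x - d) * st (x + d) - st (x - d) * c (x + d)
        - s (x - d) * ct (x + d)))))
      ≤ -(q * d ^ 2 / 4000) * (∫ x in (-π)..π, (c x ^ 2 + s x ^ 2))
        + 2 / ν * ∫ x in (-π)..π, (P x ^ 2 + R x ^ 2) := by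
  obtain ⟨hc, hs, hc₁, hs₁, hc₂, hs₂, hP, hR, hP₁, hR₁, pc, ps, pc₁, ps₁, pP, pR⟩ := M
  have cc : Continuous c := continuous_iff_continuousAt.2 fun x => (hc x).continuousAt
  have cs : Continuous s := continuous_iff_continuousAt.2 fun x => (hs x).continuousAt
  have cc₁ : Continuous c₁ := continuous_iff_continuousAt.2 fun x => (hc₁ x).continuousAt
  have cs₁ : Continuous s₁ := continuous_iff_continuousAt.2 fun x => (hs₁ x).continuousAt
  have cP : Continuous P := continuous_iff_continuousAt.2 fun x => (hP x).continuousAt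
  have cR : Continuous R := continuous_iff_continuousAt.2 fun x => (hR x).continuousAt
  have cct : Continuous ct := by rw [funext hct]; fun_prop
  have cst : Continuous st := by rw [funext hst]; fun_prop
  set a := crossWeight d with ha
  set a' : ℝ → ℝ := fun θ =>
    d * Real.cos θ * (d ^ 2 - Real.sin θ ^ 2) / (Real.sin θ ^ 2 + d ^ 2) ^ 2 with ha'
  have da : ∀ x, HasDerivAt a (a' x) x := hasDerivAt_crossWeight hd
  have ca : Continuous a := continuous_crossWeight hd
  have cw := continuous_farWeight hd
  have ca' : Continuous a' := by
    refine Continuous.div (by fun_prop) (by fun_prop) fun θ => ?_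
    exact (pow_pos (sin_sq_add_pos hd θ) 2).ne'
  have pa : Function.Periodic a (2 * π) := fun x => by
    simp only [ha, crossWeight, Real.sin_add_two_pi]
  -- the total derivative that is subtracted from the integrand
  set W : ℝ → ℝ := fun x => 2 * (ν * (c x * c₁ x + s x * s₁ x) + (c x * P x + s x * R x))
    + 1 / 100 * (a x * (ν * (c₁ (x - d) * s (x + d) + c (x - d) * s₁ (x + d)
      - s₁ (x - d) * c (x + d) - s (x - d) * c₁ (x + d))
      + (P (x - d) * s (x + d) + c (x - d) * R (x + d) - R (x - d) * c (x + d)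
      - s (x - d) * P (x + d)))) with hW
  set W' : ℝ → ℝ := fun x => 2 * (ν * (c₁ x * c₁ x + c x * c₂ x + (s₁ x * s₁ x + s x * s₂ x))
      + (c₁ x * P x + c x * P₁ x + (s₁ x * R x + s x * R₁ x)))
    + 1 / 100 * (a' x * (ν * (c₁ (x - d) * s (x + d) + c (x - d) * s₁ (x + d)
      - s₁ (x - d) * c (x + d) - s (x - d) * c₁ (x + d))
      + (P (x - d) * s (x + d) + c (x - d) * R (x + d) - R (x - d) * c (x + d)
      - s (x - d) * P (x + d))) + a x * (ν * ((c₂ (x - d) * s (x + d) + c₁ (x - d) * s₁ (x + d))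
      + (c₁ (x - d) * s₁ (x + d) + c (x - d) * s₂ (x + d))
      - (s₂ (x - d) * c (x + d) + s₁ (x - d) * c₁ (x + d))
      - (s₁ (x - d) * c₁ (x + d) + s (x - d) * c₂ (x + d)))
      + ((P₁ (x - d) * s (x + d) + P (x - d) * s₁ (x + d))
      + (c₁ (x - d) * R (x + d) + c (x - d) * R₁ (x + d))
      - (R₁ (x - d) * c (x + d) + R (x - d) * c₁ (x + d))
      - (s₁ (x - d) * P (x + d) + s (x - d) * P₁ (x + d))))) with hW'
  have hsh : ∀ {f f' : ℝ → ℝ} (_ : ∀ x, HasDerivAt f (f' x) x) (x : ℝ),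
      HasDerivAt (fun y => f (y + d)) (f' (x + d)) x := fun hf x => (hf (x + d)).comp_add_const x d
  have hsh' : ∀ {f f' : ℝ → ℝ} (_ : ∀ x, HasDerivAt f (f' x) x) (x : ℝ),
      HasDerivAt (fun y => f (y - d)) (f' (x - d)) x := fun hf x => (hf (x - d)).comp_sub_const x d
  have hWd : ∀ x, HasDerivAt W (W' x) x := by
    intro x
    have h1 := (((((hc x).mul (hc₁ x)).add ((hs x).mul (hs₁ x))).const_mul ν).add
      (((hc x).mul (hP x)).add ((hs x).mul (hR x)))).const_mul 2
    have h2 := ((((((hsh' hc₁ x).mul (hsh hs x)).add ((hsh' hc x).mul (hsh hs₁ x))).sub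
      ((hsh' hs₁ x).mul (hsh hc x))).sub ((hsh' hs x).mul (hsh hc₁ x))).const_mul ν).add
      (((((hsh' hP x).mul (hsh hs x)).add ((hsh' hc x).mul (hsh hR x))).sub
      ((hsh' hR x).mul (hsh hc x))).sub ((hsh' hs x).mul (hsh hP x)))
    exact h1.add (((da x).mul h2).const_mul (1 / 100))
  have hW0 : ∫ x in (-π)..π, W' x = 0 := by
    refine integral_deriv_eq_zero hWd (by fun_prop) fun x => ?_
    simp only [hW, pc x, ps x, pc₁ x, ps₁ x, pP x, pR x, pa x, add_right_comm x (2 * π) d,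
      add_sub_right_comm x (2 * π) d, pc (x + d), ps (x + d), pc₁ (x + d), ps₁ (x + d), pP (x + d),
      pR (x + d), pc (x - d), ps (x - d), pc₁ (x - d), ps₁ (x - d), pP (x - d), pR (x - d)]
  set F₀ : ℝ → ℝ := fun x => c x ^ 2 + s x ^ 2 with hF₀
  set D₀ : ℝ → ℝ := fun x => c₁ x ^ 2 + s₁ x ^ 2 with hD₀
  set Q₀ : ℝ → ℝ := fun x => P x ^ 2 + R x ^ 2 with hQ₀
  set G₀ : ℝ → ℝ := fun x => (c (x + d) - c (x - d)) ^ 2 + (s (x + d) - s (x - d)) ^ 2 with hG₀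
  have cF : Continuous F₀ := by fun_prop
  have cD : Continuous D₀ := by fun_prop
  have cQ : Continuous Q₀ := by fun_prop
  have cG : Continuous G₀ := by fun_prop
  set σ := Real.sin d with hσ
  have hσ1 : σ ≤ d := Real.sin_le hd.le
  have hσ2 : d / 2 ≤ σ := by
    have h1 := Real.mul_le_sin hd.le (by linarith [Real.pi_gt_three])
    have h2 : 1 / 2 ≤ 2 / π := by
      rw [div_le_div_iff₀ (by norm_num) Real.pi_pos]; linarith [Real.pi_le_four]
    linarith [mul_le_mul_of_nonneg_right h2 hd.le]
  have hμ0 : 0 < μ := by linarith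
  have hE3 : ∀ A B : ℝ, ν * (1 / d * ((80 * d * A + B / (80 * d)) / 2))
      = 40 * ν * A + q * d ^ 2 / 160 * B := by
    intro A B; rw [← hqd]; field_simp; ring
  have hE4 : ∀ A B : ℝ, 1 / d * ((80 / (q * d ^ 3) * A + B / (80 / (q * d ^ 3))) / 2)
      = 40 / ν * A + q * d ^ 2 / 160 * B := by
    intro A B; rw [← hqd]; field_simp; ring
  have hE2 : ∀ A B : ℝ, 1 / 2 * ((1 / ν * A + B / (1 / ν)) / 2) = 1 / 4 / ν * A + ν / 4 * B := by
    intro A B; field_simp; ring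
  clear_value σ
  have hpt : ∀ x, 2 * (c x * ct x + s x * st x) + 1 / 100 * (a x *
      (ct (x - d) * s (x + d) + c (x - d) * st (x + d) - st (x - d) * c (x + d)
        - s (x - d) * ct (x + d)))
      ≤ W' x + ((-ν * D₀ x + 1 / ν * Q₀ x) + 1 / 100 * (-(σ * μ * d) *
        (farWeight d x * F₀ (x + d) + farWeight d x * F₀ (x - d)) + q * d ^ 2 * G₀ x
        + (163 / 4 * ν) * (D₀ (x - d) + D₀ (x + d)) + (161 / 4 / ν) * (Q₀ (x - d) + Q₀ (x + d))
        + (q * d ^ 2 / 80) * (F₀ (x - d) + F₀ (x + d)))) := by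
    intro x
    have e1 : Real.cos (x - d) - Real.cos (x + d) = 2 * Real.sin x * σ := by
      rw [Real.cos_sub, Real.cos_add, hσ]; ring
    have hb : 2 * (c x * ct x + s x * st x) + 1 / 100 * (a x *
      (ct (x - d) * s (x + d) + c (x - d) * st (x + d) - st (x - d) * c (x + d)
        - s (x - d) * ct (x + d))) = W' x + (-2 * ν * D₀ x - 2 * (c₁ x * P x + s₁ x * R x)
        + 1 / 100 * (-(a x * (Real.cos (x - d) - Real.cos (x + d))) * μ *
          (c (x - d) * c (x + d) + s (x - d) * s (x + d))
          + -(a x * (2 * ν * (c₁ (x - d) * s₁ (x + d) + 0 * 0 - s₁ (x - d) * c₁ (x + d) - 0 * 0)))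
          + -(a x * (P (x - d) * s₁ (x + d) + R (x + d) * c₁ (x - d) - R (x - d) * c₁ (x + d)
            - P (x + d) * s₁ (x - d)))
          + ν * -(a' x * (c₁ (x - d) * s (x + d) + s₁ (x + d) * c (x - d) - s₁ (x - d) * c (x + d)
            - c₁ (x + d) * s (x - d)))
          + -(a' x * (P (x - d) * s (x + d) + R (x + d) * c (x - d) - R (x - d) * c (x + d)
            - P (x + d) * s (x - d))))) := by
      simp only [hct, hst, hW', hD₀]
      ring
    rw [hb, e1, show a x * (2 * Real.sin x * σ) = 2 * σ * (a x * Real.sin x) by ring,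
      crossWeight_mul_sin]
    have ha1 := abs_crossWeight_le hd x
    have ha2 : |a' x| ≤ 1 / d := abs_deriv_crossWeight_le hd x
    have t0 : -2 * (c₁ x * P x + s₁ x * R x) ≤ ν * D₀ x + 1 / ν * Q₀ x := by
      have := (neg_le_abs _).trans (abs_mul_four_le hν (c₁ x) (s₁ x) 0 0 (P x) (R x) 0 0)
      have e : ν * D₀ x + 1 / ν * Q₀ x = 2 * ((ν * (c₁ x ^ 2 + s₁ x ^ 2 + 0 ^ 2 + 0 ^ 2)
        + (P x ^ 2 + R x ^ 2 + 0 ^ 2 + 0 ^ 2) / ν) / 2) := by simp only [hD₀, hQ₀]; ring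
      rw [e]; linarith
    have t1 := mul_le_of_abs_le_of_abs_le ha1 (z := 2 * ν * (c₁ (x - d) * s₁ (x + d) + 0 * 0
      - s₁ (x - d) * c₁ (x + d) - 0 * 0)) (Z := 2 * ν * ((1 * (c₁ (x - d) ^ 2 + 0 ^ 2
      + s₁ (x - d) ^ 2 + 0 ^ 2) + (s₁ (x + d) ^ 2 + 0 ^ 2 + c₁ (x + d) ^ 2 + 0 ^ 2) / 1) / 2)) (by
        rw [abs_mul, abs_of_pos (by linarith : 0 < 2 * ν)]
        exact mul_le_mul_of_nonneg_left (abs_mul_four_le one_pos _ _ _ _ _ _ _ _) (by linarith))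
    have t2 := mul_le_of_abs_le_of_abs_le ha1 (abs_mul_four_le (one_div_pos.2 hν)
      (P (x - d)) (R (x + d)) (R (x - d)) (P (x + d)) (s₁ (x + d)) (c₁ (x - d)) (c₁ (x + d))
      (s₁ (x - d)))
    have t3 := mul_le_mul_of_nonneg_left (mul_le_of_abs_le_of_abs_le ha2 (abs_mul_four_le
      (by positivity : 0 < 80 * d)
      (c₁ (x - d)) (s₁ (x + d)) (s₁ (x - d)) (c₁ (x + d)) (s (x + d)) (c (x - d)) (c (x + d))
      (s (x - d)))) hν.le
    have t4 := mul_le_of_abs_le_of_abs_le ha2 (abs_mul_four_le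
      (by positivity : 0 < 80 / (q * d ^ 3))
      (P (x - d)) (R (x + d)) (R (x - d)) (P (x + d)) (s (x + d)) (c (x - d)) (c (x + d))
      (s (x - d)))
    have t5 : σ * μ * (d * farWeight d x) * G₀ x ≤ q * d ^ 2 * G₀ x := by
      have hG : 0 ≤ G₀ x := by simp only [hG₀]; positivity
      refine mul_le_mul_of_nonneg_right ?_ hG
      have h1 : σ * μ ≤ d * q := mul_le_mul hσ1 hμ' hμ0.le hd.le
      have h2 : d * farWeight d x ≤ d := mul_le_of_le_one_right hd.le (farWeight_le_one hd x)
      calc σ * μ * (d * farWeight d x) ≤ (d * q) * d := by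
            refine mul_le_mul h1 h2 (mul_nonneg hd.le (farWeight_nonneg x)) (by positivity)
        _ = q * d ^ 2 := by ring
    have e3 : ν * (1 / d * ((80 * d * (c₁ (x - d) ^ 2 + s₁ (x + d) ^ 2 + s₁ (x - d) ^ 2
        + c₁ (x + d) ^ 2) + (s (x + d) ^ 2 + c (x - d) ^ 2 + c (x + d) ^ 2 + s (x - d) ^ 2)
        / (80 * d)) / 2)) = 40 * ν * (D₀ (x - d) + D₀ (x + d))
        + (q * d ^ 2 / 160) * (F₀ (x - d) + F₀ (x + d)) := by
      rw [hE3]; simp only [hD₀, hF₀]; ring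
    have e4 : 1 / d * ((80 / (q * d ^ 3) * (P (x - d) ^ 2 + R (x + d) ^ 2 + R (x - d) ^ 2
        + P (x + d) ^ 2) + (s (x + d) ^ 2 + c (x - d) ^ 2 + c (x + d) ^ 2 + s (x - d) ^ 2)
        / (80 / (q * d ^ 3))) / 2) = 40 / ν * (Q₀ (x - d) + Q₀ (x + d))
        + (q * d ^ 2 / 160) * (F₀ (x - d) + F₀ (x + d)) := by
      rw [hE4]; simp only [hQ₀, hF₀]; ring
    have e2 : 1 / 2 * ((1 / ν * (P (x - d) ^ 2 + R (x + d) ^ 2 + R (x - d) ^ 2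
        + P (x + d) ^ 2) + (s₁ (x + d) ^ 2 + c₁ (x - d) ^ 2 + c₁ (x + d) ^ 2 + s₁ (x - d) ^ 2)
        / (1 / ν)) / 2) = 1 / 4 / ν * (Q₀ (x - d) + Q₀ (x + d))
        + ν / 4 * (D₀ (x - d) + D₀ (x + d)) := by
      rw [hE2]; simp only [hQ₀, hD₀]; ring
    have e5 : 1 / 2 * (2 * ν * ((1 * (c₁ (x - d) ^ 2 + 0 ^ 2 + s₁ (x - d) ^ 2 + 0 ^ 2)
        + (s₁ (x + d) ^ 2 + 0 ^ 2 + c₁ (x + d) ^ 2 + 0 ^ 2) / 1) / 2))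
        = ν / 2 * (D₀ (x - d) + D₀ (x + d)) := by
      simp only [hD₀]; ring
    rw [e3] at t3
    rw [e4] at t4
    rw [e2] at t2
    rw [e5] at t1
    have e6 : -(2 * σ * (d * farWeight d x)) * μ * (c (x - d) * c (x + d) + s (x - d) * s (x + d))
        = -(σ * μ * d) * (farWeight d x * F₀ (x + d) + farWeight d x * F₀ (x - d))
          + σ * μ * (d * farWeight d x) * G₀ x := by
      simp only [hF₀, hG₀]; ring
    rw [e6]
    have e7 : 161 / 4 / ν = 1 / 4 / ν + 40 / ν := by ring
    rw [e7]
    linarith [t0, t1, t2, t3, t4, t5]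
  have hint := integral_mono_of_continuous (by fun_prop) (by fun_prop) neg_pi_le_pi hpt
  have pF : Function.Periodic F₀ (2 * π) := fun x => by simp only [hF₀, pc x, ps x]
  have pD : Function.Periodic D₀ (2 * π) := fun x => by simp only [hD₀, pc₁ x, ps₁ x]
  have pQ : Function.Periodic Q₀ (2 * π) := fun x => by simp only [hQ₀, pP x, pR x]
  set F := ∫ x in (-π)..π, F₀ x with hF
  set D := ∫ x in (-π)..π, D₀ x with hD
  set Q := ∫ x in (-π)..π, Q₀ x with hQ
  have hF0 : 0 ≤ F := integral_nonneg_of_forall neg_pi_le_pi fun x => by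
    simp only [hF₀]; positivity
  have hD0 : 0 ≤ D := integral_nonneg_of_forall neg_pi_le_pi fun x => by
    simp only [hD₀]; positivity
  have hQ0 : 0 ≤ Q := integral_nonneg_of_forall neg_pi_le_pi fun x => by
    simp only [hQ₀]; positivity
  have hGD : ∫ x in (-π)..π, G₀ x ≤ 4 * d ^ 2 * D := by
    simp only [hG₀, hD, hD₀]
    rw [integral_add_of_continuous (by fun_prop) (by fun_prop),
      integral_add_of_continuous (by fun_prop) (by fun_prop)]
    have := integral_sq_shift_le hc cc₁ pc₁ hd.le
    have := integral_sq_shift_le hs cs₁ ps₁ hd.le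
    linarith
  have hspec : ∀ e : ℝ, F ≤ 10 * (∫ x in (-π)..π, farWeight d x * F₀ (x + e)) + 4 * d ^ 2 * D := by
    intro e
    have h1 := integral_sq_le_farWeight (c := fun x => c (x + e)) (c' := fun x => c₁ (x + e))
      (fun x => (hc (x + e)).comp_add_const x e) (by fun_prop)
      (fun x => by simp only [add_right_comm x (2 * π) e, pc (x + e)]) hd hd1
    have h2 := integral_sq_le_farWeight (c := fun x => s (x + e)) (c' := fun x => s₁ (x + e))
      (fun x => (hs (x + e)).comp_add_const x e) (by fun_prop)
      (fun x => by simp only [add_right_comm x (2 * π) e, ps (x + e)]) hd hd1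
    rw [integral_comp_add (f := fun x => c x ^ 2) (fun x => by simp only [pc x]),
      integral_comp_add (f := fun x => c₁ x ^ 2) (fun x => by simp only [pc₁ x])] at h1
    rw [integral_comp_add (f := fun x => s x ^ 2) (fun x => by simp only [ps x]),
      integral_comp_add (f := fun x => s₁ x ^ 2) (fun x => by simp only [ps₁ x])] at h2
    simp only [hF, hD, hF₀, hD₀, mul_add]
    rw [integral_add_of_continuous (by fun_prop) (by fun_prop),
      integral_add_of_continuous (by fun_prop) (by fun_prop),
      integral_add_of_continuous (by fun_prop) (by fun_prop)]
    linarith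
  refine hint.trans ?_
  change _ ≤ -(q * d ^ 2 / 4000) * F + 2 / ν * Q
  clear_value F₀ D₀ Q₀ G₀
  rw [integral_add_of_continuous (by fun_prop) (by fun_prop), hW0,
    integral_add_of_continuous (by fun_prop) (by fun_prop),
    integral_add_of_continuous (by fun_prop) (by fun_prop)]
  simp only [intervalIntegral.integral_const_mul]
  rw [integral_add_of_continuous (by fun_prop) (by fun_prop),
    integral_add_of_continuous (by fun_prop) (by fun_prop),
    integral_add_of_continuous (by fun_prop) (by fun_prop),
    integral_add_of_continuous (by fun_prop) (by fun_prop)]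
  simp only [intervalIntegral.integral_const_mul]
  rw [integral_add_of_continuous (f := fun x => D₀ (x - d)) (by fun_prop) (by fun_prop),
    integral_add_of_continuous (f := fun x => Q₀ (x - d)) (by fun_prop) (by fun_prop),
    integral_add_of_continuous (f := fun x => F₀ (x - d)) (by fun_prop) (by fun_prop),
    integral_add_of_continuous (f := fun x => farWeight d x * F₀ (x + d))
      (by fun_prop) (by fun_prop),
    integral_comp_add pF, integral_comp_add pD, integral_comp_add pQ,
    integral_comp_sub pF, integral_comp_sub pD, integral_comp_sub pQ]
  have s1 := hspec d
  have s2 := hspec (-d)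
  simp only [← sub_eq_add_neg] at s2
  set B₁ := ∫ x in (-π)..π, farWeight d x * F₀ (x + d)
  set B₂ := ∫ x in (-π)..π, farWeight d x * F₀ (x - d)
  have hk1 : q * d ^ 2 / 4 ≤ σ * μ * d := by
    have : (d / 2) * (q / 2) ≤ σ * μ := mul_le_mul hσ2 hμ (by positivity) (by linarith)
    linarith [mul_le_mul_of_nonneg_right this hd.le]
  have hk2 : σ * μ * d ≤ q * d ^ 2 := by
    have : σ * μ ≤ d * q := mul_le_mul hσ1 hμ' hμ0.le hd.le
    linarith [mul_le_mul_of_nonneg_right this hd.le]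
  set k := σ * μ * d
  have hk0 : 0 ≤ k := le_trans (by positivity) hk1
  have hlow : k * (F / 5 - 4 / 5 * d ^ 2 * D) ≤ k * (B₁ + B₂) :=
    mul_le_mul_of_nonneg_left (by linarith) hk0
  have hl1 : q * d ^ 2 / 4 * F ≤ k * F := mul_le_mul_of_nonneg_right hk1 hF0
  have hl2 : k * (d ^ 2 * D) ≤ ν * D := by
    have := mul_le_mul_of_nonneg_right hk2 (by positivity : 0 ≤ d ^ 2 * D)
    calc _ ≤ _ := this
      _ = ν * D := by rw [← hqd]; ring
  have hl3 : q * d ^ 2 * ∫ x in (-π)..π, G₀ x ≤ 4 * (ν * D) := by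
    have := mul_le_mul_of_nonneg_left hGD (by positivity : 0 ≤ q * d ^ 2)
    calc _ ≤ _ := this
      _ = 4 * (ν * D) := by rw [← hqd]; ring
  have hνD : 0 ≤ ν * D := by positivity
  have e8 : 161 / 4 / ν * (Q + Q) = 161 / 2 * (1 / ν * Q) := by ring
  have e9 : 2 / ν * Q = 2 * (1 / ν * Q) := by ring
  have hQν : 0 ≤ 1 / ν * Q := by positivity
  rw [e8, e9]
  linarith [hlow, hl1, hl2, hl3]

/-! ### Differential inequalities -/

theorem le_max_of_deriv_nonpos {y y' : ℝ → ℝ} {T B : ℝ} (hT : 0 ≤ T)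
    (hy : ContinuousOn y (Icc 0 T)) (hd : ∀ t ∈ Ioo 0 T, HasDerivAt y (y' t) t)
    (h : ∀ t ∈ Ioo 0 T, B < y t → y' t ≤ 0) : y T ≤ max (y 0) B := by
  by_contra! hcon
  set m := max (y 0) B with hm
  -- the last time at which `y ≤ m`
  set S := {t ∈ Icc 0 T | y t ≤ m} with hS
  have hScl : IsClosed S := hy.preimage_isClosed_of_isClosed isClosed_Icc isClosed_Iic
  have h0S : (0 : ℝ) ∈ S := ⟨⟨le_rfl, hT⟩, le_max_left _ _⟩
  have hSb : BddAbove S := ⟨T, fun t ht => ht.1.2⟩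
  have hsS : sSup S ∈ S := hScl.csSup_mem ⟨0, h0S⟩ hSb
  set τ := sSup S
  have hτT : τ < T := lt_of_le_of_ne hsS.1.2 fun h => absurd hsS.2 (by rw [h]; exact not_le.2 hcon)
  have hgt : ∀ t ∈ Ioc τ T, m < y t := by
    intro t ht
    by_contra! hle
    exact absurd (le_csSup hSb ⟨⟨hsS.1.1.trans ht.1.le, ht.2⟩, hle⟩) (not_le.2 ht.1)
  have hanti : AntitoneOn y (Icc τ T) := by
    refine antitoneOn_of_deriv_nonpos (convex_Icc _ _)
      (hy.mono (Icc_subset_Icc_left hsS.1.1)) ?_ ?_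
    · intro t ht
      rw [interior_Icc] at ht
      exact (hd t ⟨hsS.1.1.trans_lt ht.1, ht.2⟩).differentiableAt.differentiableWithinAt
    · intro t ht
      rw [interior_Icc] at ht
      have h1 : t ∈ Ioo 0 T := ⟨hsS.1.1.trans_lt ht.1, ht.2⟩
      rw [(hd t h1).deriv]
      exact h t h1 ((le_max_right _ _).trans_lt (hgt t ⟨ht.1, ht.2.le⟩))
  exact absurd (hanti ⟨le_rfl, hτT.le⟩ ⟨hτT.le, le_rfl⟩ hτT.le)
    (not_le.2 (hsS.2.trans_lt hcon))

theorem hasDerivAt_integral_right {b : ℝ → ℝ} (hb : Continuous b) (a t : ℝ) :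
    HasDerivAt (fun s => ∫ τ in a..s, b τ) (b t) t :=
  (hb.integral_hasStrictDerivAt a t).hasDerivAt

theorem le_of_deriv_le {y y' b : ℝ → ℝ} {T : ℝ} (hT : 0 ≤ T) (hy : ContinuousOn y (Icc 0 T))
    (hd : ∀ t ∈ Ioo 0 T, HasDerivAt y (y' t) t) (hb : Continuous b)
    (h : ∀ t ∈ Ioo 0 T, y' t ≤ b t) : y T ≤ y 0 + ∫ τ in (0 : ℝ)..T, b τ := by
  have hI : Continuous fun s => ∫ τ in (0 : ℝ)..s, b τ :=
    continuous_iff_continuousAt.2 fun t => (hasDerivAt_integral_right hb 0 t).continuousAt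
  have hanti : AntitoneOn (fun s => y s - ∫ τ in (0 : ℝ)..s, b τ) (Icc 0 T) := by
    refine antitoneOn_of_deriv_nonpos (convex_Icc _ _) (hy.sub hI.continuousOn) ?_ ?_
    · intro t ht
      rw [interior_Icc] at ht
      exact ((hd t ht).sub (hasDerivAt_integral_right hb 0 t)).differentiableAt.differentiableWithinAt
    · intro t ht
      rw [interior_Icc] at ht
      have := ((hd t ht).sub (hasDerivAt_integral_right hb 0 t)).deriv
      rw [show (fun s => y s - ∫ τ in (0 : ℝ)..s, b τ) = y - fun s => ∫ τ in (0 : ℝ)..s, b τ from rfl,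
        this]
      linarith [h t ht]
  have := hanti ⟨le_rfl, hT⟩ ⟨hT, le_rfl⟩ hT
  simp only [intervalIntegral.integral_same, sub_zero] at this
  linarith

theorem exp_mul_le_of_deriv_le {y y' b : ℝ → ℝ} {T α : ℝ} (hT : 0 ≤ T)
    (hy : ContinuousOn y (Icc 0 T)) (hd : ∀ t ∈ Ioo 0 T, HasDerivAt y (y' t) t)
    (hb : Continuous b) (h : ∀ t ∈ Ioo 0 T, y' t ≤ -α * y t + b t) :
    Real.exp (α * T) * y T ≤ y 0 + ∫ τ in (0 : ℝ)..T, Real.exp (α * τ) * b τ := by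
  have := le_of_deriv_le (y := fun t => Real.exp (α * t) * y t) hT
    (ContinuousOn.mul (by fun_prop) hy)
    (fun t ht => (((hasDerivAt_id t).const_mul α).exp.mul (hd t ht)))
    (b := fun t => Real.exp (α * t) * b t) (by fun_prop) (fun t ht => by
      have := mul_le_mul_of_nonneg_left (h t ht) (Real.exp_pos (α * t)).le
      simp only [id, mul_one]
      linarith)
  simpa using this

/-- Grönwall's inequality in integral form. -/
theorem le_exp_of_le_integral {y : ℝ → ℝ} (hy : Continuous y) {T C β : ℝ} (hT : 0 ≤ T)
    (hβ : 0 ≤ β) (h : ∀ t ∈ Icc 0 T, y t ≤ C + β * ∫ τ in (0 : ℝ)..t, y τ) :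
    y T ≤ C * Real.exp (β * T) := by
  have hI : Continuous fun s => ∫ τ in (0 : ℝ)..s, y τ :=
    continuous_iff_continuousAt.2 fun t => (hasDerivAt_integral_right hy 0 t).continuousAt
  have h1 := exp_mul_le_of_deriv_le (y := fun s => C + β * ∫ τ in (0 : ℝ)..s, y τ) (α := -β)
    (b := fun _ => 0) hT (by fun_prop)
    (fun t _ => ((hasDerivAt_integral_right hy 0 t).const_mul β).const_add C) continuous_const
    (fun t ht => by
      have := mul_le_mul_of_nonneg_left (h t ⟨ht.1.le, ht.2.le⟩) hβ
      linarith)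
  simp only [intervalIntegral.integral_same, mul_zero, add_zero, intervalIntegral.integral_zero] at h1
  have h2 := h T ⟨hT, le_rfl⟩
  have h3 : Real.exp (-β * T) * y T ≤ C :=
    (mul_le_mul_of_nonneg_left h2 (Real.exp_pos _).le).trans h1
  have h4 := mul_le_mul_of_nonneg_right h3 (Real.exp_pos (β * T)).le
  have h5 : Real.exp (-β * T) * Real.exp (β * T) = 1 := by
    rw [← Real.exp_add]; simp
  calc y T = Real.exp (-β * T) * Real.exp (β * T) * y T := by rw [h5, one_mul]
    _ ≤ _ := by linarith

theorem two_pi_mul_sq_le {g g' : ℝ → ℝ} (hg : ∀ x, HasDerivAt g (g' x) x) (hg' : Continuous g')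
    {x : ℝ} (hx : x ∈ Icc (-π) π) :
    2 * π * g x ^ 2 ≤ (∫ y in (-π)..π, g y ^ 2)
      + 4 * π * (√(∫ y in (-π)..π, g y ^ 2) * √(∫ y in (-π)..π, g' y ^ 2)) := by
  have hgc : Continuous g := continuous_iff_continuousAt.2 fun x => (hg x).continuousAt
  set R := √(∫ y in (-π)..π, g y ^ 2) * √(∫ y in (-π)..π, g' y ^ 2) with hR
  have hCS : ∫ y in (-π)..π, |g y| * |g' y| ≤ R := by
    have := (le_abs_self _).trans (abs_integral_mul_le (f := fun y => |g y|) (g := fun y => |g' y|)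
      (by fun_prop) (by fun_prop) neg_pi_le_pi)
    simpa only [sq_abs] using this
  have key : ∀ y ∈ Icc (-π) π, g x ^ 2 ≤ g y ^ 2 + 2 * R := by
    intro y hy
    have e : g x ^ 2 - g y ^ 2 = ∫ z in y..x, 2 * g z * g' z := by
      rw [intervalIntegral.integral_eq_sub_of_hasDerivAt
        (fun z _ => ((hg z).pow 2).congr_deriv (by simp)) (by
          exact (by fun_prop : Continuous fun z => 2 * g z * g' z).intervalIntegrable _ _)]
      rfl
    have h1 : |∫ z in y..x, 2 * g z * g' z| ≤ |∫ z in y..x, 2 * (|g z| * |g' z|)| := by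
      rw [← Real.norm_eq_abs]
      refine (intervalIntegral.norm_integral_le_abs_integral_norm).trans_eq ?_
      congr 2; ext z
      rw [Real.norm_eq_abs, abs_mul, abs_mul, abs_two]; ring
    have h2 : |∫ z in y..x, 2 * (|g z| * |g' z|)| ≤ ∫ z in (-π)..π, 2 * (|g z| * |g' z|) := by
      have := intervalIntegral.abs_integral_mono_interval (μ := volume) (a := y) (b := x)
        (c := -π) (d := π) (f := fun z => 2 * (|g z| * |g' z|)) ?_ ?_ ?_
      · refine this.trans_eq (abs_of_nonneg ?_)
        exact integral_nonneg_of_forall neg_pi_le_pi fun z => by positivity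
      · rw [uIoc_of_le neg_pi_le_pi]
        intro z hz
        rcases le_total y x with h | h
        · rw [uIoc_of_le h] at hz; exact ⟨hy.1.trans_lt hz.1, hz.2.trans hx.2⟩
        · rw [uIoc_of_ge h] at hz; exact ⟨hx.1.trans_lt hz.1, hz.2.trans hy.2⟩
      · exact ae_of_all _ fun z => by positivity
      · exact (by fun_prop : Continuous fun z => 2 * (|g z| * |g' z|)).intervalIntegrable _ _
    have h3 : ∫ z in (-π)..π, 2 * (|g z| * |g' z|) = 2 * ∫ z in (-π)..π, |g z| * |g' z| :=
      intervalIntegral.integral_const_mul _ _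
    have := le_abs_self (∫ z in y..x, 2 * g z * g' z)
    linarith
  have := intervalIntegral.integral_mono_on neg_pi_le_pi
    (continuous_const.intervalIntegrable (μ := volume) _ _)
    ((by fun_prop : Continuous fun y => g y ^ 2 + 2 * R).intervalIntegrable _ _) key
  rw [integral_add_of_continuous (by fun_prop) (by fun_prop)] at this
  simp only [intervalIntegral.integral_const, smul_eq_mul] at this
  linarith

/-- A Nash inequality on the circle, for densities of mass at most one. -/
theorem nash_circle {g g' : ℝ → ℝ} (hg : ∀ x, HasDerivAt g (g' x) x) (hg' : Continuous g')
    (h0 : ∀ x, 0 ≤ g x) (h1 : ∫ x in (-π)..π, g x ≤ 1) (h2 : 2 ≤ ∫ x in (-π)..π, g x ^ 2) :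
    (∫ x in (-π)..π, g x ^ 2) ^ 3 ≤ 16 * ∫ x in (-π)..π, g' x ^ 2 := by
  have hgc : Continuous g := continuous_iff_continuousAt.2 fun x => (hg x).continuousAt
  set A := ∫ x in (-π)..π, g x ^ 2 with hA
  set D := ∫ x in (-π)..π, g' x ^ 2 with hD
  have hD0 : 0 ≤ D := integral_nonneg_of_forall neg_pi_le_pi fun x => by positivity
  have hA0 : 0 ≤ A := by linarith
  set S := A + 2 * (√A * √D) with hS
  have hS0 : 0 ≤ S := by positivity
  have hsup : ∀ x ∈ Icc (-π) π, g x ≤ √S := by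
    intro x hx
    have h3 := two_pi_mul_sq_le hg hg' hx
    have hpi := Real.pi_gt_three
    have h4 : g x ^ 2 ≤ S := by
      have h5 : A ≤ 2 * π * A := by nlinarith
      have : 2 * π * g x ^ 2 ≤ 2 * π * S := by rw [hS]; linarith
      exact le_of_mul_le_mul_left this (by positivity)
    exact Real.le_sqrt_of_sq_le h4
  have hAS : A ≤ √S := by
    have h3 : A ≤ ∫ x in (-π)..π, √S * g x := by
      refine intervalIntegral.integral_mono_on neg_pi_le_pi
        ((by fun_prop : Continuous fun x => g x ^ 2).intervalIntegrable _ _)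
        ((by fun_prop : Continuous fun x => √S * g x).intervalIntegrable _ _) fun x hx => ?_
      rw [sq]
      exact mul_le_mul_of_nonneg_right (hsup x hx) (h0 x)
    rw [intervalIntegral.integral_const_mul] at h3
    nlinarith [Real.sqrt_nonneg S]
  have hAS2 : A ^ 2 ≤ S := by
    calc A ^ 2 ≤ √S ^ 2 := by gcongr
      _ = S := Real.sq_sqrt hS0
  have h3 : A ^ 2 ≤ 4 * (√A * √D) := by nlinarith
  have h4 : (A ^ 2) ^ 2 ≤ (4 * (√A * √D)) ^ 2 := by gcongr
  have h5 : (4 * (√A * √D)) ^ 2 = 16 * (A * D) := by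
    rw [mul_pow, mul_pow, Real.sq_sqrt hA0, Real.sq_sqrt hD0]; norm_num
  rw [h5] at h4
  have : A * A ^ 3 ≤ A * (16 * D) := by linarith
  exact le_of_mul_le_mul_left this (by linarith)

/-! ### Fourier modes in the spatial variables and Parseval's identity -/

/-- Joint continuity of a function of `(x₁, x₂, θ)`. -/
def Cont3 (h : Fun3) : Prop := Continuous fun q : ℝ × ℝ × ℝ => h q.1 q.2.1 q.2.2

theorem continuousOn_int2 {Y : Type*} [TopologicalSpace Y] {S : Set Y} {F : Y → ℝ → ℝ → ℝ}
    (hF : ContinuousOn (fun p : Y × ℝ × ℝ => F p.1 p.2.1 p.2.2) (S ×ˢ univ)) (a b c d : ℝ) :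
    ContinuousOn (fun y => ∫ x₁ in a..b, ∫ x₂ in c..d, F y x₁ x₂) S := by
  refine continuousOn_integral_param (F := fun y x₁ => ∫ x₂ in c..d, F y x₁ x₂) ?_ a b
  refine continuousOn_integral_param (Y := Y × ℝ) (S := S ×ˢ univ)
    (F := fun p x₂ => F p.1 p.2 x₂) ?_ c d
  exact hF.comp (f := fun q : (Y × ℝ) × ℝ => (q.1.1, q.1.2, q.2)) (by fun_prop)
    (fun q hq => by simpa using hq)

theorem continuous_int2 {Y : Type*} [TopologicalSpace Y] {F : Y → ℝ → ℝ → ℝ}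
    (hF : Continuous (fun p : Y × ℝ × ℝ => F p.1 p.2.1 p.2.2)) (a b c d : ℝ) :
    Continuous (fun y => ∫ x₁ in a..b, ∫ x₂ in c..d, F y x₁ x₂) :=
  continuousOn_univ.1 (continuousOn_int2 (by rw [univ_prod_univ]; exact hF.continuousOn) a b c d)

theorem hasDerivAt_int2 {U : Set ℝ} (hU : IsOpen U) {F F' : ℝ → ℝ → ℝ → ℝ}
    (hF : ContinuousOn (fun p : ℝ × ℝ × ℝ => F p.1 p.2.1 p.2.2) (U ×ˢ univ))
    (hF' : ContinuousOn (fun p : ℝ × ℝ × ℝ => F' p.1 p.2.1 p.2.2) (U ×ˢ univ))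
    (hd : ∀ t ∈ U, ∀ x₁ x₂, HasDerivAt (fun s => F s x₁ x₂) (F' t x₁ x₂) t) (a b c d : ℝ)
    {t : ℝ} (ht : t ∈ U) :
    HasDerivAt (fun s => ∫ x₁ in a..b, ∫ x₂ in c..d, F s x₁ x₂)
      (∫ x₁ in a..b, ∫ x₂ in c..d, F' t x₁ x₂) t := by
  have hc : ∀ {G : ℝ → ℝ → ℝ → ℝ},
      ContinuousOn (fun p : ℝ × ℝ × ℝ => G p.1 p.2.1 p.2.2) (U ×ˢ univ) →
      ContinuousOn (fun p : ℝ × ℝ => ∫ x₂ in c..d, G p.1 p.2 x₂) (U ×ˢ univ) := by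
    intro G hG
    refine continuousOn_integral_param (Y := ℝ × ℝ) (S := U ×ˢ univ)
      (F := fun p x₂ => G p.1 p.2 x₂) ?_ c d
    exact hG.comp (f := fun q : (ℝ × ℝ) × ℝ => (q.1.1, q.1.2, q.2)) (by fun_prop)
      (fun q hq => by simpa using hq)
  refine hasDerivAt_integral_param hU (F := fun s x₁ => ∫ x₂ in c..d, F s x₁ x₂)
    (F' := fun s x₁ => ∫ x₂ in c..d, F' s x₁ x₂) (hc hF) (hc hF') (fun s hs x₁ => ?_) a b ht
  refine hasDerivAt_integral_param hU (F := fun s x₂ => F s x₁ x₂)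
    (F' := fun s x₂ => F' s x₁ x₂) ?_ ?_ (fun r hr x₂ => hd r hr x₁ x₂) c d hs
  · exact hF.comp (f := fun q : ℝ × ℝ => (q.1, x₁, q.2)) (by fun_prop) (fun q hq => by simpa using hq)
  · exact hF'.comp (f := fun q : ℝ × ℝ => (q.1, x₁, q.2)) (by fun_prop) (fun q hq => by simpa using hq)

theorem Cont3.add {f g : Fun3} (hf : Cont3 f) (hg : Cont3 g) :
    Cont3 fun x₁ x₂ θ => f x₁ x₂ θ + g x₁ x₂ θ := Continuous.fun_add hf hg

theorem Cont3.sub {f g : Fun3} (hf : Cont3 f) (hg : Cont3 g) :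
    Cont3 fun x₁ x₂ θ => f x₁ x₂ θ - g x₁ x₂ θ := Continuous.fun_sub hf hg

theorem Cont3.mul {f g : Fun3} (hf : Cont3 f) (hg : Cont3 g) :
    Cont3 fun x₁ x₂ θ => f x₁ x₂ θ * g x₁ x₂ θ := Continuous.fun_mul hf hg

theorem Cont3.pow {f : Fun3} (hf : Cont3 f) (n : ℕ) :
    Cont3 fun x₁ x₂ θ => f x₁ x₂ θ ^ n := Continuous.fun_pow hf n

theorem Cont3.const_mul {f : Fun3} (hf : Cont3 f) (c : ℝ) :
    Cont3 fun x₁ x₂ θ => c * f x₁ x₂ θ := Continuous.fun_mul continuous_const hf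

theorem Cont3.abs {f : Fun3} (hf : Cont3 f) : Cont3 fun x₁ x₂ θ => |f x₁ x₂ θ| :=
  Continuous.abs (show Continuous fun q : ℝ × ℝ × ℝ => f q.1 q.2.1 q.2.2 from hf)

theorem Cont3.comp {f : Fun3} (hf : Cont3 f) {Y : Type*} [TopologicalSpace Y] {a b c : Y → ℝ}
    (ha : Continuous a) (hb : Continuous b) (hc : Continuous c) :
    Continuous fun y => f (a y) (b y) (c y) :=
  Continuous.comp (show Continuous fun q : ℝ × ℝ × ℝ => f q.1 q.2.1 q.2.2 from hf)
    (ha.prodMk (hb.prodMk hc))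

theorem cont3_angle {g : ℝ → ℝ} (hg : Continuous g) : Cont3 fun _ _ θ => g θ :=
  hg.comp (by fun_prop : Continuous fun q : ℝ × ℝ × ℝ => q.2.2)

/-- Lebesgue measure on a period cell of the three-dimensional torus. -/
noncomputable def cell : Measure (ℝ × ℝ × ℝ) :=
  (volume.restrict (Ioc (-π) π)).prod
    ((volume.restrict (Ioc (-π) π)).prod (volume.restrict (Ioc (-π) π)))

theorem cell_eq : cell = volume.restrict (Ioc (-π) π ×ˢ (Ioc (-π) π ×ˢ Ioc (-π) π)) := by
  unfold cell
  rw [Measure.prod_restrict, Measure.prod_restrict]; rfl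

theorem Cont3.integrable {h : Fun3} (hh : Cont3 h) :
    Integrable (fun q : ℝ × ℝ × ℝ => h q.1 q.2.1 q.2.2) cell := by
  rw [cell_eq]
  exact (hh.continuousOn.integrableOn_compact
    (isCompact_Icc.prod (isCompact_Icc.prod isCompact_Icc))).mono_set
    (prod_mono Ioc_subset_Icc_self (prod_mono Ioc_subset_Icc_self Ioc_subset_Icc_self))

theorem integral3_eq_integral_cell {h : Fun3} (hh : Cont3 h) :
    integral3 h = ∫ q, h q.1 q.2.1 q.2.2 ∂cell := by
  unfold integral3
  simp only [intervalIntegral.integral_of_le neg_pi_le_pi]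
  have h1 := hh.integrable
  unfold cell at h1 ⊢
  rw [integral_prod _ h1]
  refine integral_congr_ae ?_
  filter_upwards [h1.prod_right_ae] with x hx
  rw [integral_prod _ hx]

theorem integral3_eq_theta {h : Fun3} (hh : Cont3 h) :
    integral3 h = ∫ θ in (-π)..π, ∫ x₁ in (-π)..π, ∫ x₂ in (-π)..π, h x₁ x₂ θ := by
  unfold integral3
  have hh' : Continuous fun q : ℝ × ℝ × ℝ => h q.1 q.2.1 q.2.2 := hh
  have h1 : ∀ x₁, ∫ x₂ in (-π)..π, ∫ θ in (-π)..π, h x₁ x₂ θ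
      = ∫ θ in (-π)..π, ∫ x₂ in (-π)..π, h x₁ x₂ θ := fun x₁ =>
    integral_swap (F := fun x₂ θ => h x₁ x₂ θ)
      (hh'.comp (by fun_prop : Continuous fun p : ℝ × ℝ => (x₁, p.1, p.2))) neg_pi_le_pi neg_pi_le_pi
  simp only [h1]
  refine integral_swap (F := fun x₁ θ => ∫ x₂ in (-π)..π, h x₁ x₂ θ) ?_ neg_pi_le_pi neg_pi_le_pi
  exact intervalIntegral.continuous_parametric_intervalIntegral_of_continuous'
    (f := fun (p : ℝ × ℝ) x₂ => h p.1 x₂ p.2)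
    (hh'.comp (by fun_prop : Continuous fun p : (ℝ × ℝ) × ℝ => (p.1.1, p.2, p.1.2))) _ _

theorem integral3_mono {f g : Fun3} (hf : Cont3 f) (hg : Cont3 g)
    (h : ∀ x₁ x₂ θ, f x₁ x₂ θ ≤ g x₁ x₂ θ) : integral3 f ≤ integral3 g := by
  rw [integral3_eq_integral_cell hf, integral3_eq_integral_cell hg]
  exact integral_mono hf.integrable hg.integrable fun q => h _ _ _

theorem integral3_nonneg {f : Fun3} (h : ∀ x₁ x₂ θ, 0 ≤ f x₁ x₂ θ) : 0 ≤ integral3 f :=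
  integral_nonneg_of_forall neg_pi_le_pi fun _ =>
    integral_nonneg_of_forall neg_pi_le_pi fun _ =>
      integral_nonneg_of_forall neg_pi_le_pi fun _ => h _ _ _

theorem integral3_add {f g : Fun3} (hf : Cont3 f) (hg : Cont3 g) :
    integral3 (fun x₁ x₂ θ => f x₁ x₂ θ + g x₁ x₂ θ) = integral3 f + integral3 g := by
  rw [integral3_eq_integral_cell hf, integral3_eq_integral_cell hg,
    integral3_eq_integral_cell (hf.add hg)]
  exact integral_add hf.integrable hg.integrable

theorem integral3_const_mul (c : ℝ) (f : Fun3) :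
    integral3 (fun x₁ x₂ θ => c * f x₁ x₂ θ) = c * integral3 f := by
  simp only [integral3, intervalIntegral.integral_const_mul]

theorem integral3_const (c : ℝ) : integral3 (fun _ _ _ => c) = (2 * π) ^ 3 * c := by
  simp only [integral3, intervalIntegral.integral_const, smul_eq_mul]; ring

theorem sq_integral3_mul_le {f g : Fun3} (hf : Cont3 f) (hg : Cont3 g) :
    (integral3 fun x₁ x₂ θ => f x₁ x₂ θ * g x₁ x₂ θ) ^ 2
      ≤ (integral3 fun x₁ x₂ θ => f x₁ x₂ θ ^ 2) * integral3 fun x₁ x₂ θ => g x₁ x₂ θ ^ 2 := by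
  have cff := hf.pow 2
  have cgg := hg.pow 2
  have cfg := hf.mul hg
  have key : ∀ t : ℝ, 0 ≤ (integral3 fun x₁ x₂ θ => f x₁ x₂ θ ^ 2) * (t * t)
      + (2 * integral3 fun x₁ x₂ θ => f x₁ x₂ θ * g x₁ x₂ θ) * t
      + integral3 fun x₁ x₂ θ => g x₁ x₂ θ ^ 2 := by
    intro t
    have h0 : 0 ≤ integral3 fun x₁ x₂ θ => (t * f x₁ x₂ θ + g x₁ x₂ θ) ^ 2 :=
      integral3_nonneg fun _ _ _ => sq_nonneg _
    have h1 : (fun x₁ x₂ θ => (t * f x₁ x₂ θ + g x₁ x₂ θ) ^ 2)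
        = fun x₁ x₂ θ => ((t * t) * f x₁ x₂ θ ^ 2 + (2 * t) * (f x₁ x₂ θ * g x₁ x₂ θ))
          + g x₁ x₂ θ ^ 2 := by
      ext; ring
    rw [h1, integral3_add (f := fun x₁ x₂ θ => (t * t) * f x₁ x₂ θ ^ 2
        + (2 * t) * (f x₁ x₂ θ * g x₁ x₂ θ))
        ((cff.const_mul _).add (cfg.const_mul _)) cgg,
      integral3_add (f := fun x₁ x₂ θ => (t * t) * f x₁ x₂ θ ^ 2) (cff.const_mul _)
        (cfg.const_mul _), integral3_const_mul, integral3_const_mul] at h0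
    linarith
  have := discrim_le_zero key
  rw [discrim] at this
  linarith

theorem hasSum_integral_of_nonneg {ι : Type*} [Countable ι] {f : ι → ℝ → ℝ} {F : ℝ → ℝ}
    (hf : ∀ i, Continuous (f i)) (h0 : ∀ i x, 0 ≤ f i x) (hF : Continuous F)
    (h : ∀ x, HasSum (fun i => f i x) (F x)) (a b : ℝ) :
    HasSum (fun i => ∫ x in a..b, f i x) (∫ x in a..b, F x) := by
  refine intervalIntegral.hasSum_integral_of_dominated_convergence (bound := f)
    (fun i => (hf i).aestronglyMeasurable) ?_ ?_ ?_ ?_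
  · exact fun i => ae_of_all _ fun x _ => by rw [Real.norm_of_nonneg (h0 i x)]
  · exact ae_of_all _ fun x _ => (h x).summable
  · have : (fun x => ∑' i, f i x) = F := funext fun x => (h x).tsum_eq
    rw [this]; exact hF.intervalIntegrable _ _
  · exact ae_of_all _ fun x _ => h x

theorem hasSum_prod_of_nonneg {α β : Type*} {f : α × β → ℝ} {g : α → ℝ} {a : ℝ}
    (h0 : ∀ p, 0 ≤ f p) (hf : ∀ x, HasSum (fun y => f (x, y)) (g x)) (hg : HasSum g a) :
    HasSum f a := by
  have hs : Summable f := by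
    rw [summable_prod_of_nonneg h0]
    refine ⟨fun x => (hf x).summable, ?_⟩
    simp only [fun x => (hf x).tsum_eq]
    exact hg.summable
  have := hs.hasSum.prod_fiberwise hf
  rw [← this.unique hg]
  exact hs.hasSum

theorem HasSum.of_eq {ι : Type*} {f g : ι → ℝ} {a b : ℝ} (h : HasSum f a) (hfg : ∀ i, g i = f i)
    (hab : b = a) : HasSum g b := by
  rw [hab, funext hfg]; exact h

theorem integral_ofReal_sub_mul_I {p q : ℝ → ℝ} (hp : Continuous p) (hq : Continuous q) (a b : ℝ) :
    ∫ x in a..b, ((p x : ℂ) - (q x : ℂ) * Complex.I)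
      = ((∫ x in a..b, p x : ℝ) : ℂ) - ((∫ x in a..b, q x : ℝ) : ℂ) * Complex.I := by
  have hp' : Continuous fun x => (p x : ℂ) := Complex.continuous_ofReal.comp hp
  have hq' : Continuous fun x => (q x : ℂ) * Complex.I :=
    (Complex.continuous_ofReal.comp hq).mul continuous_const
  rw [intervalIntegral.integral_sub (hp'.intervalIntegrable _ _) (hq'.intervalIntegrable _ _),
    intervalIntegral.integral_mul_const, intervalIntegral.integral_ofReal,
    intervalIntegral.integral_ofReal]

theorem parseval_circle {u : ℝ → ℂ} (hu : Continuous u) :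
    HasSum (fun n : ℤ => ‖∫ x in (-π)..π, Complex.exp (-(n * x : ℝ) * Complex.I) * u x‖ ^ 2)
      (2 * π * ∫ x in (-π)..π, ‖u x‖ ^ 2) := by
  have hab : -π < π := by linarith [Real.pi_pos]
  have hL2 : MemLp u 2 (volume.restrict (Ioc (-π) π)) := by
    refine MemLp.mono_measure (Measure.restrict_mono Ioc_subset_Icc_self le_rfl) ?_
    obtain ⟨M, hM⟩ := isCompact_Icc.exists_bound_of_continuousOn (hu.continuousOn (s := Icc (-π) π))
    refine MemLp.of_bound hu.aestronglyMeasurable M ?_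
    exact (ae_restrict_iff' measurableSet_Icc).2 (ae_of_all _ fun x hx => hM x hx)
  have h := (hasSum_sq_fourierCoeffOn hab hL2).mul_left ((2 * π) ^ 2)
  have hpi := Real.pi_pos
  refine HasSum.of_eq h (fun n => ?_) ?_
  · rw [fourierCoeffOn_eq_integral, norm_smul]
    have e : ∀ x : ℝ, fourier (-n) (x : AddCircle (π - -π)) • u x
        = Complex.exp (-(n * x : ℝ) * Complex.I) * u x := by
      intro x
      rw [fourier_coe_apply, smul_eq_mul]
      congr 2
      push_cast
      have : (π : ℂ) ≠ 0 := by exact_mod_cast hpi.ne'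
      field_simp
      ring
    simp only [e]
    have : ‖(1 / (π - -π) : ℝ)‖ = 1 / (2 * π) := by
      rw [Real.norm_of_nonneg (by rw [sub_neg_eq_add]; positivity)]; congr 1; ring
    have h1 : 2 * π * (1 / (2 * π)) = 1 := by field_simp
    rw [this, ← mul_pow, ← mul_assoc, h1, one_mul]
  · rw [smul_eq_mul]
    have : (π - -π)⁻¹ = 1 / (2 * π) := by rw [sub_neg_eq_add, ← two_mul, one_div]
    rw [this]; field_simp

/-- The Fourier mode `∫_{𝕋²} h(x, θ) cos(k · x + φ) dx`. The cosine and sine modes are those with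
phases `φ = 0` and `φ = -π/2`. -/
noncomputable def mode (h : Fun3) (k : ℤ × ℤ) (φ : ℝ) : ℝ → ℝ := fun θ =>
  ∫ x₁ in (-π)..π, ∫ x₂ in (-π)..π, h x₁ x₂ θ * Real.cos (k.1 * x₁ + k.2 * x₂ + φ)

/-- The squared `L²` norm in `θ` of the Fourier mode `k`. -/
noncomputable def modeSq (h : Fun3) (k : ℤ × ℤ) : ℝ :=
  ∫ θ in (-π)..π, (mode h k 0 θ ^ 2 + mode h k (-(π / 2)) θ ^ 2)

theorem Cont3.continuous_mode {h : Fun3} (hh : Cont3 h) (k : ℤ × ℤ) (φ : ℝ) :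
    Continuous (mode h k φ) := by
  have hh' : Continuous fun q : ℝ × ℝ × ℝ => h q.1 q.2.1 q.2.2 := hh
  refine continuous_int2 (F := fun θ x₁ x₂ => h x₁ x₂ θ * Real.cos (k.1 * x₁ + k.2 * x₂ + φ)) ?_
    _ _ _ _
  exact (hh'.comp (by fun_prop : Continuous fun p : ℝ × ℝ × ℝ => (p.2.1, p.2.2, p.1))).mul
    (by fun_prop)

theorem modeSq_nonneg (h : Fun3) (k : ℤ × ℤ) : 0 ≤ modeSq h k :=
  integral_nonneg_of_forall neg_pi_le_pi fun _ => by positivity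

theorem integral_exp_eq_mode {g : ℝ → ℝ → ℝ} (hg : Continuous fun p : ℝ × ℝ => g p.1 p.2)
    (m n : ℤ) :
    ‖∫ x₁ in (-π)..π, Complex.exp (-(m * x₁ : ℝ) * Complex.I) *
      ∫ x₂ in (-π)..π, Complex.exp (-(n * x₂ : ℝ) * Complex.I) * (g x₁ x₂ : ℂ)‖ ^ 2
    = (∫ x₁ in (-π)..π, ∫ x₂ in (-π)..π, g x₁ x₂ * Real.cos (m * x₁ + n * x₂ + 0)) ^ 2
      + (∫ x₁ in (-π)..π, ∫ x₂ in (-π)..π, g x₁ x₂ * Real.cos (m * x₁ + n * x₂ + -(π / 2))) ^ 2 := by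
  have hcos : ∀ φ : ℝ, Continuous fun p : ℝ × ℝ => g p.1 p.2 * Real.cos (m * p.1 + n * p.2 + φ) :=
    fun φ => hg.mul (by fun_prop)
  have e1 : ∀ x₁ x₂ : ℝ, Complex.exp (-(m * x₁ : ℝ) * Complex.I) *
      (Complex.exp (-(n * x₂ : ℝ) * Complex.I) * (g x₁ x₂ : ℂ))
      = ((g x₁ x₂ * Real.cos (m * x₁ + n * x₂ + 0) : ℝ) : ℂ)
        - ((g x₁ x₂ * Real.cos (m * x₁ + n * x₂ + -(π / 2)) : ℝ) : ℂ) * Complex.I := by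
    intro x₁ x₂
    rw [← mul_assoc, ← Complex.exp_add, ← add_mul]
    rw [← sub_eq_add_neg (_ : ℝ) (π / 2), Real.cos_sub_pi_div_two, add_zero]
    have : (-((m * x₁ : ℝ) : ℂ) + -((n * x₂ : ℝ) : ℂ)) = ((-(m * x₁ + n * x₂) : ℝ) : ℂ) := by
      push_cast; ring
    rw [this, Complex.exp_mul_I, ← Complex.ofReal_cos, ← Complex.ofReal_sin, Real.cos_neg,
      Real.sin_neg]
    push_cast; ring
  have e2 : ∀ x₁ : ℝ, Complex.exp (-(m * x₁ : ℝ) * Complex.I) *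
      ∫ x₂ in (-π)..π, Complex.exp (-(n * x₂ : ℝ) * Complex.I) * (g x₁ x₂ : ℂ)
      = ((∫ x₂ in (-π)..π, g x₁ x₂ * Real.cos (m * x₁ + n * x₂ + 0) : ℝ) : ℂ)
        - ((∫ x₂ in (-π)..π, g x₁ x₂ * Real.cos (m * x₁ + n * x₂ + -(π / 2)) : ℝ) : ℂ)
          * Complex.I := by
    intro x₁
    have hc : ∀ φ : ℝ, Continuous fun x₂ => g x₁ x₂ * Real.cos (m * x₁ + n * x₂ + φ) := fun φ =>
      (hcos φ).comp (by fun_prop : Continuous fun x₂ : ℝ => (x₁, x₂))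
    rw [← intervalIntegral.integral_const_mul]
    simp only [e1]
    rw [integral_ofReal_sub_mul_I (hc 0) (hc _)]
  simp only [e2]
  have hc : ∀ φ : ℝ, Continuous fun x₁ =>
      ∫ x₂ in (-π)..π, g x₁ x₂ * Real.cos (m * x₁ + n * x₂ + φ) := fun φ =>
    intervalIntegral.continuous_parametric_intervalIntegral_of_continuous' (hcos φ) _ _
  rw [integral_ofReal_sub_mul_I (hc 0) (hc _), ← Complex.normSq_eq_norm_sq, Complex.normSq_apply]
  simp
  ring

theorem parseval_torus {g : ℝ → ℝ → ℝ} (hg : Continuous fun p : ℝ × ℝ => g p.1 p.2) :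
    HasSum (fun k : ℤ × ℤ =>
      (∫ x₁ in (-π)..π, ∫ x₂ in (-π)..π, g x₁ x₂ * Real.cos (k.1 * x₁ + k.2 * x₂ + 0)) ^ 2
      + (∫ x₁ in (-π)..π, ∫ x₂ in (-π)..π,
          g x₁ x₂ * Real.cos (k.1 * x₁ + k.2 * x₂ + -(π / 2))) ^ 2)
      ((2 * π) ^ 2 * ∫ x₁ in (-π)..π, ∫ x₂ in (-π)..π, g x₁ x₂ ^ 2) := by
  have cU : ∀ n : ℤ, Continuous fun x₁ =>
      ∫ x₂ in (-π)..π, Complex.exp (-(n * x₂ : ℝ) * Complex.I) * (g x₁ x₂ : ℂ) := fun n =>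
    intervalIntegral.continuous_parametric_intervalIntegral_of_continuous'
      (f := fun x₁ x₂ => Complex.exp (-(n * x₂ : ℝ) * Complex.I) * (g x₁ x₂ : ℂ))
      ((by fun_prop : Continuous fun p : ℝ × ℝ => Complex.exp (-(n * p.2 : ℝ) * Complex.I)).mul
        (Complex.continuous_ofReal.comp hg)) _ _
  have h1 : ∀ x₁, HasSum (fun n : ℤ =>
      ‖∫ x₂ in (-π)..π, Complex.exp (-(n * x₂ : ℝ) * Complex.I) * (g x₁ x₂ : ℂ)‖ ^ 2)
      (2 * π * ∫ x₂ in (-π)..π, g x₁ x₂ ^ 2) := by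
    intro x₁
    have := parseval_circle (u := fun x₂ => (g x₁ x₂ : ℂ)) (Complex.continuous_ofReal.comp
      (hg.comp (by fun_prop : Continuous fun x₂ : ℝ => (x₁, x₂))))
    simpa using this
  have cI : Continuous fun x₁ => 2 * π * ∫ x₂ in (-π)..π, g x₁ x₂ ^ 2 :=
    continuous_const.mul (intervalIntegral.continuous_parametric_intervalIntegral_of_continuous'
      (f := fun x₁ x₂ => g x₁ x₂ ^ 2) (hg.fun_pow 2) _ _)
  have h2 := hasSum_integral_of_nonneg (fun n => (cU n).norm.fun_pow 2) (fun n x => sq_nonneg _)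
    cI h1 (-π) π
  set U : ℤ → ℝ → ℂ := fun n x₁ =>
    ∫ x₂ in (-π)..π, Complex.exp (-(n * x₂ : ℝ) * Complex.I) * (g x₁ x₂ : ℂ) with hU
  have h7 : HasSum (fun n => 2 * π * ∫ x₁ in (-π)..π, ‖U n x₁‖ ^ 2) _ := h2.mul_left (2 * π)
  have cU' : ∀ n, Continuous (U n) := cU
  clear_value U
  have h8 : ∀ n : ℤ, HasSum (fun m : ℤ =>
      ‖∫ x₁ in (-π)..π, Complex.exp (-(m * x₁ : ℝ) * Complex.I) * U n x₁‖ ^ 2)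
      (2 * π * ∫ x₁ in (-π)..π, ‖U n x₁‖ ^ 2) := fun n => parseval_circle (cU' n)
  have h3 := hasSum_prod_of_nonneg
    (f := fun p : ℤ × ℤ => ‖∫ x₁ in (-π)..π, Complex.exp (-(p.2 * x₁ : ℝ) * Complex.I) * U p.1 x₁‖ ^ 2)
    (g := fun n => 2 * π * ∫ x₁ in (-π)..π, ‖U n x₁‖ ^ 2)
    (fun _ => sq_nonneg _) h8 h7
  have h4 := (Equiv.prodComm ℤ ℤ).hasSum_iff.2 h3
  have h5 : ∀ k : ℤ × ℤ,
      (∫ x₁ in (-π)..π, ∫ x₂ in (-π)..π, g x₁ x₂ * Real.cos (k.1 * x₁ + k.2 * x₂ + 0)) ^ 2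
      + (∫ x₁ in (-π)..π, ∫ x₂ in (-π)..π,
          g x₁ x₂ * Real.cos (k.1 * x₁ + k.2 * x₂ + -(π / 2))) ^ 2
      = ‖∫ x₁ in (-π)..π, Complex.exp (-(k.1 * x₁ : ℝ) * Complex.I) * U k.2 x₁‖ ^ 2 := fun k => by
    rw [hU]; exact (integral_exp_eq_mode hg k.1 k.2).symm
  have h6 : (2 * π) ^ 2 * (∫ x₁ in (-π)..π, ∫ x₂ in (-π)..π, g x₁ x₂ ^ 2)
      = 2 * π * ∫ x₁ in (-π)..π, 2 * π * ∫ x₂ in (-π)..π, g x₁ x₂ ^ 2 := by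
    rw [intervalIntegral.integral_const_mul]; ring
  rw [h6]
  simp only [h5]
  exact h4

/-- Parseval's identity in the spatial variables, integrated over the angle. -/
theorem hasSum_modeSq {h : Fun3} (hh : Cont3 h) :
    HasSum (modeSq h) ((2 * π) ^ 2 * integral3 fun x₁ x₂ θ => h x₁ x₂ θ ^ 2) := by
  have hh' : Continuous fun q : ℝ × ℝ × ℝ => h q.1 q.2.1 q.2.2 := hh
  rw [integral3_eq_theta (hh.pow 2),
    ← intervalIntegral.integral_const_mul]
  refine hasSum_integral_of_nonneg
    (fun k => ((hh.continuous_mode k 0).pow 2).add ((hh.continuous_mode k _).pow 2))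
    (fun k θ => add_nonneg (sq_nonneg _) (sq_nonneg _)) ?_ (fun θ => ?_) _ _
  · refine continuous_const.mul (continuous_int2 (F := fun θ x₁ x₂ => h x₁ x₂ θ ^ 2) ?_ _ _ _ _)
    exact (hh'.comp (by fun_prop : Continuous fun p : ℝ × ℝ × ℝ => (p.2.1, p.2.2, p.1))).pow 2
  · exact parseval_torus (g := fun x₁ x₂ => h x₁ x₂ θ)
      (hh'.comp (by fun_prop : Continuous fun p : ℝ × ℝ => (p.1, p.2, θ)))

/-! ### Regularity of classical solutions and the equation of a Fourier mode -/

/-- Joint continuity, for times in `S`, of a time-dependent function of `(x₁, x₂, θ)`. -/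
def ContT (S : Set ℝ) (F : ℝ → Fun3) : Prop :=
  ContinuousOn (fun q : ℝ × ℝ × ℝ × ℝ => F q.1 q.2.1 q.2.2.1 q.2.2.2) (S ×ˢ univ)

theorem ContT.mono {S S' : Set ℝ} {F : ℝ → Fun3} (hF : ContT S F) (h : S' ⊆ S) : ContT S' F :=
  ContinuousOn.mono hF (prod_mono h le_rfl)

theorem ContT.cont3 {S : Set ℝ} {F : ℝ → Fun3} (hF : ContT S F) {t : ℝ} (ht : t ∈ S) :
    Cont3 (F t) :=
  ContinuousOn.comp_continuous hF (f := fun q : ℝ × ℝ × ℝ => (t, q)) (by fun_prop)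
    (fun q => by simp [ht])

theorem ContT.compOn {S : Set ℝ} {F : ℝ → Fun3} (hF : ContT S F) {Y : Type*} [TopologicalSpace Y]
    {T : Set Y} {τ a b c : Y → ℝ} (hτ : Continuous τ) (ha : Continuous a) (hb : Continuous b)
    (hc : Continuous c) (hT : ∀ y ∈ T, τ y ∈ S) :
    ContinuousOn (fun y => F (τ y) (a y) (b y) (c y)) T :=
  ContinuousOn.comp (g := fun q : ℝ × ℝ × ℝ × ℝ => F q.1 q.2.1 q.2.2.1 q.2.2.2) hF
    (f := fun y => (τ y, a y, b y, c y)) (by fun_prop) (fun y hy => by simpa using hT y hy)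

theorem ContT.add {S : Set ℝ} {F G : ℝ → Fun3} (hF : ContT S F) (hG : ContT S G) :
    ContT S fun t x₁ x₂ θ => F t x₁ x₂ θ + G t x₁ x₂ θ := ContinuousOn.fun_add hF hG

theorem ContT.mul {S : Set ℝ} {F G : ℝ → Fun3} (hF : ContT S F) (hG : ContT S G) :
    ContT S fun t x₁ x₂ θ => F t x₁ x₂ θ * G t x₁ x₂ θ := ContinuousOn.fun_mul hF hG

theorem ContT.neg {S : Set ℝ} {F : ℝ → Fun3} (hF : ContT S F) :
    ContT S fun t x₁ x₂ θ => -F t x₁ x₂ θ := ContinuousOn.fun_neg hF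

theorem ContT.mode {S : Set ℝ} {F : ℝ → Fun3} (hF : ContT S F) (k : ℤ × ℤ) (φ : ℝ) :
    ContinuousOn (fun p : ℝ × ℝ => mode (F p.1) k φ p.2) (S ×ˢ univ) := by
  refine continuousOn_int2 (Y := ℝ × ℝ) (S := S ×ˢ univ)
    (F := fun p x₁ x₂ => F p.1 x₁ x₂ p.2 * Real.cos (k.1 * x₁ + k.2 * x₂ + φ)) ?_ _ _ _ _
  refine ContinuousOn.mul ?_ (by fun_prop)
  exact hF.compOn (by fun_prop) (by fun_prop) (by fun_prop) (by fun_prop) fun y hy => by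
    simp only [mem_prod, mem_univ, and_true] at hy; exact hy

theorem mode_add {f g : Fun3} (hf : Cont3 f) (hg : Cont3 g) (k : ℤ × ℤ) (φ θ : ℝ) :
    mode (fun x₁ x₂ θ => f x₁ x₂ θ + g x₁ x₂ θ) k φ θ = mode f k φ θ + mode g k φ θ := by
  unfold mode
  have hc : ∀ {f : Fun3}, Cont3 f → Continuous fun p : ℝ × ℝ =>
      f p.1 p.2 θ * Real.cos (k.1 * p.1 + k.2 * p.2 + φ) := fun hf =>
    (hf.comp (by fun_prop) (by fun_prop) (by fun_prop)).mul (by fun_prop)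
  have e : ∀ x₁, ∫ x₂ in (-π)..π, (f x₁ x₂ θ + g x₁ x₂ θ) * Real.cos (k.1 * x₁ + k.2 * x₂ + φ)
      = (∫ x₂ in (-π)..π, f x₁ x₂ θ * Real.cos (k.1 * x₁ + k.2 * x₂ + φ))
        + ∫ x₂ in (-π)..π, g x₁ x₂ θ * Real.cos (k.1 * x₁ + k.2 * x₂ + φ) := by
    intro x₁
    simp only [add_mul]
    exact integral_add_of_continuous ((hc hf).comp (by fun_prop : Continuous fun x₂ : ℝ => (x₁, x₂)))
      ((hc hg).comp (by fun_prop : Continuous fun x₂ : ℝ => (x₁, x₂))) _ _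
  simp only [e]
  exact integral_add_of_continuous
    (intervalIntegral.continuous_parametric_intervalIntegral_of_continuous' (hc hf) _ _)
    (intervalIntegral.continuous_parametric_intervalIntegral_of_continuous' (hc hg) _ _) _ _

theorem mode_angle_mul (g : ℝ → ℝ) (f : Fun3) (k : ℤ × ℤ) (φ θ : ℝ) :
    mode (fun x₁ x₂ θ => g θ * f x₁ x₂ θ) k φ θ = g θ * mode f k φ θ := by
  simp only [mode, mul_assoc, intervalIntegral.integral_const_mul]

theorem mode_const_mul (c : ℝ) (f : Fun3) (k : ℤ × ℤ) (φ θ : ℝ) :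
    mode (fun x₁ x₂ θ => c * f x₁ x₂ θ) k φ θ = c * mode f k φ θ := mode_angle_mul (fun _ => c) f k φ θ

theorem mode_sub {f g : Fun3} (hf : Cont3 f) (hg : Cont3 g) (k : ℤ × ℤ) (φ θ : ℝ) :
    mode (fun x₁ x₂ θ => f x₁ x₂ θ - g x₁ x₂ θ) k φ θ = mode f k φ θ - mode g k φ θ := by
  have h := mode_add hf (hg.const_mul (-1)) k φ θ
  rw [mode_const_mul] at h
  simp only [neg_mul, one_mul, ← sub_eq_add_neg] at h
  exact h

theorem mode_periodic {h : Fun3} (hp : Periodic3 h) (k : ℤ × ℤ) (φ : ℝ) :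
    Function.Periodic (mode h k φ) (2 * π) := fun θ => by
  simp only [mode, (hp _ _ θ).2.2]

theorem mode_add_pi_div_two (h : Fun3) (k : ℤ × ℤ) (θ : ℝ) :
    mode h k (0 + π / 2) θ = -mode h k (-(π / 2)) θ := by
  have : ∀ y : ℝ, Real.cos (y + (0 + π / 2)) = -Real.cos (y + -(π / 2)) := by
    intro y
    rw [zero_add, Real.cos_add_pi_div_two, ← sub_eq_add_neg, Real.cos_sub_pi_div_two]
  simp only [mode, this, mul_neg, intervalIntegral.integral_neg]

theorem hasDerivAt_mode {h h' : Fun3} (hh : Cont3 h) (hh' : Cont3 h')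
    (hd : ∀ x₁ x₂ θ, HasDerivAt (fun s => h x₁ x₂ s) (h' x₁ x₂ θ) θ) (k : ℤ × ℤ) (φ θ : ℝ) :
    HasDerivAt (mode h k φ) (mode h' k φ θ) θ := by
  have hc : ∀ {f : Fun3}, Cont3 f → ContinuousOn (fun p : ℝ × ℝ × ℝ =>
      f p.2.1 p.2.2 p.1 * Real.cos (k.1 * p.2.1 + k.2 * p.2.2 + φ)) (univ ×ˢ univ) := fun hf =>
    ((hf.comp (by fun_prop) (by fun_prop) (by fun_prop)).mul (by fun_prop)).continuousOn
  exact hasDerivAt_int2 isOpen_univ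
    (F := fun θ x₁ x₂ => h x₁ x₂ θ * Real.cos (k.1 * x₁ + k.2 * x₂ + φ))
    (F' := fun θ x₁ x₂ => h' x₁ x₂ θ * Real.cos (k.1 * x₁ + k.2 * x₂ + φ))
    (hc hh) (hc hh') (fun t _ x₁ x₂ => (hd x₁ x₂ t).mul_const _) _ _ _ _ (mem_univ θ)

theorem ContT.hasDerivAt_mode {U : Set ℝ} (hU : IsOpen U) {F F' : ℝ → Fun3} (hF : ContT U F)
    (hF' : ContT U F')
    (hd : ∀ t ∈ U, ∀ x₁ x₂ θ, HasDerivAt (fun s => F s x₁ x₂ θ) (F' t x₁ x₂ θ) t)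
    (k : ℤ × ℤ) (φ θ : ℝ) {t : ℝ} (ht : t ∈ U) :
    HasDerivAt (fun s => Vicsek.mode (F s) k φ θ) (Vicsek.mode (F' t) k φ θ) t := by
  have hc : ∀ {G : ℝ → Fun3}, ContT U G → ContinuousOn (fun p : ℝ × ℝ × ℝ =>
      G p.1 p.2.1 p.2.2 θ * Real.cos (k.1 * p.2.1 + k.2 * p.2.2 + φ)) (U ×ˢ univ) := fun hG =>
    (hG.compOn (by fun_prop) (by fun_prop) (by fun_prop) (by fun_prop) fun y hy => by
      simp only [mem_prod, mem_univ, and_true] at hy; exact hy).mul (by fun_prop)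
  exact hasDerivAt_int2 hU
    (F := fun s x₁ x₂ => F s x₁ x₂ θ * Real.cos (k.1 * x₁ + k.2 * x₂ + φ))
    (F' := fun s x₁ x₂ => F' s x₁ x₂ θ * Real.cos (k.1 * x₁ + k.2 * x₂ + φ))
    (hc hF) (hc hF') (fun t ht x₁ x₂ => (hd t ht x₁ x₂ θ).mul_const _) _ _ _ _ ht

theorem cos_int_add_two_pi (m : ℤ) (x y : ℝ) :
    Real.cos (m * (x + 2 * π) + y) = Real.cos (m * x + y) := by
  rw [show (m : ℝ) * (x + 2 * π) + y = m * x + y + m * (2 * π) by ring, Real.cos_add_int_mul_two_pi]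

/-- Integration by parts in `x₁`. -/
theorem mode_deriv_x₁ {h h' : Fun3} (hh : Cont3 h) (hh' : Cont3 h') (hp : Periodic3 h)
    (hd : ∀ x₁ x₂ θ, HasDerivAt (fun s => h s x₂ θ) (h' x₁ x₂ θ) x₁) (k : ℤ × ℤ) (φ θ : ℝ) :
    mode h' k φ θ = -(k.1 * mode h k (φ + π / 2) θ) := by
  set G : ℝ → ℝ → ℝ := fun x₁ x₂ => h x₁ x₂ θ * Real.cos (k.1 * x₁ + k.2 * x₂ + φ) with hG
  set G' : ℝ → ℝ → ℝ := fun x₁ x₂ => h' x₁ x₂ θ * Real.cos (k.1 * x₁ + k.2 * x₂ + φ)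
    + k.1 * (h x₁ x₂ θ * Real.cos (k.1 * x₁ + k.2 * x₂ + (φ + π / 2))) with hG'
  have hcos : ∀ (f : Fun3) (φ : ℝ), Cont3 f → Continuous fun p : ℝ × ℝ =>
      f p.1 p.2 θ * Real.cos (k.1 * p.1 + k.2 * p.2 + φ) := fun f φ hf =>
    (hf.comp (by fun_prop) (by fun_prop) (by fun_prop)).mul (by fun_prop)
  have c1 := hcos h φ hh
  have c2 := hcos h' φ hh'
  have c3 := hcos h (φ + π / 2) hh
  have cG' : Continuous fun p : ℝ × ℝ => G' p.1 p.2 := c2.add (continuous_const.mul c3)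
  have hGd : ∀ x₁ x₂, HasDerivAt (fun s => G s x₂) (G' x₁ x₂) x₁ := by
    intro x₁ x₂
    have h1 : HasDerivAt (fun s : ℝ => (k.1 : ℝ) * s + k.2 * x₂ + φ) (k.1 : ℝ) x₁ := by
      simpa using (((hasDerivAt_id x₁).const_mul (k.1 : ℝ)).add_const (k.2 * x₂)).add_const φ
    refine ((hd x₁ x₂ θ).mul h1.cos).congr_deriv ?_
    simp only [hG']
    rw [← add_assoc (_ + _) φ, Real.cos_add_pi_div_two]; ring
  have hI : ∀ x₁, HasDerivAt (fun s => ∫ x₂ in (-π)..π, G s x₂) (∫ x₂ in (-π)..π, G' x₁ x₂) x₁ :=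
    fun x₁ => hasDerivAt_integral_param isOpen_univ c1.continuousOn cG'.continuousOn
      (fun s _ x₂ => hGd s x₂) _ _ (mem_univ _)
  have hz := integral_deriv_eq_zero hI
    (intervalIntegral.continuous_parametric_intervalIntegral_of_continuous' cG' _ _) (fun x₁ => by
      simp only [hG, (hp x₁ _ θ).1, add_assoc, cos_int_add_two_pi])
  have e : ∀ x₁, ∫ x₂ in (-π)..π, G' x₁ x₂
      = (∫ x₂ in (-π)..π, h' x₁ x₂ θ * Real.cos (k.1 * x₁ + k.2 * x₂ + φ))
        + k.1 * ∫ x₂ in (-π)..π, h x₁ x₂ θ * Real.cos (k.1 * x₁ + k.2 * x₂ + (φ + π / 2)) := by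
    intro x₁
    rw [← intervalIntegral.integral_const_mul]
    exact integral_add_of_continuous (c2.comp (by fun_prop : Continuous fun x₂ : ℝ => (x₁, x₂)))
      ((continuous_const.fun_mul c3).comp (by fun_prop : Continuous fun x₂ : ℝ => (x₁, x₂))) _ _
  simp only [e] at hz
  rw [integral_add_of_continuous
    (intervalIntegral.continuous_parametric_intervalIntegral_of_continuous' c2 _ _)
    (continuous_const.fun_mul
      (intervalIntegral.continuous_parametric_intervalIntegral_of_continuous' c3 _ _)),
    intervalIntegral.integral_const_mul] at hz
  unfold mode
  linarith

/-- Integration by parts in `x₂`. -/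
theorem mode_deriv_x₂ {h h' : Fun3} (hh : Cont3 h) (hh' : Cont3 h') (hp : Periodic3 h)
    (hd : ∀ x₁ x₂ θ, HasDerivAt (fun s => h x₁ s θ) (h' x₁ x₂ θ) x₂) (k : ℤ × ℤ) (φ θ : ℝ) :
    mode h' k φ θ = -(k.2 * mode h k (φ + π / 2) θ) := by
  have hcos : ∀ (f : Fun3) (φ x₁ : ℝ), Cont3 f → Continuous fun x₂ : ℝ =>
      f x₁ x₂ θ * Real.cos (k.1 * x₁ + k.2 * x₂ + φ) := fun f φ x₁ hf =>
    (hf.comp (by fun_prop) (by fun_prop) (by fun_prop)).mul (by fun_prop)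
  have e : ∀ x₁, ∫ x₂ in (-π)..π, h' x₁ x₂ θ * Real.cos (k.1 * x₁ + k.2 * x₂ + φ)
      = -(k.2 * ∫ x₂ in (-π)..π, h x₁ x₂ θ * Real.cos (k.1 * x₁ + k.2 * x₂ + (φ + π / 2))) := by
    intro x₁
    have c2 := hcos h' φ x₁ hh'
    have c3 := hcos h (φ + π / 2) x₁ hh
    have hz := integral_deriv_eq_zero
      (f := fun x₂ => h x₁ x₂ θ * Real.cos (k.1 * x₁ + k.2 * x₂ + φ))
      (f' := fun x₂ => h' x₁ x₂ θ * Real.cos (k.1 * x₁ + k.2 * x₂ + φ)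
        + k.2 * (h x₁ x₂ θ * Real.cos (k.1 * x₁ + k.2 * x₂ + (φ + π / 2))))
      (fun x₂ => by
        have h1 : HasDerivAt (fun s : ℝ => (k.1 : ℝ) * x₁ + k.2 * s + φ) (k.2 : ℝ) x₂ := by
          simpa using (((hasDerivAt_id x₂).const_mul (k.2 : ℝ)).const_add (k.1 * x₁)).add_const φ
        refine ((hd x₁ x₂ θ).mul h1.cos).congr_deriv ?_
        rw [← add_assoc (_ + _) φ, Real.cos_add_pi_div_two]; ring)
      (c2.fun_add (continuous_const.fun_mul c3)) (fun x₂ => by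
        simp only [(hp x₁ x₂ θ).2.1]
        rw [add_assoc, add_left_comm, cos_int_add_two_pi, ← add_left_comm, ← add_assoc])
    rw [integral_add_of_continuous c2 (continuous_const.fun_mul c3),
      intervalIntegral.integral_const_mul] at hz
    linarith
  unfold mode
  simp only [e, intervalIntegral.integral_neg, intervalIntegral.integral_const_mul]

/-- Functions of the angle alone have no nonzero Fourier modes. -/
theorem mode_angle_eq_zero (g : ℝ → ℝ) {k : ℤ × ℤ} (hk : k ≠ 0) (φ θ : ℝ) :
    mode (fun _ _ θ => g θ) k φ θ = 0 := by
  have h0 : Cont3 fun _ _ _ => 0 := cont3_angle continuous_const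
  have hg' : ∀ c : ℝ, Cont3 fun _ _ _ => c := fun c => cont3_angle continuous_const
  have e : mode (fun _ _ θ => g θ) k φ θ = mode (fun _ _ _ => g θ) k φ θ := rfl
  have hp : Periodic3 fun _ _ _ => g θ := fun _ _ _ => ⟨rfl, rfl, rfl⟩
  have hz : mode (fun _ _ _ => 0) k (φ - π / 2) θ = 0 := by simp [mode]
  rw [e]
  by_cases h1 : k.1 = 0
  · have h2 : (k.2 : ℝ) ≠ 0 := by
      intro h2
      exact hk (Prod.ext h1 (by exact_mod_cast h2))
    have := mode_deriv_x₂ (hg' (g θ)) h0 hp (fun _ _ _ => hasDerivAt_const _ _) k (φ - π / 2) θ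
    rw [hz, sub_add_cancel] at this
    simpa [h2] using this.symm
  · have h1' : (k.1 : ℝ) ≠ 0 := by exact_mod_cast h1
    have := mode_deriv_x₁ (hg' (g θ)) h0 hp (fun _ _ _ => hasDerivAt_const _ _) k (φ - π / 2) θ
    rw [hz, sub_add_cancel] at this
    simpa [h1'] using this.symm

theorem avg_eq_mode (h : Fun3) (θ : ℝ) : avg h θ = 1 / (2 * π) ^ 2 * mode h 0 0 θ := by
  simp [avg, mode]

theorem Cont3.continuous_avg {h : Fun3} (hh : Cont3 h) : Continuous (avg h) := by
  rw [funext (avg_eq_mode h)]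
  exact continuous_const.mul (hh.continuous_mode 0 0)

theorem Cont3.rem {h : Fun3} (hh : Cont3 h) : Cont3 (rem h) :=
  hh.sub (cont3_angle hh.continuous_avg)

theorem avg_periodic {h : Fun3} (hp : Periodic3 h) : Function.Periodic (avg h) (2 * π) := by
  rw [funext (avg_eq_mode h)]
  exact fun θ => by simp only [mode_periodic hp 0 0 θ]

theorem mode_rem {h : Fun3} (hh : Cont3 h) {k : ℤ × ℤ} (hk : k ≠ 0) (φ θ : ℝ) :
    mode (rem h) k φ θ = mode h k φ θ := by
  have := mode_sub hh (cont3_angle hh.continuous_avg) k φ θ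
  rw [mode_angle_eq_zero _ hk, sub_zero] at this
  exact this

theorem mode_rem_zero {h : Fun3} (hh : Cont3 h) (φ θ : ℝ) : mode (rem h) 0 φ θ = 0 := by
  have h1 := mode_sub hh (cont3_angle hh.continuous_avg) 0 φ θ
  have h2 : mode h 0 φ θ = Real.cos φ * ((2 * π) ^ 2 * avg h θ) := by
    rw [avg_eq_mode]
    simp only [mode, Prod.fst_zero, Prod.snd_zero, Int.cast_zero, zero_mul, zero_add, Real.cos_zero,
      mul_one, intervalIntegral.integral_mul_const]
    field_simp
  have h3 : mode (fun _ _ θ => avg h θ) 0 φ θ = Real.cos φ * ((2 * π) ^ 2 * avg h θ) := by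
    simp only [mode, Prod.fst_zero, Prod.snd_zero, Int.cast_zero, zero_mul, zero_add,
      intervalIntegral.integral_const, smul_eq_mul]
    ring
  rw [h2, h3, sub_self] at h1
  exact h1

theorem modeSq_rem {h : Fun3} (hh : Cont3 h) {k : ℤ × ℤ} (hk : k ≠ 0) :
    modeSq (rem h) k = modeSq h k := by
  simp only [modeSq, mode_rem hh hk]

theorem modeSq_rem_zero {h : Fun3} (hh : Cont3 h) : modeSq (rem h) 0 = 0 := by
  simp [modeSq, mode_rem_zero hh]

/-! ### The alignment operator -/

theorem ContT.alignment {Φ : ℝ → ℝ → ℝ} {Ψ : ℝ → ℝ} (hΦ : Continuous fun q : ℝ × ℝ => Φ q.1 q.2)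
    (hΨ : Continuous Ψ) {S : Set ℝ} {F : ℝ → Fun3} (hF : ContT S F) :
    ContT S fun t => alignment Φ Ψ (F t) := by
  refine continuousOn_integral_param (Y := ℝ × ℝ × ℝ × ℝ) (S := S ×ˢ univ)
    (F := fun q η => ∫ y₁ in (-π)..π, ∫ y₂ in (-π)..π,
      Φ (y₁ - q.2.1) (y₂ - q.2.2.1) * Ψ (η - q.2.2.2) * F q.1 y₁ y₂ η) ?_ _ _
  refine continuousOn_int2 (Y := (ℝ × ℝ × ℝ × ℝ) × ℝ) (S := (S ×ˢ univ) ×ˢ univ)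
    (F := fun q y₁ y₂ =>
      Φ (y₁ - q.1.2.1) (y₂ - q.1.2.2.1) * Ψ (q.2 - q.1.2.2.2) * F q.1.1 y₁ y₂ q.2) ?_ _ _ _ _
  refine ContinuousOn.mul (Continuous.continuousOn ?_) ?_
  · exact (hΦ.comp (by fun_prop : Continuous fun p : ((ℝ × ℝ × ℝ × ℝ) × ℝ) × ℝ × ℝ =>
      (p.2.1 - p.1.1.2.1, p.2.2 - p.1.1.2.2.1))).mul (by fun_prop)
  · exact hF.compOn (by fun_prop) (by fun_prop) (by fun_prop) (by fun_prop) fun y hy => by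
      simp only [mem_prod, mem_univ, and_true] at hy; exact hy

theorem Cont3.alignment {Φ : ℝ → ℝ → ℝ} {Ψ : ℝ → ℝ} (hΦ : Continuous fun q : ℝ × ℝ => Φ q.1 q.2)
    (hΨ : Continuous Ψ) {h : Fun3} (hh : Cont3 h) : Cont3 (alignment Φ Ψ h) :=
  (ContT.alignment (S := univ) (F := fun _ => h) hΦ hΨ
    (hh.comp (by fun_prop) (by fun_prop) (by fun_prop)).continuousOn).cont3 (mem_univ 0)

theorem hasDerivAt_alignment {Φ : ℝ → ℝ → ℝ} {Ψ Ψ' : ℝ → ℝ}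
    (hΦ : Continuous fun q : ℝ × ℝ => Φ q.1 q.2) (hΨ : ∀ x, HasDerivAt Ψ (Ψ' x) x)
    (hΨ' : Continuous Ψ') {h : Fun3} (hh : Cont3 h) (x₁ x₂ θ : ℝ) :
    HasDerivAt (fun s => alignment Φ Ψ h x₁ x₂ s) (-alignment Φ Ψ' h x₁ x₂ θ) θ := by
  have cΨ : Continuous Ψ := continuous_iff_continuousAt.2 fun x => (hΨ x).continuousAt
  have hc : ∀ {Ψ : ℝ → ℝ}, Continuous Ψ → Continuous fun p : (ℝ × ℝ) × ℝ × ℝ =>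
      Φ (p.2.1 - x₁) (p.2.2 - x₂) * Ψ (p.1.2 - p.1.1) * h p.2.1 p.2.2 p.1.2 := fun hΨ =>
    ((hΦ.comp (by fun_prop : Continuous fun p : (ℝ × ℝ) × ℝ × ℝ =>
      (p.2.1 - x₁, p.2.2 - x₂))).mul (by fun_prop)).mul
      (hh.comp (by fun_prop) (by fun_prop) (by fun_prop))
  have c1 := hc cΨ
  have c2 := hc hΨ'
  have e : -alignment Φ Ψ' h x₁ x₂ θ = ∫ η in (-π)..π, ∫ y₁ in (-π)..π, ∫ y₂ in (-π)..π,
      -(Φ (y₁ - x₁) (y₂ - x₂) * Ψ' (η - θ) * h y₁ y₂ η) := by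
    simp only [Vicsek.alignment, intervalIntegral.integral_neg]
  rw [e]
  refine hasDerivAt_integral_param isOpen_univ
    (F := fun s η => ∫ y₁ in (-π)..π, ∫ y₂ in (-π)..π,
      Φ (y₁ - x₁) (y₂ - x₂) * Ψ (η - s) * h y₁ y₂ η)
    (F' := fun s η => ∫ y₁ in (-π)..π, ∫ y₂ in (-π)..π,
      -(Φ (y₁ - x₁) (y₂ - x₂) * Ψ' (η - s) * h y₁ y₂ η))
    (continuous_int2 (Y := ℝ × ℝ) c1 _ _ _ _).continuousOn
    (continuous_int2 (Y := ℝ × ℝ) (F := fun p y₁ y₂ =>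
      -(Φ (y₁ - x₁) (y₂ - x₂) * Ψ' (p.2 - p.1) * h y₁ y₂ p.2)) c2.fun_neg _ _ _ _).continuousOn
    (fun s _ η => ?_) _ _ (mem_univ _)
  refine hasDerivAt_int2 isOpen_univ
    (F := fun s y₁ y₂ => Φ (y₁ - x₁) (y₂ - x₂) * Ψ (η - s) * h y₁ y₂ η)
    (F' := fun s y₁ y₂ => -(Φ (y₁ - x₁) (y₂ - x₂) * Ψ' (η - s) * h y₁ y₂ η))
    (c1.comp (by fun_prop : Continuous fun p : ℝ × ℝ × ℝ => ((p.1, η), p.2))).continuousOn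
    (c2.fun_neg.comp (by fun_prop : Continuous fun p : ℝ × ℝ × ℝ => ((p.1, η), p.2))).continuousOn
    (fun r _ y₁ y₂ => ?_) _ _ _ _ (mem_univ _)
  have h1 : HasDerivAt (fun r => Ψ (η - r)) (-Ψ' (η - r)) r := by
    simpa using (hΨ (η - r)).comp_const_sub η r
  exact ((h1.const_mul _).mul_const _).congr_deriv (by ring)

theorem abs_alignment_le {Φ : ℝ → ℝ → ℝ} {Ψ : ℝ → ℝ} (hΦ : Continuous fun q : ℝ × ℝ => Φ q.1 q.2)
    (hΨ : Continuous Ψ) {a b : ℝ} (ha : ∀ x y, |Φ x y| ≤ a) (hb : ∀ x, |Ψ x| ≤ b) {h : Fun3}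
    (hh : Cont3 h) (x₁ x₂ θ : ℝ) :
    |alignment Φ Ψ h x₁ x₂ θ| ≤ a * b * integral3 fun x₁ x₂ θ => |h x₁ x₂ θ| := by
  set k : Fun3 := fun y₁ y₂ η => Φ (y₁ - x₁) (y₂ - x₂) * Ψ (η - θ) * h y₁ y₂ η with hk
  have ck : Cont3 k := by
    refine Continuous.mul (Continuous.mul ?_ (by fun_prop)) hh
    exact hΦ.comp (by fun_prop : Continuous fun p : ℝ × ℝ × ℝ => (p.1 - x₁, p.2.1 - x₂))
  have e : alignment Φ Ψ h x₁ x₂ θ = integral3 k := (integral3_eq_theta ck).symm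
  have hpt : ∀ y₁ y₂ η, |k y₁ y₂ η| ≤ a * b * |h y₁ y₂ η| := by
    intro y₁ y₂ η
    rw [hk, abs_mul, abs_mul]
    have := ha (y₁ - x₁) (y₂ - x₂)
    have := hb (η - θ)
    have : 0 ≤ a := (abs_nonneg _).trans (ha 0 0)
    gcongr
  rw [e, ← integral3_const_mul, abs_le]
  constructor
  · have := integral3_mono (f := fun y₁ y₂ η => (-1) * (a * b * |h y₁ y₂ η|)) (g := k)
      ((hh.abs.const_mul _).const_mul _) ck (fun y₁ y₂ η => by
        have := (abs_le.1 (hpt y₁ y₂ η)).1; linarith)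
    rw [integral3_const_mul] at this
    linarith
  · exact integral3_mono ck (hh.abs.const_mul _) fun y₁ y₂ η => (abs_le.1 (hpt y₁ y₂ η)).2

theorem alignment_add {Φ : ℝ → ℝ → ℝ} {Ψ : ℝ → ℝ} (hΦ : Continuous fun q : ℝ × ℝ => Φ q.1 q.2)
    (hΨ : Continuous Ψ) {f g : Fun3} (hf : Cont3 f) (hg : Cont3 g) (x₁ x₂ θ : ℝ) :
    alignment Φ Ψ (fun x₁ x₂ θ => f x₁ x₂ θ + g x₁ x₂ θ) x₁ x₂ θ
      = alignment Φ Ψ f x₁ x₂ θ + alignment Φ Ψ g x₁ x₂ θ := by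
  have ck : ∀ {h : Fun3}, Cont3 h →
      Cont3 fun y₁ y₂ η => Φ (y₁ - x₁) (y₂ - x₂) * Ψ (η - θ) * h y₁ y₂ η := fun hh =>
    Continuous.mul (Continuous.mul
      (hΦ.comp (by fun_prop : Continuous fun p : ℝ × ℝ × ℝ => (p.1 - x₁, p.2.1 - x₂)))
      (by fun_prop)) hh
  have e : ∀ {h : Fun3}, Cont3 h → alignment Φ Ψ h x₁ x₂ θ
      = integral3 fun y₁ y₂ η => Φ (y₁ - x₁) (y₂ - x₂) * Ψ (η - θ) * h y₁ y₂ η := fun hh =>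
    (integral3_eq_theta (ck hh)).symm
  rw [e (hf.add hg), e hf, e hg, ← integral3_add (ck hf) (ck hg)]
  simp only [mul_add]

theorem alignment_angle {Φ : ℝ → ℝ → ℝ} {Ψ : ℝ → ℝ}
    (hp : ∀ x₁ x₂ : ℝ, Φ (x₁ + 2 * π) x₂ = Φ x₁ x₂ ∧ Φ x₁ (x₂ + 2 * π) = Φ x₁ x₂)
    (g : ℝ → ℝ) (x₁ x₂ θ : ℝ) :
    alignment Φ Ψ (fun _ _ θ => g θ) x₁ x₂ θ = alignment Φ Ψ (fun _ _ θ => g θ) 0 0 θ := by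
  have e : ∀ x₁ x₂ : ℝ, ∫ y₁ in (-π)..π, ∫ y₂ in (-π)..π, Φ (y₁ - x₁) (y₂ - x₂)
      = ∫ y₁ in (-π)..π, ∫ y₂ in (-π)..π, Φ y₁ y₂ := by
    intro x₁ x₂
    have h1 : ∀ y₁, ∫ y₂ in (-π)..π, Φ (y₁ - x₁) (y₂ - x₂) = ∫ y₂ in (-π)..π, Φ (y₁ - x₁) y₂ :=
      fun y₁ => integral_comp_sub (f := fun y₂ => Φ (y₁ - x₁) y₂) (fun y => (hp _ y).2) x₂
    simp only [h1]
    exact integral_comp_sub (f := fun y₁ => ∫ y₂ in (-π)..π, Φ y₁ y₂)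
      (fun y => by simp only [(hp y _).1]) x₁
  simp only [alignment, intervalIntegral.integral_mul_const, e]

theorem Periodic3.alignment {Φ : ℝ → ℝ → ℝ} {Ψ : ℝ → ℝ}
    (hp : ∀ x₁ x₂ : ℝ, Φ (x₁ + 2 * π) x₂ = Φ x₁ x₂ ∧ Φ x₁ (x₂ + 2 * π) = Φ x₁ x₂)
    (hΨ : Function.Periodic Ψ (2 * π)) (h : Fun3) : Periodic3 (alignment Φ Ψ h) := by
  intro x₁ x₂ θ
  have h1 : ∀ x y z : ℝ, Φ (y - (x + 2 * π)) z = Φ (y - x) z := fun x y z => by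
    rw [← (hp (y - (x + 2 * π)) z).1]; congr 1; ring
  have h2 : ∀ x y z : ℝ, Φ z (y - (x + 2 * π)) = Φ z (y - x) := fun x y z => by
    rw [← (hp z (y - (x + 2 * π))).2]; congr 1; ring
  have h3 : ∀ x y : ℝ, Ψ (y - (x + 2 * π)) = Ψ (y - x) := fun x y => by
    rw [← hΨ (y - (x + 2 * π))]; congr 1; ring
  exact ⟨by simp only [Vicsek.alignment, h1], by simp only [Vicsek.alignment, h2],
    by simp only [Vicsek.alignment, h3]⟩

/-! ### Derivatives of a classical solution -/

/-- The time derivative of a time-dependent function on the torus. -/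
noncomputable def dt (f : ℝ → Fun3) : ℝ → Fun3 := fun t x₁ x₂ θ => deriv (fun s => f s x₁ x₂ θ) t

namespace ClassicalSolution

variable {Φ : ℝ → ℝ → ℝ} {Ψ : ℝ → ℝ} {v : ℝ → ℝ} {κ ν : ℝ} {f₀ : Fun3} {f : ℝ → Fun3}

theorem hasFDerivAt (S : ClassicalSolution Φ Ψ v κ ν f₀ f) {t : ℝ} (ht : 0 < t) (x₁ x₂ θ : ℝ) :
    HasFDerivAt (fun q : ℝ × ℝ × ℝ × ℝ => f q.1 q.2.1 q.2.2.1 q.2.2.2)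
      (fderiv ℝ (fun q : ℝ × ℝ × ℝ × ℝ => f q.1 q.2.1 q.2.2.1 q.2.2.2) (t, x₁, x₂, θ))
      (t, x₁, x₂, θ) :=
  ((S.contDiff.contDiffAt ((isOpen_Ioi.prod isOpen_univ).mem_nhds (by simpa using ht))).differentiableAt
    one_ne_zero).hasFDerivAt

theorem continuousOn_fderiv (S : ClassicalSolution Φ Ψ v κ ν f₀ f) (w : ℝ × ℝ × ℝ × ℝ) :
    ContinuousOn (fun q => fderiv ℝ (fun q : ℝ × ℝ × ℝ × ℝ => f q.1 q.2.1 q.2.2.1 q.2.2.2) q w)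
      (Ioi 0 ×ˢ univ) :=
  (S.contDiff.continuousOn_fderiv_of_isOpen (isOpen_Ioi.prod isOpen_univ) le_rfl).clm_apply
    continuousOn_const

theorem hasDerivAt_dt' (S : ClassicalSolution Φ Ψ v κ ν f₀ f) {t : ℝ} (ht : 0 < t) (x₁ x₂ θ : ℝ) :
    HasDerivAt (fun s => f s x₁ x₂ θ) (fderiv ℝ
      (fun q : ℝ × ℝ × ℝ × ℝ => f q.1 q.2.1 q.2.2.1 q.2.2.2) (t, x₁, x₂, θ) (1, 0, 0, 0)) t :=
  (S.hasFDerivAt ht x₁ x₂ θ).comp_hasDerivAt (f := fun s => (s, x₁, x₂, θ)) t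
    ((hasDerivAt_id t).prodMk (hasDerivAt_const _ _))

theorem hasDerivAt_dx₁' (S : ClassicalSolution Φ Ψ v κ ν f₀ f) {t : ℝ} (ht : 0 < t) (x₁ x₂ θ : ℝ) :
    HasDerivAt (fun s => f t s x₂ θ) (fderiv ℝ
      (fun q : ℝ × ℝ × ℝ × ℝ => f q.1 q.2.1 q.2.2.1 q.2.2.2) (t, x₁, x₂, θ) (0, 1, 0, 0)) x₁ :=
  (S.hasFDerivAt ht x₁ x₂ θ).comp_hasDerivAt (f := fun s => (t, s, x₂, θ)) x₁
    ((hasDerivAt_const _ _).prodMk ((hasDerivAt_id x₁).prodMk (hasDerivAt_const _ _)))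

theorem hasDerivAt_dx₂' (S : ClassicalSolution Φ Ψ v κ ν f₀ f) {t : ℝ} (ht : 0 < t) (x₁ x₂ θ : ℝ) :
    HasDerivAt (fun s => f t x₁ s θ) (fderiv ℝ
      (fun q : ℝ × ℝ × ℝ × ℝ => f q.1 q.2.1 q.2.2.1 q.2.2.2) (t, x₁, x₂, θ) (0, 0, 1, 0)) x₂ :=
  (S.hasFDerivAt ht x₁ x₂ θ).comp_hasDerivAt (f := fun s => (t, x₁, s, θ)) x₂
    ((hasDerivAt_const _ _).prodMk ((hasDerivAt_const _ _).prodMk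
      ((hasDerivAt_id x₂).prodMk (hasDerivAt_const _ _))))

theorem hasDerivAt_dθ' (S : ClassicalSolution Φ Ψ v κ ν f₀ f) {t : ℝ} (ht : 0 < t) (x₁ x₂ θ : ℝ) :
    HasDerivAt (fun s => f t x₁ x₂ s) (fderiv ℝ
      (fun q : ℝ × ℝ × ℝ × ℝ => f q.1 q.2.1 q.2.2.1 q.2.2.2) (t, x₁, x₂, θ) (0, 0, 0, 1)) θ :=
  (S.hasFDerivAt ht x₁ x₂ θ).comp_hasDerivAt (f := fun s => (t, x₁, x₂, s)) θ
    ((hasDerivAt_const _ _).prodMk ((hasDerivAt_const _ _).prodMk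
      ((hasDerivAt_const _ _).prodMk (hasDerivAt_id θ))))

theorem contT (S : ClassicalSolution Φ Ψ v κ ν f₀ f) : ContT (Ici 0) f := S.continuous

theorem contT_pos (S : ClassicalSolution Φ Ψ v κ ν f₀ f) : ContT (Ioi 0) f :=
  S.contT.mono Ioi_subset_Ici_self

theorem contT_dt (S : ClassicalSolution Φ Ψ v κ ν f₀ f) : ContT (Ioi 0) (dt f) :=
  (S.continuousOn_fderiv (1, 0, 0, 0)).congr fun _ hq => (S.hasDerivAt_dt' hq.1 _ _ _).deriv

theorem contT_dx₁ (S : ClassicalSolution Φ Ψ v κ ν f₀ f) : ContT (Ioi 0) fun t => dx₁ (f t) :=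
  (S.continuousOn_fderiv (0, 1, 0, 0)).congr fun _ hq => (S.hasDerivAt_dx₁' hq.1 _ _ _).deriv

theorem contT_dx₂ (S : ClassicalSolution Φ Ψ v κ ν f₀ f) : ContT (Ioi 0) fun t => dx₂ (f t) :=
  (S.continuousOn_fderiv (0, 0, 1, 0)).congr fun _ hq => (S.hasDerivAt_dx₂' hq.1 _ _ _).deriv

theorem contT_dθ (S : ClassicalSolution Φ Ψ v κ ν f₀ f) : ContT (Ioi 0) fun t => dθ (f t) :=
  (S.continuousOn_fderiv (0, 0, 0, 1)).congr fun _ hq => (S.hasDerivAt_dθ' hq.1 _ _ _).deriv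

theorem contT_dθdθ (S : ClassicalSolution Φ Ψ v κ ν f₀ f) : ContT (Ioi 0) fun t => dθ (dθ (f t)) :=
  S.continuous_dθdθ

theorem hasDerivAt_dt (S : ClassicalSolution Φ Ψ v κ ν f₀ f) {t : ℝ} (ht : 0 < t) (x₁ x₂ θ : ℝ) :
    HasDerivAt (fun s => f s x₁ x₂ θ) (dt f t x₁ x₂ θ) t :=
  (S.hasDerivAt_dt' ht x₁ x₂ θ).differentiableAt.hasDerivAt

theorem hasDerivAt_dx₁ (S : ClassicalSolution Φ Ψ v κ ν f₀ f) {t : ℝ} (ht : 0 < t) (x₁ x₂ θ : ℝ) :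
    HasDerivAt (fun s => f t s x₂ θ) (dx₁ (f t) x₁ x₂ θ) x₁ :=
  (S.hasDerivAt_dx₁' ht x₁ x₂ θ).differentiableAt.hasDerivAt

theorem hasDerivAt_dx₂ (S : ClassicalSolution Φ Ψ v κ ν f₀ f) {t : ℝ} (ht : 0 < t) (x₁ x₂ θ : ℝ) :
    HasDerivAt (fun s => f t x₁ s θ) (dx₂ (f t) x₁ x₂ θ) x₂ :=
  (S.hasDerivAt_dx₂' ht x₁ x₂ θ).differentiableAt.hasDerivAt

theorem hasDerivAt_dθ (S : ClassicalSolution Φ Ψ v κ ν f₀ f) {t : ℝ} (ht : 0 < t) (x₁ x₂ θ : ℝ) :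
    HasDerivAt (fun s => f t x₁ x₂ s) (dθ (f t) x₁ x₂ θ) θ :=
  (S.hasDerivAt_dθ' ht x₁ x₂ θ).differentiableAt.hasDerivAt

theorem hasDerivAt_dθdθ (S : ClassicalSolution Φ Ψ v κ ν f₀ f) {t : ℝ} (ht : 0 < t)
    (x₁ x₂ θ : ℝ) :
    HasDerivAt (fun s => dθ (f t) x₁ x₂ s) (dθ (dθ (f t)) x₁ x₂ θ) θ :=
  (S.differentiable_dθ t ht x₁ x₂ θ).hasDerivAt

end ClassicalSolution

/-! ### Bounds for the influence functions -/

/-- The properties of the influence functions that enter the estimates: `Ψ'` is the derivative of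
`Ψ`, and the bounds of the kernels `Φ(x) Ψ(θ)`, `Φ(x) Ψ'(θ)` by a constant `Λ` enter in the form
`|L[h]|, |∂_θ L[h]| ≤ Λ ‖h‖_{L¹}`. -/
structure InfluenceBounds (Φ : ℝ → ℝ → ℝ) (Ψ Ψ' : ℝ → ℝ) (Λ : ℝ) : Prop where
  cΦ : Continuous fun q : ℝ × ℝ => Φ q.1 q.2
  pΦ : ∀ x₁ x₂ : ℝ, Φ (x₁ + 2 * π) x₂ = Φ x₁ x₂ ∧ Φ x₁ (x₂ + 2 * π) = Φ x₁ x₂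
  hΨ : ∀ x, HasDerivAt Ψ (Ψ' x) x
  cΨ' : Continuous Ψ'
  pΨ : Function.Periodic Ψ (2 * π)
  one_le : 1 ≤ Λ
  bound : ∀ h, Cont3 h → ∀ x₁ x₂ θ,
    |alignment Φ Ψ h x₁ x₂ θ| ≤ Λ * integral3 fun x₁ x₂ θ => |h x₁ x₂ θ|
  bound' : ∀ h, Cont3 h → ∀ x₁ x₂ θ,
    |alignment Φ Ψ' h x₁ x₂ θ| ≤ Λ * integral3 fun x₁ x₂ θ => |h x₁ x₂ θ|

theorem InfluenceBounds.cΨ {Φ : ℝ → ℝ → ℝ} {Ψ Ψ' : ℝ → ℝ} {Λ : ℝ}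
    (B : InfluenceBounds Φ Ψ Ψ' Λ) : Continuous Ψ :=
  continuous_iff_continuousAt.2 fun x => (B.hΨ x).continuousAt

theorem exists_bound_of_periodic {g : ℝ → ℝ} (hg : Continuous g)
    (hp : Function.Periodic g (2 * π)) : ∃ b, ∀ x, |g x| ≤ b := by
  obtain ⟨b, hb⟩ := isBounded_iff_forall_norm_le.1
    (hp.isBounded_of_continuous (by positivity) hg)
  exact ⟨b, fun x => hb _ (mem_range_self x)⟩

theorem exists_bound_of_periodic₂ {Φ : ℝ → ℝ → ℝ} (hc : Continuous fun q : ℝ × ℝ => Φ q.1 q.2)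
    (hp : ∀ x₁ x₂ : ℝ, Φ (x₁ + 2 * π) x₂ = Φ x₁ x₂ ∧ Φ x₁ (x₂ + 2 * π) = Φ x₁ x₂) :
    ∃ a, ∀ x y, |Φ x y| ≤ a := by
  obtain ⟨a, ha⟩ := (isCompact_Icc.prod isCompact_Icc : IsCompact
    (Icc (0 : ℝ) (0 + 2 * π) ×ˢ Icc (0 : ℝ) (0 + 2 * π))).exists_bound_of_continuousOn hc.continuousOn
  refine ⟨a, fun x y => ?_⟩
  have px : Function.Periodic (fun x => Φ x y) (2 * π) := fun x => (hp x y).1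
  obtain ⟨x', hx', ex⟩ := px.exists_mem_Ico (by positivity) x 0
  have py : Function.Periodic (fun y => Φ x' y) (2 * π) := fun y => (hp x' y).2
  obtain ⟨y', hy', ey⟩ := py.exists_mem_Ico (by positivity) y 0
  replace ex : Φ x y = Φ x' y := ex
  replace ey : Φ x' y = Φ x' y' := ey
  rw [ex, ey]
  exact ha (x', y') ⟨Ico_subset_Icc_self hx', Ico_subset_Icc_self hy'⟩

theorem exists_influenceBounds {Φ : ℝ → ℝ → ℝ} {Ψ : ℝ → ℝ} (hΦ : SpatialInfluence Φ)
    (hΨ : AngularInfluence Ψ) : ∃ Ψ' Λ, InfluenceBounds Φ Ψ Ψ' Λ := by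
  obtain ⟨ψ, pψ, sψ, -, e⟩ := hΨ.factor
  have e' : Ψ = fun θ => Real.sin θ * ψ θ := funext e
  have sΨ : ContDiff ℝ ∞ Ψ := by
    rw [e']; exact Real.contDiff_sin.mul sψ
  have pΨ : Function.Periodic Ψ (2 * π) := fun θ => by
    rw [e, e, Real.sin_add_two_pi, pψ]
  have cΨ' : Continuous (deriv Ψ) := sΨ.continuous_deriv (by simp)
  have dΨ : ∀ x, HasDerivAt Ψ (deriv Ψ x) x := fun x =>
    (sΨ.differentiable (by simp) x).hasDerivAt
  have pΨ' : Function.Periodic (deriv Ψ) (2 * π) := fun θ => by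
    have h1 : HasDerivAt (fun x => Ψ (x + 2 * π)) (deriv Ψ (θ + 2 * π)) θ :=
      (dΨ _).comp_add_const θ (2 * π)
    rw [funext pΨ] at h1
    exact h1.unique (dΨ θ)
  have cΦ := hΦ.smooth.continuous
  obtain ⟨a, ha⟩ := exists_bound_of_periodic₂ cΦ hΦ.periodic
  obtain ⟨b, hb⟩ := exists_bound_of_periodic sΨ.continuous pΨ
  obtain ⟨b', hb'⟩ := exists_bound_of_periodic cΨ' pΨ'
  have ha0 : 0 ≤ a := (abs_nonneg _).trans (ha 0 0)
  have hb0 : 0 ≤ b := (abs_nonneg _).trans (hb 0)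
  have hb0' : 0 ≤ b' := (abs_nonneg _).trans (hb' 0)
  refine ⟨deriv Ψ, 1 + a * b + a * b', cΦ, hΦ.periodic, dΨ, cΨ', pΨ,
    by nlinarith [mul_nonneg ha0 hb0, mul_nonneg ha0 hb0'], fun h hh x₁ x₂ θ => ?_,
    fun h hh x₁ x₂ θ => ?_⟩
  · refine (abs_alignment_le cΦ sΨ.continuous ha hb hh x₁ x₂ θ).trans ?_
    have := integral3_nonneg (f := fun x₁ x₂ θ => |h x₁ x₂ θ|) fun _ _ _ => abs_nonneg _
    gcongr
    nlinarith [mul_nonneg ha0 hb0']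
  · refine (abs_alignment_le cΦ cΨ' ha hb' hh x₁ x₂ θ).trans ?_
    have := integral3_nonneg (f := fun x₁ x₂ θ => |h x₁ x₂ θ|) fun _ _ _ => abs_nonneg _
    gcongr
    nlinarith [mul_nonneg ha0 hb0]

/-! ### The equation of a Fourier mode -/

/-- The alignment flux `f L[f]`. -/
noncomputable def flux (Φ : ℝ → ℝ → ℝ) (Ψ : ℝ → ℝ) (h : Fun3) : Fun3 := fun x₁ x₂ θ =>
  h x₁ x₂ θ * alignment Φ Ψ h x₁ x₂ θ

theorem Periodic3.flux {Φ : ℝ → ℝ → ℝ} {Ψ Ψ' : ℝ → ℝ} {Λ : ℝ} (B : InfluenceBounds Φ Ψ Ψ' Λ)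
    {h : Fun3} (hh : Periodic3 h) : Periodic3 (flux Φ Ψ h) := fun x₁ x₂ θ => by
  have h1 := hh x₁ x₂ θ
  have h2 := Periodic3.alignment B.pΦ B.pΨ h x₁ x₂ θ
  simp only [Vicsek.flux, h1.1, h1.2.1, h1.2.2, h2.1, h2.2.1, h2.2.2, and_self]

theorem Cont3.flux {Φ : ℝ → ℝ → ℝ} {Ψ Ψ' : ℝ → ℝ} {Λ : ℝ} (B : InfluenceBounds Φ Ψ Ψ' Λ)
    {h : Fun3} (hh : Cont3 h) : Cont3 (flux Φ Ψ h) := hh.mul (hh.alignment B.cΦ B.cΨ)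

theorem ContT.flux {Φ : ℝ → ℝ → ℝ} {Ψ Ψ' : ℝ → ℝ} {Λ : ℝ} (B : InfluenceBounds Φ Ψ Ψ' Λ)
    {U : Set ℝ} {F : ℝ → Fun3} (hF : ContT U F) : ContT U fun t => flux Φ Ψ (F t) :=
  hF.mul (hF.alignment B.cΦ B.cΨ)

namespace ClassicalSolution

variable {Φ : ℝ → ℝ → ℝ} {Ψ Ψ' : ℝ → ℝ} {Λ : ℝ} {v : ℝ → ℝ} {κ ν : ℝ} {f₀ : Fun3} {f : ℝ → Fun3}

theorem hasDerivAt_flux (S : ClassicalSolution Φ Ψ v κ ν f₀ f) (B : InfluenceBounds Φ Ψ Ψ' Λ)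
    {t : ℝ} (ht : 0 < t) (x₁ x₂ θ : ℝ) :
    HasDerivAt (fun s => flux Φ Ψ (f t) x₁ x₂ s) (dθ (flux Φ Ψ (f t)) x₁ x₂ θ) θ :=
  ((S.hasDerivAt_dθ ht x₁ x₂ θ).mul (hasDerivAt_alignment B.cΦ B.hΨ B.cΨ'
    (S.contT_pos.cont3 ht) x₁ x₂ θ)).differentiableAt.hasDerivAt

theorem dθ_flux (S : ClassicalSolution Φ Ψ v κ ν f₀ f) (B : InfluenceBounds Φ Ψ Ψ' Λ)
    {t : ℝ} (ht : 0 < t) (x₁ x₂ θ : ℝ) :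
    dθ (flux Φ Ψ (f t)) x₁ x₂ θ = dθ (f t) x₁ x₂ θ * alignment Φ Ψ (f t) x₁ x₂ θ
      + f t x₁ x₂ θ * -alignment Φ Ψ' (f t) x₁ x₂ θ :=
  ((S.hasDerivAt_dθ ht x₁ x₂ θ).mul (hasDerivAt_alignment B.cΦ B.hΨ B.cΨ'
    (S.contT_pos.cont3 ht) x₁ x₂ θ)).deriv

theorem contT_dθ_flux (S : ClassicalSolution Φ Ψ v κ ν f₀ f) (B : InfluenceBounds Φ Ψ Ψ' Λ) :
    ContT (Ioi 0) fun t => dθ (flux Φ Ψ (f t)) :=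
  ContinuousOn.congr ((S.contT_dθ.mul (S.contT_pos.alignment B.cΦ B.cΨ)).add
    (S.contT_pos.mul (S.contT_pos.alignment B.cΦ B.cΨ').neg))
    fun _ hq => S.dθ_flux B hq.1 _ _ _

/-- The time derivative of a Fourier mode. -/
theorem mode_dt (S : ClassicalSolution Φ Ψ v κ ν f₀ f) (B : InfluenceBounds Φ Ψ Ψ' Λ)
    {t : ℝ} (ht : 0 < t) (k : ℤ × ℤ) (φ θ : ℝ) :
    mode (dt f t) k φ θ = ν * mode (dθ (dθ (f t))) k φ θ
      + v t * (k.1 * Real.cos θ + k.2 * Real.sin θ) * mode (f t) k (φ + π / 2) θ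
      - κ * mode (dθ (flux Φ Ψ (f t))) k φ θ := by
  have c := S.contT_pos.cont3 ht
  have c1 := S.contT_dx₁.cont3 ht
  have c2 := S.contT_dx₂.cont3 ht
  have c3 := S.contT_dθdθ.cont3 ht
  have c4 := (S.contT_dθ_flux B).cont3 ht
  have c5 := S.contT_dt.cont3 ht
  have c1' : Cont3 fun x₁ x₂ θ => v t * Real.cos θ * dx₁ (f t) x₁ x₂ θ :=
    (cont3_angle (g := fun θ => v t * Real.cos θ) (by fun_prop)).mul c1
  have c2' : Cont3 fun x₁ x₂ θ => v t * Real.sin θ * dx₂ (f t) x₁ x₂ θ :=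
    (cont3_angle (g := fun θ => v t * Real.sin θ) (by fun_prop)).mul c2
  have e : dt f t = fun x₁ x₂ θ => (ν * dθ (dθ (f t)) x₁ x₂ θ - κ * dθ (flux Φ Ψ (f t)) x₁ x₂ θ)
      - (v t * Real.cos θ * dx₁ (f t) x₁ x₂ θ + v t * Real.sin θ * dx₂ (f t) x₁ x₂ θ) := by
    funext x₁ x₂ θ
    have := S.equation t ht x₁ x₂ θ
    simp only [dt]
    unfold flux
    linarith
  rw [e, mode_sub ((c3.const_mul ν).sub (c4.const_mul κ)) (c1'.add c2'),
    mode_sub (c3.const_mul ν) (c4.const_mul κ), mode_add c1' c2',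
    mode_angle_mul (fun θ => v t * Real.cos θ), mode_angle_mul (fun θ => v t * Real.sin θ),
    mode_const_mul, mode_const_mul,
    mode_deriv_x₁ c c1 (S.periodic t ht.le) (fun x₁ x₂ θ => S.hasDerivAt_dx₁ ht x₁ x₂ θ),
    mode_deriv_x₂ c c2 (S.periodic t ht.le) (fun x₁ x₂ θ => S.hasDerivAt_dx₂ ht x₁ x₂ θ)]
  ring

theorem hasDerivAt_mode_dt (S : ClassicalSolution Φ Ψ v κ ν f₀ f) {t : ℝ} (ht : 0 < t)
    (k : ℤ × ℤ) (φ θ : ℝ) :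
    HasDerivAt (fun s => mode (f s) k φ θ) (mode (dt f t) k φ θ) t :=
  ContT.hasDerivAt_mode isOpen_Ioi S.contT_pos S.contT_dt
    (fun _ ht x₁ x₂ θ => S.hasDerivAt_dt ht x₁ x₂ θ) k φ θ ht

theorem periodic_dθ (S : ClassicalSolution Φ Ψ v κ ν f₀ f) {t : ℝ} (ht : 0 < t) :
    Periodic3 (dθ (f t)) := fun x₁ x₂ θ => by
  have hp := S.periodic t ht.le
  refine ⟨?_, ?_, ?_⟩
  · simp only [dθ, (hp x₁ x₂ _).1]
  · simp only [dθ, (hp x₁ x₂ _).2.1]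
  · have h1 : HasDerivAt (fun s => f t x₁ x₂ (s + 2 * π)) (dθ (f t) x₁ x₂ (θ + 2 * π)) θ :=
      (S.hasDerivAt_dθ ht x₁ x₂ _).comp_add_const θ (2 * π)
    simp only [(hp x₁ x₂ _).2.2] at h1
    exact h1.unique (S.hasDerivAt_dθ ht x₁ x₂ θ)

end ClassicalSolution

/-! ### Enhanced dissipation of a forced Fourier mode -/

theorem abs_integral_crossWeight_le {c s : ℝ → ℝ} (hc : Continuous c) (hs : Continuous s)
    (pc : Function.Periodic c (2 * π)) (ps : Function.Periodic s (2 * π)) {d : ℝ} (hd : 0 < d) :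
    |∫ x in (-π)..π, crossWeight d x * (c (x - d) * s (x + d) - s (x - d) * c (x + d))|
      ≤ 1 / 2 * ∫ x in (-π)..π, (c x ^ 2 + s x ^ 2) := by
  have cw := continuous_crossWeight hd
  set e : ℝ → ℝ := fun x => c x ^ 2 + s x ^ 2 with he
  have ce : Continuous e := by fun_prop
  have pe : Function.Periodic e (2 * π) := fun x => by simp only [he, pc x, ps x]
  have hI : ∫ x in (-π)..π, 1 / 4 * (e (x - d) + e (x + d)) = 1 / 2 * ∫ x in (-π)..π, e x := by
    rw [intervalIntegral.integral_const_mul, integral_add_of_continuous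
      (f := fun x => e (x - d)) (g := fun x => e (x + d)) (by fun_prop) (by fun_prop),
      integral_comp_add pe, integral_comp_sub pe]
    ring
  rw [← hI]
  have hpt : ∀ x, |crossWeight d x * (c (x - d) * s (x + d) - s (x - d) * c (x + d))|
      ≤ 1 / 4 * (e (x - d) + e (x + d)) := by
    intro x
    rw [abs_mul]
    have h1 := abs_crossWeight_le hd x
    have h2 : |c (x - d) * s (x + d) - s (x - d) * c (x + d)|
        ≤ 1 / 2 * (e (x - d) + e (x + d)) := by
      simp only [he]
      rw [abs_le]
      constructor <;> nlinarith [sq_nonneg (c (x - d) - s (x + d)),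
        sq_nonneg (s (x - d) - c (x + d)), sq_nonneg (c (x - d) + s (x + d)),
        sq_nonneg (s (x - d) + c (x + d))]
    calc _ ≤ 1 / 2 * (1 / 2 * (e (x - d) + e (x + d))) := by gcongr
      _ = _ := by ring
  exact intervalIntegral.abs_integral_le_integral_abs neg_pi_le_pi |>.trans
    (integral_mono_of_continuous (by fun_prop) (by fun_prop) neg_pi_le_pi hpt)

/-- A rotation of the angle turns `k · p(θ)` into `|k| cos θ`. -/
theorem exists_rotation {k : ℤ × ℤ} (hk : k ≠ 0) : ∃ q α : ℝ, 1 ≤ q ∧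
    q ^ 2 = (k.1 : ℝ) ^ 2 + (k.2 : ℝ) ^ 2 ∧
    ∀ θ, k.1 * Real.cos (θ + α) + k.2 * Real.sin (θ + α) = q * Real.cos θ := by
  set z : ℂ := ⟨k.1, k.2⟩ with hz
  have h1 : ‖z‖ * Real.cos z.arg = k.1 := Complex.norm_mul_cos_arg z
  have h2 : ‖z‖ * Real.sin z.arg = k.2 := Complex.norm_mul_sin_arg z
  have h3 : ‖z‖ ^ 2 = (k.1 : ℝ) ^ 2 + (k.2 : ℝ) ^ 2 := by
    rw [← h1, ← h2]
    linear_combination -‖z‖ ^ 2 * Real.sin_sq_add_cos_sq z.arg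
  refine ⟨‖z‖, z.arg, ?_, h3, fun θ => ?_⟩
  · have h4 : 1 ≤ k.1 ^ 2 + k.2 ^ 2 := by
      by_contra h
      have h5 := sq_nonneg k.1
      have h6 := sq_nonneg k.2
      exact hk (Prod.ext (pow_eq_zero_iff two_ne_zero |>.1 (by omega))
        (pow_eq_zero_iff two_ne_zero |>.1 (by omega)))
    have h5 : (1 : ℝ) ≤ ‖z‖ ^ 2 := by rw [h3]; exact_mod_cast h4
    exact (one_le_sq_iff₀ (norm_nonneg z)).1 h5
  · rw [← h1, ← h2, Real.cos_add, Real.sin_add]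
    linear_combination ‖z‖ * Real.cos θ * Real.sin_sq_add_cos_sq z.arg

namespace ClassicalSolution

variable {Φ : ℝ → ℝ → ℝ} {Ψ Ψ' : ℝ → ℝ} {Λ : ℝ} {v : ℝ → ℝ} {κ ν : ℝ} {f₀ : Fun3} {f : ℝ → Fun3}

theorem modeData (S : ClassicalSolution Φ Ψ v κ ν f₀ f) (B : InfluenceBounds Φ Ψ Ψ' Λ)
    {t : ℝ} (ht : 0 < t) (k : ℤ × ℤ) (α : ℝ) :
    ModeData (fun x => mode (f t) k 0 (x + α)) (fun x => mode (f t) k (-(π / 2)) (x + α))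
      (fun x => mode (dθ (f t)) k 0 (x + α)) (fun x => mode (dθ (f t)) k (-(π / 2)) (x + α))
      (fun x => mode (dθ (dθ (f t))) k 0 (x + α))
      (fun x => mode (dθ (dθ (f t))) k (-(π / 2)) (x + α))
      (fun x => -κ * mode (flux Φ Ψ (f t)) k 0 (x + α))
      (fun x => -κ * mode (flux Φ Ψ (f t)) k (-(π / 2)) (x + α))
      (fun x => -κ * mode (dθ (flux Φ Ψ (f t))) k 0 (x + α))
      (fun x => -κ * mode (dθ (flux Φ Ψ (f t))) k (-(π / 2)) (x + α)) := by
  have c := S.contT_pos.cont3 ht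
  have c1 := S.contT_dθ.cont3 ht
  have c2 := S.contT_dθdθ.cont3 ht
  have c3 := c.flux B
  have c4 := (S.contT_dθ_flux B).cont3 ht
  have p := S.periodic t ht.le
  have p1 := S.periodic_dθ ht
  have p3 := p.flux B
  have hp : ∀ {h : Fun3}, Periodic3 h → ∀ φ,
      Function.Periodic (fun x => mode h k φ (x + α)) (2 * π) := fun ph φ x => by
    have := mode_periodic ph k φ (x + α)
    simp only [← this]; congr 1; ring
  have hd : ∀ {h h' : Fun3}, Cont3 h → Cont3 h' →
      (∀ x₁ x₂ θ, HasDerivAt (fun s => h x₁ x₂ s) (h' x₁ x₂ θ) θ) → ∀ φ x,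
      HasDerivAt (fun x => mode h k φ (x + α)) (mode h' k φ (x + α)) x := fun ch ch' hh φ x =>
    (hasDerivAt_mode ch ch' hh k φ (x + α)).comp_add_const x α
  have d0 := hd c c1 (S.hasDerivAt_dθ ht)
  have d1 := hd c1 c2 (S.hasDerivAt_dθdθ ht)
  have d3 := hd c3 c4 (S.hasDerivAt_flux B ht)
  have hc : ∀ {h : Fun3}, Cont3 h → ∀ φ, Continuous fun x => mode h k φ (x + α) := fun ch φ =>
    (ch.continuous_mode k φ).comp (by fun_prop)
  exact ⟨d0 _, d0 _, d1 _, d1 _, hc c2 _, hc c2 _, fun x => (d3 _ x).const_mul _,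
    fun x => (d3 _ x).const_mul _, continuous_const.mul (hc c4 _), continuous_const.mul (hc c4 _),
    hp p _, hp p _, hp p1 _, hp p1 _, fun x => by simp only [hp p3 _ x],
    fun x => by simp only [hp p3 _ x]⟩

theorem continuousOn_modeSq {F : ℝ → Fun3} {U : Set ℝ} (hF : ContT U F) (k : ℤ × ℤ) :
    ContinuousOn (fun t => modeSq (F t) k) U :=
  continuousOn_integral_param (((hF.mode k 0).pow 2).add ((hF.mode k _).pow 2)) _ _

/-- Enhanced dissipation: a nonzero Fourier mode decays at the rate `ν^{1/2}`, up to the forcing by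
the alignment flux. -/
theorem exp_mul_modeSq_le (S : ClassicalSolution Φ Ψ v κ ν f₀ f) (B : InfluenceBounds Φ Ψ Ψ' Λ)
    (hv : SpeedProfile v) (hν : 0 < ν) (hν1 : ν ≤ 1) {k : ℤ × ℤ} (hk : k ≠ 0) {T : ℝ}
    (hT : 0 ≤ T) :
    Real.exp (√ν / 5000 * T) * modeSq (f T) k ≤ 102 / 100 * modeSq (f 0) k
      + 3 * κ ^ 2 / ν * ∫ τ in (0 : ℝ)..T,
        Real.exp (√ν / 5000 * τ) * modeSq (flux Φ Ψ (f (max τ 0))) k := by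
  obtain ⟨q, α, hq1, -, hrot⟩ := exists_rotation hk
  have hq : 0 < q := by linarith
  -- the length scale `d` balances the dissipation `ν d⁻²` against the transport `q d²`
  set d : ℝ := √(√(ν / q)) with hdef
  have hd : 0 < d := by positivity
  have hd4 : d ^ 4 = ν / q := by
    rw [show d ^ 4 = (d ^ 2) ^ 2 by ring, Real.sq_sqrt (by positivity), Real.sq_sqrt (by positivity)]
  have hqd : q * d ^ 4 = ν := by rw [hd4]; field_simp
  have hd1 : d ≤ 1 := by
    rw [hdef, Real.sqrt_le_iff, one_pow, Real.sqrt_le_iff, one_pow, div_le_one hq]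
    exact ⟨zero_le_one, zero_le_one, by linarith⟩
  have hrate : √ν ≤ q * d ^ 2 := by
    rw [Real.sqrt_le_left (by positivity)]
    calc ν = 1 * (q * d ^ 4) := by rw [hqd]; ring
      _ ≤ q * (q * d ^ 4) := by gcongr
      _ = _ := by ring
  set c : ℝ → ℝ → ℝ := fun t x => mode (f t) k 0 (x + α) with hcdef
  set s : ℝ → ℝ → ℝ := fun t x => mode (f t) k (-(π / 2)) (x + α) with hsdef
  set ct : ℝ → ℝ → ℝ := fun t x => mode (dt f t) k 0 (x + α) with hctdef
  set st : ℝ → ℝ → ℝ := fun t x => mode (dt f t) k (-(π / 2)) (x + α) with hstdef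
  have hjoint : ∀ {U : Set ℝ} {F : ℝ → Fun3}, ContT U F → ∀ φ b, ContinuousOn
      (fun p : ℝ × ℝ => mode (F p.1) k φ (p.2 + b + α)) (U ×ˢ univ) := fun hF φ b =>
    (hF.mode k φ).comp (f := fun p : ℝ × ℝ => (p.1, p.2 + b + α)) (by fun_prop)
      (fun p hp => ⟨hp.1, mem_univ _⟩)
  have cw : Continuous fun p : ℝ × ℝ => crossWeight d p.2 :=
    (continuous_crossWeight hd).comp continuous_snd
  set E : ℝ → ℝ := fun t => ∫ x in (-π)..π, (c t x ^ 2 + s t x ^ 2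
    + 1 / 100 * (crossWeight d x * (c t (x - d) * s t (x + d) - s t (x - d) * c t (x + d))))
    with hE
  have hEc : ∀ {U : Set ℝ}, ContT U f → ContinuousOn (fun p : ℝ × ℝ => c p.1 p.2 ^ 2 + s p.1 p.2 ^ 2
      + 1 / 100 * (crossWeight d p.2 * (c p.1 (p.2 - d) * s p.1 (p.2 + d)
        - s p.1 (p.2 - d) * c p.1 (p.2 + d)))) (U ×ˢ univ) := by
    intro U hU
    have h1 := fun φ => by simpa using hjoint hU φ 0
    have h2 := fun φ => by simpa using hjoint hU φ d
    have h3 := fun φ => by simpa [← sub_eq_add_neg] using hjoint hU φ (-d)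
    exact (((h1 0).pow 2).add ((h1 _).pow 2)).add (continuousOn_const.mul (cw.continuousOn.mul
      (((h3 0).mul (h2 _)).sub ((h3 _).mul (h2 _)))))
  have hEd : ∀ t, 0 < t → HasDerivAt E (∫ x in (-π)..π, (2 * (c t x * ct t x + s t x * st t x)
      + 1 / 100 * (crossWeight d x * (ct t (x - d) * s t (x + d) + c t (x - d) * st t (x + d)
        - st t (x - d) * c t (x + d) - s t (x - d) * ct t (x + d))))) t := by
    intro t ht
    refine hasDerivAt_integral_param isOpen_Ioi (hEc S.contT_pos) (F' := fun t x =>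
      2 * (c t x * ct t x + s t x * st t x)
      + 1 / 100 * (crossWeight d x * (ct t (x - d) * s t (x + d) + c t (x - d) * st t (x + d)
        - st t (x - d) * c t (x + d) - s t (x - d) * ct t (x + d)))) ?_ ?_ _ _ (mem_Ioi.2 ht)
    · have h1 := fun φ => by simpa using hjoint S.contT_pos φ 0
      have h2 := fun φ => by simpa using hjoint S.contT_pos φ d
      have h3 := fun φ => by simpa [← sub_eq_add_neg] using hjoint S.contT_pos φ (-d)
      have h1' := fun φ => by simpa using hjoint S.contT_dt φ 0
      have h2' := fun φ => by simpa using hjoint S.contT_dt φ d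
      have h3' := fun φ => by simpa [← sub_eq_add_neg] using hjoint S.contT_dt φ (-d)
      exact (continuousOn_const.mul (((h1 0).mul (h1' 0)).add ((h1 _).mul (h1' _)))).add
        (continuousOn_const.mul (cw.continuousOn.mul
        (((((h3' 0).mul (h2 _)).add ((h3 0).mul (h2' _))).sub ((h3' _).mul (h2 _))).sub
          ((h3 _).mul (h2' _)))))
    · intro r hr x
      have dc : ∀ x, HasDerivAt (fun r => c r x) (ct r x) r := fun x =>
        S.hasDerivAt_mode_dt hr k 0 _
      have ds : ∀ x, HasDerivAt (fun r => s r x) (st r x) r := fun x =>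
        S.hasDerivAt_mode_dt hr k _ _
      refine ((((dc x).pow 2).add ((ds x).pow 2)).add (((((dc (x - d)).mul (ds (x + d))).sub
        ((ds (x - d)).mul (dc (x + d)))).const_mul (crossWeight d x)).const_mul _)).congr_deriv ?_
      simp only [Nat.cast_ofNat, Nat.add_one_sub_one, pow_one]
      ring
  have hcross : ∀ t, 0 ≤ t → |E t - modeSq (f t) k| ≤ 1 / 200 * modeSq (f t) k := by
    intro t ht
    have ch := S.contT.cont3 (mem_Ici.2 ht)
    have hp := S.periodic t ht
    have cc : Continuous (c t) := (ch.continuous_mode k 0).comp (by fun_prop)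
    have cs : Continuous (s t) := (ch.continuous_mode k _).comp (by fun_prop)
    have pm := fun φ x => mode_periodic hp k φ x
    have pc : Function.Periodic (c t) (2 * π) := fun x => by
      simp only [hcdef]; rw [← pm 0 (x + α)]; congr 1; ring
    have ps : Function.Periodic (s t) (2 * π) := fun x => by
      simp only [hsdef]; rw [← pm _ (x + α)]; congr 1; ring
    have h1 : ∫ x in (-π)..π, (c t x ^ 2 + s t x ^ 2) = modeSq (f t) k :=
      integral_comp_add (f := fun θ => mode (f t) k 0 θ ^ 2 + mode (f t) k (-(π / 2)) θ ^ 2)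
        (fun θ => by simp only [pm 0 θ, pm _ θ]) α
    have h2 : E t = (∫ x in (-π)..π, (c t x ^ 2 + s t x ^ 2)) + 1 / 100 * ∫ x in (-π)..π,
        crossWeight d x * (c t (x - d) * s t (x + d) - s t (x - d) * c t (x + d)) := by
      have cw' := continuous_crossWeight hd
      rw [← intervalIntegral.integral_const_mul]
      exact integral_add_of_continuous (by fun_prop) (by fun_prop) _ _
    have h3 := abs_integral_crossWeight_le cc cs pc ps hd
    rw [h2, h1, add_sub_cancel_left, abs_mul, abs_of_pos (by norm_num : (0 : ℝ) < 1 / 100)]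
    rw [h1] at h3
    linarith
  set Q : ℝ → ℝ := fun τ => modeSq (flux Φ Ψ (f (max τ 0))) k with hQ
  have cQ : Continuous Q := by
    have := (continuousOn_modeSq (S.contT.flux B) k).comp_continuous
      (f := fun τ : ℝ => max τ 0) (by fun_prop) (fun τ => mem_Ici.2 (le_max_right _ _))
    exact this
  have hderiv : ∀ t, 0 < t → ∀ E', HasDerivAt E E' t →
      E' ≤ -(√ν / 5000) * E t + 2 * κ ^ 2 / ν * Q t := by
    intro t ht E' hE'
    rw [hE'.unique (hEd t ht)]
    have hvt := hv.range t ht.le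
    have M := S.modeData B ht k α
    have key := M.deriv_functional_le (ν := ν) (μ := v t * q) (q := q) (d := d) hd hd1 hν hq hqd
      (by nlinarith) (by nlinarith) (ct := ct t) (st := st t) (fun x => by
        have h1 := S.mode_dt B ht k 0 (x + α)
        rw [mode_add_pi_div_two, mul_assoc (v t), hrot] at h1
        simp only [hctdef, h1]
        ring) (fun x => by
        have h1 := S.mode_dt B ht k (-(π / 2)) (x + α)
        rw [neg_add_cancel, mul_assoc (v t), hrot] at h1
        simp only [hstdef, h1]
        ring)
    have p1 : ∀ φ θ, mode (f t) k φ (θ + 2 * π) = mode (f t) k φ θ :=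
      mode_periodic (S.periodic t ht.le) k
    have p2 : ∀ φ θ, mode (flux Φ Ψ (f t)) k φ (θ + 2 * π) = mode (flux Φ Ψ (f t)) k φ θ :=
      mode_periodic ((S.periodic t ht.le).flux B) k
    have h1 : ∫ x in (-π)..π, (mode (f t) k 0 (x + α) ^ 2 + mode (f t) k (-(π / 2)) (x + α) ^ 2)
        = modeSq (f t) k :=
      integral_comp_add (f := fun θ => mode (f t) k 0 θ ^ 2 + mode (f t) k (-(π / 2)) θ ^ 2)
        (fun θ => by simp only [p1]) α
    have h2 : ∫ x in (-π)..π, ((-κ * mode (flux Φ Ψ (f t)) k 0 (x + α)) ^ 2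
        + (-κ * mode (flux Φ Ψ (f t)) k (-(π / 2)) (x + α)) ^ 2) = κ ^ 2 * Q t := by
      simp only [mul_pow, neg_sq, ← mul_add, intervalIntegral.integral_const_mul, hQ,
        max_eq_left ht.le]
      congr 1
      exact integral_comp_add (f := fun θ => mode (flux Φ Ψ (f t)) k 0 θ ^ 2
        + mode (flux Φ Ψ (f t)) k (-(π / 2)) θ ^ 2) (fun θ => by simp only [p2]) α
    rw [h1, h2] at key
    refine key.trans ?_
    have h3 := (abs_le.1 (hcross t ht.le)).2
    have h4 := modeSq_nonneg (f t) k
    have h5 : √ν * modeSq (f t) k ≤ q * d ^ 2 * modeSq (f t) k := by gcongr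
    have h6 : √ν * E t ≤ √ν * (201 / 200 * modeSq (f t) k) := by
      gcongr; linarith
    have h7 : 2 / ν * (κ ^ 2 * Q t) = 2 * κ ^ 2 / ν * Q t := by ring
    rw [h7]
    have : 0 ≤ √ν * modeSq (f t) k := by positivity
    linarith
  have hfin := exp_mul_le_of_deriv_le (y := E) (b := fun t => 2 * κ ^ 2 / ν * Q t)
    (α := √ν / 5000) hT
    ((continuousOn_integral_param (hEc S.contT) _ _).mono Icc_subset_Ici_self)
    (fun t ht => hEd t ht.1) (by fun_prop) (fun t ht => hderiv t ht.1 _ (hEd t ht.1))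
  have hI : ∫ τ in (0 : ℝ)..T, Real.exp (√ν / 5000 * τ) * (2 * κ ^ 2 / ν * Q τ)
      = 2 * κ ^ 2 / ν * ∫ τ in (0 : ℝ)..T, Real.exp (√ν / 5000 * τ) * Q τ := by
    rw [← intervalIntegral.integral_const_mul]
    congr 1; ext τ; ring
  rw [hI] at hfin
  have h0 := (abs_le.1 (hcross 0 le_rfl)).2
  have hT' := (abs_le.1 (hcross T hT)).1
  have hm0 := modeSq_nonneg (f 0) k
  have hI0 : 0 ≤ ∫ τ in (0 : ℝ)..T, Real.exp (√ν / 5000 * τ) * Q τ :=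
    integral_nonneg_of_forall hT fun τ => mul_nonneg (Real.exp_pos _).le (modeSq_nonneg _ _)
  have hK : 0 ≤ κ ^ 2 / ν * ∫ τ in (0 : ℝ)..T, Real.exp (√ν / 5000 * τ) * Q τ := by positivity
  have h8 : Real.exp (√ν / 5000 * T) * (199 / 200 * modeSq (f T) k)
      ≤ Real.exp (√ν / 5000 * T) * E T := by
    gcongr; linarith
  rw [mul_div_assoc, mul_assoc] at hfin ⊢
  linarith

end ClassicalSolution

/-! ### Positivity and conservation of mass -/

theorem nonneg_of_hasDerivAt_of_isLocalMin {g g' : ℝ → ℝ} {g'' x : ℝ}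
    (hg : ∀ y, HasDerivAt g (g' y) y) (hg' : HasDerivAt g' g'' x) (hmin : IsLocalMin g x) :
    0 ≤ g'' := by
  by_contra! hneg
  have e : deriv g = g' := funext fun y => (hg y).deriv
  have h1 : deriv (deriv g) x = g'' := by rw [e]; exact hg'.deriv
  have hmax : IsLocalMax g x := isLocalMax_of_deriv_deriv_neg (by rw [h1]; exact hneg)
    hmin.deriv_eq_zero (hg x).continuousAt
  have hconst : g =ᶠ[𝓝 x] fun _ => g x := by
    filter_upwards [hmin, hmax] with y h2 h3 using le_antisymm h3 h2
  have h4 := hconst.deriv.deriv_eq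
  simp only [deriv_const'] at h4
  linarith [h4.symm.trans h1]

theorem nonpos_of_hasDerivAt_of_left_min {y : ℝ → ℝ} {y' t : ℝ} (ht : 0 < t)
    (hy : HasDerivAt y y' t) (hmin : ∀ s ∈ Icc 0 t, y t ≤ y s) : y' ≤ 0 := by
  have h1 : Tendsto (slope y t) (𝓝[<] t) (𝓝 y') :=
    (hasDerivAt_iff_tendsto_slope.1 hy).mono_left (nhdsWithin_mono _ fun s hs => ne_of_lt hs)
  refine le_of_tendsto h1 ?_
  filter_upwards [Ioo_mem_nhdsLT ht] with s hs
  rw [slope_def_field]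
  exact div_nonpos_of_nonneg_of_nonpos (by linarith [hmin s ⟨hs.1.le, hs.2.le⟩]) (by linarith [hs.2])

theorem Periodic3.exists_cell {h : Fun3} (hp : Periodic3 h) (x₁ x₂ θ : ℝ) :
    ∃ y₁ ∈ Icc 0 (2 * π), ∃ y₂ ∈ Icc 0 (2 * π), ∃ η ∈ Icc 0 (2 * π), h x₁ x₂ θ = h y₁ y₂ η := by
  have h1 : Function.Periodic (fun x => h x x₂ θ) (2 * π) := fun x => (hp x x₂ θ).1
  obtain ⟨y₁, hy₁, e₁⟩ := h1.exists_mem_Ico₀ (by positivity) x₁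
  have h2 : Function.Periodic (fun x => h y₁ x θ) (2 * π) := fun x => (hp y₁ x θ).2.1
  obtain ⟨y₂, hy₂, e₂⟩ := h2.exists_mem_Ico₀ (by positivity) x₂
  have h3 : Function.Periodic (fun x => h y₁ y₂ x) (2 * π) := fun x => (hp y₁ y₂ x).2.2
  obtain ⟨η, hη, e₃⟩ := h3.exists_mem_Ico₀ (by positivity) θ
  exact ⟨y₁, Ico_subset_Icc_self hy₁, y₂, Ico_subset_Icc_self hy₂, η, Ico_subset_Icc_self hη,
    e₁.trans (e₂.trans e₃)⟩

theorem ContT.integral3 {U : Set ℝ} {F : ℝ → Fun3} (hF : ContT U F) :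
    ContinuousOn (fun t => integral3 (F t)) U := by
  refine continuousOn_int2 (Y := ℝ) (F := fun t x₁ x₂ => ∫ θ in (-π)..π, F t x₁ x₂ θ) ?_ _ _ _ _
  refine continuousOn_integral_param (Y := ℝ × ℝ × ℝ)
    (F := fun p θ => F p.1 p.2.1 p.2.2 θ) ?_ _ _
  exact hF.compOn (by fun_prop) (by fun_prop) (by fun_prop) (by fun_prop) fun y hy => hy.1.1

theorem ContT.avg {S : Set ℝ} {F : ℝ → Fun3} (hF : ContT S F) :
    ContinuousOn (fun p : ℝ × ℝ => avg (F p.1) p.2) (S ×ˢ univ) := by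
  have e : (fun p : ℝ × ℝ => Vicsek.avg (F p.1) p.2)
      = fun p => 1 / (2 * π) ^ 2 * Vicsek.mode (F p.1) 0 0 p.2 := funext fun p => avg_eq_mode _ _
  rw [e]
  exact continuousOn_const.mul (hF.mode 0 0)

theorem ContT.rem {S : Set ℝ} {F : ℝ → Fun3} (hF : ContT S F) : ContT S fun t => rem (F t) :=
  ContinuousOn.sub hF (hF.avg.comp (f := fun q : ℝ × ℝ × ℝ × ℝ => (q.1, q.2.2.2)) (by fun_prop)
    fun q hq => ⟨hq.1, mem_univ _⟩)

namespace ClassicalSolution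

variable {Φ : ℝ → ℝ → ℝ} {Ψ Ψ' : ℝ → ℝ} {Λ : ℝ} {v : ℝ → ℝ} {κ ν : ℝ} {f₀ : Fun3} {f : ℝ → Fun3}

theorem init (S : ClassicalSolution Φ Ψ v κ ν f₀ f) : f 0 = f₀ := by
  funext x₁ x₂ θ; exact S.initial x₁ x₂ θ

/-- The minimum principle for `e^{-lt} f`, with `l` larger than the zeroth order coefficient
`-κ ∂_θ L[f]` of the equation. -/
theorem nonneg (S : ClassicalSolution Φ Ψ v κ ν f₀ f) (B : InfluenceBounds Φ Ψ Ψ' Λ)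
    (hν : 0 < ν) (hf₀ : ∀ x₁ x₂ θ, 0 ≤ f₀ x₁ x₂ θ) {T : ℝ} (hT : 0 ≤ T) (x₁ x₂ θ : ℝ) :
    0 ≤ f T x₁ x₂ θ := by
  set C : Set (ℝ × ℝ × ℝ × ℝ) :=
    Icc 0 T ×ˢ (Icc 0 (2 * π) ×ˢ (Icc 0 (2 * π) ×ˢ Icc 0 (2 * π))) with hC
  have hCc : IsCompact C :=
    isCompact_Icc.prod (isCompact_Icc.prod (isCompact_Icc.prod isCompact_Icc))
  have hCU : C ⊆ Ici 0 ×ˢ univ := fun q hq => ⟨hq.1.1, mem_univ _⟩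
  obtain ⟨b, hb⟩ := hCc.exists_bound_of_continuousOn (ContinuousOn.mono
    (S.contT.alignment B.cΦ B.cΨ' : ContinuousOn _ _) hCU)
  set l : ℝ := |κ| * |b| + 1 with hl
  have hg : ContinuousOn (fun q : ℝ × ℝ × ℝ × ℝ =>
      Real.exp (-(l * q.1)) * f q.1 q.2.1 q.2.2.1 q.2.2.2) C :=
    (Continuous.continuousOn (by fun_prop)).mul (S.continuous.mono hCU)
  obtain ⟨⟨t, a₁, a₂, a₃⟩, hq, hmin⟩ := hCc.exists_isMinOn
    ⟨(0, 0, 0, 0), ⟨⟨le_rfl, hT⟩, ⟨le_rfl, by positivity⟩, ⟨le_rfl, by positivity⟩,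
      ⟨le_rfl, by positivity⟩⟩⟩ hg
  have ht : t ∈ Icc 0 T := hq.1
  -- by periodicity the minimum over the cell is a minimum over the whole space
  have hmin' : ∀ s ∈ Icc 0 T, ∀ y₁ y₂ η,
      Real.exp (-(l * t)) * f t a₁ a₂ a₃ ≤ Real.exp (-(l * s)) * f s y₁ y₂ η := by
    intro s hs y₁ y₂ η
    obtain ⟨z₁, h₁, z₂, h₂, ζ, h₃, e⟩ := (S.periodic s hs.1).exists_cell y₁ y₂ η
    rw [e]
    exact hmin (show (s, z₁, z₂, ζ) ∈ C from ⟨hs, h₁, h₂, h₃⟩)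
  have hex : ∀ r : ℝ, 0 < Real.exp r := Real.exp_pos
  suffices h : 0 ≤ f t a₁ a₂ a₃ by
    have h1 := hmin' T ⟨hT, le_rfl⟩ x₁ x₂ θ
    exact (mul_nonneg_iff_of_pos_left (hex _)).1 ((mul_nonneg (hex _).le h).trans h1)
  by_contra! hneg
  have ht0 : 0 < t := by
    rcases ht.1.eq_or_lt with h | h
    · rw [← h, S.initial] at hneg
      exact absurd hneg (not_lt.2 (hf₀ _ _ _))
    · exact h
  have hloc : ∀ y₁ y₂ η, f t a₁ a₂ a₃ ≤ f t y₁ y₂ η := fun y₁ y₂ η =>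
    (mul_le_mul_iff_right₀ (hex _)).1 (hmin' t ht y₁ y₂ η)
  have h1 : dx₁ (f t) a₁ a₂ a₃ = 0 :=
    IsLocalMin.deriv_eq_zero (f := fun s => f t s a₂ a₃) (Eventually.of_forall fun y => hloc y _ _)
  have h2 : dx₂ (f t) a₁ a₂ a₃ = 0 :=
    IsLocalMin.deriv_eq_zero (f := fun s => f t a₁ s a₃) (Eventually.of_forall fun y => hloc _ y _)
  have h3' : IsLocalMin (fun s => f t a₁ a₂ s) a₃ := Eventually.of_forall fun y => hloc _ _ y
  have h3 : dθ (f t) a₁ a₂ a₃ = 0 := h3'.deriv_eq_zero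
  have h4 : 0 ≤ dθ (dθ (f t)) a₁ a₂ a₃ := nonneg_of_hasDerivAt_of_isLocalMin
    (fun y => S.hasDerivAt_dθ ht0 a₁ a₂ y) (S.hasDerivAt_dθdθ ht0 a₁ a₂ a₃) h3'
  have h5 : Real.exp (-(l * t)) * (-l) * f t a₁ a₂ a₃ + Real.exp (-(l * t)) * dt f t a₁ a₂ a₃ ≤ 0 := by
    have h6 : HasDerivAt (fun s => Real.exp (-(l * s))) (Real.exp (-(l * t)) * (-l)) t := by
      simpa using ((hasDerivAt_id t).const_mul l).neg.exp
    exact nonpos_of_hasDerivAt_of_left_min ht0 (h6.mul (S.hasDerivAt_dt ht0 a₁ a₂ a₃))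
      fun s hs => hmin' s ⟨hs.1, hs.2.trans ht.2⟩ _ _ _
  have h6 : -l * f t a₁ a₂ a₃ + dt f t a₁ a₂ a₃ ≤ 0 := by
    by_contra! h
    have := mul_pos (hex (-(l * t))) h
    linarith
  have h7 := S.equation t ht0 a₁ a₂ a₃
  have h8 := S.dθ_flux B ht0 a₁ a₂ a₃
  unfold flux at h8
  rw [h8, h1, h2, h3] at h7
  have h9 : κ * alignment Φ Ψ' (f t) a₁ a₂ a₃ < l := by
    have h10 := hb (t, a₁, a₂, a₃) hq
    rw [Real.norm_eq_abs] at h10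
    calc _ ≤ |κ * alignment Φ Ψ' (f t) a₁ a₂ a₃| := le_abs_self _
      _ ≤ |κ| * |b| := by
        rw [abs_mul]
        exact mul_le_mul_of_nonneg_left (h10.trans (le_abs_self b)) (abs_nonneg _)
      _ < l := by linarith
  have h10 := mul_pos_of_neg_of_neg hneg (sub_neg.2 h9)
  have h11 := mul_nonneg hν.le h4
  simp only [dt] at h6
  linarith

theorem hasDerivAt_mass (S : ClassicalSolution Φ Ψ v κ ν f₀ f) (B : InfluenceBounds Φ Ψ Ψ' Λ)
    {t : ℝ} (ht : 0 < t) : HasDerivAt (fun s => ∫ θ in (-π)..π, mode (f s) 0 0 θ) 0 t := by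
  have h1 := hasDerivAt_integral_param isOpen_Ioi (F := fun s θ => mode (f s) 0 0 θ)
    (F' := fun s θ => mode (dt f s) 0 0 θ) (S.contT_pos.mode 0 0) (S.contT_dt.mode 0 0)
    (fun s hs θ => S.hasDerivAt_mode_dt hs 0 0 θ) (-π) π (mem_Ioi.2 ht)
  have M := S.modeData B ht 0 0
  simp only [add_zero] at M
  have h2 := integral_deriv_eq_zero M.hc₁ M.hc₂ M.pc₁
  have h3 := integral_deriv_eq_zero M.hP M.hP₁ M.pP
  have h4 : ∀ θ, mode (dt f t) 0 0 θ
      = ν * mode (dθ (dθ (f t))) 0 0 θ + -κ * mode (dθ (flux Φ Ψ (f t))) 0 0 θ := by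
    intro θ
    rw [S.mode_dt B ht 0 0 θ]
    simp only [Prod.fst_zero, Prod.snd_zero, Int.cast_zero, zero_mul, add_zero, mul_zero]
    ring
  have h5 : ∫ θ in (-π)..π, mode (dt f t) 0 0 θ = 0 := by
    simp only [h4]
    rw [integral_add_of_continuous (continuous_const.fun_mul M.hc₂) M.hP₁,
      intervalIntegral.integral_const_mul, h2, h3]
    simp
  rwa [h5] at h1

theorem integral3_eq_mode_zero {h : Fun3} (hh : Cont3 h) :
    integral3 h = ∫ θ in (-π)..π, mode h 0 0 θ := by
  rw [integral3_eq_theta hh]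
  simp [mode]

theorem integral3_eq_one (S : ClassicalSolution Φ Ψ v κ ν f₀ f) (B : InfluenceBounds Φ Ψ Ψ' Λ)
    (h₀ : integral3 f₀ = 1) {t : ℝ} (ht : 0 ≤ t) : integral3 (f t) = 1 := by
  have e : ∀ t, 0 ≤ t → integral3 (f t) = ∫ θ in (-π)..π, mode (f t) 0 0 θ := fun t ht =>
    integral3_eq_mode_zero (S.contT.cont3 (mem_Ici.2 ht))
  have hc : ContinuousOn (fun s => ∫ θ in (-π)..π, mode (f s) 0 0 θ) (Icc 0 t) :=
    (continuousOn_integral_param (S.contT.mode 0 0) _ _).mono Icc_subset_Ici_self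
  rcases ht.eq_or_lt with h | h
  · rw [← h, S.init, h₀]
  have h1 := exists_hasDerivAt_eq_slope _ _ h hc fun s hs => S.hasDerivAt_mass B hs.1
  obtain ⟨_, _, h1⟩ := h1
  rw [← e t ht, ← e 0 le_rfl, S.init, h₀, eq_comm, div_eq_zero_iff] at h1
  rcases h1 with h1 | h1 <;> linarith

theorem integral3_abs_eq_one (S : ClassicalSolution Φ Ψ v κ ν f₀ f)
    (B : InfluenceBounds Φ Ψ Ψ' Λ) (hν : 0 < ν) (hf₀ : InitialDatum f₀) {t : ℝ} (ht : 0 ≤ t) :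
    (integral3 fun x₁ x₂ θ => |f t x₁ x₂ θ|) = 1 := by
  simp only [abs_of_nonneg (S.nonneg B hν (fun _ _ _ => (hf₀.pos _ _ _).le) ht _ _ _)]
  exact S.integral3_eq_one B hf₀.mass ht

end ClassicalSolution

/-! ### Decay of the remainder -/

/-- The squared norm `‖h_≠‖²_{L²}`. -/
noncomputable def remSq (h : Fun3) : ℝ := integral3 fun x₁ x₂ θ => rem h x₁ x₂ θ ^ 2

/-- The squared norm `‖⟨h⟩‖²_{L²(𝕋)}`. -/
noncomputable def avgSq (h : Fun3) : ℝ := ∫ θ in (-π)..π, avg h θ ^ 2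

theorem remSq_nonneg (h : Fun3) : 0 ≤ remSq h := integral3_nonneg fun _ _ _ => sq_nonneg _

theorem avgSq_nonneg (h : Fun3) : 0 ≤ avgSq h :=
  integral_nonneg_of_forall neg_pi_le_pi fun _ => sq_nonneg _

theorem ContT.continuousOn_remSq {U : Set ℝ} {F : ℝ → Fun3} (hF : ContT U F) :
    ContinuousOn (fun t => remSq (F t)) U := by
  have h := (hF.rem.mul hF.rem).integral3
  simp only [← sq] at h
  exact h

theorem ContT.continuousOn_avgSq {U : Set ℝ} {F : ℝ → Fun3} (hF : ContT U F) :
    ContinuousOn (fun t => avgSq (F t)) U :=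
  continuousOn_integral_param (hF.avg.pow 2) _ _

/-- The part of the alignment flux that carries its nonzero Fourier modes: the product
`⟨h⟩ L[⟨h⟩]` does not depend on `x`. -/
noncomputable def fluxRem (Φ : ℝ → ℝ → ℝ) (Ψ : ℝ → ℝ) (h : Fun3) : Fun3 := fun x₁ x₂ θ =>
  rem h x₁ x₂ θ * alignment Φ Ψ h x₁ x₂ θ + avg h θ * alignment Φ Ψ (rem h) x₁ x₂ θ

section

variable {Φ : ℝ → ℝ → ℝ} {Ψ Ψ' : ℝ → ℝ} {Λ : ℝ} {v : ℝ → ℝ} {κ ν : ℝ} {f₀ : Fun3} {f : ℝ → Fun3}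

theorem Cont3.fluxRem (B : InfluenceBounds Φ Ψ Ψ' Λ) {h : Fun3} (hh : Cont3 h) :
    Cont3 (fluxRem Φ Ψ h) :=
  (hh.rem.mul (hh.alignment B.cΦ B.cΨ)).add
    ((cont3_angle hh.continuous_avg).mul (hh.rem.alignment B.cΦ B.cΨ))

theorem flux_eq (B : InfluenceBounds Φ Ψ Ψ' Λ) {h : Fun3} (hh : Cont3 h) :
    flux Φ Ψ h = fun x₁ x₂ θ => fluxRem Φ Ψ h x₁ x₂ θ
      + avg h θ * alignment Φ Ψ (fun _ _ θ => avg h θ) 0 0 θ := by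
  funext x₁ x₂ θ
  have h1 := alignment_add B.cΦ B.cΨ hh.rem (cont3_angle hh.continuous_avg) x₁ x₂ θ
  rw [alignment_angle B.pΦ] at h1
  have h2 : (fun x₁ x₂ θ => rem h x₁ x₂ θ + avg h θ) = h := by
    funext x₁ x₂ θ; simp [rem]
  rw [h2] at h1
  have h3 : h x₁ x₂ θ = rem h x₁ x₂ θ + avg h θ := by simp [rem]
  simp only [flux, fluxRem]
  rw [h3]
  linear_combination avg h θ * h1

theorem modeSq_flux (B : InfluenceBounds Φ Ψ Ψ' Λ) {h : Fun3} (hh : Cont3 h) {k : ℤ × ℤ}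
    (hk : k ≠ 0) : modeSq (flux Φ Ψ h) k = modeSq (fluxRem Φ Ψ h) k := by
  have hc : Cont3 fun _ _ θ => avg h θ * alignment Φ Ψ (fun _ _ θ => avg h θ) 0 0 θ :=
    cont3_angle (hh.continuous_avg.mul (((cont3_angle hh.continuous_avg).alignment B.cΦ B.cΨ).comp
      continuous_const continuous_const continuous_id))
  have e : ∀ φ θ, mode (flux Φ Ψ h) k φ θ = mode (fluxRem Φ Ψ h) k φ θ := by
    intro φ θ
    rw [flux_eq B hh, mode_add (hh.fluxRem B) hc,
      mode_angle_eq_zero (fun θ => avg h θ * alignment Φ Ψ (fun _ _ θ => avg h θ) 0 0 θ) hk, add_zero]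
  simp only [modeSq, e]

theorem sq_integral3_abs_le {h : Fun3} (hh : Cont3 h) :
    (integral3 fun x₁ x₂ θ => |h x₁ x₂ θ|) ^ 2
      ≤ (2 * π) ^ 3 * integral3 fun x₁ x₂ θ => h x₁ x₂ θ ^ 2 := by
  have h1 := sq_integral3_mul_le hh.abs (cont3_angle (continuous_const (y := (1 : ℝ))))
  simp only [mul_one, sq_abs, one_pow, integral3_const] at h1
  linarith

theorem integral3_angle (g : ℝ → ℝ) :
    (integral3 fun _ _ θ => g θ) = (2 * π) ^ 2 * ∫ θ in (-π)..π, g θ := by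
  simp only [integral3, intervalIntegral.integral_const, smul_eq_mul]
  ring

theorem integral3_sq_fluxRem_le (B : InfluenceBounds Φ Ψ Ψ' Λ) {h : Fun3} (hh : Cont3 h)
    (h1 : (integral3 fun x₁ x₂ θ => |h x₁ x₂ θ|) = 1) :
    (integral3 fun x₁ x₂ θ => fluxRem Φ Ψ h x₁ x₂ θ ^ 2)
      ≤ 2 * (2 * π) ^ 5 * Λ ^ 2 * (1 + avgSq h) * remSq h := by
  have hL : ∀ x₁ x₂ θ, alignment Φ Ψ h x₁ x₂ θ ^ 2 ≤ Λ ^ 2 := fun x₁ x₂ θ => by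
    have := B.bound h hh x₁ x₂ θ
    rw [h1, mul_one] at this
    exact sq_le_sq' (abs_le.1 this).1 (abs_le.1 this).2
  have hR : ∀ x₁ x₂ θ, alignment Φ Ψ (rem h) x₁ x₂ θ ^ 2 ≤ Λ ^ 2 * ((2 * π) ^ 3 * remSq h) :=
    fun x₁ x₂ θ => by
    have h2 := B.bound _ hh.rem x₁ x₂ θ
    calc _ ≤ (Λ * integral3 fun x₁ x₂ θ => |rem h x₁ x₂ θ|) ^ 2 :=
          sq_le_sq' (abs_le.1 h2).1 (abs_le.1 h2).2
      _ = Λ ^ 2 * (integral3 fun x₁ x₂ θ => |rem h x₁ x₂ θ|) ^ 2 := by ring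
      _ ≤ _ := by
        gcongr
        exact sq_integral3_abs_le hh.rem
  have hpt : ∀ x₁ x₂ θ, fluxRem Φ Ψ h x₁ x₂ θ ^ 2 ≤ 2 * Λ ^ 2 * rem h x₁ x₂ θ ^ 2
      + 2 * (Λ ^ 2 * ((2 * π) ^ 3 * remSq h)) * avg h θ ^ 2 := by
    intro x₁ x₂ θ
    have h2 := mul_le_mul_of_nonneg_left (hL x₁ x₂ θ) (sq_nonneg (rem h x₁ x₂ θ))
    have h3 := mul_le_mul_of_nonneg_left (hR x₁ x₂ θ) (sq_nonneg (avg h θ))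
    have h4 := sq_nonneg (rem h x₁ x₂ θ * alignment Φ Ψ h x₁ x₂ θ
      - avg h θ * alignment Φ Ψ (rem h) x₁ x₂ θ)
    simp only [fluxRem]
    nlinarith
  have ca : Cont3 fun _ _ θ => avg h θ ^ 2 := cont3_angle (hh.continuous_avg.pow 2)
  refine (integral3_mono ((hh.fluxRem B).pow 2) (((hh.rem.pow 2).const_mul _).add
    (ca.const_mul _)) hpt).trans ?_
  rw [integral3_add ((hh.rem.pow 2).const_mul _) (ca.const_mul _), integral3_const_mul,
    integral3_const_mul, integral3_angle fun θ => avg h θ ^ 2]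
  have h5 : (1 : ℝ) ≤ (2 * π) ^ 5 := one_le_pow₀ (by linarith [Real.pi_gt_three])
  have h6 : 0 ≤ Λ ^ 2 * remSq h := mul_nonneg (sq_nonneg _) (remSq_nonneg h)
  have h7 := mul_le_mul_of_nonneg_right h5 h6
  change 2 * Λ ^ 2 * remSq h
    + 2 * (Λ ^ 2 * ((2 * π) ^ 3 * remSq h)) * ((2 * π) ^ 2 * avgSq h) ≤ _
  linarith

theorem hasSum_modeSq_rem {h : Fun3} (hh : Cont3 h) :
    HasSum (modeSq (rem h)) ((2 * π) ^ 2 * remSq h) := hasSum_modeSq hh.rem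

/-- The averages and the remainder are orthogonal projections. -/
theorem remSq_le {h : Fun3} (hh : Cont3 h) : remSq h ≤ integral3 fun x₁ x₂ θ => h x₁ x₂ θ ^ 2 := by
  have h1 := hasSum_le (fun k => ?_) (hasSum_modeSq_rem hh) (hasSum_modeSq hh)
  · exact le_of_mul_le_mul_left h1 (by positivity)
  · by_cases hk : k = 0
    · rw [hk, modeSq_rem_zero hh]; exact modeSq_nonneg _ _
    · rw [modeSq_rem hh hk]

theorem avgSq_le {h : Fun3} (hh : Cont3 h) : avgSq h ≤ integral3 fun x₁ x₂ θ => h x₁ x₂ θ ^ 2 := by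
  have h1 := le_hasSum (hasSum_modeSq hh) 0 fun k _ => modeSq_nonneg _ _
  have h2 : (2 * π) ^ 4 * avgSq h ≤ modeSq h 0 := by
    have e : ∀ θ, mode h 0 0 θ = (2 * π) ^ 2 * avg h θ := fun θ => by
      rw [avg_eq_mode]; field_simp
    rw [avgSq, ← intervalIntegral.integral_const_mul]
    have c := hh.continuous_avg
    have c0 := hh.continuous_mode 0 0
    have c1 := hh.continuous_mode 0 (-(π / 2))
    refine integral_mono_of_continuous (by fun_prop) (by fun_prop) neg_pi_le_pi fun θ => ?_
    have := sq_nonneg (mode h 0 (-(π / 2)) θ)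
    rw [e]; linarith
  have h3 : (1 : ℝ) ≤ (2 * π) ^ 2 := one_le_pow₀ (by linarith [Real.pi_gt_three])
  have h4 : (2 * π) ^ 2 * ((2 * π) ^ 2 * avgSq h)
      ≤ (2 * π) ^ 2 * integral3 fun x₁ x₂ θ => h x₁ x₂ θ ^ 2 := by linarith
  have h5 := le_of_mul_le_mul_left h4 (by positivity)
  have h6 := mul_le_mul_of_nonneg_right h3 (avgSq_nonneg h)
  linarith

namespace ClassicalSolution

/-- Summation of the estimates for the nonzero Fourier modes. -/
theorem exp_mul_remSq_le (S : ClassicalSolution Φ Ψ v κ ν f₀ f) (B : InfluenceBounds Φ Ψ Ψ' Λ)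
    (hv : SpeedProfile v) (hν : 0 < ν) (hν1 : ν ≤ 1) (hf₀ : InitialDatum f₀) {T : ℝ} (hT : 0 ≤ T) :
    Real.exp (√ν / 5000 * T) * remSq (f T) ≤ 102 / 100 * remSq f₀
      + 6 * (2 * π) ^ 5 * Λ ^ 2 * κ ^ 2 / ν * ∫ τ in (0 : ℝ)..T, Real.exp (√ν / 5000 * τ)
        * ((1 + avgSq (f (max τ 0))) * remSq (f (max τ 0))) := by
  have c := fun {t : ℝ} (ht : 0 ≤ t) => S.contT.cont3 (mem_Ici.2 ht)
  have cA : Continuous fun τ => avgSq (f (max τ 0)) :=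
    S.contT.continuousOn_avgSq.comp_continuous (f := fun τ : ℝ => max τ 0) (by fun_prop)
      fun τ => mem_Ici.2 (le_max_right _ _)
  have cF : Continuous fun τ => remSq (f (max τ 0)) :=
    S.contT.continuousOn_remSq.comp_continuous (f := fun τ : ℝ => max τ 0) (by fun_prop)
      fun τ => mem_Ici.2 (le_max_right _ _)
  have cQ : ∀ k, Continuous fun τ => modeSq (flux Φ Ψ (f (max τ 0))) k := fun k =>
    (continuousOn_modeSq (S.contT.flux B) k).comp_continuous (f := fun τ : ℝ => max τ 0)
      (by fun_prop) fun τ => mem_Ici.2 (le_max_right _ _)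
  have cE : ∀ k, Continuous fun τ =>
      Real.exp (√ν / 5000 * τ) * modeSq (flux Φ Ψ (f (max τ 0))) k := fun k =>
    Continuous.mul (by fun_prop) (cQ k)
  set R : ℝ := 102 / 100 * remSq f₀
      + 6 * (2 * π) ^ 5 * Λ ^ 2 * κ ^ 2 / ν * ∫ τ in (0 : ℝ)..T, Real.exp (√ν / 5000 * τ)
        * ((1 + avgSq (f (max τ 0))) * remSq (f (max τ 0))) with hR
  have hfin : ∀ K : Finset (ℤ × ℤ), ∑ k ∈ K, Real.exp (√ν / 5000 * T) * modeSq (rem (f T)) k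
      ≤ (2 * π) ^ 2 * R := by
    intro K
    classical
    set K' := K.filter (· ≠ 0) with hK'
    have h1 : ∑ k ∈ K, Real.exp (√ν / 5000 * T) * modeSq (rem (f T)) k
        = ∑ k ∈ K', Real.exp (√ν / 5000 * T) * modeSq (rem (f T)) k := by
      refine (Finset.sum_filter_of_ne fun k _ hk => ?_).symm
      rintro rfl
      simp [modeSq_rem_zero (c hT)] at hk
    rw [h1]
    have h2 : ∀ k ∈ K', Real.exp (√ν / 5000 * T) * modeSq (rem (f T)) k
        ≤ 102 / 100 * modeSq (rem f₀) k + 3 * κ ^ 2 / ν * ∫ τ in (0 : ℝ)..T,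
        Real.exp (√ν / 5000 * τ) * modeSq (flux Φ Ψ (f (max τ 0))) k := fun k hk => by
      have hk0 := (Finset.mem_filter.1 hk).2
      have h3 := S.exp_mul_modeSq_le B hv hν hν1 hk0 hT
      rw [modeSq_rem (c hT) hk0, ← S.init, modeSq_rem (c le_rfl) hk0]
      exact h3
    refine (Finset.sum_le_sum h2).trans ?_
    rw [Finset.sum_add_distrib, ← Finset.mul_sum, ← Finset.mul_sum,
      ← intervalIntegral.integral_finsetSum fun k _ =>
        (cE k).intervalIntegrable _ _]
    have h3 : ∑ k ∈ K', modeSq (rem f₀) k ≤ (2 * π) ^ 2 * remSq f₀ :=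
      sum_le_hasSum _ (fun k _ => modeSq_nonneg _ _) (hasSum_modeSq_rem hf₀.smooth.smooth.continuous)
    have h4 : ∀ τ, ∑ k ∈ K', Real.exp (√ν / 5000 * τ) * modeSq (flux Φ Ψ (f (max τ 0))) k
        ≤ (2 * π) ^ 2 * (2 * (2 * π) ^ 5 * Λ ^ 2) * (Real.exp (√ν / 5000 * τ)
          * ((1 + avgSq (f (max τ 0))) * remSq (f (max τ 0)))) := by
      intro τ
      have hτ := le_max_right τ 0
      rw [← Finset.mul_sum]
      have h5 : ∑ k ∈ K', modeSq (flux Φ Ψ (f (max τ 0))) k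
          = ∑ k ∈ K', modeSq (fluxRem Φ Ψ (f (max τ 0))) k :=
        Finset.sum_congr rfl fun k hk => modeSq_flux B (c hτ) (Finset.mem_filter.1 hk).2
      have h6 := sum_le_hasSum K' (fun k _ => modeSq_nonneg _ _)
        (hasSum_modeSq ((c hτ).fluxRem B))
      have h7 := integral3_sq_fluxRem_le B (c hτ) (S.integral3_abs_eq_one B hν hf₀ hτ)
      rw [h5]
      calc _ ≤ Real.exp (√ν / 5000 * τ) * ((2 * π) ^ 2 * (2 * (2 * π) ^ 5 * Λ ^ 2
            * (1 + avgSq (f (max τ 0))) * remSq (f (max τ 0)))) := by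
            gcongr
            exact h6.trans (by gcongr)
        _ = _ := by ring
    have h5 := integral_mono_of_continuous (a := 0) (b := T)
      (continuous_finsetSum K' fun k _ => cE k)
      (by fun_prop) hT h4
    rw [intervalIntegral.integral_const_mul] at h5
    have h6 := mul_le_mul_of_nonneg_left h5 (show 0 ≤ 3 * κ ^ 2 / ν by positivity)
    have h7 : 3 * κ ^ 2 / ν * ((2 * π) ^ 2 * (2 * (2 * π) ^ 5 * Λ ^ 2)
        * ∫ τ in (0 : ℝ)..T, Real.exp (√ν / 5000 * τ)
        * ((1 + avgSq (f (max τ 0))) * remSq (f (max τ 0))))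
        = (2 * π) ^ 2 * (6 * (2 * π) ^ 5 * Λ ^ 2 * κ ^ 2 / ν * ∫ τ in (0 : ℝ)..T,
          Real.exp (√ν / 5000 * τ) * ((1 + avgSq (f (max τ 0))) * remSq (f (max τ 0)))) := by
      ring
    rw [h7] at h6
    rw [hR]
    linarith
  have h1 := hasSum_le_of_sum_le ((hasSum_modeSq_rem (c hT)).mul_left (Real.exp (√ν / 5000 * T))) hfin
  rw [mul_left_comm] at h1
  exact le_of_mul_le_mul_left h1 (by positivity)

/-- As long as the averages are bounded, the remainder decays exponentially up to the rate `β` of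
growth due to alignment. -/
theorem remSq_le_exp (S : ClassicalSolution Φ Ψ v κ ν f₀ f) (B : InfluenceBounds Φ Ψ Ψ' Λ)
    (hv : SpeedProfile v) (hν : 0 < ν) (hν1 : ν ≤ 1) (hf₀ : InitialDatum f₀) {T M β : ℝ}
    (hT : 0 ≤ T) (hM : ∀ t ∈ Icc 0 T, avgSq (f t) ≤ M)
    (hβ : 6 * (2 * π) ^ 5 * Λ ^ 2 * κ ^ 2 / ν * (1 + M) ≤ β) :
    remSq (f T) ≤ 102 / 100 * remSq f₀ * Real.exp ((β - √ν / 5000) * T) := by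
  have cA : Continuous fun τ => avgSq (f (max τ 0)) :=
    S.contT.continuousOn_avgSq.comp_continuous (f := fun τ : ℝ => max τ 0) (by fun_prop)
      fun τ => mem_Ici.2 (le_max_right _ _)
  have cF : Continuous fun τ => remSq (f (max τ 0)) :=
    S.contT.continuousOn_remSq.comp_continuous (f := fun τ : ℝ => max τ 0) (by fun_prop)
      fun τ => mem_Ici.2 (le_max_right _ _)
  have hM0 : 0 ≤ M := (avgSq_nonneg _).trans (hM 0 ⟨le_rfl, hT⟩)
  have hK : 0 ≤ 6 * (2 * π) ^ 5 * Λ ^ 2 * κ ^ 2 / ν := by positivity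
  have hβ0 : 0 ≤ β := le_trans (by positivity) hβ
  have h1 := le_exp_of_le_integral (y := fun τ => Real.exp (√ν / 5000 * τ) * remSq (f (max τ 0)))
    (by fun_prop) (C := 102 / 100 * remSq f₀) hT hβ0 fun t ht => by
      have h2 := S.exp_mul_remSq_le B hv hν hν1 hf₀ ht.1
      simp only [max_eq_left ht.1]
      refine h2.trans ?_
      rw [← intervalIntegral.integral_const_mul, ← intervalIntegral.integral_const_mul]
      gcongr
      refine intervalIntegral.integral_mono_on ht.1 (Continuous.intervalIntegrable (by fun_prop) _ _)
        (Continuous.intervalIntegrable (by fun_prop) _ _) fun τ hτ => ?_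
      have h3 := hM τ ⟨hτ.1, hτ.2.trans ht.2⟩
      rw [max_eq_left hτ.1]
      have h4 : 0 ≤ Real.exp (√ν / 5000 * τ) * remSq (f τ) :=
        mul_nonneg (Real.exp_pos _).le (remSq_nonneg _)
      calc _ = 6 * (2 * π) ^ 5 * Λ ^ 2 * κ ^ 2 / ν * (1 + avgSq (f τ))
            * (Real.exp (√ν / 5000 * τ) * remSq (f τ)) := by ring
        _ ≤ _ := by
          gcongr
          exact le_trans (by gcongr) hβ
  simp only [max_eq_left hT] at h1
  have h2 : remSq (f T) = Real.exp (-(√ν / 5000 * T))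
      * (Real.exp (√ν / 5000 * T) * remSq (f T)) := by
    rw [← mul_assoc, ← Real.exp_add, neg_add_cancel, Real.exp_zero, one_mul]
  rw [h2]
  calc _ ≤ Real.exp (-(√ν / 5000 * T)) * (102 / 100 * remSq f₀ * Real.exp (β * T)) := by gcongr
    _ = 102 / 100 * remSq f₀ * (Real.exp (-(√ν / 5000 * T)) * Real.exp (β * T)) := by ring
    _ = _ := by rw [← Real.exp_add]; congr 2; ring

end ClassicalSolution

end

/-! ### Energy estimates for the averages -/

theorem le_max_add_integral_of_deriv_le {y y' b : ℝ → ℝ} {T B : ℝ} (hT : 0 ≤ T)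
    (hy : ContinuousOn y (Icc 0 T)) (hd : ∀ t ∈ Ioo 0 T, HasDerivAt y (y' t) t)
    (hb : Continuous b) (hb0 : ∀ t, 0 ≤ b t) (h : ∀ t ∈ Ioo 0 T, B < y t → y' t ≤ b t) :
    y T ≤ max (y 0) B + ∫ τ in (0 : ℝ)..T, b τ := by
  have h1 := le_max_of_deriv_nonpos (y := fun t => y t - ∫ τ in (0 : ℝ)..t, b τ)
    (y' := fun t => y' t - b t) (B := B) hT
    (hy.sub (continuous_iff_continuousAt.2 fun t =>
      (hasDerivAt_integral_right hb 0 t).continuousAt).continuousOn)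
    (fun t ht => (hd t ht).sub (hasDerivAt_integral_right hb 0 t)) fun t ht hB => by
      have h2 : 0 ≤ ∫ τ in (0 : ℝ)..t, b τ := integral_nonneg_of_forall ht.1.le hb0
      linarith [h t ht (by linarith)]
  simp only [intervalIntegral.integral_same, sub_zero] at h1
  linarith

theorem abs_avg_le {h k : Fun3} (hh : Cont3 h) (hk : Cont3 k) {b θ : ℝ}
    (hb : ∀ x₁ x₂, |k x₁ x₂ θ| ≤ b * h x₁ x₂ θ) : |avg k θ| ≤ b * avg h θ := by
  have hc : ∀ {f : Fun3}, Cont3 f → Continuous fun p : ℝ × ℝ => f p.1 p.2 θ := fun hf =>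
    hf.comp (by fun_prop) (by fun_prop) (by fun_prop)
  have hs : ∀ {f : Fun3}, Cont3 f → ∀ x₁, Continuous fun x₂ => f x₁ x₂ θ := fun hf x₁ =>
    hf.comp (by fun_prop) (by fun_prop) (by fun_prop)
  have hi : ∀ {f : Fun3}, Cont3 f → Continuous fun x₁ => ∫ x₂ in (-π)..π, f x₁ x₂ θ := fun hf =>
    intervalIntegral.continuous_parametric_intervalIntegral_of_continuous' (hc hf) _ _
  have h1 : |∫ x₁ in (-π)..π, ∫ x₂ in (-π)..π, k x₁ x₂ θ|
      ≤ b * ∫ x₁ in (-π)..π, ∫ x₂ in (-π)..π, h x₁ x₂ θ := by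
    refine (intervalIntegral.abs_integral_le_integral_abs neg_pi_le_pi).trans ?_
    rw [← intervalIntegral.integral_const_mul]
    refine integral_mono_of_continuous (hi hk).abs (continuous_const.fun_mul (hi hh)) neg_pi_le_pi
      fun x₁ => ?_
    refine (intervalIntegral.abs_integral_le_integral_abs neg_pi_le_pi).trans ?_
    rw [← intervalIntegral.integral_const_mul]
    exact integral_mono_of_continuous (hs hk x₁).abs (continuous_const.fun_mul (hs hh x₁)) neg_pi_le_pi
      fun x₂ => hb x₁ x₂
  simp only [avg]
  rw [abs_mul, abs_of_pos (show 0 < 1 / (2 * π) ^ 2 by positivity), mul_left_comm]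
  gcongr

theorem hasDerivAt_avg {h h' : Fun3} (hh : Cont3 h) (hh' : Cont3 h')
    (hd : ∀ x₁ x₂ θ, HasDerivAt (fun s => h x₁ x₂ s) (h' x₁ x₂ θ) θ) (θ : ℝ) :
    HasDerivAt (avg h) (avg h' θ) θ := by
  rw [funext (avg_eq_mode h), avg_eq_mode]
  exact (hasDerivAt_mode hh hh' hd 0 0 θ).const_mul _

namespace ClassicalSolution

variable {Φ : ℝ → ℝ → ℝ} {Ψ Ψ' : ℝ → ℝ} {Λ : ℝ} {v : ℝ → ℝ} {κ ν : ℝ} {f₀ : Fun3} {f : ℝ → Fun3}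

theorem avg_nonneg (S : ClassicalSolution Φ Ψ v κ ν f₀ f) (B : InfluenceBounds Φ Ψ Ψ' Λ)
    (hν : 0 < ν) (hf₀ : InitialDatum f₀) {t : ℝ} (ht : 0 ≤ t) (θ : ℝ) : 0 ≤ avg (f t) θ := by
  refine mul_nonneg (by positivity) (integral_nonneg_of_forall neg_pi_le_pi fun x₁ =>
    integral_nonneg_of_forall neg_pi_le_pi fun x₂ => ?_)
  exact S.nonneg B hν (fun _ _ _ => (hf₀.pos _ _ _).le) ht _ _ _

theorem integral_avg (S : ClassicalSolution Φ Ψ v κ ν f₀ f) (B : InfluenceBounds Φ Ψ Ψ' Λ)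
    (h₀ : integral3 f₀ = 1) {t : ℝ} (ht : 0 ≤ t) :
    (2 * π) ^ 2 * ∫ θ in (-π)..π, avg (f t) θ = 1 := by
  rw [← S.integral3_eq_one B h₀ ht, integral3_eq_mode_zero (S.contT.cont3 (mem_Ici.2 ht)),
    funext (avg_eq_mode (f t)), intervalIntegral.integral_const_mul]
  field_simp

/-- The energy identity for the averages. -/
theorem hasDerivAt_avgSq (S : ClassicalSolution Φ Ψ v κ ν f₀ f) (B : InfluenceBounds Φ Ψ Ψ' Λ)
    {t : ℝ} (ht : 0 < t) :
    HasDerivAt (fun s => avgSq (f s)) (-2 * ν * (∫ θ in (-π)..π, avg (dθ (f t)) θ ^ 2)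
      + 2 * κ * ∫ θ in (-π)..π, avg (dθ (f t)) θ * avg (flux Φ Ψ (f t)) θ) t := by
  have c := S.contT_pos.cont3 ht
  have c1 := S.contT_dθ.cont3 ht
  have c2 := S.contT_dθdθ.cont3 ht
  have c3 := c.flux B
  have c4 := (S.contT_dθ_flux B).cont3 ht
  have a := c.continuous_avg
  have a1 := c1.continuous_avg
  have a2 := c2.continuous_avg
  have a3 := c3.continuous_avg
  have a4 := c4.continuous_avg
  have d0 := hasDerivAt_avg c c1 (S.hasDerivAt_dθ ht)
  have d1 := hasDerivAt_avg c1 c2 (S.hasDerivAt_dθdθ ht)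
  have d3 := hasDerivAt_avg c3 c4 (S.hasDerivAt_flux B ht)
  have p := avg_periodic (S.periodic t ht.le)
  have p1 := avg_periodic (S.periodic_dθ ht)
  have p3 := avg_periodic ((S.periodic t ht.le).flux B)
  have h1 := hasDerivAt_integral_param isOpen_Ioi (F := fun s θ => avg (f s) θ ^ 2)
    (F' := fun s θ => 2 * (avg (f s) θ * avg (dt f s) θ)) (S.contT_pos.avg.pow 2)
    (continuousOn_const.mul (S.contT_pos.avg.mul S.contT_dt.avg))
    (fun s hs θ => by
      have h2 : HasDerivAt (fun s => avg (f s) θ) (avg (dt f s) θ) s := by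
        simp only [avg_eq_mode]
        exact (S.hasDerivAt_mode_dt hs 0 0 θ).const_mul _
      refine (h2.pow 2).congr_deriv ?_
      simp only [Nat.cast_ofNat, Nat.add_one_sub_one, pow_one]; ring) (-π) π (mem_Ioi.2 ht)
  refine h1.congr_deriv ?_
  have e : ∀ θ, avg (dt f t) θ = ν * avg (dθ (dθ (f t))) θ - κ * avg (dθ (flux Φ Ψ (f t))) θ := by
    intro θ
    simp only [avg_eq_mode, S.mode_dt B ht 0 0 θ, Prod.fst_zero, Prod.snd_zero, Int.cast_zero,
      zero_mul, add_zero, mul_zero]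
    ring
  have z1 := integral_deriv_eq_zero (fun θ => (d0 θ).mul (d1 θ)) (by fun_prop)
    fun θ => by simp only [Pi.mul_apply, p θ, p1 θ]
  have z2 := integral_deriv_eq_zero (fun θ => (d0 θ).mul (d3 θ)) (by fun_prop)
    fun θ => by simp only [Pi.mul_apply, p θ, p3 θ]
  rw [integral_add_of_continuous (f := fun θ => avg (dθ (f t)) θ * avg (dθ (f t)) θ)
    (g := fun θ => avg (f t) θ * avg (dθ (dθ (f t))) θ) (by fun_prop) (by fun_prop)] at z1
  rw [integral_add_of_continuous (f := fun θ => avg (dθ (f t)) θ * avg (flux Φ Ψ (f t)) θ)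
    (g := fun θ => avg (f t) θ * avg (dθ (flux Φ Ψ (f t))) θ) (by fun_prop) (by fun_prop)] at z2
  have e2 : ∫ θ in (-π)..π, 2 * (avg (f t) θ * avg (dt f t) θ)
      = 2 * ν * (∫ θ in (-π)..π, avg (f t) θ * avg (dθ (dθ (f t))) θ)
        - 2 * κ * ∫ θ in (-π)..π, avg (f t) θ * avg (dθ (flux Φ Ψ (f t))) θ := by
    rw [← intervalIntegral.integral_const_mul, ← intervalIntegral.integral_const_mul,
      ← integral_sub_of_continuous (by fun_prop) (by fun_prop)]
    congr 1; ext θ; rw [e]; ring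
  rw [e2]
  simp only [← sq] at z1
  linear_combination 2 * ν * z1 - 2 * κ * z2

theorem nash_avg (S : ClassicalSolution Φ Ψ v κ ν f₀ f) (B : InfluenceBounds Φ Ψ Ψ' Λ)
    (hν : 0 < ν) (hf₀ : InitialDatum f₀) {t : ℝ} (ht : 0 < t) (h2 : 2 ≤ avgSq (f t)) :
    avgSq (f t) ^ 3 ≤ 16 * ∫ θ in (-π)..π, avg (dθ (f t)) θ ^ 2 := by
  have c := S.contT_pos.cont3 ht
  have c1 := S.contT_dθ.cont3 ht
  refine nash_circle (hasDerivAt_avg c c1 (S.hasDerivAt_dθ ht)) c1.continuous_avg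
    (S.avg_nonneg B hν hf₀ ht.le) ?_ h2
  have h1 := S.integral_avg B hf₀.mass ht.le
  have h3 : (1 : ℝ) ≤ (2 * π) ^ 2 := one_le_pow₀ (by linarith [Real.pi_gt_three])
  have h4 : 0 ≤ ∫ θ in (-π)..π, avg (f t) θ :=
    integral_nonneg_of_forall neg_pi_le_pi (S.avg_nonneg B hν hf₀ ht.le)
  nlinarith [mul_le_mul_of_nonneg_right h3 h4]

theorem two_mul_integral_mul_le {g m : ℝ → ℝ} (hg : Continuous g) (hm : Continuous m) (hν : 0 < ν) :
    2 * κ * (∫ x in (-π)..π, g x * m x) ≤ ν * (∫ x in (-π)..π, g x ^ 2)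
      + κ ^ 2 / ν * ∫ x in (-π)..π, m x ^ 2 := by
  rw [← intervalIntegral.integral_const_mul, ← intervalIntegral.integral_const_mul,
    ← intervalIntegral.integral_const_mul,
    ← integral_add_of_continuous (by fun_prop) (by fun_prop)]
  refine integral_mono_of_continuous (by fun_prop) (by fun_prop) neg_pi_le_pi fun x => ?_
  have h1 : ν * g x ^ 2 + κ ^ 2 / ν * m x ^ 2 - 2 * κ * (g x * m x)
      = (ν * g x - κ * m x) ^ 2 / ν := by field_simp; ring
  have h2 : 0 ≤ (ν * g x - κ * m x) ^ 2 / ν := by positivity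
  linarith

/-- When `κ ≲ ν`, the dissipation controls the averages. -/
theorem avgSq_le_max (S : ClassicalSolution Φ Ψ v κ ν f₀ f) (B : InfluenceBounds Φ Ψ Ψ' Λ)
    (hκ : 0 < κ) (hν : 0 < ν) (hf₀ : InitialDatum f₀) {Cd : ℝ} (hCd : 1 ≤ Cd) (hκν : κ ≤ Cd * ν)
    {T : ℝ} (hT : 0 ≤ T) : avgSq (f T) ≤ max (avgSq f₀) (4 * Cd * Λ) := by
  have h1 := le_max_of_deriv_nonpos (y := fun t => avgSq (f t)) (B := 4 * Cd * Λ) hT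
    (S.contT.continuousOn_avgSq.mono Icc_subset_Ici_self)
    (fun t ht => S.hasDerivAt_avgSq B ht.1) fun t ht hB => by
      have ht0 : 0 < t := ht.1
      have c := S.contT_pos.cont3 ht0
      have c1 := (S.contT_dθ.cont3 ht0).continuous_avg
      have c3 := (c.flux B).continuous_avg
      have ca := c.continuous_avg
      have hΛ := B.one_le
      have hCΛ : 1 ≤ Cd * Λ := one_le_mul_of_one_le_of_one_le hCd hΛ
      have hn := S.nash_avg B hν hf₀ ht0 (by linarith)
      have hm : ∀ θ, avg (flux Φ Ψ (f t)) θ ^ 2 ≤ Λ ^ 2 * avg (f t) θ ^ 2 := by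
        intro θ
        have h2 := abs_avg_le c (c.flux B) (b := Λ) (θ := θ) fun x₁ x₂ => by
          have h3 := B.bound _ c x₁ x₂ θ
          rw [S.integral3_abs_eq_one B hν hf₀ ht0.le, mul_one] at h3
          have h4 := S.nonneg B hν (fun _ _ _ => (hf₀.pos _ _ _).le) ht0.le x₁ x₂ θ
          rw [flux, abs_mul, abs_of_nonneg h4, mul_comm]
          gcongr
        rw [← mul_pow]
        exact sq_le_sq' (abs_le.1 h2).1 (abs_le.1 h2).2
      have h3 := two_mul_integral_mul_le (κ := κ) c1 c3 hν
      have h4 : ∫ θ in (-π)..π, avg (flux Φ Ψ (f t)) θ ^ 2 ≤ Λ ^ 2 * avgSq (f t) := by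
        rw [avgSq, ← intervalIntegral.integral_const_mul]
        exact integral_mono_of_continuous (by fun_prop) (by fun_prop) neg_pi_le_pi hm
      have h5 := mul_le_mul_of_nonneg_left h4 (show 0 ≤ κ ^ 2 / ν by positivity)
      have h6 := mul_le_mul_of_nonneg_left hn hν.le
      set A := avgSq (f t) with hA
      have hA0 : 0 < A := lt_trans (by linarith) hB
      have h7 : κ ^ 2 / ν * (Λ ^ 2 * A) ≤ ν * A ^ 3 / 16 := by
        have h8 : κ ^ 2 ≤ (Cd * ν) ^ 2 := by gcongr
        have h9 : (4 * Cd * Λ) ^ 2 ≤ A ^ 2 := by gcongr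
        calc κ ^ 2 / ν * (Λ ^ 2 * A) ≤ (Cd * ν) ^ 2 / ν * (Λ ^ 2 * A) := by gcongr
          _ = ν * A * (4 * Cd * Λ) ^ 2 / 16 := by field_simp; ring
          _ ≤ ν * A * A ^ 2 / 16 := by gcongr
          _ = _ := by ring
      linarith
  simp only [S.init] at h1
  exact h1

/-- The energy estimate for the averages, with the interaction of averages and remainder as
forcing. -/
theorem avgSq_le_add_integral (S : ClassicalSolution Φ Ψ v κ ν f₀ f)
    (B : InfluenceBounds Φ Ψ Ψ' Λ) (hκ : 0 < κ) (hν : 0 < ν) (hf₀ : InitialDatum f₀) {T : ℝ}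
    (hT : 0 ≤ T) :
    avgSq (f T) ≤ max (avgSq f₀) (max 2 (4 * √(Λ * κ / ν)))
      + ∫ τ in (0 : ℝ)..T, (2 * π) ^ 3 * Λ ^ 2 * κ ^ 2 / ν
        * (avgSq (f (max τ 0)) * remSq (f (max τ 0))) := by
  have cA : Continuous fun τ => avgSq (f (max τ 0)) :=
    S.contT.continuousOn_avgSq.comp_continuous (f := fun τ : ℝ => max τ 0) (by fun_prop)
      fun τ => mem_Ici.2 (le_max_right _ _)
  have cF : Continuous fun τ => remSq (f (max τ 0)) :=
    S.contT.continuousOn_remSq.comp_continuous (f := fun τ : ℝ => max τ 0) (by fun_prop)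
      fun τ => mem_Ici.2 (le_max_right _ _)
  have h1 := le_max_add_integral_of_deriv_le (y := fun t => avgSq (f t))
    (B := max 2 (4 * √(Λ * κ / ν))) (b := fun τ => (2 * π) ^ 3 * Λ ^ 2 * κ ^ 2 / ν
        * (avgSq (f (max τ 0)) * remSq (f (max τ 0)))) hT
    (S.contT.continuousOn_avgSq.mono Icc_subset_Ici_self)
    (fun t ht => S.hasDerivAt_avgSq B ht.1) (by fun_prop)
    (fun t => mul_nonneg (by positivity) (mul_nonneg (avgSq_nonneg _) (remSq_nonneg _)))
    fun t ht hB => by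
      have ht0 : 0 < t := ht.1
      have c := S.contT_pos.cont3 ht0
      have cθ := S.contT_dθ.cont3 ht0
      have c1 := cθ.continuous_avg
      have ca := c.continuous_avg
      have hΛ := B.one_le
      have hn := S.nash_avg B hν hf₀ ht0 ((le_max_left _ _).trans hB.le)
      rw [max_eq_left ht0.le]
      have cg := cont3_angle ca
      have cm : Cont3 fun x₁ x₂ θ => f t x₁ x₂ θ * alignment Φ Ψ (rem (f t)) x₁ x₂ θ :=
        c.mul (c.rem.alignment B.cΦ B.cΨ)
      set l : ℝ → ℝ := fun θ => alignment Φ Ψ (fun _ _ θ => avg (f t) θ) 0 0 θ with hl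
      set l' : ℝ → ℝ := fun θ => -alignment Φ Ψ' (fun _ _ θ => avg (f t) θ) 0 0 θ with hl'
      set m : ℝ → ℝ := avg fun x₁ x₂ θ => f t x₁ x₂ θ * alignment Φ Ψ (rem (f t)) x₁ x₂ θ with hm
      have cm' : Continuous m := cm.continuous_avg
      have dl : ∀ θ, HasDerivAt l (l' θ) θ := fun θ =>
        hasDerivAt_alignment B.cΦ B.hΨ B.cΨ' cg 0 0 θ
      have cl : Continuous l := continuous_iff_continuousAt.2 fun x => (dl x).continuousAt
      have cl' : Continuous l' := by
        have := (cg.alignment B.cΦ B.cΨ').comp (Y := ℝ) (a := fun _ => 0) (b := fun _ => 0)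
          (c := fun θ => θ) continuous_const continuous_const continuous_id
        exact this.neg
      have bl' : ∀ θ, -l' θ ≤ Λ := fun θ => by
        have h2 := B.bound' _ cg 0 0 θ
        have h3 : (integral3 fun _ _ θ => |avg (f t) θ|) = 1 := by
          simp only [abs_of_nonneg (S.avg_nonneg B hν hf₀ ht0.le _)]
          rw [integral3_angle, S.integral_avg B hf₀.mass ht0.le]
        rw [h3, mul_one] at h2
        simp only [hl', neg_neg]
        exact (abs_le.1 h2).2
      have hflux : ∀ θ, avg (flux Φ Ψ (f t)) θ = avg (f t) θ * l θ + m θ := by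
        intro θ
        have e : flux Φ Ψ (f t) = fun x₁ x₂ θ => l θ * f t x₁ x₂ θ
            + f t x₁ x₂ θ * alignment Φ Ψ (rem (f t)) x₁ x₂ θ := by
          funext x₁ x₂ θ
          have h1 := alignment_add B.cΦ B.cΨ c.rem cg x₁ x₂ θ
          rw [alignment_angle B.pΦ] at h1
          have h2 : (fun x₁ x₂ θ => rem (f t) x₁ x₂ θ + avg (f t) θ) = f t := by
            funext x₁ x₂ θ; simp [rem]
          rw [h2] at h1
          simp only [flux, h1, hl]
          ring
        rw [e, hm]
        simp only [avg_eq_mode]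
        rw [mode_add ((cont3_angle cl).mul c) cm, mode_angle_mul]
        ring
      have hmb : ∀ θ, m θ ^ 2 ≤ Λ ^ 2 * ((2 * π) ^ 3 * remSq (f t)) * avg (f t) θ ^ 2 := by
        intro θ
        have h2 := abs_avg_le c cm (b := Λ * integral3 fun x₁ x₂ θ => |rem (f t) x₁ x₂ θ|)
          (θ := θ) fun x₁ x₂ => by
          have h3 := B.bound _ c.rem x₁ x₂ θ
          have h4 := S.nonneg B hν (fun _ _ _ => (hf₀.pos _ _ _).le) ht0.le x₁ x₂ θ
          rw [abs_mul, abs_of_nonneg h4, mul_comm]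
          gcongr
        calc m θ ^ 2 ≤ ((Λ * integral3 fun x₁ x₂ θ => |rem (f t) x₁ x₂ θ|) * avg (f t) θ) ^ 2 :=
              sq_le_sq' (abs_le.1 h2).1 (abs_le.1 h2).2
          _ = Λ ^ 2 * (integral3 fun x₁ x₂ θ => |rem (f t) x₁ x₂ θ|) ^ 2 * avg (f t) θ ^ 2 := by
            ring
          _ ≤ _ := by
            gcongr
            exact sq_integral3_abs_le c.rem
      have d0 := hasDerivAt_avg c cθ (S.hasDerivAt_dθ ht0)
      have p := avg_periodic (S.periodic t ht0.le)
      have pl : ∀ θ, l (θ + 2 * π) = l θ := fun θ =>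
        ((Periodic3.alignment B.pΦ B.pΨ (fun _ _ θ => avg (f t) θ)) 0 0 θ).2.2
      -- `2 ∫ g' g l = -∫ g² l'`
      have z := integral_deriv_eq_zero (fun θ => ((d0 θ).pow 2).mul (dl θ)) (by fun_prop)
        fun θ => by simp only [Pi.mul_apply, Pi.pow_apply, p θ, pl θ]
      have z' : 2 * (∫ θ in (-π)..π, avg (dθ (f t)) θ * (avg (f t) θ * l θ))
          = ∫ θ in (-π)..π, avg (f t) θ ^ 2 * -l' θ := by
        rw [integral_add_of_continuous (by fun_prop) (by fun_prop)] at z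
        simp only [mul_neg, intervalIntegral.integral_neg, ← intervalIntegral.integral_const_mul]
        rw [← add_eq_zero_iff_eq_neg, ← z]
        congr 2
        ext θ
        simp only [Nat.cast_ofNat, Nat.add_one_sub_one, pow_one]
        ring
      have z2 : ∫ θ in (-π)..π, avg (f t) θ ^ 2 * -l' θ ≤ Λ * avgSq (f t) := by
        rw [avgSq, ← intervalIntegral.integral_const_mul]
        refine integral_mono_of_continuous (by fun_prop) (by fun_prop) neg_pi_le_pi fun θ => ?_
        rw [mul_comm]
        exact mul_le_mul_of_nonneg_right (bl' θ) (sq_nonneg _)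
      have e1 : ∫ θ in (-π)..π, avg (dθ (f t)) θ * avg (flux Φ Ψ (f t)) θ
          = (∫ θ in (-π)..π, avg (dθ (f t)) θ * (avg (f t) θ * l θ))
            + ∫ θ in (-π)..π, avg (dθ (f t)) θ * m θ := by
        rw [← integral_add_of_continuous (by fun_prop) (by fun_prop)]
        simp only [hflux, mul_add]
      have h3 := two_mul_integral_mul_le (κ := κ) c1 cm' hν
      have h4 : ∫ θ in (-π)..π, m θ ^ 2 ≤ Λ ^ 2 * ((2 * π) ^ 3 * remSq (f t)) * avgSq (f t) := by
        rw [avgSq, ← intervalIntegral.integral_const_mul]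
        exact integral_mono_of_continuous (by fun_prop) (by fun_prop) neg_pi_le_pi hmb
      have h5 := mul_le_mul_of_nonneg_left h4 (show 0 ≤ κ ^ 2 / ν by positivity)
      have h6 := mul_le_mul_of_nonneg_left hn hν.le
      have h8 := mul_le_mul_of_nonneg_left z2 hκ.le
      rw [e1]
      rw [← z'] at h8
      set A := avgSq (f t) with hA
      have hA0 : 0 < A := lt_of_lt_of_le two_pos ((le_max_left _ _).trans hB.le)
      have h7 : κ * (Λ * A) ≤ ν * A ^ 3 / 16 := by
        have h9 : (4 * √(Λ * κ / ν)) ^ 2 ≤ A ^ 2 := by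
          gcongr; exact (le_max_right _ _).trans hB.le
        rw [mul_pow, Real.sq_sqrt (by positivity)] at h9
        calc κ * (Λ * A) = ν * A * (4 ^ 2 * (Λ * κ / ν)) / 16 := by field_simp; norm_num
          _ ≤ ν * A * A ^ 2 / 16 := by gcongr
          _ = _ := by ring
      have h10 : (2 * π) ^ 3 * Λ ^ 2 * κ ^ 2 / ν * (A * remSq (f t))
          = κ ^ 2 / ν * (Λ ^ 2 * ((2 * π) ^ 3 * remSq (f t)) * A) := by ring
      rw [h10]
      linarith
  simp only [S.init] at h1
  exact h1

end ClassicalSolution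

/-! ### Bootstrap for enhanced dissipation -/

/-- The powers of `κ` and `ν` in the bootstrap are small when `κ ≤ ν^{5/6}` is small. -/
theorem coupling_small {κ ν η : ℝ} (hκ : 0 < κ) (hν : 0 < ν) (hη : 0 < η) (hη1 : η ≤ 1)
    (h1 : κ ≤ η ^ 10) (h2 : κ ^ 6 ≤ ν ^ 5) :
    κ ^ 2 / (ν * √ν) ≤ η ∧ κ ^ 2 / (ν * √ν) * √(κ / ν) ≤ η := by
  obtain ⟨x, hx, rfl⟩ : ∃ x : ℝ, 0 < x ∧ κ = x ^ 10 := by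
    refine ⟨κ ^ ((10 : ℝ)⁻¹), by positivity, ?_⟩
    have := Real.rpow_inv_natCast_pow hκ.le (show (10 : ℕ) ≠ 0 by norm_num)
    exact_mod_cast this.symm
  have hxη : x ≤ η := le_of_pow_le_pow_left₀ (by norm_num) hη.le h1
  have h3 : x ^ 12 ≤ ν := by
    refine le_of_pow_le_pow_left₀ (n := 5) (by norm_num) hν.le ?_
    calc (x ^ 12) ^ 5 = (x ^ 10) ^ 6 := by ring
      _ ≤ ν ^ 5 := h2
  set σ := √ν with hσ
  have hσ0 : 0 < σ := Real.sqrt_pos.2 hν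
  have hσν : ν = σ ^ 2 := (Real.sq_sqrt hν.le).symm
  have h4 : x ^ 6 ≤ σ := Real.le_sqrt_of_sq_le (by rw [← pow_mul]; exact h3)
  have h5 : √(x ^ 10 / ν) = x ^ 5 / σ := by
    rw [hσν, show x ^ 10 / σ ^ 2 = (x ^ 5 / σ) ^ 2 by ring, Real.sqrt_sq (by positivity)]
  have h6 : (x ^ 10) ^ 2 / (ν * σ) ≤ x ^ 2 := by
    rw [div_le_iff₀ (by positivity)]
    calc (x ^ 10) ^ 2 = x ^ 2 * (x ^ 6) ^ 3 := by ring
      _ ≤ x ^ 2 * σ ^ 3 := by gcongr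
      _ = _ := by rw [hσν]; ring
  have h7 : (x ^ 10) ^ 2 / (ν * σ) * (x ^ 5 / σ) ≤ x := by
    rw [div_mul_div_comm, div_le_iff₀ (by positivity)]
    calc (x ^ 10) ^ 2 * x ^ 5 = x * (x ^ 6) ^ 4 := by ring
      _ ≤ x * σ ^ 4 := by gcongr
      _ = _ := by rw [hσν]; ring
  rw [h5]
  refine ⟨h6.trans ?_, h7.trans hxη⟩
  nlinarith

namespace ClassicalSolution

variable {Φ : ℝ → ℝ → ℝ} {Ψ Ψ' : ℝ → ℝ} {Λ : ℝ} {v : ℝ → ℝ} {κ ν : ℝ} {f₀ : Fun3} {f : ℝ → Fun3}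

/-- Bootstrap: while the averages stay below `M`, the remainder decays so fast that the averages
stay strictly below `M`. -/
theorem bootstrap (S : ClassicalSolution Φ Ψ v κ ν f₀ f) (B : InfluenceBounds Φ Ψ Ψ' Λ)
    (hv : SpeedProfile v) (hκ : 0 < κ) (hν : 0 < ν) (hν1 : ν ≤ 1) (hf₀ : InitialDatum f₀) {M : ℝ}
    (hM : M = 1 + max (avgSq f₀) (max 2 (4 * √(Λ * κ / ν))))
    (hβ : 6 * (2 * π) ^ 5 * Λ ^ 2 * κ ^ 2 / ν * (1 + M) ≤ √ν / 10000)
    (hI : (2 * π) ^ 3 * Λ ^ 2 * κ ^ 2 / ν * (M * (102 / 100 * remSq f₀)) * (10000 / √ν) ≤ 1 / 2)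
    {t : ℝ} (ht : 0 ≤ t) :
    avgSq (f t) ≤ M ∧ remSq (f t) ≤ 102 / 100 * remSq f₀ * Real.exp (-(√ν / 10000 * t)) := by
  have hσ : 0 < √ν := Real.sqrt_pos.2 hν
  have hA0 : avgSq f₀ ≤ M - 1 := by rw [hM, add_sub_cancel_left]; exact le_max_left _ _
  have hM0 : 0 ≤ M := by linarith [avgSq_nonneg f₀]
  have hF : ∀ T, 0 ≤ T → (∀ t ∈ Icc 0 T, avgSq (f t) ≤ M) →
      remSq (f T) ≤ 102 / 100 * remSq f₀ * Real.exp (-(√ν / 10000 * T)) := by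
    intro T hT h
    refine (S.remSq_le_exp B hv hν hν1 hf₀ hT h hβ).trans (le_of_eq ?_)
    congr 2; ring
  have hstep : ∀ T, 0 ≤ T → (∀ t ∈ Icc 0 T, avgSq (f t) ≤ M) → avgSq (f T) ≤ M - 1 / 2 := by
    intro T hT h
    have h1 := S.avgSq_le_add_integral B hκ hν hf₀ hT
    set K := (2 * π) ^ 3 * Λ ^ 2 * κ ^ 2 / ν with hK
    have hK0 : 0 ≤ K := by positivity
    have cA : Continuous fun τ => avgSq (f (max τ 0)) :=
      S.contT.continuousOn_avgSq.comp_continuous (f := fun τ : ℝ => max τ 0) (by fun_prop)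
        fun τ => mem_Ici.2 (le_max_right _ _)
    have cF : Continuous fun τ => remSq (f (max τ 0)) :=
      S.contT.continuousOn_remSq.comp_continuous (f := fun τ : ℝ => max τ 0) (by fun_prop)
        fun τ => mem_Ici.2 (le_max_right _ _)
    have h2 : ∫ τ in (0 : ℝ)..T, K * (avgSq (f (max τ 0)) * remSq (f (max τ 0)))
        ≤ ∫ τ in (0 : ℝ)..T, K * (M * (102 / 100 * remSq f₀))
          * Real.exp (-(√ν / 10000) * τ) := by
      refine intervalIntegral.integral_mono_on hT (Continuous.intervalIntegrable (by fun_prop) _ _)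
        (Continuous.intervalIntegrable (by fun_prop) _ _) fun τ hτ => ?_
      rw [max_eq_left hτ.1]
      have h3 := h τ hτ
      have h4 := hF τ hτ.1 fun t ht => h t ⟨ht.1, ht.2.trans hτ.2⟩
      rw [neg_mul]
      calc _ ≤ K * (M * (102 / 100 * remSq f₀ * Real.exp (-(√ν / 10000 * τ)))) := by
            have := remSq_nonneg (f τ)
            gcongr
        _ = _ := by ring
    have h3 : ∫ τ in (0 : ℝ)..T, Real.exp (-(√ν / 10000) * τ) ≤ 10000 / √ν := by
      have h5 : ∀ x : ℝ, HasDerivAt (fun τ => -(10000 / √ν) * Real.exp (-(√ν / 10000) * τ))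
          (Real.exp (-(√ν / 10000) * x)) x := fun x => by
        refine ((((hasDerivAt_id x).const_mul (-(√ν / 10000))).exp).const_mul
          (-(10000 / √ν))).congr_deriv ?_
        simp only [id]
        field_simp
      rw [intervalIntegral.integral_eq_sub_of_hasDerivAt (fun x _ => h5 x)
        (Continuous.intervalIntegrable (by fun_prop) _ _)]
      have h6 : 0 ≤ 10000 / √ν * Real.exp (-(√ν / 10000) * T) := by positivity
      simp only [mul_zero, Real.exp_zero]
      linarith
    rw [intervalIntegral.integral_const_mul (K * (M * (102 / 100 * remSq f₀)))] at h2
    have h4 : K * (M * (102 / 100 * remSq f₀)) * ∫ τ in (0 : ℝ)..T, Real.exp (-(√ν / 10000) * τ)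
        ≤ K * (M * (102 / 100 * remSq f₀)) * (10000 / √ν) := by
      have := remSq_nonneg f₀
      gcongr
    have h7 := h2.trans (h4.trans hI)
    linarith only [h1, h7, hM]
  have hall : ∀ T, 0 ≤ T → avgSq (f T) ≤ M := by
    intro T hT
    by_contra! hlt
    have hc : ContinuousOn (fun t => avgSq (f t)) (Icc 0 T) :=
      S.contT.continuousOn_avgSq.mono Icc_subset_Ici_self
    -- the first time at which the averages reach the level `M`
    have hcomp : IsCompact {t ∈ Icc 0 T | M ≤ avgSq (f t)} := by
      have := hc.preimage_isClosed_of_isClosed isClosed_Icc (isClosed_Ici (a := M))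
      exact isCompact_Icc.of_isClosed_subset this fun t ht => ht.1
    obtain ⟨t₁, ⟨ht₁, hMt⟩, hmin⟩ := hcomp.exists_isLeast ⟨T, ⟨hT, le_rfl⟩, hlt.le⟩
    have hbefore : ∀ s ∈ Icc 0 t₁, avgSq (f s) ≤ M := by
      intro s hs
      by_contra! hs'
      have h0 : avgSq (f 0) ≤ M := by rw [S.init]; linarith
      have h1 : M ∈ Icc (avgSq (f 0)) (avgSq (f s)) := ⟨h0, hs'.le⟩
      obtain ⟨r, hr, hrM⟩ := intermediate_value_Icc hs.1
        (hc.mono (Icc_subset_Icc le_rfl (hs.2.trans ht₁.2))) h1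
      simp only at hrM
      have h2 : t₁ ≤ r := hmin ⟨⟨hr.1, hr.2.trans (hs.2.trans ht₁.2)⟩, hrM.ge⟩
      have h3 : r = s := le_antisymm hr.2 (hs.2.trans h2)
      rw [h3] at hrM
      linarith
    linarith [hstep t₁ ht₁.1 hbefore]
  exact ⟨hall t ht, hF t ht fun s hs => hall s hs.1⟩

/-- Enhanced dissipation. -/
theorem enhanced_dissipation (S : ClassicalSolution Φ Ψ v κ ν f₀ f)
    (B : InfluenceBounds Φ Ψ Ψ' Λ) (hv : SpeedProfile v) (hκ : 0 < κ) (hν : 0 < ν) (hν1 : ν ≤ 1)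
    (hf₀ : InitialDatum f₀) {r : ℝ} (hr : normL2 f₀ = r) (h6 : κ ^ 6 ≤ ν ^ 5)
    (hsmall : κ ≤ (1 / (1200000 * (2 * π) ^ 5 * Λ ^ 3 * (1 + r ^ 2) ^ 2)) ^ 10) {t : ℝ}
    (ht : 0 ≤ t) :
    avgSq (f t) ≤ 3 + avgSq f₀ + 4 * Λ * √(κ / ν) ∧
      remSq (f t) ≤ 102 / 100 * remSq f₀ * Real.exp (-(√ν / 10000 * t)) := by
  have hΛ := B.one_le
  have hΛ0 : 0 < Λ := by linarith
  have hσ : 0 < √ν := Real.sqrt_pos.2 hν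
  have c₀ : Cont3 f₀ := hf₀.smooth.smooth.continuous
  have hr2 : (integral3 fun x₁ x₂ θ => f₀ x₁ x₂ θ ^ 2) = r ^ 2 := by
    rw [← hr, normL2, Real.sq_sqrt (integral3_nonneg fun _ _ _ => sq_nonneg _)]
  have hA0 : avgSq f₀ ≤ r ^ 2 := hr2 ▸ avgSq_le c₀
  have hF0 : remSq f₀ ≤ r ^ 2 := hr2 ▸ remSq_le c₀
  have hA0' := avgSq_nonneg f₀
  have hF0' := remSq_nonneg f₀
  have hP5 : (1 : ℝ) ≤ (2 * π) ^ 5 := one_le_pow₀ (by linarith [Real.pi_gt_three])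
  have hP3 : (2 * π) ^ 3 ≤ (2 * π) ^ 5 :=
    pow_le_pow_right₀ (by linarith [Real.pi_gt_three]) (by norm_num)
  set P : ℝ := 1 + r ^ 2 with hP
  have hP1 : 1 ≤ P := by rw [hP]; linarith [sq_nonneg r]
  set L : ℝ := 1200000 * (2 * π) ^ 5 * Λ ^ 3 * P ^ 2 with hL
  have hL1 : 1 ≤ L := by
    have h1 : (1 : ℝ) ≤ 1200000 * (2 * π) ^ 5 := by linarith
    exact one_le_mul_of_one_le_of_one_le
      (one_le_mul_of_one_le_of_one_le h1 (one_le_pow₀ hΛ)) (one_le_pow₀ hP1)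
  obtain ⟨hw, hz⟩ := coupling_small hκ hν (by positivity : 0 < 1 / L)
    ((div_le_one (by linarith)).2 hL1) hsmall h6
  set ρ := √(κ / ν) with hρ
  have hρ0 : 0 ≤ ρ := Real.sqrt_nonneg _
  set w := κ ^ 2 / (ν * √ν) with hwdef
  have hw0 : 0 ≤ w := by positivity
  set M := 1 + max (avgSq f₀) (max 2 (4 * √(Λ * κ / ν))) with hM
  have hMle : M ≤ 3 + avgSq f₀ + 4 * Λ * ρ := by
    have h1 : √(Λ * κ / ν) ≤ Λ * ρ := by
      rw [mul_div_assoc, Real.sqrt_mul hΛ0.le]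
      gcongr
      rw [Real.sqrt_le_left hΛ0.le]
      exact le_self_pow₀ hΛ (by norm_num)
    have h2 : 0 ≤ Λ * ρ := by positivity
    have h3 : max (avgSq f₀) (max 2 (4 * √(Λ * κ / ν))) ≤ 2 + avgSq f₀ + 4 * (Λ * ρ) :=
      max_le (by linarith) (max_le (by linarith) (by linarith))
    linarith
  have hM1 : 1 + M ≤ 5 * Λ * P * (1 + ρ) := by
    have h1 : 0 ≤ (Λ - 1) * P := mul_nonneg (by linarith) (by linarith)
    have h2 : 0 ≤ Λ * ρ * (P - 1) := mul_nonneg (by positivity) (by linarith)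
    have h3 : 0 ≤ Λ * P * ρ := by positivity
    have h4 : 0 ≤ Λ * ρ := by positivity
    have h5 : 5 * Λ * P * (1 + ρ) = 5 * ((Λ - 1) * P) + 5 * P + 5 * (Λ * ρ * (P - 1))
      + 5 * (Λ * ρ) := by ring
    rw [h5]
    linarith
  have hM0 : 0 ≤ M := by
    have := le_max_left (avgSq f₀) (max 2 (4 * √(Λ * κ / ν)))
    linarith
  -- the common smallness condition behind both hypotheses of the bootstrap
  have key : 60000 * (2 * π) ^ 5 * Λ ^ 2 * w * ((1 + M) * P) ≤ 1 / 2 := by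
    calc _ ≤ 60000 * (2 * π) ^ 5 * Λ ^ 2 * w * (5 * Λ * P * (1 + ρ) * P) := by gcongr
      _ = 300000 * (2 * π) ^ 5 * Λ ^ 3 * P ^ 2 * (w + w * ρ) := by ring
      _ ≤ 300000 * (2 * π) ^ 5 * Λ ^ 3 * P ^ 2 * (1 / L + 1 / L) := by gcongr
      _ = 1 / 2 := by rw [hL]; field_simp; norm_num
  have e : κ ^ 2 / ν = w * √ν := by rw [hwdef]; field_simp
  have h := S.bootstrap B hv hκ hν hν1 hf₀ hM ?_ ?_ ht
  · exact ⟨h.1.trans hMle, h.2⟩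
  · have h1 : 60000 * (2 * π) ^ 5 * Λ ^ 2 * w * ((1 + M) * 1)
        ≤ 60000 * (2 * π) ^ 5 * Λ ^ 2 * w * ((1 + M) * P) := by gcongr
    have h2 := mul_le_mul_of_nonneg_right (h1.trans key) hσ.le
    rw [mul_div_assoc, e]
    linarith
  · have h1 : (2 * π) ^ 3 * Λ ^ 2 * κ ^ 2 / ν * (M * (102 / 100 * remSq f₀)) * (10000 / √ν)
        = 10200 * ((2 * π) ^ 3 * Λ ^ 2 * w * (M * remSq f₀)) := by
      rw [mul_div_assoc, e]; field_simp; ring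
    rw [h1]
    have h2 : (2 * π) ^ 3 * Λ ^ 2 * w * (M * remSq f₀)
        ≤ (2 * π) ^ 5 * Λ ^ 2 * w * ((1 + M) * P) := by
      gcongr <;> linarith
    have h3 : 0 ≤ (2 * π) ^ 5 * Λ ^ 2 * w * ((1 + M) * P) := by positivity
    linarith

end ClassicalSolution

/-! ### Weighted estimates for the linear transport-diffusion equation -/

/-- A weight that is concentrated within distance `s` of the critical points of the cosine. -/
noncomputable def nearWeight (s θ : ℝ) : ℝ := s ^ 2 / (Real.sin θ ^ 2 + s ^ 2)

/-- The derivative of `nearWeight s`. -/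
noncomputable def nearWeight' (s θ : ℝ) : ℝ :=
  -(2 * s ^ 2 * Real.sin θ * Real.cos θ / (Real.sin θ ^ 2 + s ^ 2) ^ 2)

section

variable {s : ℝ}

theorem continuous_nearWeight (hs : 0 < s) : Continuous (nearWeight s) := by
  unfold nearWeight
  exact Continuous.div (by fun_prop) (by fun_prop) fun θ => (sin_sq_add_pos hs θ).ne'

theorem continuous_nearWeight' (hs : 0 < s) : Continuous (nearWeight' s) := by
  unfold nearWeight'
  exact (Continuous.div (by fun_prop) (by fun_prop)
    fun θ => (pow_pos (sin_sq_add_pos hs θ) 2).ne').neg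

theorem hasDerivAt_nearWeight (hs : 0 < s) (θ : ℝ) :
    HasDerivAt (nearWeight s) (nearWeight' s θ) θ := by
  have h0 := (sin_sq_add_pos hs θ).ne'
  have h1 := ((Real.hasDerivAt_sin θ).pow 2).add_const (s ^ 2)
  refine ((hasDerivAt_const θ (s ^ 2)).div h1 h0).congr_deriv ?_
  simp only [nearWeight', Pi.pow_apply, Nat.cast_ofNat, Nat.add_one_sub_one, pow_one]
  ring

theorem nearWeight_periodic : Function.Periodic (nearWeight s) (2 * π) := fun θ => by
  simp only [nearWeight, Real.sin_add_two_pi]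

theorem nearWeight_pos (hs : 0 < s) (θ : ℝ) : 0 < nearWeight s θ :=
  div_pos (by positivity) (sin_sq_add_pos hs θ)

theorem nearWeight_le_one (hs : 0 < s) (θ : ℝ) : nearWeight s θ ≤ 1 := by
  rw [nearWeight, div_le_one (sin_sq_add_pos hs θ)]
  linarith [sq_nonneg (Real.sin θ)]

theorem nearWeight_add (hs : 0 < s) (θ : ℝ) :
    nearWeight s θ + nearWeight s θ * Real.sin θ ^ 2 / s ^ 2 = 1 := by
  have h0 := (sin_sq_add_pos hs θ).ne'
  rw [nearWeight]
  field_simp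
  ring

theorem nearWeight_mul_sin_sq_le (hs : 0 < s) (θ : ℝ) :
    nearWeight s θ * Real.sin θ ^ 2 ≤ s ^ 2 := by
  have h1 := nearWeight_add hs θ
  have h2 := nearWeight_pos hs θ
  have h3 : nearWeight s θ * Real.sin θ ^ 2 / s ^ 2 ≤ 1 := by linarith
  rwa [div_le_one (by positivity)] at h3

theorem abs_nearWeight'_le (hs : 0 < s) (θ : ℝ) : |nearWeight' s θ| ≤ nearWeight s θ / s := by
  have h0 := sin_sq_add_pos hs θ
  have h1 : |Real.sin θ * Real.cos θ| * (2 * s) ≤ Real.sin θ ^ 2 + s ^ 2 := by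
    have h2 : |Real.sin θ * Real.cos θ| ≤ |Real.sin θ| := by
      rw [abs_mul]
      exact mul_le_of_le_one_right (abs_nonneg _) (Real.abs_cos_le_one θ)
    have h3 := sq_nonneg (|Real.sin θ| - s)
    rw [← sq_abs (Real.sin θ)]
    nlinarith
  rw [nearWeight', nearWeight, abs_neg, div_div, abs_div, abs_of_pos (pow_pos h0 2),
    div_le_div_iff₀ (by positivity) (by positivity), mul_assoc, abs_mul,
    abs_of_nonneg (by positivity : 0 ≤ 2 * s ^ 2)]
  nlinarith [mul_le_mul_of_nonneg_left h1 (mul_pos (pow_pos hs 2) h0).le]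

theorem abs_deriv_nearWeight_mul_sin_le (hs : 0 < s) (θ : ℝ) :
    |nearWeight' s θ * Real.sin θ + nearWeight s θ * Real.cos θ| ≤ 3 * nearWeight s θ := by
  have h0 := sin_sq_add_pos hs θ
  have hw := nearWeight_pos hs θ
  have e : nearWeight' s θ * Real.sin θ + nearWeight s θ * Real.cos θ
      = nearWeight s θ * (Real.cos θ * (1 - 2 * (Real.sin θ ^ 2 / (Real.sin θ ^ 2 + s ^ 2)))) := by
    rw [nearWeight', nearWeight]
    field_simp
    ring
  have h1 : Real.sin θ ^ 2 / (Real.sin θ ^ 2 + s ^ 2) ≤ 1 := by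
    rw [div_le_one h0]; linarith [sq_nonneg s]
  have h2 : 0 ≤ Real.sin θ ^ 2 / (Real.sin θ ^ 2 + s ^ 2) := by positivity
  rw [e, abs_mul, abs_of_pos hw, mul_comm 3]
  gcongr
  rw [abs_mul]
  calc _ ≤ 1 * |1 - 2 * (Real.sin θ ^ 2 / (Real.sin θ ^ 2 + s ^ 2))| := by
        gcongr; exact Real.abs_cos_le_one θ
    _ ≤ 3 := by rw [one_mul, abs_le]; constructor <;> linarith

/-- The weight has mass of order `s`: `ω cos² = s cos (arctan(sin/s))'` is integrated by parts. -/
theorem integral_nearWeight_le (hs : 0 < s) (hs1 : s ≤ 1) :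
    ∫ θ in (-π)..π, nearWeight s θ ≤ 17 * s := by
  have cw := continuous_nearWeight hs
  have hd : ∀ θ, HasDerivAt (fun θ => Real.cos θ * Real.arctan (Real.sin θ / s))
      (-Real.sin θ * Real.arctan (Real.sin θ / s) + nearWeight s θ * Real.cos θ ^ 2 / s) θ := by
    intro θ
    have h0 := (sin_sq_add_pos hs θ).ne'
    refine ((Real.hasDerivAt_cos θ).mul (((Real.hasDerivAt_sin θ).div_const s).arctan)).congr_deriv ?_
    rw [nearWeight]
    have h1 : 1 + (Real.sin θ / s) ^ 2 ≠ 0 := by positivity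
    field_simp
    ring
  have ca : Continuous fun θ => Real.arctan (Real.sin θ / s) :=
    Real.continuous_arctan.comp (by fun_prop)
  have h1 := integral_deriv_eq_zero hd (by fun_prop) fun θ => by
    simp only [Real.cos_add_two_pi, Real.sin_add_two_pi]
  rw [integral_add_of_continuous (by fun_prop) (by fun_prop)] at h1
  have h2 : ∫ θ in (-π)..π, -(-Real.sin θ * Real.arctan (Real.sin θ / s))
      ≤ ∫ θ in (-π)..π, π / 2 := by
    refine integral_mono_of_continuous (by fun_prop) continuous_const neg_pi_le_pi fun θ => ?_
    calc _ ≤ |(-(-Real.sin θ * Real.arctan (Real.sin θ / s)))| := le_abs_self _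
      _ = |Real.sin θ| * |Real.arctan (Real.sin θ / s)| := by rw [abs_neg, abs_mul, abs_neg]
      _ ≤ 1 * (π / 2) := by
        gcongr
        · exact Real.abs_sin_le_one θ
        · exact abs_le.2 ⟨(Real.neg_pi_div_two_lt_arctan _).le, (Real.arctan_lt_pi_div_two _).le⟩
      _ = _ := one_mul _
  rw [intervalIntegral.integral_neg, intervalIntegral.integral_const, smul_eq_mul] at h2
  have h3 : ∫ θ in (-π)..π, nearWeight s θ
      ≤ ∫ θ in (-π)..π, (s * (nearWeight s θ * Real.cos θ ^ 2 / s) + s ^ 2) := by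
    refine integral_mono_of_continuous cw (by fun_prop) neg_pi_le_pi fun θ => ?_
    have h4 := nearWeight_mul_sin_sq_le hs θ
    have h5 : s * (nearWeight s θ * Real.cos θ ^ 2 / s)
        = nearWeight s θ - nearWeight s θ * Real.sin θ ^ 2 := by
      rw [Real.cos_sq']; field_simp
    rw [h5]; linarith
  rw [integral_add_of_continuous (by fun_prop) (by fun_prop), intervalIntegral.integral_const_mul,
    intervalIntegral.integral_const, smul_eq_mul] at h3
  have h6 : ∫ θ in (-π)..π, nearWeight s θ * Real.cos θ ^ 2 / s ≤ π ^ 2 := by linarith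
  have h7 := mul_le_mul_of_nonneg_left h6 hs.le
  have hp : π ^ 2 < 10 := by nlinarith [Real.pi_lt_d2, Real.pi_gt_three]
  have hp' := Real.pi_lt_d2
  nlinarith

theorem integral_nearWeight_mul_sq_le (hs : 0 < s) (hs1 : s ≤ 1) {a b : ℝ → ℝ} (ha : Continuous a)
    (hb : Continuous b) {m : ℝ} (hm : ∀ θ, a θ ^ 2 + b θ ^ 2 ≤ m) :
    ∫ θ in (-π)..π, nearWeight s θ * (a θ ^ 2 + b θ ^ 2) ≤ 17 * s * m := by
  have cw := continuous_nearWeight hs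
  have hm0 : 0 ≤ m := le_trans (by positivity) (hm 0)
  calc _ ≤ ∫ θ in (-π)..π, m * nearWeight s θ := by
        refine integral_mono_of_continuous (by fun_prop) (by fun_prop) neg_pi_le_pi fun θ => ?_
        rw [mul_comm m]
        exact mul_le_mul_of_nonneg_left (hm θ) (nearWeight_pos hs θ).le
    _ = m * ∫ θ in (-π)..π, nearWeight s θ := intervalIntegral.integral_const_mul _ _
    _ ≤ m * (17 * s) := by gcongr; exact integral_nearWeight_le hs hs1
    _ = _ := by ring

end

/-- Weighted energy estimate for `u = a + ib`, `∂_τ u = ν u'' + iq cos θ u + r`. -/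
theorem deriv_nearWeight_energy_le {a b a₁ b₁ a₂ b₂ r₁ r₂ : ℝ → ℝ}
    (ha : ∀ x, HasDerivAt a (a₁ x) x) (hb : ∀ x, HasDerivAt b (b₁ x) x)
    (ha₁ : ∀ x, HasDerivAt a₁ (a₂ x) x) (hb₁ : ∀ x, HasDerivAt b₁ (b₂ x) x)
    (ha₂ : Continuous a₂) (hb₂ : Continuous b₂) (hr₁ : Continuous r₁) (hr₂ : Continuous r₂)
    (pa : Function.Periodic a (2 * π)) (pb : Function.Periodic b (2 * π))
    (pa₁ : Function.Periodic a₁ (2 * π)) (pb₁ : Function.Periodic b₁ (2 * π))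
    {ν q s : ℝ} (hν : 0 < ν) (hs : 0 < s) (hs1 : s ≤ 1) :
    (∫ x in (-π)..π, 2 * (nearWeight s x * (a x * (ν * a₂ x - q * Real.cos x * b x + r₁ x)
      + b x * (ν * b₂ x + q * Real.cos x * a x + r₂ x))))
      ≤ -ν * (∫ x in (-π)..π, nearWeight s x * (a₁ x ^ 2 + b₁ x ^ 2))
        + 2 * ν / s ^ 2 * (∫ x in (-π)..π, nearWeight s x * (a x ^ 2 + b x ^ 2))
        + 1 / ν * ∫ x in (-π)..π, (r₁ x ^ 2 + r₂ x ^ 2) := by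
  have cw := continuous_nearWeight hs
  have cw' := continuous_nearWeight' hs
  have ca : Continuous a := continuous_iff_continuousAt.2 fun x => (ha x).continuousAt
  have cb : Continuous b := continuous_iff_continuousAt.2 fun x => (hb x).continuousAt
  have ca₁ : Continuous a₁ := continuous_iff_continuousAt.2 fun x => (ha₁ x).continuousAt
  have cb₁ : Continuous b₁ := continuous_iff_continuousAt.2 fun x => (hb₁ x).continuousAt
  have hG : ∀ x, HasDerivAt (fun x => 2 * ν * (nearWeight s x * (a x * a₁ x + b x * b₁ x)))
      (2 * ν * (nearWeight' s x * (a x * a₁ x + b x * b₁ x)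
        + nearWeight s x * (a₁ x * a₁ x + a x * a₂ x + (b₁ x * b₁ x + b x * b₂ x)))) x := fun x =>
    ((hasDerivAt_nearWeight hs x).mul (((ha x).mul (ha₁ x)).add ((hb x).mul (hb₁ x)))).const_mul _
  have hz := integral_deriv_eq_zero hG (by fun_prop) fun x => by
    simp only [nearWeight_periodic x, pa x, pb x, pa₁ x, pb₁ x]
  have hs2 : 1 ≤ 1 / s ^ 2 := by
    rw [le_div_iff₀ (by positivity), one_mul]; exact pow_le_one₀ hs.le hs1
  have hpt : ∀ x, 2 * (nearWeight s x * (a x * (ν * a₂ x - q * Real.cos x * b x + r₁ x)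
      + b x * (ν * b₂ x + q * Real.cos x * a x + r₂ x)))
      - 2 * ν * (nearWeight' s x * (a x * a₁ x + b x * b₁ x)
        + nearWeight s x * (a₁ x * a₁ x + a x * a₂ x + (b₁ x * b₁ x + b x * b₂ x)))
      ≤ -ν * (nearWeight s x * (a₁ x ^ 2 + b₁ x ^ 2))
        + 2 * ν / s ^ 2 * (nearWeight s x * (a x ^ 2 + b x ^ 2))
        + 1 / ν * (r₁ x ^ 2 + r₂ x ^ 2) := by
    intro x
    have hw := nearWeight_pos hs x
    have hw1 := nearWeight_le_one hs x
    have hw' := abs_nearWeight'_le hs x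
    set w := nearWeight s x
    set w' := nearWeight' s x
    have key : ∀ α β ρ : ℝ, -(2 * ν * (w' * (α * β))) + 2 * (w * (α * ρ))
        ≤ ν * (w * β ^ 2) + 2 * ν / s ^ 2 * (w * α ^ 2) + 1 / ν * ρ ^ 2 := by
      intro α β ρ
      have h1 : -(w' * (α * β)) ≤ w / s * |α * β| := by
        calc -(w' * (α * β)) ≤ |w' * (α * β)| := neg_le_abs _
          _ = |w'| * |α * β| := abs_mul _ _
          _ ≤ _ := by gcongr
      have h2 : 2 * (w / s * |α * β|) ≤ w * β ^ 2 + w * (α ^ 2 / s ^ 2) := by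
        have h3 := mul_nonneg hw.le (sq_nonneg (|α| / s - |β|))
        have h4 : w * (|α| / s - |β|) ^ 2
            = w * |β| ^ 2 + w * (|α| ^ 2 / s ^ 2) - 2 * (w / s * (|α| * |β|)) := by
          field_simp; ring
        rw [abs_mul]
        rw [h4, sq_abs, sq_abs] at h3
        linarith
      have h5 : 2 * (w * (α * ρ)) ≤ ν * (w * α ^ 2) + 1 / ν * ρ ^ 2 := by
        have h6 : 0 ≤ w * (ν * α - ρ) ^ 2 / ν := by positivity
        have h7 : w * (ν * α - ρ) ^ 2 / ν
            = ν * (w * α ^ 2) + w * (1 / ν * ρ ^ 2) - 2 * (w * (α * ρ)) := by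
          field_simp; ring
        have h8 : w * (1 / ν * ρ ^ 2) ≤ 1 * (1 / ν * ρ ^ 2) := by gcongr
        linarith
      have h9 : ν * (w * α ^ 2) ≤ ν / s ^ 2 * (w * α ^ 2) := by
        have h10 := mul_le_mul_of_nonneg_right hs2 (by positivity : 0 ≤ ν * (w * α ^ 2))
        calc _ = 1 * (ν * (w * α ^ 2)) := by ring
          _ ≤ _ := h10
          _ = _ := by ring
      have h11 := mul_le_mul_of_nonneg_left h1 (by positivity : 0 ≤ 2 * ν)
      have h12 := mul_le_mul_of_nonneg_left h2 hν.le
      have h13 : ν * (w * (α ^ 2 / s ^ 2)) = ν / s ^ 2 * (w * α ^ 2) := by ring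
      have h14 : 2 * ν / s ^ 2 * (w * α ^ 2) = 2 * (ν / s ^ 2 * (w * α ^ 2)) := by ring
      linarith
    have k1 := key (a x) (a₁ x) (r₁ x)
    have k2 := key (b x) (b₁ x) (r₂ x)
    linarith
  have hI := integral_mono_of_continuous (by fun_prop) (by fun_prop) neg_pi_le_pi hpt
  rw [integral_sub_of_continuous (by fun_prop) (by fun_prop), hz,
    integral_add_of_continuous (by fun_prop) (by fun_prop),
    integral_add_of_continuous (by fun_prop) (by fun_prop), intervalIntegral.integral_const_mul (-ν),
    intervalIntegral.integral_const_mul (2 * ν / s ^ 2),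
    intervalIntegral.integral_const_mul (1 / ν), sub_zero] at hI
  exact hI

/-- Energy estimate for `w = u' + iτq sin θ u`, in real and imaginary parts `p` and `m`: the
operator `∂_θ + iτq sin θ` commutes with the transport `∂_τ - iq cos θ`. -/
theorem deriv_commuting_energy_le {a b a₁ b₁ a₂ b₂ a₃ b₃ r₁ r₂ r₁' r₂' : ℝ → ℝ}
    (ha : ∀ x, HasDerivAt a (a₁ x) x) (hb : ∀ x, HasDerivAt b (b₁ x) x)
    (ha₁ : ∀ x, HasDerivAt a₁ (a₂ x) x) (hb₁ : ∀ x, HasDerivAt b₁ (b₂ x) x)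
    (ha₂ : ∀ x, HasDerivAt a₂ (a₃ x) x) (hb₂ : ∀ x, HasDerivAt b₂ (b₃ x) x)
    (ha₃ : Continuous a₃) (hb₃ : Continuous b₃) (hr₁ : Continuous r₁) (hr₂ : Continuous r₂)
    (hr₁' : Continuous r₁') (hr₂' : Continuous r₂')
    (pa : Function.Periodic a (2 * π)) (pb : Function.Periodic b (2 * π))
    (pa₁ : Function.Periodic a₁ (2 * π)) (pb₁ : Function.Periodic b₁ (2 * π))
    (pa₂ : Function.Periodic a₂ (2 * π)) (pb₂ : Function.Periodic b₂ (2 * π))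
    {ν q τ : ℝ} (hν : 0 < ν) {p m : ℝ → ℝ} (hp : ∀ x, p x = a₁ x - τ * q * Real.sin x * b x)
    (hm : ∀ x, m x = b₁ x + τ * q * Real.sin x * a x) :
    (∫ x in (-π)..π, 2 * (p x * (ν * a₃ x - ν * τ * q * Real.sin x * b₂ x - q * Real.cos x * m x
        + (r₁' x - τ * q * Real.sin x * r₂ x))
      + m x * (ν * b₃ x + ν * τ * q * Real.sin x * a₂ x + q * Real.cos x * p x
        + (r₂' x + τ * q * Real.sin x * r₁ x))))
      ≤ 3 * ν * (τ * q) ^ 2 * (∫ x in (-π)..π, (a x ^ 2 + b x ^ 2))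
        + 2 * ν * (∫ x in (-π)..π, (p x ^ 2 + m x ^ 2))
        + 1 / ν * ∫ x in (-π)..π, ((r₁' x - τ * q * Real.sin x * r₂ x) ^ 2
          + (r₂' x + τ * q * Real.sin x * r₁ x) ^ 2) := by
  have ca : Continuous a := continuous_iff_continuousAt.2 fun x => (ha x).continuousAt
  have cb : Continuous b := continuous_iff_continuousAt.2 fun x => (hb x).continuousAt
  have ca₁ : Continuous a₁ := continuous_iff_continuousAt.2 fun x => (ha₁ x).continuousAt
  have cb₁ : Continuous b₁ := continuous_iff_continuousAt.2 fun x => (hb₁ x).continuousAt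
  have ca₂ : Continuous a₂ := continuous_iff_continuousAt.2 fun x => (ha₂ x).continuousAt
  have cb₂ : Continuous b₂ := continuous_iff_continuousAt.2 fun x => (hb₂ x).continuousAt
  obtain rfl : p = fun x => a₁ x - τ * q * Real.sin x * b x := funext hp
  obtain rfl : m = fun x => b₁ x + τ * q * Real.sin x * a x := funext hm
  set p : ℝ → ℝ := fun x => a₁ x - τ * q * Real.sin x * b x with hpdef
  set m : ℝ → ℝ := fun x => b₁ x + τ * q * Real.sin x * a x with hmdef
  set p₁ : ℝ → ℝ := fun x => a₂ x - (τ * q * Real.cos x * b x + τ * q * Real.sin x * b₁ x) with hp₁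
  set m₁ : ℝ → ℝ := fun x => b₂ x + (τ * q * Real.cos x * a x + τ * q * Real.sin x * a₁ x) with hm₁
  set p₂ : ℝ → ℝ := fun x => a₃ x - ((τ * q * -Real.sin x * b x + τ * q * Real.cos x * b₁ x)
    + (τ * q * Real.cos x * b₁ x + τ * q * Real.sin x * b₂ x)) with hp₂
  set m₂ : ℝ → ℝ := fun x => b₃ x + ((τ * q * -Real.sin x * a x + τ * q * Real.cos x * a₁ x)
    + (τ * q * Real.cos x * a₁ x + τ * q * Real.sin x * a₂ x)) with hm₂
  have dsin : ∀ x, HasDerivAt (fun x => τ * q * Real.sin x) (τ * q * Real.cos x) x := fun x =>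
    (Real.hasDerivAt_sin x).const_mul _
  have dcos : ∀ x, HasDerivAt (fun x => τ * q * Real.cos x) (τ * q * -Real.sin x) x := fun x =>
    (Real.hasDerivAt_cos x).const_mul _
  have dp : ∀ x, HasDerivAt p (p₁ x) x := fun x => (ha₁ x).sub ((dsin x).mul (hb x))
  have dm : ∀ x, HasDerivAt m (m₁ x) x := fun x => (hb₁ x).add ((dsin x).mul (ha x))
  have dp₁ : ∀ x, HasDerivAt p₁ (p₂ x) x := fun x =>
    (ha₂ x).sub (((dcos x).mul (hb x)).add ((dsin x).mul (hb₁ x)))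
  have dm₁ : ∀ x, HasDerivAt m₁ (m₂ x) x := fun x =>
    (hb₂ x).add (((dcos x).mul (ha x)).add ((dsin x).mul (ha₁ x)))
  have pp : ∀ x, p (x + 2 * π) = p x := fun x => by simp only [hpdef, pa₁ x, pb x, Real.sin_add_two_pi]
  have pm : ∀ x, m (x + 2 * π) = m x := fun x => by simp only [hmdef, pb₁ x, pa x, Real.sin_add_two_pi]
  have pp₁ : ∀ x, p₁ (x + 2 * π) = p₁ x := fun x => by
    simp only [hp₁, pa₂ x, pb₁ x, pb x, Real.sin_add_two_pi, Real.cos_add_two_pi]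
  have pm₁ : ∀ x, m₁ (x + 2 * π) = m₁ x := fun x => by
    simp only [hm₁, pb₂ x, pa₁ x, pa x, Real.sin_add_two_pi, Real.cos_add_two_pi]
  have cp : Continuous p := by fun_prop
  have cm : Continuous m := by fun_prop
  have cp₁ : Continuous p₁ := by fun_prop
  have cm₁ : Continuous m₁ := by fun_prop
  have cp₂ : Continuous p₂ := by fun_prop
  have cm₂ : Continuous m₂ := by fun_prop
  have hG : ∀ x, HasDerivAt (fun x => 2 * ν * (p x * p₁ x + m x * m₁ x)
      + 4 * ν * (p x * (τ * q * Real.cos x * b x) - m x * (τ * q * Real.cos x * a x)))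
      (2 * ν * (p₁ x * p₁ x + p x * p₂ x + (m₁ x * m₁ x + m x * m₂ x))
      + 4 * ν * (p₁ x * (τ * q * Real.cos x * b x)
        + p x * (τ * q * -Real.sin x * b x + τ * q * Real.cos x * b₁ x)
        - (m₁ x * (τ * q * Real.cos x * a x)
        + m x * (τ * q * -Real.sin x * a x + τ * q * Real.cos x * a₁ x)))) x := fun x =>
    ((((dp x).mul (dp₁ x)).add ((dm x).mul (dm₁ x))).const_mul _).add
      ((((dp x).mul ((dcos x).mul (hb x))).sub ((dm x).mul ((dcos x).mul (ha x)))).const_mul _)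
  have hz := integral_deriv_eq_zero hG (by fun_prop) fun x => by
    simp only [pp x, pm x, pp₁ x, pm₁ x, pa x, pb x, Real.cos_add_two_pi]
  have hpt : ∀ x, 2 * (p x * (ν * a₃ x - ν * τ * q * Real.sin x * b₂ x - q * Real.cos x * m x
        + (r₁' x - τ * q * Real.sin x * r₂ x))
      + m x * (ν * b₃ x + ν * τ * q * Real.sin x * a₂ x + q * Real.cos x * p x
        + (r₂' x + τ * q * Real.sin x * r₁ x)))
      - (2 * ν * (p₁ x * p₁ x + p x * p₂ x + (m₁ x * m₁ x + m x * m₂ x))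
      + 4 * ν * (p₁ x * (τ * q * Real.cos x * b x)
        + p x * (τ * q * -Real.sin x * b x + τ * q * Real.cos x * b₁ x)
        - (m₁ x * (τ * q * Real.cos x * a x)
        + m x * (τ * q * -Real.sin x * a x + τ * q * Real.cos x * a₁ x))))
      ≤ 3 * ν * (τ * q) ^ 2 * (a x ^ 2 + b x ^ 2) + 2 * ν * (p x ^ 2 + m x ^ 2)
        + 1 / ν * ((r₁' x - τ * q * Real.sin x * r₂ x) ^ 2
          + (r₂' x + τ * q * Real.sin x * r₁ x) ^ 2) := by
    intro x
    set ρ₁ := r₁' x - τ * q * Real.sin x * r₂ x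
    set ρ₂ := r₂' x + τ * q * Real.sin x * r₁ x
    have e₁ : ν * a₃ x - ν * τ * q * Real.sin x * b₂ x
        = ν * p₂ x + ν * τ * q * (2 * Real.cos x * b₁ x - Real.sin x * b x) := by
      simp only [hp₂]; ring
    have e₂ : ν * b₃ x + ν * τ * q * Real.sin x * a₂ x
        = ν * m₂ x - ν * τ * q * (2 * Real.cos x * a₁ x - Real.sin x * a x) := by
      simp only [hm₂]; ring
    rw [e₁, e₂]
    have key : ∀ g ρ : ℝ, 2 * (g * ρ) ≤ ν * g ^ 2 + 1 / ν * ρ ^ 2 := by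
      intro g ρ
      have h1 : 0 ≤ (ν * g - ρ) ^ 2 / ν := by positivity
      have h2 : (ν * g - ρ) ^ 2 / ν = ν * g ^ 2 + 1 / ν * ρ ^ 2 - 2 * (g * ρ) := by
        field_simp; ring
      linarith
    have k1 := key (p x) ρ₁
    have k2 := key (m x) ρ₂
    have k3 : ∀ g y : ℝ, g * (2 * y) ≤ g ^ 2 + y ^ 2 := fun g y => by nlinarith [sq_nonneg (g - y)]
    have k4 := mul_le_mul_of_nonneg_left (k3 (p₁ x) (-(τ * q * Real.cos x * b x))) hν.le
    have k5 := mul_le_mul_of_nonneg_left (k3 (m₁ x) (τ * q * Real.cos x * a x)) hν.le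
    have k6 := mul_le_mul_of_nonneg_left (k3 (p x) (τ * q * Real.sin x * b x)) hν.le
    have k7 := mul_le_mul_of_nonneg_left (k3 (m x) (-(τ * q * Real.sin x * a x))) hν.le
    have hc : Real.cos x ^ 2 ≤ 1 := by nlinarith [Real.sin_sq_add_cos_sq x, sq_nonneg (Real.sin x)]
    have hsq : Real.sin x ^ 2 = 1 - Real.cos x ^ 2 := by linarith [Real.sin_sq_add_cos_sq x]
    have k8 : 0 ≤ ν * ((τ * q) ^ 2 * (a x ^ 2 + b x ^ 2)) := by positivity
    have k9 := mul_le_mul_of_nonneg_left hc k8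
    have h10 : ν * (τ * q * Real.sin x * b x) ^ 2 + ν * (-(τ * q * Real.sin x * a x)) ^ 2
        = ν * ((τ * q) ^ 2 * (a x ^ 2 + b x ^ 2)) * (1 - Real.cos x ^ 2) := by
      rw [← hsq]; ring
    have h11 : ν * (-(τ * q * Real.cos x * b x)) ^ 2 + ν * (τ * q * Real.cos x * a x) ^ 2
        = ν * ((τ * q) ^ 2 * (a x ^ 2 + b x ^ 2)) * Real.cos x ^ 2 := by ring
    linarith
  have hI := integral_mono_of_continuous (by fun_prop) (by fun_prop) neg_pi_le_pi hpt
  rw [integral_sub_of_continuous (by fun_prop) (by fun_prop), hz,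
    integral_add_of_continuous (by fun_prop) (by fun_prop),
    integral_add_of_continuous (by fun_prop) (by fun_prop), intervalIntegral.integral_const_mul
      (3 * ν * (τ * q) ^ 2), intervalIntegral.integral_const_mul (2 * ν),
    intervalIntegral.integral_const_mul (1 / ν), sub_zero] at hI
  exact hI

/-! ### Mixing for the linear transport-diffusion equation -/

theorem le_exp_mul_of_deriv_le {y y' : ℝ → ℝ} {T c b : ℝ} (hT : 0 ≤ T) (hc : 0 ≤ c) (hb : 0 ≤ b)
    (hy : ContinuousOn y (Icc 0 T)) (hd : ∀ t ∈ Ioo 0 T, HasDerivAt y (y' t) t)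
    (h : ∀ t ∈ Ioo 0 T, y' t ≤ c * y t + b) : y T ≤ Real.exp (c * T) * (y 0 + b * T) := by
  have h1 := exp_mul_le_of_deriv_le (α := -c) (b := fun _ => b) hT hy hd continuous_const
    fun t ht => by simpa using h t ht
  have h2 : ∫ τ in (0 : ℝ)..T, Real.exp (-c * τ) * b ≤ ∫ τ in (0 : ℝ)..T, b := by
    refine intervalIntegral.integral_mono_on hT (Continuous.intervalIntegrable (by fun_prop) _ _)
      (Continuous.intervalIntegrable (by fun_prop) _ _) fun τ hτ => ?_
    refine mul_le_of_le_one_left hb (Real.exp_le_one_iff.2 ?_)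
    have := mul_nonneg hc hτ.1
    linarith
  rw [intervalIntegral.integral_const, smul_eq_mul, sub_zero] at h2
  have h3 : y T = Real.exp (c * T) * (Real.exp (-c * T) * y T) := by
    rw [← mul_assoc, ← Real.exp_add]; simp
  rw [h3]
  gcongr
  linarith

theorem sq_le_of_forall_le {I P Q : ℝ} (hP : 0 ≤ P) (hQ : 0 ≤ Q)
    (h : ∀ l : ℝ, 0 < l → |I| ≤ l * P + Q / l) : I ^ 2 ≤ 4 * (P * Q) := by
  rw [← sq_abs]
  by_contra! hlt
  have hI : 0 < |I| := by
    rcases (abs_nonneg I).eq_or_lt with h0 | h0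
    · rw [← h0] at hlt; nlinarith [mul_nonneg hP hQ]
    · exact h0
  rcases hP.eq_or_lt with h0 | h0
  · -- `P = 0`: a large multiplier contradicts `I ≠ 0`
    have h1 := h ((2 * Q + 1) / |I|) (by positivity)
    rw [← h0, mul_zero, zero_add, div_div_eq_mul_div, le_div_iff₀ (by positivity)] at h1
    nlinarith
  · have h1 := h (|I| / (2 * P)) (by positivity)
    have h2 : |I| / (2 * P) * P + Q / (|I| / (2 * P)) = |I| / 2 + 2 * (P * Q) / |I| := by
      field_simp
    rw [h2] at h1
    have h3 : |I| / 2 ≤ 2 * (P * Q) / |I| := by linarith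
    rw [le_div_iff₀ hI] at h3
    nlinarith

/-- The pairing of `u = a + ib` with a test function gains from both the smallness of `u` near the
critical points and the bound on `w = u' + iTq sin θ u`, since `sin θ u = (w - u') / (iTq)`. -/
theorem sq_integral_pairing_le {a b a₁ b₁ p m g₁ g₂ g₁' g₂' : ℝ → ℝ}
    (ha : ∀ x, HasDerivAt a (a₁ x) x) (hb : ∀ x, HasDerivAt b (b₁ x) x)
    (ca₁ : Continuous a₁) (cb₁ : Continuous b₁)
    (hg₁ : ∀ x, HasDerivAt g₁ (g₁' x) x) (hg₂ : ∀ x, HasDerivAt g₂ (g₂' x) x)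
    (cg₁' : Continuous g₁') (cg₂' : Continuous g₂')
    (pa : Function.Periodic a (2 * π)) (pb : Function.Periodic b (2 * π))
    (pg₁ : Function.Periodic g₁ (2 * π)) (pg₂ : Function.Periodic g₂ (2 * π))
    {q s T : ℝ} (hq : 1 ≤ q) (hs : 0 < s) (hsT : s ^ 2 * T = 1)
    (hp : ∀ x, p x = a₁ x - T * q * Real.sin x * b x)
    (hm : ∀ x, m x = b₁ x + T * q * Real.sin x * a x) :
    (∫ x in (-π)..π, (a x * g₁ x + b x * g₂ x)) ^ 2
      ≤ 4 * ((3 * (∫ x in (-π)..π, nearWeight s x * (a x ^ 2 + b x ^ 2))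
          + s ^ 2 / q ^ 2 * ∫ x in (-π)..π, (p x ^ 2 + m x ^ 2))
        * (3 * (∫ x in (-π)..π, nearWeight s x * (g₁ x ^ 2 + g₂ x ^ 2))
          + s ^ 2 * ∫ x in (-π)..π, (g₁' x ^ 2 + g₂' x ^ 2))) := by
  have cw := continuous_nearWeight hs
  have cw' := continuous_nearWeight' hs
  have ca : Continuous a := continuous_iff_continuousAt.2 fun x => (ha x).continuousAt
  have cb : Continuous b := continuous_iff_continuousAt.2 fun x => (hb x).continuousAt
  have cg₁ : Continuous g₁ := continuous_iff_continuousAt.2 fun x => (hg₁ x).continuousAt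
  have cg₂ : Continuous g₂ := continuous_iff_continuousAt.2 fun x => (hg₂ x).continuousAt
  have cp : Continuous p := by rw [funext hp]; fun_prop
  have cm : Continuous m := by rw [funext hm]; fun_prop
  have hq0 : 0 < q := by linarith
  have hn : ∀ {f₁ f₂ : ℝ → ℝ}, 0 ≤ ∫ x in (-π)..π, (f₁ x ^ 2 + f₂ x ^ 2) := fun {f₁ f₂} =>
    integral_nonneg_of_forall neg_pi_le_pi fun x => by positivity
  have hnw : ∀ {f₁ f₂ : ℝ → ℝ}, 0 ≤ ∫ x in (-π)..π, nearWeight s x * (f₁ x ^ 2 + f₂ x ^ 2) :=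
    fun {f₁ f₂} => integral_nonneg_of_forall neg_pi_le_pi fun x =>
      mul_nonneg (nearWeight_pos hs x).le (by positivity)
  refine sq_le_of_forall_le (add_nonneg (mul_nonneg (by norm_num) hnw)
    (mul_nonneg (by positivity) hn)) (add_nonneg (mul_nonneg (by norm_num) hnw)
    (mul_nonneg (by positivity) hn)) fun l hl => ?_
  set D : ℝ → ℝ := fun x => nearWeight' s x * Real.sin x + nearWeight s x * Real.cos x with hD
  have cD : Continuous D := by fun_prop
  have dW : ∀ x, HasDerivAt (fun x => nearWeight s x * Real.sin x) (D x) x := fun x =>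
    (hasDerivAt_nearWeight hs x).mul (Real.hasDerivAt_sin x)
  have hG : ∀ x, HasDerivAt (fun x => 1 / q * (nearWeight s x * Real.sin x * (a x * g₂ x - b x * g₁ x)))
      (1 / q * (D x * (a x * g₂ x - b x * g₁ x) + nearWeight s x * Real.sin x
        * (a₁ x * g₂ x + a x * g₂' x - (b₁ x * g₁ x + b x * g₁' x)))) x := fun x =>
    ((dW x).mul (((ha x).mul (hg₂ x)).sub ((hb x).mul (hg₁ x)))).const_mul _
  have hz := integral_deriv_eq_zero hG (by fun_prop) fun x => by
    simp only [nearWeight_periodic x, pa x, pb x, pg₁ x, pg₂ x, Real.sin_add_two_pi]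
  have hI : ∫ x in (-π)..π, (a x * g₁ x + b x * g₂ x) = ∫ x in (-π)..π,
      (nearWeight s x * (a x * g₁ x + b x * g₂ x)
        + (nearWeight s x * Real.sin x * (m x / q * g₁ x - p x / q * g₂ x)
        + 1 / q * (D x * (b x * g₁ x - a x * g₂ x)
          + nearWeight s x * Real.sin x * (b x * g₁' x - a x * g₂' x)))) := by
    rw [← sub_zero (∫ x in (-π)..π, (a x * g₁ x + b x * g₂ x)), ← hz,
      ← integral_sub_of_continuous (by fun_prop) (by fun_prop)]
    congr 1
    ext x
    have h1 := nearWeight_add hs x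
    have h2 : nearWeight s x * Real.sin x ^ 2 / s ^ 2 = T * nearWeight s x * Real.sin x ^ 2 := by
      rw [div_eq_iff (by positivity)]
      linear_combination -(nearWeight s x * Real.sin x ^ 2) * hsT
    rw [h2] at h1
    rw [hp, hm]
    field_simp
    linear_combination -q * (a x * g₁ x + b x * g₂ x) * h1
  rw [hI]
  have hpt : ∀ x, |nearWeight s x * (a x * g₁ x + b x * g₂ x)
        + (nearWeight s x * Real.sin x * (m x / q * g₁ x - p x / q * g₂ x)
        + 1 / q * (D x * (b x * g₁ x - a x * g₂ x)
          + nearWeight s x * Real.sin x * (b x * g₁' x - a x * g₂' x)))|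
      ≤ l * (3 * (nearWeight s x * (a x ^ 2 + b x ^ 2)) + s ^ 2 / q ^ 2 * (p x ^ 2 + m x ^ 2))
        + 1 / l * (3 * (nearWeight s x * (g₁ x ^ 2 + g₂ x ^ 2))
          + s ^ 2 * (g₁' x ^ 2 + g₂' x ^ 2)) := by
    intro x
    have hw := nearWeight_pos hs x
    have hws := nearWeight_mul_sin_sq_le hs x
    have hw1 := nearWeight_le_one hs x
    have hDx : |D x| ≤ 3 * nearWeight s x := abs_deriv_nearWeight_mul_sin_le hs x
    set w := nearWeight s x
    have young : ∀ y z : ℝ, |y * z| ≤ l / 2 * y ^ 2 + 1 / l * (z ^ 2 / 2) := by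
      intro y z
      have h1 : 0 ≤ (l * |y| - |z|) ^ 2 / (2 * l) := by positivity
      have h2 : (l * |y| - |z|) ^ 2 / (2 * l) = l / 2 * |y| ^ 2 + 1 / l * (|z| ^ 2 / 2)
          - |y| * |z| := by field_simp; ring
      rw [abs_mul]
      rw [h2, sq_abs, sq_abs] at h1
      linarith
    have t1 : ∀ y z : ℝ, |w * (y * z)| ≤ l / 2 * (w * y ^ 2) + 1 / l * (w * z ^ 2 / 2) := by
      intro y z
      rw [abs_mul, abs_of_pos hw]
      calc _ ≤ w * (l / 2 * y ^ 2 + 1 / l * (z ^ 2 / 2)) := by gcongr; exact young y z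
        _ = _ := by ring
    have t2 : ∀ y z : ℝ, |w * Real.sin x * (y / q * z)|
        ≤ l / 2 * (s ^ 2 / q ^ 2 * y ^ 2) + 1 / l * (w * z ^ 2 / 2) := by
      intro y z
      have h1 := young (s * (y / q)) (w * Real.sin x / s * z)
      have h2 : s * (y / q) * (w * Real.sin x / s * z) = w * Real.sin x * (y / q * z) := by
        field_simp
      have h3 : (w * Real.sin x / s * z) ^ 2 ≤ w * z ^ 2 := by
        calc _ = w * (w * Real.sin x ^ 2) / s ^ 2 * z ^ 2 := by ring
          _ ≤ w * s ^ 2 / s ^ 2 * z ^ 2 := by gcongr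
          _ = _ := by field_simp
      rw [h2] at h1
      refine h1.trans ?_
      calc _ ≤ l / 2 * (s * (y / q)) ^ 2 + 1 / l * (w * z ^ 2 / 2) := by gcongr
        _ = _ := by ring
    have hq1 : |1 / q| ≤ 1 := by rw [abs_of_pos (by positivity), div_le_one hq0]; exact hq
    have t3 : ∀ y z : ℝ, |1 / q * (D x * (y * z))|
        ≤ l / 2 * (3 * (w * y ^ 2)) + 1 / l * (3 * (w * z ^ 2) / 2) := by
      intro y z
      rw [abs_mul, abs_mul]
      calc _ ≤ 1 * (3 * w * (l / 2 * y ^ 2 + 1 / l * (z ^ 2 / 2))) := by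
            gcongr; exact young y z
        _ = _ := by ring
    have t4 : ∀ y z : ℝ, |1 / q * (w * Real.sin x * (y * z))|
        ≤ l / 2 * (w * y ^ 2) + 1 / l * (s ^ 2 * z ^ 2 / 2) := by
      intro y z
      rw [abs_mul]
      have h1 : |w * Real.sin x * (y * z)| ≤ l / 2 * (w * y ^ 2) + 1 / l * (s ^ 2 * z ^ 2 / 2) := by
        rw [mul_assoc, abs_mul, abs_of_pos hw, show Real.sin x * (y * z) = y * (Real.sin x * z) by ring]
        calc _ ≤ w * (l / 2 * y ^ 2 + 1 / l * ((Real.sin x * z) ^ 2 / 2)) := by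
              gcongr; exact young _ _
          _ = l / 2 * (w * y ^ 2) + 1 / l * (w * Real.sin x ^ 2 * z ^ 2 / 2) := by ring
          _ ≤ _ := by gcongr
      calc _ ≤ 1 * |w * Real.sin x * (y * z)| := by gcongr
        _ = |w * Real.sin x * (y * z)| := one_mul _
        _ ≤ _ := h1
    have e : w * (a x * g₁ x + b x * g₂ x)
        + (w * Real.sin x * (m x / q * g₁ x - p x / q * g₂ x)
        + 1 / q * (D x * (b x * g₁ x - a x * g₂ x)
          + w * Real.sin x * (b x * g₁' x - a x * g₂' x)))
        = w * (a x * g₁ x) + w * (b x * g₂ x) + w * Real.sin x * (m x / q * g₁ x)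
          - w * Real.sin x * (p x / q * g₂ x) + 1 / q * (D x * (b x * g₁ x))
          - 1 / q * (D x * (a x * g₂ x)) + 1 / q * (w * Real.sin x * (b x * g₁' x))
          - 1 / q * (w * Real.sin x * (a x * g₂' x)) := by ring
    rw [e]
    have a1 := abs_le.1 (t1 (a x) (g₁ x))
    have a2 := abs_le.1 (t1 (b x) (g₂ x))
    have a3 := abs_le.1 (t2 (m x) (g₁ x))
    have a4 := abs_le.1 (t2 (p x) (g₂ x))
    have a5 := abs_le.1 (t3 (b x) (g₁ x))
    have a6 := abs_le.1 (t3 (a x) (g₂ x))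
    have a7 := abs_le.1 (t4 (b x) (g₁' x))
    have a8 := abs_le.1 (t4 (a x) (g₂' x))
    have n1 : 0 ≤ l * (w * (a x ^ 2 + b x ^ 2)) := by positivity
    have n2 : 0 ≤ 1 / l * (w * (g₁ x ^ 2 + g₂ x ^ 2)) := by positivity
    have n3 : 0 ≤ l * (s ^ 2 / q ^ 2 * (p x ^ 2 + m x ^ 2)) := by positivity
    have n4 : 0 ≤ 1 / l * (s ^ 2 * (g₁' x ^ 2 + g₂' x ^ 2)) := by positivity
    rw [abs_le]
    constructor
    · linarith [a1.1, a2.1, a3.1, a4.2, a5.1, a6.2, a7.1, a8.2]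
    · linarith [a1.2, a2.2, a3.2, a4.1, a5.2, a6.1, a7.2, a8.1]
  refine (intervalIntegral.abs_integral_le_integral_abs neg_pi_le_pi).trans
    ((integral_mono_of_continuous (by fun_prop) (by fun_prop) neg_pi_le_pi hpt).trans (le_of_eq ?_))
  rw [integral_add_of_continuous (by fun_prop) (by fun_prop), intervalIntegral.integral_const_mul l,
    intervalIntegral.integral_const_mul (1 / l),
    integral_add_of_continuous (by fun_prop) (by fun_prop),
    integral_add_of_continuous (by fun_prop) (by fun_prop), intervalIntegral.integral_const_mul 3,
    intervalIntegral.integral_const_mul 3, intervalIntegral.integral_const_mul (s ^ 2 / q ^ 2),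
    intervalIntegral.integral_const_mul (s ^ 2)]
  ring

/-- A solution `u = a + ib` of `∂_τ u = ν u'' + iq cos θ u + r` with residual `r = r₁ + ir₂`. The
functions of `(τ, θ)` carrying an index are the derivatives in `θ` of `a` and `b`, and `r₁'`, `r₂'`
those of `r₁`, `r₂`. -/
structure LinearFlow (ν q : ℝ) (a b a₁ b₁ a₂ b₂ a₃ b₃ r₁ r₂ r₁' r₂' : ℝ → ℝ → ℝ) : Prop where
  ca : Continuous fun z : ℝ × ℝ => a z.1 z.2
  cb : Continuous fun z : ℝ × ℝ => b z.1 z.2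
  ca₁ : Continuous fun z : ℝ × ℝ => a₁ z.1 z.2
  cb₁ : Continuous fun z : ℝ × ℝ => b₁ z.1 z.2
  ca₂ : Continuous fun z : ℝ × ℝ => a₂ z.1 z.2
  cb₂ : Continuous fun z : ℝ × ℝ => b₂ z.1 z.2
  ca₃ : Continuous fun z : ℝ × ℝ => a₃ z.1 z.2
  cb₃ : Continuous fun z : ℝ × ℝ => b₃ z.1 z.2
  cr₁ : Continuous fun z : ℝ × ℝ => r₁ z.1 z.2
  cr₂ : Continuous fun z : ℝ × ℝ => r₂ z.1 z.2
  cr₁' : Continuous fun z : ℝ × ℝ => r₁' z.1 z.2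
  cr₂' : Continuous fun z : ℝ × ℝ => r₂' z.1 z.2
  ha : ∀ τ x, HasDerivAt (a τ) (a₁ τ x) x
  hb : ∀ τ x, HasDerivAt (b τ) (b₁ τ x) x
  ha₁ : ∀ τ x, HasDerivAt (a₁ τ) (a₂ τ x) x
  hb₁ : ∀ τ x, HasDerivAt (b₁ τ) (b₂ τ x) x
  ha₂ : ∀ τ x, HasDerivAt (a₂ τ) (a₃ τ x) x
  hb₂ : ∀ τ x, HasDerivAt (b₂ τ) (b₃ τ x) x
  pa : ∀ τ, Function.Periodic (a τ) (2 * π)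
  pb : ∀ τ, Function.Periodic (b τ) (2 * π)
  pa₁ : ∀ τ, Function.Periodic (a₁ τ) (2 * π)
  pb₁ : ∀ τ, Function.Periodic (b₁ τ) (2 * π)
  pa₂ : ∀ τ, Function.Periodic (a₂ τ) (2 * π)
  pb₂ : ∀ τ, Function.Periodic (b₂ τ) (2 * π)
  ta : ∀ τ x, HasDerivAt (fun τ => a τ x) (ν * a₂ τ x - q * Real.cos x * b τ x + r₁ τ x) τ
  tb : ∀ τ x, HasDerivAt (fun τ => b τ x) (ν * b₂ τ x + q * Real.cos x * a τ x + r₂ τ x) τ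
  ta₁ : ∀ τ x, HasDerivAt (fun τ => a₁ τ x)
    (ν * a₃ τ x - (q * -Real.sin x * b τ x + q * Real.cos x * b₁ τ x) + r₁' τ x) τ
  tb₁ : ∀ τ x, HasDerivAt (fun τ => b₁ τ x)
    (ν * b₃ τ x + (q * -Real.sin x * a τ x + q * Real.cos x * a₁ τ x) + r₂' τ x) τ

theorem sq_add_sq_le_of_hasDerivAt {a b a₁ b₁ : ℝ → ℝ} (ha : ∀ x, HasDerivAt a (a₁ x) x)
    (hb : ∀ x, HasDerivAt b (b₁ x) x) (ca₁ : Continuous a₁) (cb₁ : Continuous b₁)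
    (pa : Function.Periodic a (2 * π)) (pb : Function.Periodic b (2 * π)) (x : ℝ) :
    a x ^ 2 + b x ^ 2 ≤ 2 * ((∫ x in (-π)..π, (a x ^ 2 + b x ^ 2))
      + ∫ x in (-π)..π, (a₁ x ^ 2 + b₁ x ^ 2)) := by
  have key : ∀ {g g₁ : ℝ → ℝ}, (∀ x, HasDerivAt g (g₁ x) x) → Continuous g₁ →
      Function.Periodic g (2 * π) → ∀ x,
      g x ^ 2 ≤ 2 * ((∫ x in (-π)..π, g x ^ 2) + ∫ x in (-π)..π, g₁ x ^ 2) := by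
    intro g g₁ hg cg₁ pg x
    obtain ⟨y, hy, e⟩ := pg.exists_mem_Ico (by positivity) x (-π)
    rw [e]
    have h1 := two_pi_mul_sq_le hg cg₁ (x := y) ⟨hy.1, by linarith [hy.2]⟩
    set A := ∫ x in (-π)..π, g x ^ 2 with hA
    set B := ∫ x in (-π)..π, g₁ x ^ 2 with hB
    have hA0 : 0 ≤ A := integral_nonneg_of_forall neg_pi_le_pi fun _ => sq_nonneg _
    have hB0 : 0 ≤ B := integral_nonneg_of_forall neg_pi_le_pi fun _ => sq_nonneg _
    have h2 : 2 * (√A * √B) ≤ A + B := by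
      nlinarith [sq_nonneg (√A - √B), Real.sq_sqrt hA0, Real.sq_sqrt hB0]
    have hpi := Real.pi_gt_three
    have h3 := mul_le_mul_of_nonneg_left h2 (by positivity : 0 ≤ 2 * π)
    have h4 : 1 * (A + B) ≤ 2 * π * (A + B) := by gcongr; linarith
    have h5 : 2 * π * g y ^ 2 ≤ 2 * π * (2 * (A + B)) := by linarith
    exact le_of_mul_le_mul_left h5 (by positivity)
  have ca : Continuous a := continuous_iff_continuousAt.2 fun x => (ha x).continuousAt
  have cb : Continuous b := continuous_iff_continuousAt.2 fun x => (hb x).continuousAt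
  rw [integral_add_of_continuous (by fun_prop) (by fun_prop),
    integral_add_of_continuous (by fun_prop) (by fun_prop)]
  linarith [key ha ca₁ pa x, key hb cb₁ pb x]

/-- The weighted norm of `u` and the norm of `u' + iTq sin θ u` at time `T`. -/
theorem LinearFlow.weighted_bounds {ν q : ℝ} {a b a₁ b₁ a₂ b₂ a₃ b₃ r₁ r₂ r₁' r₂' : ℝ → ℝ → ℝ}
    (F : LinearFlow ν q a b a₁ b₁ a₂ b₂ a₃ b₃ r₁ r₂ r₁' r₂') (hν : 0 < ν)
    {T Δ ε s : ℝ} (hT : 1 ≤ T) (hΔ : ν * T ^ 2 ≤ Δ) (hε : 0 ≤ ε)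
    (hr : ∀ τ ∈ Icc 0 T, ∫ x in (-π)..π, (r₁ τ x ^ 2 + r₂ τ x ^ 2) ≤ ε)
    (hr' : ∀ τ ∈ Icc 0 T, ∫ x in (-π)..π, ((r₁' τ x - τ * q * Real.sin x * r₂ τ x) ^ 2
      + (r₂' τ x + τ * q * Real.sin x * r₁ τ x) ^ 2) ≤ ε)
    (hs : 0 < s) (hs1 : s ≤ 1) (hs2 : s ^ 2 = 1 / T) {H₀ B : ℝ}
    (hH₀ : H₀ = (∫ x in (-π)..π, (a 0 x ^ 2 + b 0 x ^ 2))
      + ∫ x in (-π)..π, (a₁ 0 x ^ 2 + b₁ 0 x ^ 2))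
    (hB : B = Real.exp (2 * Δ) * (34 * s * H₀ + T * ε / ν)) :
    (∫ x in (-π)..π, nearWeight s x * (a T x ^ 2 + b T x ^ 2)) ≤ B ∧
    (∫ x in (-π)..π, ((a₁ T x - T * q * Real.sin x * b T x) ^ 2
      + (b₁ T x + T * q * Real.sin x * a T x) ^ 2))
      ≤ Real.exp (8 * Δ) * (H₀ + 6 * T * (34 * s * H₀)
        + (3 * ν * (T * q) ^ 2 * B + 7 * T * (ε / ν)) * T) := by
  have hT0 : 0 < T := by linarith
  have hΔ0 : 0 ≤ Δ := le_trans (by positivity) hΔ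
  have hνs : 2 * ν / s ^ 2 = 2 * ν * T := by rw [hs2]; field_simp
  have cw := continuous_nearWeight hs
  have cwp : Continuous fun z : ℝ × ℝ => nearWeight s z.2 := cw.comp continuous_snd
  have ca := F.ca
  have cb := F.cb
  have ca₁ := F.ca₁
  have cb₁ := F.cb₁
  have ca₂ := F.ca₂
  have cb₂ := F.cb₂
  have ca₃ := F.ca₃
  have cb₃ := F.cb₃
  have cr₁ := F.cr₁
  have cr₂ := F.cr₂
  have cr₁' := F.cr₁'
  have cr₂' := F.cr₂'
  have sl : ∀ {g : ℝ → ℝ → ℝ}, Continuous (fun z : ℝ × ℝ => g z.1 z.2) → ∀ τ, Continuous (g τ) :=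
    fun hg τ => hg.comp (by fun_prop : Continuous fun x : ℝ => (τ, x))
  set p : ℝ → ℝ → ℝ := fun τ x => a₁ τ x - τ * q * Real.sin x * b τ x with hp
  set m : ℝ → ℝ → ℝ := fun τ x => b₁ τ x + τ * q * Real.sin x * a τ x with hm
  have cp : Continuous fun z : ℝ × ℝ => p z.1 z.2 := by fun_prop
  have cm : Continuous fun z : ℝ × ℝ => m z.1 z.2 := by fun_prop
  set X : ℝ → ℝ := fun τ => ∫ x in (-π)..π, nearWeight s x * (a τ x ^ 2 + b τ x ^ 2) with hX
  set W : ℝ → ℝ := fun τ => ∫ x in (-π)..π, (p τ x ^ 2 + m τ x ^ 2) with hW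
  set Y : ℝ → ℝ := fun τ => ∫ x in (-π)..π, nearWeight s x * (a₁ τ x ^ 2 + b₁ τ x ^ 2) with hY
  have hX0 : ∀ τ, 0 ≤ X τ := fun τ => integral_nonneg_of_forall neg_pi_le_pi fun x =>
    mul_nonneg (nearWeight_pos hs x).le (by positivity)
  have hW0 : ∀ τ, 0 ≤ W τ := fun τ => integral_nonneg_of_forall neg_pi_le_pi fun x => by positivity
  have hn0 : 0 ≤ ∫ x in (-π)..π, (a 0 x ^ 2 + b 0 x ^ 2) :=
    integral_nonneg_of_forall neg_pi_le_pi fun x => by positivity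
  have hn1 : 0 ≤ ∫ x in (-π)..π, (a₁ 0 x ^ 2 + b₁ 0 x ^ 2) :=
    integral_nonneg_of_forall neg_pi_le_pi fun x => by positivity
  -- the evolution of the weighted norm
  have hXd : ∀ τ, HasDerivAt X (∫ x in (-π)..π, 2 * (nearWeight s x *
      (a τ x * (ν * a₂ τ x - q * Real.cos x * b τ x + r₁ τ x)
      + b τ x * (ν * b₂ τ x + q * Real.cos x * a τ x + r₂ τ x)))) τ := by
    intro τ
    refine hasDerivAt_integral_param isOpen_univ
      (F := fun τ x => nearWeight s x * (a τ x ^ 2 + b τ x ^ 2))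
      (F' := fun τ x => 2 * (nearWeight s x *
      (a τ x * (ν * a₂ τ x - q * Real.cos x * b τ x + r₁ τ x)
      + b τ x * (ν * b₂ τ x + q * Real.cos x * a τ x + r₂ τ x))))
      (Continuous.continuousOn (by fun_prop)) (Continuous.continuousOn (by fun_prop))
      (fun τ _ x => ?_) _ _ (mem_univ τ)
    refine ((((F.ta τ x).pow 2).add ((F.tb τ x).pow 2)).const_mul (nearWeight s x)).congr_deriv ?_
    simp only [Nat.cast_ofNat, Nat.add_one_sub_one, pow_one]
    ring
  have hXle : ∀ τ ∈ Icc 0 T, (∫ x in (-π)..π, 2 * (nearWeight s x *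
      (a τ x * (ν * a₂ τ x - q * Real.cos x * b τ x + r₁ τ x)
      + b τ x * (ν * b₂ τ x + q * Real.cos x * a τ x + r₂ τ x))))
      ≤ -ν * Y τ + 2 * ν * T * X τ + ε / ν := by
    intro τ hτ
    have h1 := deriv_nearWeight_energy_le (F.ha τ) (F.hb τ) (F.ha₁ τ) (F.hb₁ τ) (sl ca₂ τ)
      (sl cb₂ τ) (sl cr₁ τ) (sl cr₂ τ) (F.pa τ) (F.pb τ) (F.pa₁ τ) (F.pb₁ τ) (q := q) hν hs hs1
    rw [hνs] at h1
    have h2 := mul_le_mul_of_nonneg_left (hr τ hτ) (by positivity : 0 ≤ 1 / ν)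
    have h3 : 1 / ν * ε = ε / ν := by ring
    linarith
  have hY0 : ∀ τ, 0 ≤ Y τ := fun τ => integral_nonneg_of_forall neg_pi_le_pi fun x =>
    mul_nonneg (nearWeight_pos hs x).le (by positivity)
  have hXi : X 0 ≤ 34 * s * H₀ := by
    have h1 := integral_nearWeight_mul_sq_le hs hs1 (sl ca 0) (sl cb 0)
      (sq_add_sq_le_of_hasDerivAt (F.ha 0) (F.hb 0) (sl ca₁ 0) (sl cb₁ 0) (F.pa 0) (F.pb 0))
    rw [← hH₀] at h1
    linarith
  have hH0 : 0 ≤ H₀ := hH₀ ▸ add_nonneg hn0 hn1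
  have hXb : ∀ τ ∈ Icc 0 T, X τ ≤ B := by
    intro τ hτ
    have h1 := le_exp_mul_of_deriv_le (y := X) (c := 2 * ν * T) (b := ε / ν) hτ.1 (by positivity)
      (by positivity) (fun t _ => (hXd t).continuousAt.continuousWithinAt)
      (fun t _ => hXd t) fun t ht => by
        have h2 := hXle t ⟨ht.1.le, ht.2.le.trans hτ.2⟩
        have h3 := mul_nonneg hν.le (hY0 t)
        linarith
    refine h1.trans ?_
    rw [hB]
    have h4 : 2 * ν * T * τ ≤ 2 * Δ := by
      calc 2 * ν * T * τ ≤ 2 * ν * T * T := by gcongr; exact hτ.2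
        _ = 2 * (ν * T ^ 2) := by ring
        _ ≤ _ := by gcongr
    have h5 : ε / ν * τ ≤ T * ε / ν := by
      calc ε / ν * τ ≤ ε / ν * T := by gcongr; exact hτ.2
        _ = _ := by ring
    have h6 := hX0 0
    have h7 := hτ.1
    gcongr
  -- the evolution of the commuting derivative
  have hWd : ∀ τ, HasDerivAt W (∫ x in (-π)..π,
      2 * (p τ x * (ν * a₃ τ x - ν * τ * q * Real.sin x * b₂ τ x - q * Real.cos x * m τ x
        + (r₁' τ x - τ * q * Real.sin x * r₂ τ x))
      + m τ x * (ν * b₃ τ x + ν * τ * q * Real.sin x * a₂ τ x + q * Real.cos x * p τ x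
        + (r₂' τ x + τ * q * Real.sin x * r₁ τ x)))) τ := by
    intro τ
    refine hasDerivAt_integral_param isOpen_univ (F := fun τ x => p τ x ^ 2 + m τ x ^ 2)
      (F' := fun τ x =>
        2 * (p τ x * (ν * a₃ τ x - ν * τ * q * Real.sin x * b₂ τ x - q * Real.cos x * m τ x
        + (r₁' τ x - τ * q * Real.sin x * r₂ τ x))
      + m τ x * (ν * b₃ τ x + ν * τ * q * Real.sin x * a₂ τ x + q * Real.cos x * p τ x
        + (r₂' τ x + τ * q * Real.sin x * r₁ τ x))))
      (Continuous.continuousOn (by fun_prop)) (Continuous.continuousOn (by fun_prop))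
      (fun τ _ x => ?_) _ _ (mem_univ τ)
    have hl : HasDerivAt (fun τ : ℝ => τ * q * Real.sin x) (q * Real.sin x) τ := by
      simpa using ((hasDerivAt_id τ).mul_const q).mul_const (Real.sin x)
    have dp : HasDerivAt (fun τ => p τ x) _ τ := (F.ta₁ τ x).sub (hl.mul (F.tb τ x))
    have dm : HasDerivAt (fun τ => m τ x) _ τ := (F.tb₁ τ x).add (hl.mul (F.ta τ x))
    refine ((dp.pow 2).add (dm.pow 2)).congr_deriv ?_
    simp only [Nat.cast_ofNat, Nat.add_one_sub_one, pow_one, hp, hm]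
    ring
  have hu : ∀ τ ∈ Icc 0 T, 3 * ν * (τ * q) ^ 2 * (∫ x in (-π)..π, (a τ x ^ 2 + b τ x ^ 2))
      ≤ 3 * ν * (T * q) ^ 2 * X τ + 6 * ν * T * (W τ + Y τ) := by
    intro τ hτ
    have c1 := sl ca τ
    have c2 := sl cb τ
    have c3 := sl ca₁ τ
    have c4 := sl cb₁ τ
    have c5 := sl cp τ
    have c6 := sl cm τ
    have hpt : ∀ x, (τ * q) ^ 2 * (a τ x ^ 2 + b τ x ^ 2)
        ≤ (T * q) ^ 2 * (nearWeight s x * (a τ x ^ 2 + b τ x ^ 2))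
          + 2 * T * ((p τ x ^ 2 + m τ x ^ 2) + nearWeight s x * (a₁ τ x ^ 2 + b₁ τ x ^ 2)) := by
      intro x
      have hw := nearWeight_pos hs x
      have hw1 := nearWeight_le_one hs x
      have h1 := nearWeight_add hs x
      rw [hs2] at h1
      set w := nearWeight s x
      have h2 : (τ * q) ^ 2 * (a τ x ^ 2 + b τ x ^ 2)
          = (τ * q) ^ 2 * (w * (a τ x ^ 2 + b τ x ^ 2))
            + T * (w * ((m τ x - b₁ τ x) ^ 2 + (a₁ τ x - p τ x) ^ 2)) := by
        have h3 : w * Real.sin x ^ 2 / (1 / T) = T * w * Real.sin x ^ 2 := by field_simp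
        rw [h3] at h1
        simp only [hp, hm]
        linear_combination -(τ * q) ^ 2 * (a τ x ^ 2 + b τ x ^ 2) * h1
      have h4 : (m τ x - b₁ τ x) ^ 2 + (a₁ τ x - p τ x) ^ 2
          ≤ 2 * (p τ x ^ 2 + m τ x ^ 2) + 2 * (a₁ τ x ^ 2 + b₁ τ x ^ 2) := by
        nlinarith [sq_nonneg (m τ x + b₁ τ x), sq_nonneg (a₁ τ x + p τ x)]
      have h5 : w * (p τ x ^ 2 + m τ x ^ 2) ≤ 1 * (p τ x ^ 2 + m τ x ^ 2) := by gcongr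
      have h6 : (τ * q) ^ 2 ≤ (T * q) ^ 2 := by
        have := hτ.1
        rw [mul_pow, mul_pow]
        gcongr; exact hτ.2
      rw [h2]
      have h7 := mul_le_mul_of_nonneg_right h6 (by positivity : 0 ≤ w * (a τ x ^ 2 + b τ x ^ 2))
      have h8 := mul_le_mul_of_nonneg_left h4 hw.le
      have h9 := mul_le_mul_of_nonneg_left h8 hT0.le
      have h10 := mul_le_mul_of_nonneg_left h5 hT0.le
      linarith
    have hI := integral_mono_of_continuous (by fun_prop) (by fun_prop) neg_pi_le_pi hpt
    rw [intervalIntegral.integral_const_mul ((τ * q) ^ 2),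
      integral_add_of_continuous
        (f := fun x => (T * q) ^ 2 * (nearWeight s x * (a τ x ^ 2 + b τ x ^ 2)))
        (g := fun x => 2 * T * ((p τ x ^ 2 + m τ x ^ 2)
          + nearWeight s x * (a₁ τ x ^ 2 + b₁ τ x ^ 2))) (by fun_prop) (by fun_prop),
      intervalIntegral.integral_const_mul ((T * q) ^ 2), intervalIntegral.integral_const_mul (2 * T),
      integral_add_of_continuous (f := fun x => p τ x ^ 2 + m τ x ^ 2)
        (g := fun x => nearWeight s x * (a₁ τ x ^ 2 + b₁ τ x ^ 2)) (by fun_prop)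
        (by fun_prop)] at hI
    have h1 := mul_le_mul_of_nonneg_left hI (by positivity : 0 ≤ 3 * ν)
    have h2 : 3 * ν * (τ * q) ^ 2 * (∫ x in (-π)..π, (a τ x ^ 2 + b τ x ^ 2))
        = 3 * ν * ((τ * q) ^ 2 * (∫ x in (-π)..π, (a τ x ^ 2 + b τ x ^ 2))) := by ring
    rw [h2]
    refine h1.trans (le_of_eq ?_)
    simp only [hX, hW, hY]
    ring
  set C : ℝ := 3 * ν * (T * q) ^ 2 * B + 7 * T * (ε / ν) with hC
  have hB0 : 0 ≤ B := (hX0 0).trans (hXb 0 ⟨le_rfl, hT0.le⟩)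
  have hVT := le_exp_mul_of_deriv_le (y := fun τ => W τ + 6 * T * X τ) (c := 8 * ν * T) (b := C)
    hT0.le (by positivity) (by positivity)
    (fun t _ => ((hWd t).add ((hXd t).const_mul (6 * T))).continuousAt.continuousWithinAt)
    (fun t _ => (hWd t).add ((hXd t).const_mul (6 * T))) fun τ hτ' => by
      have hτ : τ ∈ Icc 0 T := Ioo_subset_Icc_self hτ'
      have h1 := deriv_commuting_energy_le (F.ha τ) (F.hb τ) (F.ha₁ τ) (F.hb₁ τ) (F.ha₂ τ) (F.hb₂ τ)
        (sl ca₃ τ) (sl cb₃ τ) (sl cr₁ τ) (sl cr₂ τ) (sl cr₁' τ) (sl cr₂' τ) (F.pa τ) (F.pb τ)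
        (F.pa₁ τ) (F.pb₁ τ) (F.pa₂ τ) (F.pb₂ τ) (q := q) (τ := τ) hν (p := p τ) (m := m τ)
        (fun x => rfl) (fun x => rfl)
      have h2 := mul_le_mul_of_nonneg_left (hXle τ hτ) (by positivity : 0 ≤ 6 * T)
      have h3 := hu τ hτ
      have h4 := mul_le_mul_of_nonneg_left (hr' τ hτ) (by positivity : 0 ≤ 1 / ν)
      have h5 : 1 / ν * ε ≤ T * (ε / ν) := by
        calc 1 / ν * ε = 1 * (ε / ν) := by ring
          _ ≤ _ := by gcongr
      have h6 := mul_le_mul_of_nonneg_left (hXb τ hτ) (by positivity : 0 ≤ 3 * ν * (T * q) ^ 2)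
      have h7 : ν * W τ ≤ ν * T * W τ := by
        calc ν * W τ = ν * 1 * W τ := by ring
          _ ≤ _ := by
            have := hW0 τ
            gcongr
      have h8 : 0 ≤ ν * T * (T * X τ) := mul_nonneg (by positivity) (mul_nonneg hT0.le (hX0 τ))
      rw [hC]
      change _ ≤ 8 * ν * T * (W τ + 6 * T * X τ) + _
      have h9 : 2 * ν * W τ = 2 * (ν * W τ) := by ring
      have h10 : 6 * T * (-ν * Y τ + 2 * ν * T * X τ + ε / ν)
          = -(6 * ν * T * Y τ) + 12 * (ν * T * (T * X τ)) + 6 * (T * (ε / ν)) := by ring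
      have h11 : 8 * ν * T * (W τ + 6 * T * X τ)
          = 8 * (ν * T * W τ) + 48 * (ν * T * (T * X τ)) := by ring
      have h12 : 6 * ν * T * (W τ + Y τ) = 6 * (ν * T * W τ) + 6 * ν * T * Y τ := by ring
      have hWτ : (∫ x in (-π)..π, (p τ x ^ 2 + m τ x ^ 2)) = W τ := rfl
      rw [hWτ, h9] at h1
      rw [h10] at h2
      rw [h12] at h3
      rw [h11]
      linarith
  have hexp : Real.exp (8 * ν * T * T) ≤ Real.exp (8 * Δ) := by
    rw [Real.exp_le_exp]
    calc 8 * ν * T * T = 8 * (ν * T ^ 2) := by ring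
      _ ≤ _ := by gcongr
  have hWi : W 0 ≤ H₀ := by
    have e : W 0 = ∫ x in (-π)..π, (a₁ 0 x ^ 2 + b₁ 0 x ^ 2) := by
      simp only [hW, hp, hm, zero_mul, sub_zero, add_zero]
    rw [e, hH₀]; linarith
  refine ⟨hXb T ⟨hT0.le, le_rfl⟩, ?_⟩
  have h3 : 0 ≤ 6 * T * X T := mul_nonneg (by positivity) (hX0 T)
  change W T ≤ _
  calc W T ≤ W T + 6 * T * X T := by linarith
    _ ≤ _ := hVT
    _ ≤ _ := by
      have := hW0 0
      have := hX0 0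
      gcongr

theorem pairing_coefficient_le {ν q T Δ ε s H₀ B X W : ℝ} (hν : 0 < ν) (hq : 1 ≤ q) (hT : 1 ≤ T)
    (hΔ : ν * T ^ 2 ≤ Δ) (hε : 0 ≤ ε) (hs : 0 < s) (hs1 : s ≤ 1) (hs2 : s ^ 2 = 1 / T)
    (hH0 : 0 ≤ H₀) (hB : B = Real.exp (2 * Δ) * (34 * s * H₀ + T * ε / ν)) (hX : X ≤ B)
    (hW : W ≤ Real.exp (8 * Δ) * (H₀ + 6 * T * (34 * s * H₀)
        + (3 * ν * (T * q) ^ 2 * B + 7 * T * (ε / ν)) * T)) :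
    3 * X + s ^ 2 / q ^ 2 * W
      ≤ Real.exp (10 * Δ) * (1 + Δ) * (410 * s * H₀ + 10 * T * ε / ν) := by
  have hT0 : 0 < T := by linarith
  have hq0 : 0 < q := by linarith
  have hΔ0 : 0 ≤ Δ := le_trans (by positivity) hΔ
  have hB0 : 0 ≤ B := by rw [hB]; positivity
  have he2 : 1 ≤ Real.exp (2 * Δ) := Real.one_le_exp (by positivity)
  have he8 : 1 ≤ Real.exp (8 * Δ) := Real.one_le_exp (by positivity)
  have he10 : Real.exp (8 * Δ) * Real.exp (2 * Δ) = Real.exp (10 * Δ) := by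
    rw [← Real.exp_add]; congr 1; ring
  have hεν : 0 ≤ T * ε / ν := by positivity
  have h3 : s ^ 2 / q ^ 2 * (H₀ + 6 * T * (34 * s * H₀) + (3 * ν * (T * q) ^ 2 * B + 7 * T * (ε / ν)) * T)
      ≤ s * H₀ + 204 * (s * H₀) + (3 * Δ * B + 7 * (T * ε / ν)) := by
    have hqi : 1 / q ^ 2 ≤ 1 := by
      rw [div_le_one (by positivity)]; exact one_le_pow₀ hq
    have hss : s ^ 2 ≤ s := by nlinarith
    have e1 : s ^ 2 / q ^ 2 * (H₀ + 6 * T * (34 * s * H₀) + (3 * ν * (T * q) ^ 2 * B + 7 * T * (ε / ν)) * T)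
        = 1 / q ^ 2 * (s ^ 2 * H₀ + 204 * (s * H₀) + 7 * (T * ε / ν))
          + 3 * (ν * T ^ 2) * B := by
      rw [hs2]; field_simp; ring
    rw [e1]
    have e2 : 1 / q ^ 2 * (s ^ 2 * H₀ + 204 * (s * H₀) + 7 * (T * ε / ν))
        ≤ 1 * (s * H₀ + 204 * (s * H₀) + 7 * (T * ε / ν)) := by gcongr
    have e3 : 3 * (ν * T ^ 2) * B ≤ 3 * Δ * B := by gcongr
    linarith
  have h4 : s ^ 2 / q ^ 2 * W ≤ Real.exp (8 * Δ)
      * (s * H₀ + 204 * (s * H₀) + (3 * Δ * B + 7 * (T * ε / ν))) := by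
    calc _ ≤ s ^ 2 / q ^ 2 * (Real.exp (8 * Δ) * (H₀ + 6 * T * (34 * s * H₀) + (3 * ν * (T * q) ^ 2 * B + 7 * T * (ε / ν)) * T)) := by gcongr
      _ = Real.exp (8 * Δ) * (s ^ 2 / q ^ 2 * (H₀ + 6 * T * (34 * s * H₀) + (3 * ν * (T * q) ^ 2 * B + 7 * T * (ε / ν)) * T)) := by ring
      _ ≤ _ := by gcongr
  have hsH : 0 ≤ s * H₀ := by positivity
  have h5 : 3 * X ≤ Real.exp (8 * Δ) * (3 * B) := by
    calc 3 * X ≤ 1 * (3 * B) := by linarith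
      _ ≤ _ := by gcongr
  have h6 : 205 * (s * H₀) + 7 * (T * ε / ν)
      ≤ Real.exp (2 * Δ) * ((1 + Δ) * (205 * (s * H₀) + 7 * (T * ε / ν))) := by
    calc _ = 1 * (1 * (205 * (s * H₀) + 7 * (T * ε / ν))) := by ring
      _ ≤ _ := by gcongr; linarith
  calc 3 * X + s ^ 2 / q ^ 2 * W
      ≤ Real.exp (8 * Δ) * (3 * B) + Real.exp (8 * Δ)
        * (s * H₀ + 204 * (s * H₀) + (3 * Δ * B + 7 * (T * ε / ν))) := add_le_add h5 h4
    _ = Real.exp (8 * Δ) * (3 * (1 + Δ) * B + (205 * (s * H₀) + 7 * (T * ε / ν))) := by ring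
    _ ≤ Real.exp (8 * Δ) * (3 * (1 + Δ) * B
        + Real.exp (2 * Δ) * ((1 + Δ) * (205 * (s * H₀) + 7 * (T * ε / ν)))) := by gcongr
    _ = Real.exp (10 * Δ) * (1 + Δ) * (307 * (s * H₀) + 10 * (T * ε / ν)) := by
      rw [hB, ← he10]; ring
    _ ≤ Real.exp (10 * Δ) * (1 + Δ) * (410 * (s * H₀) + 10 * (T * ε / ν)) := by gcongr; norm_num
    _ = _ := by ring

/-- Linear mixing: at time `T ≲ ν^{-1/2}` the pairing with a test function is of order `T^{-1/2}`,
up to the residual. -/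
theorem LinearFlow.sq_pairing_le {ν q : ℝ} {a b a₁ b₁ a₂ b₂ a₃ b₃ r₁ r₂ r₁' r₂' : ℝ → ℝ → ℝ}
    (F : LinearFlow ν q a b a₁ b₁ a₂ b₂ a₃ b₃ r₁ r₂ r₁' r₂') (hν : 0 < ν) (hq : 1 ≤ q)
    {T Δ ε : ℝ} (hT : 1 ≤ T) (hΔ : ν * T ^ 2 ≤ Δ) (hε : 0 ≤ ε)
    (hr : ∀ τ ∈ Icc 0 T, ∫ x in (-π)..π, (r₁ τ x ^ 2 + r₂ τ x ^ 2) ≤ ε)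
    (hr' : ∀ τ ∈ Icc 0 T, ∫ x in (-π)..π, ((r₁' τ x - τ * q * Real.sin x * r₂ τ x) ^ 2
      + (r₂' τ x + τ * q * Real.sin x * r₁ τ x) ^ 2) ≤ ε)
    {g₁ g₂ g₁' g₂' : ℝ → ℝ}
    (hg₁ : ∀ x, HasDerivAt g₁ (g₁' x) x) (hg₂ : ∀ x, HasDerivAt g₂ (g₂' x) x)
    (cg₁' : Continuous g₁') (cg₂' : Continuous g₂')
    (pg₁ : Function.Periodic g₁ (2 * π)) (pg₂ : Function.Periodic g₂ (2 * π)) :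
    (∫ x in (-π)..π, (a T x * g₁ x + b T x * g₂ x)) ^ 2
      ≤ 412 * Real.exp (10 * Δ) * (1 + Δ) * (410 / T * ((∫ x in (-π)..π, (a 0 x ^ 2 + b 0 x ^ 2))
          + ∫ x in (-π)..π, (a₁ 0 x ^ 2 + b₁ 0 x ^ 2)) + 10 * T * ε / ν)
        * ((∫ x in (-π)..π, (g₁ x ^ 2 + g₂ x ^ 2)) + ∫ x in (-π)..π, (g₁' x ^ 2 + g₂' x ^ 2)) := by
  have hT0 : 0 < T := by linarith
  have hΔ0 : 0 ≤ Δ := le_trans (by positivity) hΔ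
  -- the size of the critical layers
  set s : ℝ := 1 / √T with hsdef
  have hs : 0 < s := by positivity
  have hs2 : s ^ 2 = 1 / T := by rw [hsdef, div_pow, Real.sq_sqrt hT0.le, one_pow]
  have hsT : s ^ 2 * T = 1 := by rw [hs2]; field_simp
  have hs1 : s ≤ 1 := by
    rw [hsdef, div_le_one (by positivity), Real.one_le_sqrt]; exact hT
  clear_value s
  have sl : ∀ {g : ℝ → ℝ → ℝ}, Continuous (fun z : ℝ × ℝ => g z.1 z.2) → ∀ τ, Continuous (g τ) :=
    fun hg τ => hg.comp (by fun_prop : Continuous fun x : ℝ => (τ, x))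
  have hn : ∀ {f₁ f₂ : ℝ → ℝ}, 0 ≤ ∫ x in (-π)..π, (f₁ x ^ 2 + f₂ x ^ 2) := fun {f₁ f₂} =>
    integral_nonneg_of_forall neg_pi_le_pi fun x => by positivity
  obtain ⟨hX, hW⟩ := F.weighted_bounds hν hT hΔ hε hr hr' hs hs1 hs2 rfl rfl
  have hP := pairing_coefficient_le hν hq hT hΔ hε hs hs1 hs2 (add_nonneg hn hn) rfl hX hW
  set H₀ := (∫ x in (-π)..π, (a 0 x ^ 2 + b 0 x ^ 2)) + ∫ x in (-π)..π, (a₁ 0 x ^ 2 + b₁ 0 x ^ 2)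
  have hH0 : 0 ≤ H₀ := add_nonneg hn hn
  set G := (∫ x in (-π)..π, (g₁ x ^ 2 + g₂ x ^ 2)) + ∫ x in (-π)..π, (g₁' x ^ 2 + g₂' x ^ 2)
    with hG
  have cg₁ : Continuous g₁ := continuous_iff_continuousAt.2 fun x => (hg₁ x).continuousAt
  have cg₂ : Continuous g₂ := continuous_iff_continuousAt.2 fun x => (hg₂ x).continuousAt
  have hQ : 3 * (∫ x in (-π)..π, nearWeight s x * (g₁ x ^ 2 + g₂ x ^ 2))
      + s ^ 2 * (∫ x in (-π)..π, (g₁' x ^ 2 + g₂' x ^ 2)) ≤ 103 * s * G := by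
    have h1 := integral_nearWeight_mul_sq_le hs hs1 cg₁ cg₂
      (sq_add_sq_le_of_hasDerivAt hg₁ hg₂ cg₁' cg₂' pg₁ pg₂)
    rw [← hG] at h1
    have h2 : 0 ≤ ∫ x in (-π)..π, (g₁ x ^ 2 + g₂ x ^ 2) :=
      integral_nonneg_of_forall neg_pi_le_pi fun x => by positivity
    have h3 : 0 ≤ ∫ x in (-π)..π, (g₁' x ^ 2 + g₂' x ^ 2) :=
      integral_nonneg_of_forall neg_pi_le_pi fun x => by positivity
    have h4 : s ^ 2 * (∫ x in (-π)..π, (g₁' x ^ 2 + g₂' x ^ 2)) ≤ s * G := by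
      have : s ^ 2 ≤ s := by nlinarith
      gcongr
      rw [hG]; linarith
    linarith
  have hG0 : 0 ≤ G := add_nonneg (integral_nonneg_of_forall neg_pi_le_pi fun x => by positivity)
    (integral_nonneg_of_forall neg_pi_le_pi fun x => by positivity)
  have key := sq_integral_pairing_le (F.ha T) (F.hb T) (sl F.ca₁ T) (sl F.cb₁ T) hg₁ hg₂ cg₁' cg₂'
    (F.pa T) (F.pb T) pg₁ pg₂ hq hs hsT (fun _ => rfl) (fun _ => rfl)
  have hQ0 : 0 ≤ 3 * (∫ x in (-π)..π, nearWeight s x * (g₁ x ^ 2 + g₂ x ^ 2))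
      + s ^ 2 * (∫ x in (-π)..π, (g₁' x ^ 2 + g₂' x ^ 2)) :=
    add_nonneg (mul_nonneg (by norm_num) (integral_nonneg_of_forall neg_pi_le_pi fun x =>
      mul_nonneg (nearWeight_pos hs x).le (by positivity)))
      (mul_nonneg (by positivity) (integral_nonneg_of_forall neg_pi_le_pi fun x => by positivity))
  have hεν : 0 ≤ T * ε / ν := by positivity
  refine key.trans ?_
  calc _ ≤ 4 * (Real.exp (10 * Δ) * (1 + Δ) * (410 * s * H₀ + 10 * T * ε / ν) * (103 * s * G)) := by
        gcongr
    _ = 412 * Real.exp (10 * Δ) * (1 + Δ) * (410 * s ^ 2 * H₀ + s * (10 * T * ε / ν)) * G := by ring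
    _ ≤ 412 * Real.exp (10 * Δ) * (1 + Δ) * (410 / T * H₀ + 10 * T * ε / ν) * G := by
        have h1 : s * (10 * T * ε / ν) ≤ 1 * (10 * T * ε / ν) := by gcongr
        have h2 : 410 * s ^ 2 * H₀ = 410 / T * H₀ := by rw [hs2]; ring
        rw [h2]
        gcongr
        linarith

/-! ### Galerkin approximation -/

theorem exists_linear_flow {ι : Type*} [Fintype ι] (L : (ι → ℂ) →L[ℂ] (ι → ℂ)) (c : ι → ℂ) :
    ∃ A : ℝ → ι → ℂ, A 0 = c ∧ ∀ τ i, HasDerivAt (fun τ => A τ i) (L (A τ) i) τ := by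
  refine ⟨fun τ => NormedSpace.exp (τ • L) c, ?_, fun τ i => ?_⟩
  · show NormedSpace.exp ((0 : ℝ) • L) c = c
    rw [show (0 : ℝ) • L = 0 from zero_smul ℝ L, NormedSpace.exp_zero]; rfl
  have h1 : HasDerivAt (fun τ : ℝ => NormedSpace.exp (τ • L)) (L * NormedSpace.exp (τ • L)) τ :=
    hasDerivAt_exp_smul_const' L τ
  have h2 := (((ContinuousLinearMap.apply ℂ (ι → ℂ) c).restrictScalars ℝ).hasFDerivAt.comp_hasDerivAt
    τ h1)
  exact (hasDerivAt_pi.1 h2) i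

/-- The truncation to the frequencies `|n| ≤ N` of
`a_n' = -ν n² a_n + (iq/2) (a_{n-1} + a_{n+1})`. -/
theorem exists_galerkin (ν q : ℝ) (N : ℕ) (c : ℤ → ℂ) (hc : ∀ n : ℤ, N < n.natAbs → c n = 0) :
    ∃ A : ℝ → ℤ → ℂ, A 0 = c ∧ (∀ τ, ∀ n : ℤ, N < n.natAbs → A τ n = 0) ∧
      ∀ τ, ∀ n : ℤ, n.natAbs ≤ N → HasDerivAt (fun τ => A τ n)
        (-(ν * (n : ℂ) ^ 2) * A τ n + Complex.I * q / 2 * (A τ (n - 1) + A τ (n + 1))) τ := by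
  classical
  set ι := {n : ℤ // n ∈ Finset.Icc (-(N : ℤ)) N} with hι
  let ext : (ι → ℂ) → ℤ → ℂ := fun a n => if h : n ∈ Finset.Icc (-(N : ℤ)) N then a ⟨n, h⟩ else 0
  have ext_add : ∀ a b n, ext (a + b) n = ext a n + ext b n := by
    intro a b n
    by_cases h : n ∈ Finset.Icc (-(N : ℤ)) N <;> simp only [ext, h, dite_true, dite_false,
      Pi.add_apply, add_zero]
  have ext_smul : ∀ (r : ℂ) a n, ext (r • a) n = r * ext a n := by
    intro r a n
    by_cases h : n ∈ Finset.Icc (-(N : ℤ)) N <;> simp only [ext, h, dite_true, dite_false,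
      Pi.smul_apply, smul_eq_mul, mul_zero]
  let L : (ι → ℂ) →ₗ[ℂ] (ι → ℂ) :=
    { toFun := fun a n => -(ν * (n.1 : ℂ) ^ 2) * ext a n.1
        + Complex.I * q / 2 * (ext a (n.1 - 1) + ext a (n.1 + 1))
      map_add' := fun a b => by
        funext n; simp only [ext_add, Pi.add_apply]; ring
      map_smul' := fun r a => by
        funext n; simp only [ext_smul, Pi.smul_apply, smul_eq_mul, RingHom.id_apply]; ring }
  obtain ⟨A, hA0, hA⟩ := exists_linear_flow (LinearMap.toContinuousLinearMap L) fun n => c n.1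
  have hmem : ∀ n : ℤ, n ∈ Finset.Icc (-(N : ℤ)) N ↔ n.natAbs ≤ N := by
    intro n; rw [Finset.mem_Icc]; omega
  refine ⟨fun τ => ext (A τ), ?_, ?_, ?_⟩
  · funext n
    by_cases h : n ∈ Finset.Icc (-(N : ℤ)) N
    · simp only [ext, h, dite_true, hA0]
    · simp only [ext, h, dite_false]
      rw [hmem] at h
      exact (hc n (by omega)).symm
  · intro τ n hn
    have h : n ∉ Finset.Icc (-(N : ℤ)) N := by rw [hmem]; omega
    simp only [ext, h, dite_false]
  · intro τ n hn
    have h : n ∈ Finset.Icc (-(N : ℤ)) N := (hmem n).2 hn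
    have h1 := hA τ ⟨n, h⟩
    have e : (fun τ => ext (A τ) n) = fun τ => A τ ⟨n, h⟩ := by
      funext τ; simp only [ext, h, dite_true]
    simp only [e]
    exact h1

theorem sum_shift_le {N : ℕ} {w : ℤ → ℝ} (h0 : ∀ n, 0 ≤ w n) (hw : ∀ n : ℤ, N < n.natAbs → w n = 0)
    {d : ℤ} (hd : d.natAbs = 1) :
    ∑ n ∈ Finset.Icc (-(N : ℤ)) N, w (n + d) ≤ ∑ n ∈ Finset.Icc (-(N : ℤ)) N, w n := by
  have h1 : ∑ n ∈ Finset.Icc (-(N : ℤ)) N, w (n + d)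
      = ∑ n ∈ Finset.Icc (-(N : ℤ) + d) (N + d), w n := by
    refine Finset.sum_nbij' (fun n => n + d) (fun n => n - d) ?_ ?_ ?_ ?_ ?_ <;>
      intro n hn <;> simp only [Finset.mem_Icc] at * <;> omega
  have h2 : ∑ n ∈ Finset.Icc (-(N : ℤ)) N, w n
      = ∑ n ∈ Finset.Icc (-(N : ℤ) - 1) (N + 1), w n := by
    refine Finset.sum_subset (fun n hn => ?_) fun n _ hn => hw n ?_
    · simp only [Finset.mem_Icc] at *; omega
    · simp only [Finset.mem_Icc] at hn; omega
  rw [h1, h2]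
  refine Finset.sum_le_sum_of_subset_of_nonneg (fun n hn => ?_) fun n _ _ => h0 n
  simp only [Finset.mem_Icc] at *; omega

/-- Exponential decay of the coefficients in the frequency, uniformly in the truncation. -/
theorem galerkin_decay {ν q : ℝ} (hν : 0 ≤ ν) (hq : 0 ≤ q) {N : ℕ} {A : ℝ → ℤ → ℂ}
    (hA : ∀ τ, ∀ n : ℤ, N < n.natAbs → A τ n = 0)
    (hd : ∀ τ, ∀ n : ℤ, n.natAbs ≤ N → HasDerivAt (fun τ => A τ n)
        (-(ν * (n : ℂ) ^ 2) * A τ n + Complex.I * q / 2 * (A τ (n - 1) + A τ (n + 1))) τ)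
    {T : ℝ} (hT : 0 ≤ T) :
    ∑ n ∈ Finset.Icc (-(N : ℤ)) N, (4 : ℝ) ^ n.natAbs * ‖A T n‖ ^ 2
      ≤ Real.exp (5 * q * T)
        * ∑ n ∈ Finset.Icc (-(N : ℤ)) N, (4 : ℝ) ^ n.natAbs * ‖A 0 n‖ ^ 2 := by
  have hmem : ∀ n : ℤ, n ∈ Finset.Icc (-(N : ℤ)) N → n.natAbs ≤ N := by
    intro n; rw [Finset.mem_Icc]; omega
  have hder : ∀ τ, HasDerivAt (fun τ => ∑ n ∈ Finset.Icc (-(N : ℤ)) N, (4 : ℝ) ^ n.natAbs * ‖A τ n‖ ^ 2)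
      (∑ n ∈ Finset.Icc (-(N : ℤ)) N, (4 : ℝ) ^ n.natAbs * (2 * inner ℝ (A τ n)
        (-(ν * (n : ℂ) ^ 2) * A τ n + Complex.I * q / 2 * (A τ (n - 1) + A τ (n + 1))))) τ := by
    intro τ
    refine HasDerivAt.fun_sum fun n hn => ?_
    exact ((hd τ n (hmem n hn)).norm_sq).const_mul _
  have hle : ∀ τ, (∑ n ∈ Finset.Icc (-(N : ℤ)) N, (4 : ℝ) ^ n.natAbs * (2 * inner ℝ (A τ n)
        (-(ν * (n : ℂ) ^ 2) * A τ n + Complex.I * q / 2 * (A τ (n - 1) + A τ (n + 1)))))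
      ≤ 5 * q * ∑ n ∈ Finset.Icc (-(N : ℤ)) N, (4 : ℝ) ^ n.natAbs * ‖A τ n‖ ^ 2 := by
    intro τ
    set w : ℤ → ℝ := fun n => (4 : ℝ) ^ n.natAbs * ‖A τ n‖ ^ 2 with hw
    have hw0 : ∀ n, 0 ≤ w n := fun n => by positivity
    have hwz : ∀ n : ℤ, N < n.natAbs → w n = 0 := fun n hn => by simp [hw, hA τ n hn]
    have h1 : ∀ n : ℤ, (4 : ℝ) ^ n.natAbs * (2 * inner ℝ (A τ n)
        (-(ν * (n : ℂ) ^ 2) * A τ n + Complex.I * q / 2 * (A τ (n - 1) + A τ (n + 1))))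
        ≤ q * w n + 2 * q * w (n + -1) + 2 * q * w (n + 1) := by
      intro n
      have e1 : inner ℝ (A τ n) (-(ν * (n : ℂ) ^ 2) * A τ n) = -(ν * (n : ℝ) ^ 2) * ‖A τ n‖ ^ 2 := by
        have : -((ν : ℂ) * (n : ℂ) ^ 2) * A τ n = (-(ν * (n : ℝ) ^ 2)) • A τ n := by
          rw [Complex.real_smul]; push_cast; ring
        rw [this, inner_smul_right, real_inner_self_eq_norm_sq]
      have e2 : inner ℝ (A τ n) (Complex.I * q / 2 * (A τ (n - 1) + A τ (n + 1)))
          ≤ ‖A τ n‖ * (q / 2 * (‖A τ (n - 1)‖ + ‖A τ (n + 1)‖)) := by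
        refine (real_inner_le_norm _ _).trans ?_
        gcongr
        rw [norm_mul]
        have : ‖Complex.I * (q : ℂ) / 2‖ = q / 2 := by
          simp [abs_of_nonneg hq]
        rw [this]
        gcongr
        exact norm_add_le _ _
      have e3 : 2 * inner ℝ (A τ n)
          (-(ν * (n : ℂ) ^ 2) * A τ n + Complex.I * q / 2 * (A τ (n - 1) + A τ (n + 1)))
          ≤ q * ‖A τ n‖ ^ 2 + q / 2 * ‖A τ (n - 1)‖ ^ 2 + q / 2 * ‖A τ (n + 1)‖ ^ 2 := by
        rw [inner_add_right, e1]
        have h2 : 0 ≤ ν * (n : ℝ) ^ 2 * ‖A τ n‖ ^ 2 := by positivity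
        have h3 := mul_nonneg hq (sq_nonneg (‖A τ n‖ - ‖A τ (n - 1)‖))
        have h4 := mul_nonneg hq (sq_nonneg (‖A τ n‖ - ‖A τ (n + 1)‖))
        linarith
      have h4 : (4 : ℝ) ^ n.natAbs ≤ 4 * 4 ^ (n - 1).natAbs := by
        rw [← pow_succ']
        exact pow_le_pow_right₀ (by norm_num) (by omega)
      have h5 : (4 : ℝ) ^ n.natAbs ≤ 4 * 4 ^ (n + 1).natAbs := by
        rw [← pow_succ']
        exact pow_le_pow_right₀ (by norm_num) (by omega)
      calc _ ≤ (4 : ℝ) ^ n.natAbs * (q * ‖A τ n‖ ^ 2 + q / 2 * ‖A τ (n - 1)‖ ^ 2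
            + q / 2 * ‖A τ (n + 1)‖ ^ 2) := by gcongr
        _ = q * w n + q / 2 * ((4 : ℝ) ^ n.natAbs * ‖A τ (n - 1)‖ ^ 2)
            + q / 2 * ((4 : ℝ) ^ n.natAbs * ‖A τ (n + 1)‖ ^ 2) := by simp only [hw]; ring
        _ ≤ q * w n + q / 2 * (4 * 4 ^ (n - 1).natAbs * ‖A τ (n - 1)‖ ^ 2)
            + q / 2 * (4 * 4 ^ (n + 1).natAbs * ‖A τ (n + 1)‖ ^ 2) := by gcongr
        _ = _ := by simp only [hw, ← sub_eq_add_neg]; ring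
    refine (Finset.sum_le_sum fun n _ => h1 n).trans ?_
    rw [Finset.sum_add_distrib, Finset.sum_add_distrib, ← Finset.mul_sum, ← Finset.mul_sum,
      ← Finset.mul_sum]
    have h6 := mul_le_mul_of_nonneg_left (sum_shift_le hw0 hwz (d := -1) rfl)
      (by positivity : 0 ≤ 2 * q)
    have h7 := mul_le_mul_of_nonneg_left (sum_shift_le hw0 hwz (d := 1) rfl)
      (by positivity : 0 ≤ 2 * q)
    linarith
  have := le_exp_mul_of_deriv_le (c := 5 * q) (b := 0) hT (by positivity) le_rfl
    (fun t _ => (hder t).continuousAt.continuousWithinAt) (fun t _ => hder t)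
    fun t _ => by rw [add_zero]; exact hle t
  simpa using this

theorem exp_int_add_one (n : ℤ) (x : ℝ) : Complex.exp (((n + 1 : ℤ) : ℂ) * x * Complex.I)
    = Complex.exp (x * Complex.I) * Complex.exp (n * x * Complex.I) := by
  rw [← Complex.exp_add]; congr 1; push_cast; ring

theorem exp_int_sub_one (n : ℤ) (x : ℝ) : Complex.exp (((n - 1 : ℤ) : ℂ) * x * Complex.I)
    = Complex.exp (-x * Complex.I) * Complex.exp (n * x * Complex.I) := by
  rw [← Complex.exp_add]; congr 1; push_cast; ring

/-- The boundary terms of the truncation. -/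
theorem sum_neighbours {N : ℕ} {A : ℤ → ℂ} (hA : ∀ n : ℤ, N < n.natAbs → A n = 0) (x : ℝ) :
    ∑ n ∈ Finset.Icc (-(N : ℤ)) N, (A (n - 1) + A (n + 1)) * Complex.exp (n * x * Complex.I)
      = 2 * Real.cos x * (∑ n ∈ Finset.Icc (-(N : ℤ)) N, A n * Complex.exp (n * x * Complex.I))
        - (A N * Complex.exp (((N + 1 : ℤ) : ℂ) * x * Complex.I)
          + A (-N) * Complex.exp (((-N - 1 : ℤ) : ℂ) * x * Complex.I)) := by
  set E : ℤ → ℂ := fun n => Complex.exp (n * x * Complex.I) with hE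
  have h1 : ∑ n ∈ Finset.Icc (-(N : ℤ)) N, A n * E (n + 1)
      = (∑ n ∈ Finset.Icc (-(N : ℤ)) N, A (n - 1) * E n) + A N * E (N + 1) := by
    have e1 : ∑ n ∈ Finset.Icc (-(N : ℤ)) N, A n * E (n + 1)
        = ∑ n ∈ Finset.Icc (-(N : ℤ) + 1) (N + 1), A (n - 1) * E n := by
      refine Finset.sum_nbij' (fun n => n + 1) (fun n => n - 1) ?_ ?_ ?_ ?_ ?_ <;>
        intro n hn <;> simp only [Finset.mem_Icc] at * <;> first | omega | skip
      simp
    have e2 : Finset.Icc (-(N : ℤ) + 1) (N + 1) = insert (N + 1 : ℤ) (Finset.Icc (-(N : ℤ) + 1) N) := by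
      ext n; simp only [Finset.mem_Icc, Finset.mem_insert]; omega
    have e3 : Finset.Icc (-(N : ℤ)) N = insert (-(N : ℤ)) (Finset.Icc (-(N : ℤ) + 1) N) := by
      ext n; simp only [Finset.mem_Icc, Finset.mem_insert]; omega
    rw [e1, e2, Finset.sum_insert (by simp), e3, Finset.sum_insert (by simp),
      hA (-(N : ℤ) - 1) (by omega), add_sub_cancel_right]
    ring
  have h2 : ∑ n ∈ Finset.Icc (-(N : ℤ)) N, A n * E (n - 1)
      = (∑ n ∈ Finset.Icc (-(N : ℤ)) N, A (n + 1) * E n) + A (-N) * E (-N - 1) := by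
    have e1 : ∑ n ∈ Finset.Icc (-(N : ℤ)) N, A n * E (n - 1)
        = ∑ n ∈ Finset.Icc (-(N : ℤ) - 1) (N - 1), A (n + 1) * E n := by
      refine Finset.sum_nbij' (fun n => n - 1) (fun n => n + 1) ?_ ?_ ?_ ?_ ?_ <;>
        intro n hn <;> simp only [Finset.mem_Icc] at * <;> first | omega | skip
      simp
    have e2 : Finset.Icc (-(N : ℤ) - 1) (N - 1)
        = insert (-(N : ℤ) - 1) (Finset.Icc (-(N : ℤ)) (N - 1)) := by
      ext n; simp only [Finset.mem_Icc, Finset.mem_insert]; omega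
    have e3 : Finset.Icc (-(N : ℤ)) N = insert (N : ℤ) (Finset.Icc (-(N : ℤ)) (N - 1)) := by
      ext n; simp only [Finset.mem_Icc, Finset.mem_insert]; omega
    rw [e1, e2, Finset.sum_insert (by simp), e3, Finset.sum_insert (by simp),
      hA ((N : ℤ) + 1) (by omega), sub_add_cancel]
    ring
  have h3 : (2 * Real.cos x : ℂ) = Complex.exp (x * Complex.I) + Complex.exp (-x * Complex.I) := by
    rw [Complex.ofReal_cos, Complex.two_cos]
  have h4 : (2 * Real.cos x : ℂ) * (∑ n ∈ Finset.Icc (-(N : ℤ)) N, A n * E n)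
      = (∑ n ∈ Finset.Icc (-(N : ℤ)) N, A n * E (n + 1))
        + ∑ n ∈ Finset.Icc (-(N : ℤ)) N, A n * E (n - 1) := by
    rw [h3, Finset.mul_sum, ← Finset.sum_add_distrib]
    refine Finset.sum_congr rfl fun n _ => ?_
    simp only [hE]
    rw [exp_int_add_one, exp_int_sub_one]
    ring
  have h5 : ∑ n ∈ Finset.Icc (-(N : ℤ)) N, (A (n - 1) + A (n + 1)) * E n
      = (∑ n ∈ Finset.Icc (-(N : ℤ)) N, A (n - 1) * E n)
        + ∑ n ∈ Finset.Icc (-(N : ℤ)) N, A (n + 1) * E n := by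
    rw [← Finset.sum_add_distrib]
    exact Finset.sum_congr rfl fun n _ => by ring
  change ∑ n ∈ Finset.Icc (-(N : ℤ)) N, (A (n - 1) + A (n + 1)) * E n
    = 2 * Real.cos x * (∑ n ∈ Finset.Icc (-(N : ℤ)) N, A n * E n)
      - (A N * E (N + 1) + A (-N) * E (-N - 1))
  rw [h4, h1, h2, h5]
  ring

theorem hasDerivAt_re {g : ℝ → ℂ} {g' : ℂ} {x : ℝ} (h : HasDerivAt g g' x) :
    HasDerivAt (fun x => (g x).re) g'.re x :=
  Complex.reCLM.hasFDerivAt.comp_hasDerivAt x h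

theorem hasDerivAt_im {g : ℝ → ℂ} {g' : ℂ} {x : ℝ} (h : HasDerivAt g g' x) :
    HasDerivAt (fun x => (g x).im) g'.im x :=
  Complex.imCLM.hasFDerivAt.comp_hasDerivAt x h

/-- The complex form `∂_τ u = ν u'' + i q cos x u + r` of the real system. -/
theorem LinearFlow.of_complex {ν q : ℝ} {U : ℕ → ℝ → ℝ → ℂ} {R R' : ℝ → ℝ → ℂ}
    (hc : ∀ j, Continuous fun z : ℝ × ℝ => U j z.1 z.2)
    (cR : Continuous fun z : ℝ × ℝ => R z.1 z.2) (cR' : Continuous fun z : ℝ × ℝ => R' z.1 z.2)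
    (hx : ∀ j τ x, HasDerivAt (U j τ) (U (j + 1) τ x) x)
    (hp : ∀ j τ, Function.Periodic (U j τ) (2 * π))
    (t0 : ∀ τ x, HasDerivAt (fun τ => U 0 τ x)
      (ν * U 2 τ x + Complex.I * q * (Real.cos x * U 0 τ x) + R τ x) τ)
    (t1 : ∀ τ x, HasDerivAt (fun τ => U 1 τ x)
      (ν * U 3 τ x + Complex.I * q * (-Real.sin x * U 0 τ x + Real.cos x * U 1 τ x) + R' τ x) τ) :
    LinearFlow ν q (fun τ x => (U 0 τ x).re) (fun τ x => (U 0 τ x).im)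
      (fun τ x => (U 1 τ x).re) (fun τ x => (U 1 τ x).im)
      (fun τ x => (U 2 τ x).re) (fun τ x => (U 2 τ x).im)
      (fun τ x => (U 3 τ x).re) (fun τ x => (U 3 τ x).im)
      (fun τ x => (R τ x).re) (fun τ x => (R τ x).im)
      (fun τ x => (R' τ x).re) (fun τ x => (R' τ x).im) where
  ca := Complex.continuous_re.comp (hc 0)
  cb := Complex.continuous_im.comp (hc 0)
  ca₁ := Complex.continuous_re.comp (hc 1)
  cb₁ := Complex.continuous_im.comp (hc 1)
  ca₂ := Complex.continuous_re.comp (hc 2)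
  cb₂ := Complex.continuous_im.comp (hc 2)
  ca₃ := Complex.continuous_re.comp (hc 3)
  cb₃ := Complex.continuous_im.comp (hc 3)
  cr₁ := Complex.continuous_re.comp cR
  cr₂ := Complex.continuous_im.comp cR
  cr₁' := Complex.continuous_re.comp cR'
  cr₂' := Complex.continuous_im.comp cR'
  ha τ x := hasDerivAt_re (hx 0 τ x)
  hb τ x := hasDerivAt_im (hx 0 τ x)
  ha₁ τ x := hasDerivAt_re (hx 1 τ x)
  hb₁ τ x := hasDerivAt_im (hx 1 τ x)
  ha₂ τ x := hasDerivAt_re (hx 2 τ x)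
  hb₂ τ x := hasDerivAt_im (hx 2 τ x)
  pa τ x := congrArg Complex.re (hp 0 τ x)
  pb τ x := congrArg Complex.im (hp 0 τ x)
  pa₁ τ x := congrArg Complex.re (hp 1 τ x)
  pb₁ τ x := congrArg Complex.im (hp 1 τ x)
  pa₂ τ x := congrArg Complex.re (hp 2 τ x)
  pb₂ τ x := congrArg Complex.im (hp 2 τ x)
  ta τ x := (hasDerivAt_re (t0 τ x)).congr_deriv (by
    simp [-Complex.ofReal_cos, -Complex.ofReal_sin]; ring)
  tb τ x := (hasDerivAt_im (t0 τ x)).congr_deriv (by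
    simp [-Complex.ofReal_cos, -Complex.ofReal_sin]; ring)
  ta₁ τ x := (hasDerivAt_re (t1 τ x)).congr_deriv (by
    simp [-Complex.ofReal_cos, -Complex.ofReal_sin]; ring)
  tb₁ τ x := (hasDerivAt_im (t1 τ x)).congr_deriv (by
    simp [-Complex.ofReal_cos, -Complex.ofReal_sin]; ring)

/-- The `j`-th derivative of the trigonometric polynomial with coefficients `A n`, `n ∈ S`. -/
noncomputable def trigSum (S : Finset ℤ) (A : ℤ → ℂ) (j : ℕ) (x : ℝ) : ℂ :=
  ∑ n ∈ S, (Complex.I * n) ^ j * A n * Complex.exp (n * x * Complex.I)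

theorem hasDerivAt_exp_int (n : ℂ) (x : ℝ) : HasDerivAt (fun x : ℝ => Complex.exp (n * x * Complex.I))
    (Complex.I * n * Complex.exp (n * x * Complex.I)) x := by
  have h1 : HasDerivAt (fun x : ℝ => n * (x : ℂ) * Complex.I) (n * 1 * Complex.I) x :=
    ((Complex.ofRealCLM.hasDerivAt (x := x)).const_mul n).mul_const _
  exact h1.cexp.congr_deriv (by ring)

theorem hasDerivAt_trigSum (S : Finset ℤ) (A : ℤ → ℂ) (j : ℕ) (x : ℝ) :
    HasDerivAt (trigSum S A j) (trigSum S A (j + 1) x) x := by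
  refine (HasDerivAt.fun_sum fun (n : ℤ) _ =>
    (hasDerivAt_exp_int n x).const_mul ((Complex.I * n) ^ j * A n)).congr_deriv ?_
  exact Finset.sum_congr rfl fun n _ => by ring

theorem periodic_trigSum (S : Finset ℤ) (A : ℤ → ℂ) (j : ℕ) :
    Function.Periodic (trigSum S A j) (2 * π) := by
  intro x
  refine Finset.sum_congr rfl fun n _ => ?_
  congr 1
  rw [show (n : ℂ) * ((x + 2 * π : ℝ) : ℂ) * Complex.I
    = n * x * Complex.I + n * (2 * π * Complex.I) by push_cast; ring, Complex.exp_add,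
    Complex.exp_int_mul_two_pi_mul_I, mul_one]

theorem continuous_trigSum (S : Finset ℤ) {A : ℝ → ℤ → ℂ} (hA : ∀ n ∈ S, Continuous fun τ => A τ n)
    (j : ℕ) : Continuous fun z : ℝ × ℝ => trigSum S (A z.1) j z.2 := by
  refine continuous_finsetSum _ fun n hn => ?_
  have h1 : Continuous fun z : ℝ × ℝ => A z.1 n := (hA n hn).comp continuous_fst
  have h2 : Continuous fun z : ℝ × ℝ => Complex.exp (n * (z.2 : ℝ) * Complex.I) := by fun_prop
  exact (continuous_const.mul h1).mul h2

theorem norm_exp_int (n : ℤ) (x : ℝ) : ‖Complex.exp (n * x * Complex.I)‖ = 1 := by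
  have := Complex.norm_exp_ofReal_mul_I (n * x)
  simpa using this

/-- Solutions of the linear equation with trigonometric data, up to an arbitrarily small residual,
obtained by truncating to finitely many frequencies. -/
theorem exists_linearFlow {ν q T ε : ℝ} (hν : 0 ≤ ν) (hq : 1 ≤ q) (hT : 0 ≤ T) (hε : 0 < ε)
    (K : Finset ℤ) (c : ℤ → ℂ) :
    ∃ a b a₁ b₁ a₂ b₂ a₃ b₃ r₁ r₂ r₁' r₂' : ℝ → ℝ → ℝ,
      LinearFlow ν q a b a₁ b₁ a₂ b₂ a₃ b₃ r₁ r₂ r₁' r₂' ∧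
      (∀ τ ∈ Icc 0 T, ∫ x in (-π)..π, (r₁ τ x ^ 2 + r₂ τ x ^ 2) ≤ ε) ∧
      (∀ τ ∈ Icc 0 T, ∫ x in (-π)..π, ((r₁' τ x - τ * q * Real.sin x * r₂ τ x) ^ 2
        + (r₂' τ x + τ * q * Real.sin x * r₁ τ x) ^ 2) ≤ ε) ∧
      (∀ x, a 0 x = (trigSum K c 0 x).re ∧ b 0 x = (trigSum K c 0 x).im ∧
        a₁ 0 x = (trigSum K c 1 x).re ∧ b₁ 0 x = (trigSum K c 1 x).im) := by
  classical
  set W : ℝ := ∑ n ∈ K, (4 : ℝ) ^ n.natAbs * ‖c n‖ ^ 2 with hW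
  have hW0 : 0 ≤ W := Finset.sum_nonneg fun n _ => by positivity
  set B : ℝ := Real.exp (5 * q * T) * W with hB
  have hB0 : 0 ≤ B := by positivity
  set G : ℝ := q + T * q ^ 2 with hG
  have hG0 : 0 ≤ G := by positivity
  -- the truncation error is of size `(N + 1)² 4⁻ᴺ`
  obtain ⟨N, hNK, hNε⟩ : ∃ N : ℕ, (∀ n ∈ K, n.natAbs ≤ N) ∧
      2 * π * (G ^ 2 * B * (4 * (((N : ℝ) + 1) ^ 2 * (1 / 4) ^ (N + 1)))) ≤ ε := by
    have h1 := tendsto_pow_const_mul_const_pow_of_abs_lt_one 2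
      (show |(1 / 4 : ℝ)| < 1 by rw [abs_of_pos] <;> norm_num)
    have h2 := (h1.comp (tendsto_add_atTop_nat 1)).const_mul (2 * π * (G ^ 2 * B * 4))
    rw [mul_zero] at h2
    have h3 := h2.eventually (eventually_le_nhds hε)
    obtain ⟨N, hN1, hN2⟩ := (h3.and (eventually_ge_atTop (K.sup Int.natAbs))).exists
    refine ⟨N, fun n hn => (Finset.le_sup (f := Int.natAbs) hn).trans hN2, le_of_eq_of_le ?_ hN1⟩
    simp only [Function.comp_apply]
    push_cast
    ring
  set S : Finset ℤ := Finset.Icc (-(N : ℤ)) N with hS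
  have hKS : K ⊆ S := fun n hn => by
    have := hNK n hn
    rw [hS, Finset.mem_Icc]; omega
  set c' : ℤ → ℂ := fun n => if n ∈ K then c n else 0 with hc'
  obtain ⟨A, hA0, hAz, hAd⟩ := exists_galerkin ν q N c' (fun n hn => by
    have : n ∉ K := fun h => by have := hNK n h; omega
    simp [hc', this])
  have hmem : ∀ n ∈ S, n.natAbs ≤ N := by
    intro n; rw [hS, Finset.mem_Icc]; omega
  have hAc : ∀ n : ℤ, n.natAbs ≤ N → Continuous fun τ => A τ n := fun n hn =>
    continuous_iff_continuousAt.2 fun τ => (hAd τ n hn).continuousAt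
  have hdata : ∀ j x, trigSum S (A 0) j x = trigSum K c j x := by
    intro j x
    rw [hA0, trigSum, trigSum]
    symm
    rw [← Finset.sum_subset hKS (fun n _ hn => by simp [hc', hn])]
    exact Finset.sum_congr rfl fun n hn => by simp [hc', hn]
  have hbound : ∀ τ ∈ Icc 0 T, ∀ n : ℤ, n.natAbs = N → ‖A τ n‖ ^ 2 ≤ (1 / 4) ^ N * B := by
    intro τ hτ n hn
    have h1 := galerkin_decay hν (by linarith) hAz hAd hτ.1
    have h2 : ∑ n ∈ S, (4 : ℝ) ^ n.natAbs * ‖A 0 n‖ ^ 2 = W := by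
      rw [hA0, hW]
      symm
      rw [← Finset.sum_subset hKS (fun n _ hn => by simp [hc', hn])]
      exact Finset.sum_congr rfl fun n hn => by simp [hc', hn]
    have h3 : (4 : ℝ) ^ n.natAbs * ‖A τ n‖ ^ 2
        ≤ ∑ n ∈ S, (4 : ℝ) ^ n.natAbs * ‖A τ n‖ ^ 2 :=
      Finset.single_le_sum (f := fun n : ℤ => (4 : ℝ) ^ n.natAbs * ‖A τ n‖ ^ 2)
        (fun n _ => by positivity) (by rw [hS, Finset.mem_Icc]; omega)
    rw [← hS, h2] at h1
    have h4 : Real.exp (5 * q * τ) ≤ Real.exp (5 * q * T) :=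
      Real.exp_le_exp.2 (mul_le_mul_of_nonneg_left hτ.2 (by linarith))
    have h5 : (4 : ℝ) ^ N * ‖A τ n‖ ^ 2 ≤ B := by
      rw [← hn]
      exact (h3.trans h1).trans (mul_le_mul_of_nonneg_right h4 hW0)
    have h6 : (1 / 4 : ℝ) ^ N * 4 ^ N = 1 := by rw [← mul_pow]; norm_num
    calc ‖A τ n‖ ^ 2 = (1 / 4) ^ N * (4 ^ N * ‖A τ n‖ ^ 2) := by rw [← mul_assoc, h6, one_mul]
      _ ≤ _ := by gcongr
  -- the residual and its derivative
  set R : ℝ → ℝ → ℂ := fun τ x => -(Complex.I * q / 2)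
    * (A τ N * Complex.exp (((N + 1 : ℤ) : ℂ) * x * Complex.I)
      + A τ (-N) * Complex.exp (((-N - 1 : ℤ) : ℂ) * x * Complex.I)) with hR
  set R' : ℝ → ℝ → ℂ := fun τ x => -(Complex.I * q / 2)
    * (A τ N * (Complex.I * ((N + 1 : ℤ) : ℂ) * Complex.exp (((N + 1 : ℤ) : ℂ) * x * Complex.I))
      + A τ (-N) * (Complex.I * ((-N - 1 : ℤ) : ℂ)
        * Complex.exp (((-N - 1 : ℤ) : ℂ) * x * Complex.I))) with hR'
  have hAN := hAc N (by omega)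
  have hAN' := hAc (-N) (by omega)
  have hA1 : Continuous fun z : ℝ × ℝ => A z.1 N := hAN.comp continuous_fst
  have hA2 : Continuous fun z : ℝ × ℝ => A z.1 (-N) := hAN'.comp continuous_fst
  have cR : Continuous fun z : ℝ × ℝ => R z.1 z.2 := by
    simp only [hR]; fun_prop
  have cR' : Continuous fun z : ℝ × ℝ => R' z.1 z.2 := by
    simp only [hR']; fun_prop
  have hRR' : ∀ τ x, HasDerivAt (R τ) (R' τ x) x := fun τ x =>
    (((hasDerivAt_exp_int _ x).const_mul _).add ((hasDerivAt_exp_int _ x).const_mul _)).const_mul _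
  -- the truncated equation in physical space
  set D : ℝ → ℤ → ℂ := fun τ n =>
    -(ν * (n : ℂ) ^ 2) * A τ n + Complex.I * q / 2 * (A τ (n - 1) + A τ (n + 1)) with hD
  have hid : ∀ τ x, trigSum S (D τ) 0 x = ν * trigSum S (A τ) 2 x
      + Complex.I * q * (Real.cos x * trigSum S (A τ) 0 x) + R τ x := by
    intro τ x
    have h1 := sum_neighbours (hAz τ) x
    have h2 : trigSum S (D τ) 0 x = ν * trigSum S (A τ) 2 x + Complex.I * q / 2
        * ∑ n ∈ S, (A τ (n - 1) + A τ (n + 1)) * Complex.exp (n * x * Complex.I) := by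
      rw [trigSum, trigSum, Finset.mul_sum, Finset.mul_sum, ← Finset.sum_add_distrib]
      refine Finset.sum_congr rfl fun n _ => ?_
      simp only [hD, mul_pow, Complex.I_sq]
      ring
    have h3 : trigSum S (A τ) 0 x = ∑ n ∈ S, A τ n * Complex.exp (n * x * Complex.I) := by
      simp [trigSum]
    rw [h2, h1, h3]
    simp only [hR]
    ring
  have hid' : ∀ τ x, trigSum S (D τ) 1 x = ν * trigSum S (A τ) 3 x
      + Complex.I * q * (-Real.sin x * trigSum S (A τ) 0 x
        + Real.cos x * trigSum S (A τ) 1 x) + R' τ x := by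
    intro τ x
    have h1 := hasDerivAt_trigSum S (D τ) 0 x
    rw [show trigSum S (D τ) 0 = fun x => ν * trigSum S (A τ) 2 x
      + Complex.I * q * (Real.cos x * trigSum S (A τ) 0 x) + R τ x from funext (hid τ)] at h1
    have h2 := (((hasDerivAt_trigSum S (A τ) 2 x).const_mul (ν : ℂ)).add
      (((Real.hasDerivAt_cos x).ofReal_comp.mul (hasDerivAt_trigSum S (A τ) 0 x)).const_mul
        (Complex.I * q))).add (hRR' τ x)
    refine (h1.unique h2).trans ?_
    push_cast
    ring
  have htime : ∀ j τ x, HasDerivAt (fun τ => trigSum S (A τ) j x) (trigSum S (D τ) j x) τ :=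
    fun j τ x => HasDerivAt.fun_sum fun n hn =>
      ((hAd τ n (hmem n hn)).const_mul _).mul_const _
  have F := LinearFlow.of_complex (ν := ν) (q := q) (U := fun j τ x => trigSum S (A τ) j x)
    (fun j => continuous_trigSum S (fun n hn => hAc n (hmem n hn)) j) cR cR'
    (fun j τ x => hasDerivAt_trigSum S (A τ) j x) (fun j τ => periodic_trigSum S (A τ) j)
    (fun τ x => (htime 0 τ x).congr_deriv (hid τ x))
    (fun τ x => (htime 1 τ x).congr_deriv (hid' τ x))
  have hN1 : (1 : ℝ) ≤ N + 1 := by linarith [(Nat.cast_nonneg N : (0 : ℝ) ≤ N)]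
  -- bounds for the residual
  have hpair : ∀ τ ∈ Icc 0 T, (‖A τ N‖ + ‖A τ (-N)‖) ^ 2 ≤ 4 * ((1 / 4) ^ N * B) := by
    intro τ hτ
    have h1 := hbound τ hτ N (by omega)
    have h2 := hbound τ hτ (-N) (by omega)
    nlinarith [sq_nonneg (‖A τ N‖ - ‖A τ (-N)‖)]
  have hnR : ∀ τ x, ‖R τ x‖ ≤ q / 2 * (‖A τ N‖ + ‖A τ (-N)‖) := by
    intro τ x
    simp only [hR]
    rw [norm_mul]
    have e : ‖-(Complex.I * (q : ℂ) / 2)‖ = q / 2 := by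
      simp [abs_of_nonneg (by linarith : (0 : ℝ) ≤ q)]
    rw [e]
    gcongr
    refine (norm_add_le _ _).trans_eq ?_
    rw [norm_mul, norm_mul, norm_exp_int, norm_exp_int, mul_one, mul_one]
  have hnR' : ∀ τ x, ‖R' τ x‖ ≤ q / 2 * ((N + 1) * (‖A τ N‖ + ‖A τ (-N)‖)) := by
    intro τ x
    simp only [hR']
    rw [norm_mul]
    have e : ‖-(Complex.I * (q : ℂ) / 2)‖ = q / 2 := by
      simp [abs_of_nonneg (by linarith : (0 : ℝ) ≤ q)]
    rw [e]
    gcongr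
    refine (norm_add_le _ _).trans_eq ?_
    have e1 : ‖((N + 1 : ℤ) : ℂ)‖ = N + 1 := by
      rw [Complex.norm_intCast]; push_cast; rw [abs_of_pos (by linarith)]
    have e2 : ‖((-N - 1 : ℤ) : ℂ)‖ = N + 1 := by
      rw [Complex.norm_intCast]; push_cast
      rw [show (-(N : ℝ) - 1) = -(N + 1) by ring, abs_neg, abs_of_pos (by linarith)]
    rw [norm_mul, norm_mul, norm_mul, norm_mul, norm_mul, norm_mul, norm_exp_int, norm_exp_int, e1,
      e2, Complex.norm_I]
    ring
  have hsmall : ∀ τ ∈ Icc 0 T, ∀ z : ℂ, ‖z‖ ≤ G / 2 * ((N + 1) * (‖A τ N‖ + ‖A τ (-N)‖)) →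
      z.re ^ 2 + z.im ^ 2 ≤ G ^ 2 * B * (4 * (((N : ℝ) + 1) ^ 2 * (1 / 4) ^ (N + 1))) := by
    intro τ hτ z hz
    have h1 : z.re ^ 2 + z.im ^ 2 = ‖z‖ ^ 2 := by
      rw [← Complex.normSq_eq_norm_sq, Complex.normSq_apply]; ring
    rw [h1]
    calc ‖z‖ ^ 2 ≤ (G / 2 * ((N + 1) * (‖A τ N‖ + ‖A τ (-N)‖))) ^ 2 := by gcongr
      _ = G ^ 2 / 4 * (N + 1) ^ 2 * (‖A τ N‖ + ‖A τ (-N)‖) ^ 2 := by ring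
      _ ≤ G ^ 2 / 4 * (N + 1) ^ 2 * (4 * ((1 / 4) ^ N * B)) := by
        gcongr; exact hpair τ hτ
      _ = _ := by ring
  have hint : ∀ g : ℝ → ℝ, Continuous g →
      (∀ x, g x ≤ G ^ 2 * B * (4 * (((N : ℝ) + 1) ^ 2 * (1 / 4) ^ (N + 1)))) →
      ∫ x in (-π)..π, g x ≤ ε := by
    intro g hg hgle
    refine (integral_mono_of_continuous hg continuous_const neg_pi_le_pi hgle).trans ?_
    rw [intervalIntegral.integral_const, smul_eq_mul]
    linarith
  refine ⟨_, _, _, _, _, _, _, _, _, _, _, _, F, fun τ hτ => hint _ ?_ fun x => ?_,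
    fun τ hτ => hint _ ?_ fun x => ?_, fun x => ?_⟩
  · have h1 : Continuous (R τ) := cR.comp (by fun_prop : Continuous fun x : ℝ => (τ, x))
    fun_prop
  · refine hsmall τ hτ (R τ x) ((hnR τ x).trans ?_)
    have h1 : q ≤ G := by rw [hG]; nlinarith [mul_nonneg hT (sq_nonneg q)]
    have h2 : 0 ≤ ‖A τ N‖ + ‖A τ (-N)‖ := by positivity
    have h3 : ‖A τ N‖ + ‖A τ (-N)‖ ≤ (N + 1) * (‖A τ N‖ + ‖A τ (-N)‖) :=
      le_mul_of_one_le_left h2 hN1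
    gcongr
  · have h1 : Continuous (R τ) := cR.comp (by fun_prop : Continuous fun x : ℝ => (τ, x))
    have h2 : Continuous (R' τ) := cR'.comp (by fun_prop : Continuous fun x : ℝ => (τ, x))
    fun_prop
  · have h1 := hsmall τ hτ (R' τ x + Complex.I * ((τ * q * Real.sin x : ℝ) : ℂ) * R τ x) ?_
    · refine le_of_eq_of_le ?_ h1
      simp only [Complex.add_re, Complex.add_im, Complex.mul_re, Complex.mul_im, Complex.I_re,
        Complex.I_im, Complex.ofReal_re, Complex.ofReal_im]
      ring
    · refine (norm_add_le _ _).trans ?_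
      have e : ‖Complex.I * ((τ * q * Real.sin x : ℝ) : ℂ) * R τ x‖
          = |τ * q * Real.sin x| * ‖R τ x‖ := by
        rw [norm_mul (Complex.I * _), norm_mul Complex.I, Complex.norm_I, one_mul,
          Complex.norm_real, Real.norm_eq_abs]
      rw [e]
      have h2 : 0 ≤ ‖A τ N‖ + ‖A τ (-N)‖ := by positivity
      have h3 : ‖A τ N‖ + ‖A τ (-N)‖ ≤ (N + 1) * (‖A τ N‖ + ‖A τ (-N)‖) :=
        le_mul_of_one_le_left h2 hN1
      have h4 : |τ * q * Real.sin x| ≤ T * q := by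
        rw [abs_mul, abs_of_nonneg (mul_nonneg hτ.1 (by linarith))]
        calc τ * q * |Real.sin x| ≤ τ * q * 1 := by
              refine mul_le_mul_of_nonneg_left (Real.abs_sin_le_one x)
                (mul_nonneg hτ.1 (by linarith))
          _ ≤ T * q := by rw [mul_one]; exact mul_le_mul_of_nonneg_right hτ.2 (by linarith)
      calc ‖R' τ x‖ + |τ * q * Real.sin x| * ‖R τ x‖
          ≤ q / 2 * ((N + 1) * (‖A τ N‖ + ‖A τ (-N)‖))
            + T * q * (q / 2 * ((N + 1) * (‖A τ N‖ + ‖A τ (-N)‖))) := by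
            refine add_le_add (hnR' τ x) (mul_le_mul h4 ((hnR τ x).trans ?_) (norm_nonneg _)
              (by positivity))
            exact mul_le_mul_of_nonneg_left h3 (by linarith)
        _ = _ := by rw [hG]; ring
  · simp only [hdata, and_self]

/-! ### Trigonometric approximation in `H¹` of the circle -/

/-- `∫ e^{-inx} u(x) dx` over a period. -/
noncomputable def circleCoeff (u : ℝ → ℂ) (n : ℤ) : ℂ :=
  ∫ x in (-π)..π, Complex.exp (-(n * x : ℝ) * Complex.I) * u x

theorem circleCoeff_exp (n m : ℤ) :
    circleCoeff (fun x => Complex.exp (n * x * Complex.I)) m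
      = if m = n then (2 * π : ℂ) else 0 := by
  have e : ∀ x : ℝ, Complex.exp (-(m * x : ℝ) * Complex.I) * Complex.exp (n * x * Complex.I)
      = Complex.exp (((n - m : ℤ) * Complex.I) * x) := fun x => by
    rw [← Complex.exp_add]; congr 1; push_cast; ring
  simp only [circleCoeff, e]
  split_ifs with h
  · subst h
    simp
    ring
  · have h1 : ((n - m : ℤ) : ℂ) * Complex.I ≠ 0 :=
      mul_ne_zero (Int.cast_ne_zero.2 (sub_ne_zero.2 (Ne.symm h))) Complex.I_ne_zero
    rw [integral_exp_mul_complex h1, div_eq_zero_iff, sub_eq_zero]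
    left
    rw [show ((n - m : ℤ) : ℂ) * Complex.I * (π : ℝ) = ((n - m : ℤ) : ℂ) * Complex.I * ((-π : ℝ) : ℂ)
      + (n - m : ℤ) * (2 * π * Complex.I) by push_cast; ring, Complex.exp_add,
      Complex.exp_int_mul_two_pi_mul_I, mul_one]

theorem continuous_trigSum_const (S : Finset ℤ) (A : ℤ → ℂ) (j : ℕ) : Continuous (trigSum S A j) :=
  continuous_iff_continuousAt.2 fun x => (hasDerivAt_trigSum S A j x).continuousAt

theorem circleCoeff_sub_trigSum {u : ℝ → ℂ} (hu : Continuous u) (K : Finset ℤ) (m : ℤ) :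
    circleCoeff (fun x => u x - trigSum K (fun n => circleCoeff u n / (2 * π)) 0 x) m
      = if m ∈ K then 0 else circleCoeff u m := by
  have hpi : (2 * π : ℂ) ≠ 0 := by
    exact_mod_cast (by positivity : (2 * π : ℝ) ≠ 0)
  have h1 : circleCoeff (trigSum K (fun n => circleCoeff u n / (2 * π)) 0) m
      = ∑ n ∈ K, circleCoeff u n / (2 * π) * circleCoeff (fun x => Complex.exp (n * x * Complex.I)) m := by
    simp only [circleCoeff, trigSum, pow_zero, one_mul, Finset.mul_sum]
    rw [intervalIntegral.integral_finsetSum fun n _ =>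
      Continuous.intervalIntegrable (by fun_prop) _ _]
    refine Finset.sum_congr rfl fun n _ => ?_
    rw [← intervalIntegral.integral_const_mul]
    congr 1
    ext x
    ring
  have h2 : circleCoeff (fun x => u x - trigSum K (fun n => circleCoeff u n / (2 * π)) 0 x) m
      = circleCoeff u m - circleCoeff (trigSum K (fun n => circleCoeff u n / (2 * π)) 0) m := by
    have := continuous_trigSum_const K (fun n => circleCoeff u n / (2 * π)) 0
    simp only [circleCoeff, mul_sub] at this ⊢
    exact intervalIntegral.integral_sub (Continuous.intervalIntegrable (by fun_prop) _ _)
      (Continuous.intervalIntegrable (by fun_prop) _ _)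
  rw [h2, h1]
  simp only [circleCoeff_exp, mul_ite, mul_zero, Finset.sum_ite_eq, div_mul_cancel₀ _ hpi]
  split_ifs <;> simp

theorem tendsto_trigSum {u : ℝ → ℂ} (hu : Continuous u) :
    Tendsto (fun K : Finset ℤ => ∫ x in (-π)..π,
      ‖u x - trigSum K (fun n => circleCoeff u n / (2 * π)) 0 x‖ ^ 2) atTop (𝓝 0) := by
  have hpi := Real.pi_pos
  have h1 := parseval_circle hu
  have key : ∀ K : Finset ℤ, ∫ x in (-π)..π,
      ‖u x - trigSum K (fun n => circleCoeff u n / (2 * π)) 0 x‖ ^ 2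
      = (2 * π)⁻¹ * (2 * π * (∫ x in (-π)..π, ‖u x‖ ^ 2) - ∑ m ∈ K, ‖circleCoeff u m‖ ^ 2) := by
    intro K
    have h2 := parseval_circle
      (hu.sub (continuous_trigSum_const K (fun n => circleCoeff u n / (2 * π)) 0))
    have h3 : HasSum (fun m => if m ∈ K then ‖circleCoeff u m‖ ^ 2 else 0)
        (∑ m ∈ K, if m ∈ K then ‖circleCoeff u m‖ ^ 2 else 0) :=
      hasSum_sum_of_ne_finset_zero fun m hm => if_neg hm
    have h4 := (h1.sub h3).unique (HasSum.of_eq h2 (fun m => ?_) rfl)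
    · rw [Finset.sum_congr rfl fun m hm => if_pos hm] at h4
      rw [h4]
      simp only [Pi.sub_apply]
      field_simp
    · have := circleCoeff_sub_trigSum hu K m
      rw [circleCoeff] at this
      simp only [Pi.sub_apply]
      rw [this]
      split_ifs <;> simp [circleCoeff]
  simp only [key]
  have h2 := (h1.const_sub (2 * π * ∫ x in (-π)..π, ‖u x‖ ^ 2)).const_mul (2 * π)⁻¹
  simpa [circleCoeff] using h2

theorem circleCoeff_deriv {z z' : ℝ → ℂ} (hz : ∀ x, HasDerivAt z (z' x) x) (hz' : Continuous z')
    (hp : Function.Periodic z (2 * π)) (n : ℤ) :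
    circleCoeff z' n = Complex.I * n * circleCoeff z n := by
  have hzc : Continuous z := continuous_iff_continuousAt.2 fun x => (hz x).continuousAt
  have h1 : ∀ x : ℝ, HasDerivAt (fun x : ℝ => Complex.exp (((-n : ℤ) : ℂ) * x * Complex.I) * z x)
      (Complex.I * ((-n : ℤ) : ℂ) * Complex.exp (((-n : ℤ) : ℂ) * x * Complex.I) * z x
        + Complex.exp (((-n : ℤ) : ℂ) * x * Complex.I) * z' x) x := fun x =>
    (hasDerivAt_exp_int _ x).mul (hz x)
  have h2 := intervalIntegral.integral_eq_sub_of_hasDerivAt (a := -π) (b := π) (fun x _ => h1 x)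
    (Continuous.intervalIntegrable (by fun_prop) _ _)
  have h3 : z (-π) = z π := by
    rw [← hp (-π)]; congr 1; ring
  have h4 : Complex.exp (((-n : ℤ) : ℂ) * ((-π : ℝ) : ℂ) * Complex.I)
      = Complex.exp (((-n : ℤ) : ℂ) * (π : ℝ) * Complex.I) := by
    rw [show ((-n : ℤ) : ℂ) * ((-π : ℝ) : ℂ) * Complex.I = ((-n : ℤ) : ℂ) * (π : ℝ) * Complex.I
      + n * (2 * π * Complex.I) by push_cast; ring, Complex.exp_add,
      Complex.exp_int_mul_two_pi_mul_I, mul_one]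
  rw [h3, h4, sub_self, intervalIntegral.integral_add
    (Continuous.intervalIntegrable (by fun_prop) _ _)
    (Continuous.intervalIntegrable (by fun_prop) _ _)] at h2
  have e : ∀ x : ℝ, Complex.exp (-(n * x : ℝ) * Complex.I)
      = Complex.exp (((-n : ℤ) : ℂ) * x * Complex.I) := fun x => by
    congr 1; push_cast; ring
  simp only [circleCoeff, e]
  rw [← intervalIntegral.integral_const_mul, ← sub_eq_zero, ← h2, add_comm, sub_eq_add_neg,
    ← intervalIntegral.integral_neg]
  congr 2
  ext x
  push_cast
  ring

theorem exists_trigSum_approx {c s c₁ s₁ : ℝ → ℝ} (hc : ∀ x, HasDerivAt c (c₁ x) x)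
    (hs : ∀ x, HasDerivAt s (s₁ x) x) (cc₁ : Continuous c₁) (cs₁ : Continuous s₁)
    (pc : Function.Periodic c (2 * π)) (ps : Function.Periodic s (2 * π)) {ε : ℝ} (hε : 0 < ε) :
    ∃ (K : Finset ℤ) (A : ℤ → ℂ),
      (∫ x in (-π)..π, ((c x - (trigSum K A 0 x).re) ^ 2 + (s x - (trigSum K A 0 x).im) ^ 2)) ≤ ε ∧
      (∫ x in (-π)..π, ((c₁ x - (trigSum K A 1 x).re) ^ 2
        + (s₁ x - (trigSum K A 1 x).im) ^ 2)) ≤ ε := by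
  set z : ℝ → ℂ := fun x => c x + Complex.I * s x with hz
  set z' : ℝ → ℂ := fun x => c₁ x + Complex.I * s₁ x with hz'
  have hd : ∀ x, HasDerivAt z (z' x) x := fun x =>
    (hc x).ofReal_comp.add ((hs x).ofReal_comp.const_mul _)
  have cz : Continuous z := continuous_iff_continuousAt.2 fun x => (hd x).continuousAt
  have cz' : Continuous z' := by simp only [hz']; fun_prop
  have pz : Function.Periodic z (2 * π) := fun x => by simp only [hz, pc x, ps x]
  obtain ⟨K, h1, h2⟩ := (((tendsto_trigSum cz).eventually (eventually_le_nhds hε)).and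
    ((tendsto_trigSum cz').eventually (eventually_le_nhds hε))).exists
  have hn : ∀ w : ℂ, w.re ^ 2 + w.im ^ 2 = ‖w‖ ^ 2 := fun w => by
    rw [← Complex.normSq_eq_norm_sq, Complex.normSq_apply]; ring
  refine ⟨K, fun n => circleCoeff z n / (2 * π), le_of_eq_of_le ?_ h1, le_of_eq_of_le ?_ h2⟩
  · congr 1
    ext x
    rw [← hn]
    simp [hz]
  · congr 1
    ext x
    have e : trigSum K (fun n => circleCoeff z' n / (2 * π)) 0 x
        = trigSum K (fun n => circleCoeff z n / (2 * π)) 1 x := by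
      refine Finset.sum_congr rfl fun n _ => ?_
      beta_reduce
      rw [circleCoeff_deriv hd cz' pz]
      ring
    rw [← hn, e]
    simp [hz']

/-! ### Comparison with the linear flow -/

/-- The energy estimate for the difference of two solutions: the transport term is skew, and the
force, being in divergence form, costs `ν⁻¹`. -/
theorem ModeData.deriv_energy_le {C S C₁ S₁ C₂ S₂ P R P₁ R₁ : ℝ → ℝ}
    (M : ModeData C S C₁ S₁ C₂ S₂ P R P₁ R₁) {ν q : ℝ} (hν : 0 < ν) {r₁ r₂ Ct St : ℝ → ℝ}
    (cr₁ : Continuous r₁) (cr₂ : Continuous r₂)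
    (hCt : ∀ x, Ct x = ν * C₂ x - q * Real.cos x * S x + P₁ x - r₁ x)
    (hSt : ∀ x, St x = ν * S₂ x + q * Real.cos x * C x + R₁ x - r₂ x) :
    ∫ x in (-π)..π, 2 * (C x * Ct x + S x * St x)
      ≤ ν * (∫ x in (-π)..π, (C x ^ 2 + S x ^ 2))
        + (1 / (2 * ν) * (∫ x in (-π)..π, (P x ^ 2 + R x ^ 2))
          + 1 / ν * ∫ x in (-π)..π, (r₁ x ^ 2 + r₂ x ^ 2)) := by
  have ct : ∀ {g g' : ℝ → ℝ}, (∀ x, HasDerivAt g (g' x) x) → Continuous g := fun h =>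
    continuous_iff_continuousAt.2 fun x => (h x).continuousAt
  have cC := ct M.hc
  have cS := ct M.hs
  have cC₁ := ct M.hc₁
  have cS₁ := ct M.hs₁
  have cP := ct M.hP
  have cR := ct M.hR
  have cC₂ := M.hc₂
  have cS₂ := M.hs₂
  have cP₁ := M.hP₁
  have cR₁ := M.hR₁
  -- a total derivative
  set g' : ℝ → ℝ := fun x => 2 * (ν * ((C₁ x * C₁ x + C x * C₂ x) + (S₁ x * S₁ x + S x * S₂ x))
    + ((C₁ x * P x + C x * P₁ x) + (S₁ x * R x + S x * R₁ x))) with hg'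
  have h0 : ∫ x in (-π)..π, g' x = 0 := by
    refine integral_deriv_eq_zero (f := fun x => 2 * (ν * (C x * C₁ x + S x * S₁ x)
      + (C x * P x + S x * R x))) (fun x => ?_) (by simp only [hg']; fun_prop) (fun x => by
        simp only [M.pc x, M.ps x, M.pc₁ x, M.ps₁ x, M.pP x, M.pR x])
    exact (((((M.hc x).mul (M.hc₁ x)).add ((M.hs x).mul (M.hs₁ x))).const_mul ν).add
      (((M.hc x).mul (M.hP x)).add ((M.hs x).mul (M.hR x)))).const_mul 2
  have cCt : Continuous Ct := by rw [funext hCt]; fun_prop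
  have cSt : Continuous St := by rw [funext hSt]; fun_prop
  have h1 : ∫ x in (-π)..π, (2 * (C x * Ct x + S x * St x) - g' x)
      ≤ ∫ x in (-π)..π, (ν * (C x ^ 2 + S x ^ 2) + (1 / (2 * ν) * (P x ^ 2 + R x ^ 2)
        + 1 / ν * (r₁ x ^ 2 + r₂ x ^ 2))) := by
    refine integral_mono_of_continuous (by simp only [hg']; fun_prop) (by fun_prop) neg_pi_le_pi
      fun x => ?_
    simp only [hg', hCt, hSt]
    have y1 : ∀ u w : ℝ, -(2 * (u * w)) ≤ 2 * ν * u ^ 2 + 1 / (2 * ν) * w ^ 2 := by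
      intro u w
      have : 2 * ν * u ^ 2 + 1 / (2 * ν) * w ^ 2 + 2 * (u * w)
          = 1 / (2 * ν) * (2 * ν * u + w) ^ 2 := by field_simp; ring
      have h2 : 0 ≤ 1 / (2 * ν) * (2 * ν * u + w) ^ 2 := by positivity
      linarith
    have y2 : ∀ u w : ℝ, -(2 * (u * w)) ≤ ν * u ^ 2 + 1 / ν * w ^ 2 := by
      intro u w
      have : ν * u ^ 2 + 1 / ν * w ^ 2 + 2 * (u * w) = 1 / ν * (ν * u + w) ^ 2 := by
        field_simp; ring
      have h2 : 0 ≤ 1 / ν * (ν * u + w) ^ 2 := by positivity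
      linarith
    linarith [y1 (C₁ x) (P x), y1 (S₁ x) (R x), y2 (C x) (r₁ x), y2 (S x) (r₂ x)]
  rw [integral_sub_of_continuous (by fun_prop) (by simp only [hg']; fun_prop), h0, sub_zero,
    integral_add_of_continuous (by fun_prop) (by fun_prop),
    integral_add_of_continuous (by fun_prop) (by fun_prop),
    intervalIntegral.integral_const_mul ν, intervalIntegral.integral_const_mul (1 / (2 * ν)),
    intervalIntegral.integral_const_mul (1 / ν)] at h1
  exact h1

/-- Forced solutions `(c, s)` of `∂_τ u = ν u'' + i q cos x u + p'`, continuous up to the initial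
time, with `‖p‖² ≤ Q`. -/
structure ForcedFlow (ν q : ℝ) (c s c₁ s₁ c₂ s₂ P R P₁ R₁ ct st : ℝ → ℝ → ℝ) (Q : ℝ → ℝ) :
    Prop where
  data : ∀ τ, 0 < τ → ModeData (c τ) (s τ) (c₁ τ) (s₁ τ) (c₂ τ) (s₂ τ) (P τ) (R τ) (P₁ τ) (R₁ τ)
  cc : ContinuousOn (fun z : ℝ × ℝ => c z.1 z.2) (Ici 0 ×ˢ univ)
  cs : ContinuousOn (fun z : ℝ × ℝ => s z.1 z.2) (Ici 0 ×ˢ univ)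
  cct : ContinuousOn (fun z : ℝ × ℝ => ct z.1 z.2) (Ioi 0 ×ˢ univ)
  cst : ContinuousOn (fun z : ℝ × ℝ => st z.1 z.2) (Ioi 0 ×ˢ univ)
  tc : ∀ τ, 0 < τ → ∀ x, HasDerivAt (fun τ => c τ x) (ct τ x) τ
  ts : ∀ τ, 0 < τ → ∀ x, HasDerivAt (fun τ => s τ x) (st τ x) τ
  eqc : ∀ τ, 0 < τ → ∀ x, ct τ x = ν * c₂ τ x - q * Real.cos x * s τ x + P₁ τ x
  eqs : ∀ τ, 0 < τ → ∀ x, st τ x = ν * s₂ τ x + q * Real.cos x * c τ x + R₁ τ x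
  cQ : Continuous Q
  hQ : ∀ τ, 0 < τ → ∫ x in (-π)..π, (P τ x ^ 2 + R τ x ^ 2) ≤ Q τ

theorem ForcedFlow.integral_sq_sub_le {ν q : ℝ} {c s c₁ s₁ c₂ s₂ P R P₁ R₁ ct st : ℝ → ℝ → ℝ}
    {Q : ℝ → ℝ} (D : ForcedFlow ν q c s c₁ s₁ c₂ s₂ P R P₁ R₁ ct st Q)
    {a b a₁ b₁ a₂ b₂ a₃ b₃ r₁ r₂ r₁' r₂' : ℝ → ℝ → ℝ}
    (F : LinearFlow ν q a b a₁ b₁ a₂ b₂ a₃ b₃ r₁ r₂ r₁' r₂') (hν : 0 < ν) {T ε : ℝ} (hT : 0 ≤ T)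
    (hε : 0 ≤ ε) (hQ0 : ∀ τ, 0 ≤ Q τ)
    (hr : ∀ τ ∈ Icc 0 T, ∫ x in (-π)..π, (r₁ τ x ^ 2 + r₂ τ x ^ 2) ≤ ε) :
    ∫ x in (-π)..π, ((c T x - a T x) ^ 2 + (s T x - b T x) ^ 2)
      ≤ Real.exp (ν * T) * ((∫ x in (-π)..π, ((c 0 x - a 0 x) ^ 2 + (s 0 x - b 0 x) ^ 2))
        + (1 / (2 * ν) * (∫ τ in (0 : ℝ)..T, Q τ) + T * ε / ν)) := by
  set H : ℝ → ℝ := fun τ => ∫ x in (-π)..π, ((c τ x - a τ x) ^ 2 + (s τ x - b τ x) ^ 2) with hH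
  have hc1 : ContinuousOn (fun z : ℝ × ℝ => (c z.1 z.2 - a z.1 z.2) ^ 2
      + (s z.1 z.2 - b z.1 z.2) ^ 2) (Ici 0 ×ˢ univ) :=
    ((D.cc.sub F.ca.continuousOn).pow 2).add ((D.cs.sub F.cb.continuousOn).pow 2)
  have hsub : Ioi (0 : ℝ) ×ˢ (univ : Set ℝ) ⊆ Ici 0 ×ˢ univ :=
    prod_mono Ioi_subset_Ici_self le_rfl
  -- the time derivatives of the linear flow
  set at' : ℝ → ℝ → ℝ := fun τ x => ν * a₂ τ x - q * Real.cos x * b τ x + r₁ τ x with hat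
  set bt' : ℝ → ℝ → ℝ := fun τ x => ν * b₂ τ x + q * Real.cos x * a τ x + r₂ τ x with hbt
  have ca := F.ca
  have cb := F.cb
  have ca₂ := F.ca₂
  have cb₂ := F.cb₂
  have cr₁ := F.cr₁
  have cr₂ := F.cr₂
  have cat : Continuous fun z : ℝ × ℝ => at' z.1 z.2 := by simp only [hat]; fun_prop
  have cbt : Continuous fun z : ℝ × ℝ => bt' z.1 z.2 := by simp only [hbt]; fun_prop
  have hHd : ∀ τ ∈ Ioo 0 T, HasDerivAt H (∫ x in (-π)..π, 2 * ((c τ x - a τ x) * (ct τ x - at' τ x)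
      + (s τ x - b τ x) * (st τ x - bt' τ x))) τ := by
    intro τ hτ
    refine hasDerivAt_integral_param isOpen_Ioi (hc1.mono hsub) (F' := fun τ x =>
      2 * ((c τ x - a τ x) * (ct τ x - at' τ x) + (s τ x - b τ x) * (st τ x - bt' τ x))) ?_ ?_ _ _
      (mem_Ioi.2 hτ.1)
    · exact continuousOn_const.mul ((((D.cc.mono hsub).sub ca.continuousOn).mul
        (D.cct.sub cat.continuousOn)).add (((D.cs.mono hsub).sub cb.continuousOn).mul
        (D.cst.sub cbt.continuousOn)))
    · intro t ht x
      refine ((((D.tc t ht x).sub (F.ta t x)).pow 2).add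
        (((D.ts t ht x).sub (F.tb t x)).pow 2)).congr_deriv ?_
      simp only [Nat.cast_ofNat, Nat.add_one_sub_one, pow_one, hat, hbt, Pi.sub_apply]
      ring
  have hle : ∀ τ ∈ Ioo 0 T, (∫ x in (-π)..π, 2 * ((c τ x - a τ x) * (ct τ x - at' τ x)
      + (s τ x - b τ x) * (st τ x - bt' τ x))) ≤ -(-ν) * H τ + (1 / (2 * ν) * Q τ + ε / ν) := by
    intro τ hτ
    have M := D.data τ hτ.1
    have sl : ∀ {g : ℝ → ℝ → ℝ}, Continuous (fun z : ℝ × ℝ => g z.1 z.2) → Continuous (g τ) :=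
      fun hg => hg.comp (by fun_prop : Continuous fun x : ℝ => (τ, x))
    have M' : ModeData (fun x => c τ x - a τ x) (fun x => s τ x - b τ x)
        (fun x => c₁ τ x - a₁ τ x) (fun x => s₁ τ x - b₁ τ x) (fun x => c₂ τ x - a₂ τ x)
        (fun x => s₂ τ x - b₂ τ x) (P τ) (R τ) (P₁ τ) (R₁ τ) :=
      ⟨fun x => (M.hc x).sub (F.ha τ x), fun x => (M.hs x).sub (F.hb τ x),
        fun x => (M.hc₁ x).sub (F.ha₁ τ x), fun x => (M.hs₁ x).sub (F.hb₁ τ x),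
        M.hc₂.sub (sl ca₂), M.hs₂.sub (sl cb₂), M.hP, M.hR, M.hP₁, M.hR₁,
        M.pc.sub (F.pa τ), M.ps.sub (F.pb τ), M.pc₁.sub (F.pa₁ τ), M.ps₁.sub (F.pb₁ τ),
        M.pP, M.pR⟩
    refine (M'.deriv_energy_le (q := q) hν (sl cr₁) (sl cr₂) (fun x => ?_) fun x => ?_).trans ?_
    · simp only [hat, D.eqc τ hτ.1 x]; ring
    · simp only [hbt, D.eqs τ hτ.1 x]; ring
    · have h1 := D.hQ τ hτ.1
      have h2 := hr τ ⟨hτ.1.le, hτ.2.le⟩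
      have h3 : 1 / ν * (∫ x in (-π)..π, (r₁ τ x ^ 2 + r₂ τ x ^ 2)) ≤ ε / ν := by
        rw [one_div_mul_eq_div]; gcongr
      rw [neg_neg]
      gcongr
  have cQ := D.cQ
  have hfin := exp_mul_le_of_deriv_le (y := H) (b := fun τ => 1 / (2 * ν) * Q τ + ε / ν) (α := -ν)
    hT ((continuousOn_integral_param hc1 _ _).mono Icc_subset_Ici_self) hHd (by fun_prop) hle
  have hI : ∫ τ in (0 : ℝ)..T, Real.exp (-ν * τ) * (1 / (2 * ν) * Q τ + ε / ν)
      ≤ ∫ τ in (0 : ℝ)..T, (1 / (2 * ν) * Q τ + ε / ν) := by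
    refine intervalIntegral.integral_mono_on hT (Continuous.intervalIntegrable (by fun_prop) _ _)
      (Continuous.intervalIntegrable (by fun_prop) _ _) fun τ hτ => ?_
    have h1 : Real.exp (-ν * τ) ≤ 1 := Real.exp_le_one_iff.2 (by nlinarith [hτ.1])
    have h2 := hQ0 τ
    have h3 : 0 ≤ 1 / (2 * ν) * Q τ + ε / ν := by positivity
    exact mul_le_of_le_one_left h3 h1
  rw [integral_add_of_continuous (by fun_prop) (by fun_prop),
    intervalIntegral.integral_const_mul (1 / (2 * ν)), intervalIntegral.integral_const, sub_zero,
    smul_eq_mul, ← mul_div_assoc] at hI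
  have h4 := mul_le_mul_of_nonneg_left (hfin.trans (add_le_add le_rfl hI)) (Real.exp_pos (ν * T)).le
  rwa [← mul_assoc, ← Real.exp_add, show ν * T + -ν * T = 0 by ring, Real.exp_zero, one_mul] at h4

theorem le_of_forall_le_add_mul {a b c : ℝ} (h : ∀ ε, 0 < ε → a ≤ b + c * ε) : a ≤ b := by
  refine le_of_forall_pos_le_add fun δ hδ => ?_
  have hc : 0 < |c| + 1 := by positivity
  refine (h (δ / (|c| + 1)) (by positivity)).trans ?_
  have h1 : c * (δ / (|c| + 1)) ≤ (|c| + 1) * (δ / (|c| + 1)) := by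
    gcongr; linarith [le_abs_self c]
  rw [mul_div_cancel₀ _ hc.ne'] at h1
  linarith

theorem integral_sq_le_two_mul {c s a b : ℝ → ℝ} (cc : Continuous c) (cs : Continuous s)
    (ca : Continuous a) (cb : Continuous b) :
    ∫ x in (-π)..π, (a x ^ 2 + b x ^ 2) ≤ 2 * (∫ x in (-π)..π, (c x ^ 2 + s x ^ 2))
      + 2 * ∫ x in (-π)..π, ((c x - a x) ^ 2 + (s x - b x) ^ 2) := by
  rw [← intervalIntegral.integral_const_mul 2, ← intervalIntegral.integral_const_mul 2,
    ← integral_add_of_continuous (by fun_prop) (by fun_prop)]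
  refine integral_mono_of_continuous (by fun_prop) (by fun_prop) neg_pi_le_pi fun x => ?_
  nlinarith [sq_nonneg (2 * c x - a x), sq_nonneg (2 * s x - b x)]

theorem sq_integral_add_mul_le {c s g₁ g₂ : ℝ → ℝ} (cc : Continuous c) (cs : Continuous s)
    (cg₁ : Continuous g₁) (cg₂ : Continuous g₂) :
    (∫ x in (-π)..π, (c x * g₁ x + s x * g₂ x)) ^ 2
      ≤ (∫ x in (-π)..π, (c x ^ 2 + s x ^ 2)) * ∫ x in (-π)..π, (g₁ x ^ 2 + g₂ x ^ 2) := by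
  rw [integral_add_of_continuous (by fun_prop) (by fun_prop),
    integral_add_of_continuous (by fun_prop) (by fun_prop),
    integral_add_of_continuous (by fun_prop) (by fun_prop)]
  have h1 := sq_integral_mul_le cc cg₁ neg_pi_le_pi
  have h2 := sq_integral_mul_le cs cg₂ neg_pi_le_pi
  have hn : ∀ g : ℝ → ℝ, 0 ≤ ∫ x in (-π)..π, g x ^ 2 := fun g =>
    integral_nonneg_of_forall neg_pi_le_pi fun x => sq_nonneg _
  have n1 := hn c
  have n2 := hn s
  have n3 := hn g₁
  have n4 := hn g₂
  set X := ∫ x in (-π)..π, c x * g₁ x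
  set Y := ∫ x in (-π)..π, s x * g₂ x
  set A := ∫ x in (-π)..π, c x ^ 2
  set B := ∫ x in (-π)..π, s x ^ 2
  set C := ∫ x in (-π)..π, g₁ x ^ 2
  set D := ∫ x in (-π)..π, g₂ x ^ 2
  have h3 : (2 * (X * Y)) ^ 2 ≤ (A * D + B * C) ^ 2 := by
    have h4 : X ^ 2 * Y ^ 2 ≤ A * C * (B * D) := mul_le_mul h1 h2 (sq_nonneg _) (by positivity)
    nlinarith [sq_nonneg (A * D - B * C)]
  have h5 := (abs_le.1 (abs_le_of_sq_le_sq h3 (by positivity))).2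
  nlinarith

/-- Inviscid mixing at times `T ≤ (Δ / ν)^{1/2}`: pairings with `H¹` functions decay like `T^{-1/2}`,
up to the contribution of the force. -/
theorem ForcedFlow.sq_pairing_le {ν q : ℝ} {c s c₁ s₁ c₂ s₂ P R P₁ R₁ ct st : ℝ → ℝ → ℝ}
    {Q : ℝ → ℝ} (D : ForcedFlow ν q c s c₁ s₁ c₂ s₂ P R P₁ R₁ ct st Q) (hν : 0 < ν) (hq : 1 ≤ q)
    {T Δ : ℝ} (hT : 1 ≤ T) (hΔ : ν * T ^ 2 ≤ Δ) (hQ0 : ∀ τ, 0 ≤ Q τ)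
    {c₁₀ s₁₀ : ℝ → ℝ} (hc : ∀ x, HasDerivAt (c 0) (c₁₀ x) x) (hs : ∀ x, HasDerivAt (s 0) (s₁₀ x) x)
    (cc₁ : Continuous c₁₀) (cs₁ : Continuous s₁₀)
    (pc : Function.Periodic (c 0) (2 * π)) (ps : Function.Periodic (s 0) (2 * π))
    {g₁ g₂ g₁' g₂' : ℝ → ℝ}
    (hg₁ : ∀ x, HasDerivAt g₁ (g₁' x) x) (hg₂ : ∀ x, HasDerivAt g₂ (g₂' x) x)
    (cg₁' : Continuous g₁') (cg₂' : Continuous g₂')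
    (pg₁ : Function.Periodic g₁ (2 * π)) (pg₂ : Function.Periodic g₂ (2 * π)) :
    (∫ x in (-π)..π, (c T x * g₁ x + s T x * g₂ x)) ^ 2
      ≤ 700000 * Real.exp (10 * Δ) * (1 + Δ) * (1 / T * ((∫ x in (-π)..π, (c 0 x ^ 2 + s 0 x ^ 2))
          + ∫ x in (-π)..π, (c₁₀ x ^ 2 + s₁₀ x ^ 2)) + 1 / ν * ∫ τ in (0 : ℝ)..T, Q τ)
        * ((∫ x in (-π)..π, (g₁ x ^ 2 + g₂ x ^ 2)) + ∫ x in (-π)..π, (g₁' x ^ 2 + g₂' x ^ 2)) := by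
  have hT0 : 0 < T := by linarith
  have hΔ0 : 0 ≤ Δ := le_trans (by positivity) hΔ
  have ct' : ∀ {g g' : ℝ → ℝ}, (∀ x, HasDerivAt g (g' x) x) → Continuous g := fun h =>
    continuous_iff_continuousAt.2 fun x => (h x).continuousAt
  have cg₁ := ct' hg₁
  have cg₂ := ct' hg₂
  have cc0 := ct' hc
  have cs0 := ct' hs
  set G := (∫ x in (-π)..π, (g₁ x ^ 2 + g₂ x ^ 2)) + ∫ x in (-π)..π, (g₁' x ^ 2 + g₂' x ^ 2) with hG
  set N := (∫ x in (-π)..π, (c 0 x ^ 2 + s 0 x ^ 2)) + ∫ x in (-π)..π, (c₁₀ x ^ 2 + s₁₀ x ^ 2) with hN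
  set I := ∫ τ in (0 : ℝ)..T, Q τ with hI
  set E := Real.exp (10 * Δ) * (1 + Δ) with hE
  have hG' : 0 ≤ ∫ x in (-π)..π, (g₁' x ^ 2 + g₂' x ^ 2) :=
    integral_nonneg_of_forall neg_pi_le_pi fun x => by positivity
  have hG0 : 0 ≤ G := add_nonneg (integral_nonneg_of_forall neg_pi_le_pi fun x => by positivity) hG'
  have hN0 : 0 ≤ N := add_nonneg (integral_nonneg_of_forall neg_pi_le_pi fun x => by positivity)
    (integral_nonneg_of_forall neg_pi_le_pi fun x => by positivity)
  have hI0 : 0 ≤ I := integral_nonneg_of_forall hT0.le hQ0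
  refine le_of_forall_le_add_mul (c := (824 * E * (1640 / T + 10 * T / ν)
    + 2 * (E * (1 + T / ν))) * G) fun ε hε => ?_
  obtain ⟨K, A, hA0, hA1⟩ := exists_trigSum_approx hc hs cc₁ cs₁ pc ps hε
  obtain ⟨a, b, a₁, b₁, a₂, b₂, a₃, b₃, r₁, r₂, r₁', r₂', F, hr, hr', hdat⟩ :=
    exists_linearFlow hν.le hq hT0.le hε K A
  have sl : ∀ {g : ℝ → ℝ → ℝ}, Continuous (fun z : ℝ × ℝ => g z.1 z.2) → ∀ τ, Continuous (g τ) :=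
    fun hg τ => hg.comp (by fun_prop : Continuous fun x : ℝ => (τ, x))
  have caT := sl F.ca T
  have cbT := sl F.cb T
  have ccT : Continuous (c T) := D.cc.comp_continuous (f := fun x : ℝ => (T, x)) (by fun_prop)
    fun x => ⟨hT0.le, mem_univ _⟩
  have csT : Continuous (s T) := D.cs.comp_continuous (f := fun x : ℝ => (T, x)) (by fun_prop)
    fun x => ⟨hT0.le, mem_univ _⟩
  have h1 := F.sq_pairing_le hν hq hT hΔ hε.le hr hr' hg₁ hg₂ cg₁' cg₂' pg₁ pg₂
  have h2 := D.integral_sq_sub_le F hν hT0.le hε.le hQ0 hr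
  have hA0' : ∫ x in (-π)..π, ((c 0 x - a 0 x) ^ 2 + (s 0 x - b 0 x) ^ 2) ≤ ε := by
    refine le_of_eq_of_le ?_ hA0
    congr 1; ext x
    rw [(hdat x).1, (hdat x).2.1]
  have hA1' : ∫ x in (-π)..π, ((c₁₀ x - a₁ 0 x) ^ 2 + (s₁₀ x - b₁ 0 x) ^ 2) ≤ ε := by
    refine le_of_eq_of_le ?_ hA1
    congr 1; ext x
    rw [(hdat x).2.2.1, (hdat x).2.2.2]
  have h3 := integral_sq_le_two_mul cc0 cs0 (sl F.ca 0) (sl F.cb 0)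
  have h4 := integral_sq_le_two_mul cc₁ cs₁ (sl F.ca₁ 0) (sl F.cb₁ 0)
  have h5 : (∫ x in (-π)..π, (a 0 x ^ 2 + b 0 x ^ 2)) + ∫ x in (-π)..π, (a₁ 0 x ^ 2 + b₁ 0 x ^ 2)
      ≤ 2 * N + 4 * ε := by rw [hN]; linarith
  -- the difference is controlled by the Cauchy–Schwarz inequality
  set H := ∫ x in (-π)..π, ((c T x - a T x) ^ 2 + (s T x - b T x) ^ 2) with hH
  have h6 : (∫ x in (-π)..π, ((c T x - a T x) * g₁ x + (s T x - b T x) * g₂ x)) ^ 2 ≤ H * G := by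
    refine (sq_integral_add_mul_le (by fun_prop) (by fun_prop) cg₁ cg₂).trans ?_
    have : 0 ≤ H := integral_nonneg_of_forall neg_pi_le_pi fun x => by positivity
    refine mul_le_mul_of_nonneg_left ?_ this
    linarith
  have h7 : ∫ x in (-π)..π, (c T x * g₁ x + s T x * g₂ x)
      = (∫ x in (-π)..π, (a T x * g₁ x + b T x * g₂ x))
        + ∫ x in (-π)..π, ((c T x - a T x) * g₁ x + (s T x - b T x) * g₂ x) := by
    rw [← integral_add_of_continuous (by fun_prop) (by fun_prop)]
    congr 1; ext x; ring
  have hE1 : Real.exp (ν * T) ≤ E := by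
    have e1 : ν * T ≤ 10 * Δ := by
      have : ν * T ≤ ν * T ^ 2 := by gcongr; nlinarith
      linarith
    calc Real.exp (ν * T) ≤ Real.exp (10 * Δ) * 1 := by rw [mul_one]; exact Real.exp_le_exp.2 e1
      _ ≤ _ := by rw [hE]; gcongr; linarith
  have hE0 : 0 ≤ E := by positivity
  have h8 : H ≤ E * (ε + (1 / (2 * ν) * I + T * ε / ν)) := by
    refine h2.trans (mul_le_mul hE1 (by linarith) ?_ hE0)
    have n1 : 0 ≤ ∫ x in (-π)..π, ((c 0 x - a 0 x) ^ 2 + (s 0 x - b 0 x) ^ 2) :=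
      integral_nonneg_of_forall neg_pi_le_pi fun x => by positivity
    positivity
  have h9 : (∫ x in (-π)..π, (a T x * g₁ x + b T x * g₂ x)) ^ 2
      ≤ 412 * E * (410 / T * (2 * N + 4 * ε) + 10 * T * ε / ν) * G := by
    refine h1.trans ?_
    rw [hE, ← mul_assoc]
    gcongr
  have h10 : H * G ≤ E * (ε + (1 / (2 * ν) * I + T * ε / ν)) * G := by gcongr
  rw [h7]
  refine (add_sq_le (a := ∫ x in (-π)..π, (a T x * g₁ x + b T x * g₂ x))).trans ?_
  have h11 := mul_le_mul_of_nonneg_left (add_le_add h9 (h6.trans h10)) (by norm_num : (0 : ℝ) ≤ 2)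
  refine h11.trans ?_
  have h12 : 0 ≤ E * (1 / T * N) * G := by positivity
  have h13 : 0 ≤ E * (1 / ν * I) * G := by positivity
  have e1 : 2 * (412 * E * (410 / T * (2 * N + 4 * ε) + 10 * T * ε / ν) * G
      + E * (ε + (1 / (2 * ν) * I + T * ε / ν)) * G)
      = 675680 * (E * (1 / T * N) * G) + E * (1 / ν * I) * G
        + (824 * E * (1640 / T + 10 * T / ν) + 2 * (E * (1 + T / ν))) * G * ε := by
    field_simp; ring
  have e2 : 700000 * Real.exp (10 * Δ) * (1 + Δ) * (1 / T * N + 1 / ν * I) * G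
      = 700000 * (E * (1 / T * N) * G) + 700000 * (E * (1 / ν * I) * G) := by rw [hE]; ring
  rw [e1, e2]
  linarith

/-! ### Duality between `Ḣ⁻¹` and `Ḣ¹` on the Fourier side -/

namespace SmoothTorus

variable {h : Fun3}

theorem cont3 (H : SmoothTorus h) : Cont3 h := H.smooth.continuous

theorem hasFDerivAt (H : SmoothTorus h) (x₁ x₂ θ : ℝ) :
    HasFDerivAt (fun q : ℝ × ℝ × ℝ => h q.1 q.2.1 q.2.2)
      (fderiv ℝ (fun q : ℝ × ℝ × ℝ => h q.1 q.2.1 q.2.2) (x₁, x₂, θ)) (x₁, x₂, θ) :=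
  (H.smooth.differentiable (by simp) _).hasFDerivAt

theorem hasDerivAt_fderiv_x₁ (H : SmoothTorus h) (x₁ x₂ θ : ℝ) :
    HasDerivAt (fun s => h s x₂ θ)
      (fderiv ℝ (fun q : ℝ × ℝ × ℝ => h q.1 q.2.1 q.2.2) (x₁, x₂, θ) (1, 0, 0)) x₁ :=
  (H.hasFDerivAt x₁ x₂ θ).comp_hasDerivAt (f := fun s => (s, x₂, θ)) x₁
    ((hasDerivAt_id _).prodMk ((hasDerivAt_const _ _).prodMk (hasDerivAt_const _ _)))

theorem hasDerivAt_fderiv_x₂ (H : SmoothTorus h) (x₁ x₂ θ : ℝ) :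
    HasDerivAt (fun s => h x₁ s θ)
      (fderiv ℝ (fun q : ℝ × ℝ × ℝ => h q.1 q.2.1 q.2.2) (x₁, x₂, θ) (0, 1, 0)) x₂ :=
  (H.hasFDerivAt x₁ x₂ θ).comp_hasDerivAt (f := fun s => (x₁, s, θ)) x₂
    ((hasDerivAt_const _ _).prodMk ((hasDerivAt_id _).prodMk (hasDerivAt_const _ _)))

theorem hasDerivAt_fderiv_θ (H : SmoothTorus h) (x₁ x₂ θ : ℝ) :
    HasDerivAt (fun s => h x₁ x₂ s)
      (fderiv ℝ (fun q : ℝ × ℝ × ℝ => h q.1 q.2.1 q.2.2) (x₁, x₂, θ) (0, 0, 1)) θ :=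
  (H.hasFDerivAt x₁ x₂ θ).comp_hasDerivAt (f := fun s => (x₁, x₂, s)) θ
    ((hasDerivAt_const _ _).prodMk ((hasDerivAt_const _ _).prodMk (hasDerivAt_id _)))

theorem continuous_fderiv (H : SmoothTorus h) (w : ℝ × ℝ × ℝ) :
    Continuous fun q : ℝ × ℝ × ℝ => fderiv ℝ (fun q : ℝ × ℝ × ℝ => h q.1 q.2.1 q.2.2) q w :=
  (H.smooth.continuous_fderiv (by simp)).clm_apply continuous_const

theorem cont3_dx₁ (H : SmoothTorus h) : Cont3 (dx₁ h) :=
  (H.continuous_fderiv (1, 0, 0)).congr fun _ => (H.hasDerivAt_fderiv_x₁ _ _ _).deriv.symm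

theorem cont3_dx₂ (H : SmoothTorus h) : Cont3 (dx₂ h) :=
  (H.continuous_fderiv (0, 1, 0)).congr fun _ => (H.hasDerivAt_fderiv_x₂ _ _ _).deriv.symm

theorem cont3_dθ (H : SmoothTorus h) : Cont3 (dθ h) :=
  (H.continuous_fderiv (0, 0, 1)).congr fun _ => (H.hasDerivAt_fderiv_θ _ _ _).deriv.symm

theorem hasDerivAt_dx₁ (H : SmoothTorus h) (x₁ x₂ θ : ℝ) :
    HasDerivAt (fun s => h s x₂ θ) (dx₁ h x₁ x₂ θ) x₁ :=
  (H.hasDerivAt_fderiv_x₁ x₁ x₂ θ).differentiableAt.hasDerivAt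

theorem hasDerivAt_dx₂ (H : SmoothTorus h) (x₁ x₂ θ : ℝ) :
    HasDerivAt (fun s => h x₁ s θ) (dx₂ h x₁ x₂ θ) x₂ :=
  (H.hasDerivAt_fderiv_x₂ x₁ x₂ θ).differentiableAt.hasDerivAt

theorem hasDerivAt_dθ (H : SmoothTorus h) (x₁ x₂ θ : ℝ) :
    HasDerivAt (fun s => h x₁ x₂ s) (dθ h x₁ x₂ θ) θ :=
  (H.hasDerivAt_fderiv_θ x₁ x₂ θ).differentiableAt.hasDerivAt

theorem dθ_rem (H : SmoothTorus h) : dθ (rem h) = rem (dθ h) := by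
  funext x₁ x₂ θ
  exact ((H.hasDerivAt_dθ x₁ x₂ θ).sub (hasDerivAt_avg H.cont3 H.cont3_dθ H.hasDerivAt_dθ θ)).deriv

/-- The frequency-by-frequency Poincaré inequality. -/
theorem modeSq_le (H : SmoothTorus h) {k : ℤ × ℤ} (hk : k ≠ 0) :
    modeSq h k ≤ modeSq (dx₁ h) k + modeSq (dx₂ h) k := by
  have h1 : ∀ {m : ℤ} {h' : Fun3}, (∀ φ θ, mode h' k φ θ = -(m * mode h k (φ + π / 2) θ)) →
      modeSq h' k = (m : ℝ) ^ 2 * modeSq h k := by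
    intro m h' e
    rw [modeSq, modeSq, ← intervalIntegral.integral_const_mul]
    congr 1
    ext θ
    rw [e, e, neg_add_cancel, mode_add_pi_div_two]
    ring
  rw [h1 (mode_deriv_x₁ H.cont3 H.cont3_dx₁ H.periodic H.hasDerivAt_dx₁ k),
    h1 (mode_deriv_x₂ H.cont3 H.cont3_dx₂ H.periodic H.hasDerivAt_dx₂ k), ← add_mul]
  refine le_mul_of_one_le_left (modeSq_nonneg _ _) ?_
  have h2 : (1 : ℤ) ≤ k.1 ^ 2 + k.2 ^ 2 := by
    by_contra! hlt
    have e1 : k.1 ^ 2 = 0 := by have := sq_nonneg k.1; have := sq_nonneg k.2; omega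
    have e2 : k.2 ^ 2 = 0 := by have := sq_nonneg k.1; have := sq_nonneg k.2; omega
    exact hk (Prod.ext (pow_eq_zero_iff two_ne_zero |>.1 e1) (pow_eq_zero_iff two_ne_zero |>.1 e2))
  exact_mod_cast h2

theorem sq_normGrad (h : Fun3) : normGrad h ^ 2 = (integral3 fun x₁ x₂ θ => dx₁ h x₁ x₂ θ ^ 2)
    + (integral3 fun x₁ x₂ θ => dx₂ h x₁ x₂ θ ^ 2) + integral3 fun x₁ x₂ θ => dθ h x₁ x₂ θ ^ 2 := by
  rw [normGrad, Real.sq_sqrt (by positivity), normL2, normL2, normL2,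
    Real.sq_sqrt (integral3_nonneg fun _ _ _ => sq_nonneg _),
    Real.sq_sqrt (integral3_nonneg fun _ _ _ => sq_nonneg _),
    Real.sq_sqrt (integral3_nonneg fun _ _ _ => sq_nonneg _)]

theorem sum_modeSq_le (H : SmoothTorus h) {K : Finset (ℤ × ℤ)} (hK : (0 : ℤ × ℤ) ∉ K) :
    ∑ k ∈ K, (modeSq h k + modeSq (dθ h) k) ≤ (2 * π) ^ 2 * normGrad h ^ 2 := by
  have h1 := ((hasSum_modeSq H.cont3_dx₁).add (hasSum_modeSq H.cont3_dx₂)).add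
    (hasSum_modeSq H.cont3_dθ)
  rw [← mul_add, ← mul_add, ← sq_normGrad] at h1
  refine le_trans (Finset.sum_le_sum fun k hk => ?_) (sum_le_hasSum K (fun k _ =>
    add_nonneg (add_nonneg (modeSq_nonneg _ _) (modeSq_nonneg _ _)) (modeSq_nonneg _ _)) h1)
  have := H.modeSq_le (ne_of_mem_of_not_mem hk hK)
  linarith

/-- The norm of `(h_≠, ∂_θ h_≠)` is part of the `H¹` norm of `h_≠`. -/
theorem remSq_add_remSq_dθ_le (H : SmoothTorus h) :
    remSq h + remSq (dθ h) ≤ normH1 (rem h) ^ 2 := by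
  have h1 : normH1 (rem h) ^ 2 = remSq h + normGrad (rem h) ^ 2 := by
    rw [normH1, Real.sq_sqrt (by positivity), normL2,
      Real.sq_sqrt (integral3_nonneg fun _ _ _ => sq_nonneg _), remSq]
  rw [h1, sq_normGrad, H.dθ_rem]
  have h2 : 0 ≤ integral3 fun x₁ x₂ θ => dx₁ (rem h) x₁ x₂ θ ^ 2 :=
    integral3_nonneg fun _ _ _ => sq_nonneg _
  have h3 : 0 ≤ integral3 fun x₁ x₂ θ => dx₂ (rem h) x₁ x₂ θ ^ 2 :=
    integral3_nonneg fun _ _ _ => sq_nonneg _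
  rw [remSq, remSq]
  linarith

end SmoothTorus

/-- The pairing of the Fourier modes `k` of two functions. -/
noncomputable def modePairing (h g : Fun3) (k : ℤ × ℤ) : ℝ :=
  ∫ θ in (-π)..π, (mode h k 0 θ * mode g k 0 θ + mode h k (-(π / 2)) θ * mode g k (-(π / 2)) θ)

theorem hasSum_modePairing {h g : Fun3} (hh : Cont3 h) (hg : Cont3 g) :
    HasSum (modePairing h g) ((2 * π) ^ 2 * integral3 fun x₁ x₂ θ => h x₁ x₂ θ * g x₁ x₂ θ) := by
  have h1 := ((hasSum_modeSq (hh.add hg)).sub (hasSum_modeSq (hh.sub hg))).mul_left (1 / 4)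
  refine HasSum.of_eq h1 (fun k => ?_) ?_
  · have c1 := hh.continuous_mode k 0
    have c2 := hh.continuous_mode k (-(π / 2))
    have c3 := hg.continuous_mode k 0
    have c4 := hg.continuous_mode k (-(π / 2))
    simp only [modeSq, mode_add hh hg, mode_sub hh hg, modePairing]
    rw [← integral_sub_of_continuous (by fun_prop) (by fun_prop),
      ← intervalIntegral.integral_const_mul]
    congr 1
    ext θ
    ring
  · have h2 := integral3_add ((hh.sub hg).pow 2) ((hh.mul hg).const_mul 4)
    have h3 : integral3 (fun x₁ x₂ θ => (h x₁ x₂ θ + g x₁ x₂ θ) ^ 2)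
        = integral3 (fun x₁ x₂ θ => (h x₁ x₂ θ - g x₁ x₂ θ) ^ 2)
          + integral3 (fun x₁ x₂ θ => 4 * (h x₁ x₂ θ * g x₁ x₂ θ)) := by
      rw [← h2]
      congr 1
      funext x₁ x₂ θ
      ring
    rw [h3, integral3_const_mul]
    ring

/-- Bounds for the pairings of single modes, by quantities that sum to `A`, bound the pairing of
`h_≠` with a test function. -/
theorem abs_integral3_rem_mul_le {h φ : Fun3} (hh : Cont3 h) (hφ : SmoothTorus φ)
    (hφ1 : normGrad φ ≤ 1) {X : ℤ × ℤ → ℝ} {A : ℝ} (hX0 : ∀ k, 0 ≤ X k)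
    (hX : ∀ K : Finset (ℤ × ℤ), (0 : ℤ × ℤ) ∉ K → ∑ k ∈ K, X k ≤ A)
    (hp : ∀ k ≠ 0, modePairing h φ k ^ 2 ≤ X k * (modeSq φ k + modeSq (dθ φ) k)) :
    |integral3 fun x₁ x₂ θ => rem h x₁ x₂ θ * φ x₁ x₂ θ| ≤ √A := by
  classical
  have hs := hasSum_modePairing hh.rem hφ.cont3
  have hY0 : ∀ k, 0 ≤ modeSq φ k + modeSq (dθ φ) k := fun k =>
    add_nonneg (modeSq_nonneg _ _) (modeSq_nonneg _ _)
  have hpi := Real.pi_gt_three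
  have hgrad : 0 ≤ normGrad φ := Real.sqrt_nonneg _
  have key : ∀ K : Finset (ℤ × ℤ), |∑ k ∈ K, modePairing (rem h) φ k| ≤ √A * (2 * π) := by
    intro K
    have h1 : ∑ k ∈ K, modePairing (rem h) φ k = ∑ k ∈ K.erase 0, modePairing (rem h) φ k := by
      symm
      refine Finset.sum_subset (Finset.erase_subset _ _) fun k hk hk' => ?_
      have : k = 0 := by
        by_contra hne
        exact hk' (Finset.mem_erase.2 ⟨hne, hk⟩)
      rw [this]
      simp [modePairing, mode_rem_zero hh]
    have h0 : (0 : ℤ × ℤ) ∉ K.erase 0 := Finset.notMem_erase _ _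
    rw [h1]
    calc |∑ k ∈ K.erase 0, modePairing (rem h) φ k|
        ≤ ∑ k ∈ K.erase 0, |modePairing (rem h) φ k| := Finset.abs_sum_le_sum_abs _ _
      _ ≤ ∑ k ∈ K.erase 0, √(X k) * √(modeSq φ k + modeSq (dθ φ) k) := by
          refine Finset.sum_le_sum fun k hk => ?_
          have hk0 := (Finset.mem_erase.1 hk).1
          rw [← Real.sqrt_mul (hX0 k)]
          refine Real.abs_le_sqrt (le_of_eq_of_le ?_ (hp k hk0))
          simp only [modePairing, mode_rem hh hk0]
      _ ≤ √(∑ k ∈ K.erase 0, X k) * √(∑ k ∈ K.erase 0, (modeSq φ k + modeSq (dθ φ) k)) :=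
          Real.sum_sqrt_mul_sqrt_le _ hX0 hY0
      _ ≤ √A * √((2 * π) ^ 2 * 1) := by
          gcongr
          · exact hX _ h0
          · refine (hφ.sum_modeSq_le h0).trans ?_
            gcongr
            nlinarith
      _ = √A * (2 * π) := by rw [mul_one, Real.sqrt_sq (by positivity)]
  have h2 : |(2 * π) ^ 2 * integral3 fun x₁ x₂ θ => rem h x₁ x₂ θ * φ x₁ x₂ θ| ≤ √A * (2 * π) :=
    le_of_tendsto hs.abs (Eventually.of_forall key)
  rw [abs_mul, abs_of_pos (by positivity)] at h2
  set I := |integral3 fun x₁ x₂ θ => rem h x₁ x₂ θ * φ x₁ x₂ θ|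
  have hI : 0 ≤ I := abs_nonneg _
  have h3 : 2 * π * I * (2 * π) ≤ √A * (2 * π) := by linarith
  have h4 := le_of_mul_le_mul_right h3 (by positivity)
  nlinarith

theorem sq_modePairing_le {h g : Fun3} (hh : Cont3 h) (hg : Cont3 g) (k : ℤ × ℤ) :
    modePairing h g k ^ 2 ≤ modeSq h k * modeSq g k :=
  sq_integral_add_mul_le (hh.continuous_mode _ _) (hh.continuous_mode _ _) (hg.continuous_mode _ _)
    (hg.continuous_mode _ _)

theorem sum_modeSq_le_remSq {h : Fun3} (hh : Cont3 h) {K : Finset (ℤ × ℤ)} (hK : (0 : ℤ × ℤ) ∉ K) :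
    ∑ k ∈ K, modeSq h k ≤ (2 * π) ^ 2 * remSq h := by
  rw [show ∑ k ∈ K, modeSq h k = ∑ k ∈ K, modeSq (rem h) k from
    Finset.sum_congr rfl fun k hk => (modeSq_rem hh (ne_of_mem_of_not_mem hk hK)).symm]
  exact sum_le_hasSum K (fun k _ => modeSq_nonneg _ _) (hasSum_modeSq_rem hh)

namespace ClassicalSolution

variable {Φ : ℝ → ℝ → ℝ} {Ψ Ψ' : ℝ → ℝ} {Λ : ℝ} {v : ℝ → ℝ} {κ ν : ℝ} {f₀ : Fun3} {f : ℝ → Fun3}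

/-- Mixing for a single mode, up to the contribution of the alignment. -/
theorem sq_modePairing_le (S : ClassicalSolution Φ Ψ v κ ν f₀ f) (B : InfluenceBounds Φ Ψ Ψ' Λ)
    (hv1 : ∀ t, 0 ≤ t → v t = 1) (hν : 0 < ν) (hf₀ : InitialDatum f₀) {T Δ : ℝ} (hT : 1 ≤ T)
    (hΔ : ν * T ^ 2 ≤ Δ) {k : ℤ × ℤ} (hk : k ≠ 0) {φ : Fun3} (hφ : SmoothTorus φ) :
    modePairing (f T) φ k ^ 2
      ≤ 700000 * Real.exp (10 * Δ) * (1 + Δ) * (1 / T * (modeSq f₀ k + modeSq (dθ f₀) k)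
        + 1 / ν * ∫ τ in (0 : ℝ)..T, κ ^ 2 * modeSq (flux Φ Ψ (f (max τ 0))) k)
      * (modeSq φ k + modeSq (dθ φ) k) := by
  obtain ⟨q, α, hq1, -, hrot⟩ := exists_rotation hk
  have hT0 : 0 ≤ T := by linarith
  have pm : ∀ {h : Fun3}, Periodic3 h → ∀ φ', Function.Periodic (fun x => mode h k φ' (x + α))
      (2 * π) := fun hp φ' x => by
    have := mode_periodic hp k φ' (x + α)
    simp only [← this]; congr 1; ring
  have hI : ∀ {h : Fun3}, Periodic3 h → ∫ x in (-π)..π,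
      (mode h k 0 (x + α) ^ 2 + mode h k (-(π / 2)) (x + α) ^ 2) = modeSq h k := fun hp =>
    integral_comp_add (f := fun θ => mode _ k 0 θ ^ 2 + mode _ k (-(π / 2)) θ ^ 2)
      (fun θ => by simp only [mode_periodic hp k _ θ]) α
  have hjoint : ∀ {U : Set ℝ} {F : ℝ → Fun3}, ContT U F → ∀ φ', ContinuousOn
      (fun p : ℝ × ℝ => mode (F p.1) k φ' (p.2 + α)) (U ×ˢ univ) := fun hF φ' =>
    (hF.mode k φ').comp (f := fun p : ℝ × ℝ => (p.1, p.2 + α)) (by fun_prop)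
      (fun p hp => ⟨hp.1, mem_univ _⟩)
  have hd : ∀ {h : Fun3}, SmoothTorus h → ∀ φ' x,
      HasDerivAt (fun x => mode h k φ' (x + α)) (mode (dθ h) k φ' (x + α)) x := fun H φ' x =>
    (hasDerivAt_mode H.cont3 H.cont3_dθ H.hasDerivAt_dθ k φ' (x + α)).comp_add_const x α
  have hcd : ∀ {h : Fun3}, SmoothTorus h → ∀ φ', Continuous fun x => mode (dθ h) k φ' (x + α) :=
    fun H φ' => (H.cont3_dθ.continuous_mode k φ').comp (by fun_prop)
  have hpd : ∀ {h : Fun3}, SmoothTorus h → Periodic3 (dθ h) := fun {h} H x₁ x₂ θ => by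
    refine ⟨?_, ?_, ?_⟩
    · simp only [dθ, (H.periodic x₁ x₂ _).1]
    · simp only [dθ, (H.periodic x₁ x₂ _).2.1]
    · have h1 : (fun s => h x₁ x₂ s) = fun s => h x₁ x₂ (s + 2 * π) :=
        funext fun s => (H.periodic x₁ x₂ s).2.2.symm
      simp only [dθ]
      conv_rhs => rw [h1]
      rw [deriv_comp_add_const]
  have cQ : Continuous fun τ : ℝ => κ ^ 2 * modeSq (flux Φ Ψ (f (max τ 0))) k :=
    continuous_const.mul ((continuousOn_modeSq (S.contT.flux B) k).comp_continuous
      (f := fun τ : ℝ => max τ 0) (by fun_prop) (fun τ => mem_Ici.2 (le_max_right _ _)))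
  have D : ForcedFlow ν q (fun t x => mode (f t) k 0 (x + α))
      (fun t x => mode (f t) k (-(π / 2)) (x + α))
      (fun t x => mode (dθ (f t)) k 0 (x + α)) (fun t x => mode (dθ (f t)) k (-(π / 2)) (x + α))
      (fun t x => mode (dθ (dθ (f t))) k 0 (x + α))
      (fun t x => mode (dθ (dθ (f t))) k (-(π / 2)) (x + α))
      (fun t x => -κ * mode (flux Φ Ψ (f t)) k 0 (x + α))
      (fun t x => -κ * mode (flux Φ Ψ (f t)) k (-(π / 2)) (x + α))
      (fun t x => -κ * mode (dθ (flux Φ Ψ (f t))) k 0 (x + α))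
      (fun t x => -κ * mode (dθ (flux Φ Ψ (f t))) k (-(π / 2)) (x + α))
      (fun t x => mode (dt f t) k 0 (x + α)) (fun t x => mode (dt f t) k (-(π / 2)) (x + α))
      (fun τ => κ ^ 2 * modeSq (flux Φ Ψ (f (max τ 0))) k) :=
    { data := fun t ht => S.modeData B ht k α
      cc := hjoint S.contT 0
      cs := hjoint S.contT _
      cct := hjoint S.contT_dt 0
      cst := hjoint S.contT_dt _
      tc := fun t ht x => S.hasDerivAt_mode_dt ht k 0 _
      ts := fun t ht x => S.hasDerivAt_mode_dt ht k _ _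
      eqc := fun t ht x => by
        have h1 := S.mode_dt B ht k 0 (x + α)
        rw [mode_add_pi_div_two, hv1 t ht.le, one_mul, hrot] at h1
        rw [h1]
        ring
      eqs := fun t ht x => by
        have h1 := S.mode_dt B ht k (-(π / 2)) (x + α)
        rw [neg_add_cancel, hv1 t ht.le, one_mul, hrot] at h1
        rw [h1]
        ring
      cQ := cQ
      hQ := fun t ht => by
        simp only [mul_pow, neg_sq, ← mul_add, intervalIntegral.integral_const_mul,
          max_eq_left ht.le]
        rw [hI ((S.periodic t ht.le).flux B)] }
  have key := D.sq_pairing_le hν hq1 hT hΔ (fun τ => mul_nonneg (sq_nonneg _) (modeSq_nonneg _ _))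
    (c₁₀ := fun x => mode (dθ f₀) k 0 (x + α)) (s₁₀ := fun x => mode (dθ f₀) k (-(π / 2)) (x + α))
    (by rw [S.init]; exact hd hf₀.smooth 0) (by rw [S.init]; exact hd hf₀.smooth _)
    (hcd hf₀.smooth _) (hcd hf₀.smooth _)
    (by rw [S.init]; exact pm hf₀.smooth.periodic _) (by rw [S.init]; exact pm hf₀.smooth.periodic _)
    (hd hφ 0) (hd hφ (-(π / 2))) (hcd hφ _) (hcd hφ _) (pm hφ.periodic _) (pm hφ.periodic _)
  rw [S.init, hI hf₀.smooth.periodic, hI (hpd hf₀.smooth), hI hφ.periodic, hI (hpd hφ)] at key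
  have e : ∫ x in (-π)..π, (mode (f T) k 0 (x + α) * mode φ k 0 (x + α)
      + mode (f T) k (-(π / 2)) (x + α) * mode φ k (-(π / 2)) (x + α)) = modePairing (f T) φ k :=
    integral_comp_add (f := fun θ => mode (f T) k 0 θ * mode φ k 0 θ
      + mode (f T) k (-(π / 2)) θ * mode φ k (-(π / 2)) θ) (fun θ => by
        simp only [mode_periodic (S.periodic T hT0) k _ θ, mode_periodic hφ.periodic k _ θ]) α
  rwa [e] at key

end ClassicalSolution

/-! ### Mixing -/

namespace ClassicalSolution

variable {Φ : ℝ → ℝ → ℝ} {Ψ Ψ' : ℝ → ℝ} {Λ : ℝ} {v : ℝ → ℝ} {κ ν : ℝ} {f₀ : Fun3} {f : ℝ → Fun3}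

/-- For `κ ≤ Cd ν` the averages stay bounded, so the alignment acts on `f_≠` with strength `O(ν)`. -/
theorem remSq_le_of_coupling_le (S : ClassicalSolution Φ Ψ v κ ν f₀ f)
    (B : InfluenceBounds Φ Ψ Ψ' Λ) (hv : SpeedProfile v) (hκ : 0 < κ) (hν : 0 < ν) (hν1 : ν ≤ 1)
    (hf₀ : InitialDatum f₀) {Cd Γ Δ T : ℝ} (hCd : 1 ≤ Cd) (hκν : κ ≤ Cd * ν)
    (hΓ : Γ = 2 * (2 * π) ^ 5 * Λ ^ 2 * Cd ^ 2 * (1 + max (avgSq f₀) (4 * Cd * Λ)))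
    (hT : 0 ≤ T) (hΔ : ν * T ≤ Δ) :
    remSq (f T) ≤ 102 / 100 * remSq f₀ * Real.exp (3 * Γ * Δ) ∧
    κ ^ 2 * (integral3 fun x₁ x₂ θ => fluxRem Φ Ψ (f T) x₁ x₂ θ ^ 2)
      ≤ ν ^ 2 * (Γ * (102 / 100 * remSq f₀ * Real.exp (3 * Γ * Δ))) := by
  set M := max (avgSq f₀) (4 * Cd * Λ) with hM
  have hM0 : 0 ≤ M := (avgSq_nonneg _).trans (le_max_left _ _)
  have hΓ0 : 0 ≤ Γ := by rw [hΓ]; positivity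
  have hR0 := remSq_nonneg f₀
  have hκ2 : κ ^ 2 ≤ Cd ^ 2 * ν ^ 2 := by rw [← mul_pow]; gcongr
  have hA : ∀ t, 0 ≤ t → avgSq (f t) ≤ M := fun t ht => S.avgSq_le_max B hκ hν hf₀ hCd hκν ht
  have h1 := S.remSq_le_exp B hv hν hν1 hf₀ (β := 3 * Γ * ν) hT (fun t ht => hA t ht.1) (by
    calc 6 * (2 * π) ^ 5 * Λ ^ 2 * κ ^ 2 / ν * (1 + M)
        ≤ 6 * (2 * π) ^ 5 * Λ ^ 2 * (Cd ^ 2 * ν ^ 2) / ν * (1 + M) := by gcongr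
      _ = 3 * Γ * ν := by rw [hΓ]; field_simp; ring)
  have h2 : (3 * Γ * ν - √ν / 5000) * T ≤ 3 * Γ * Δ := by
    have e1 : 0 ≤ √ν / 5000 * T := by positivity
    have e2 : 3 * Γ * (ν * T) ≤ 3 * Γ * Δ := by gcongr
    linarith
  have h3 : remSq (f T) ≤ 102 / 100 * remSq f₀ * Real.exp (3 * Γ * Δ) := by
    refine h1.trans ?_
    gcongr
  refine ⟨h3, ?_⟩
  have h4 := integral3_sq_fluxRem_le B (S.contT.cont3 (mem_Ici.2 hT))
    (S.integral3_abs_eq_one B hν hf₀ hT)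
  have h5 := hA T hT
  have h6 := avgSq_nonneg (f T)
  have h7 := remSq_nonneg (f T)
  calc κ ^ 2 * (integral3 fun x₁ x₂ θ => fluxRem Φ Ψ (f T) x₁ x₂ θ ^ 2)
      ≤ (Cd ^ 2 * ν ^ 2) * (2 * (2 * π) ^ 5 * Λ ^ 2 * (1 + avgSq (f T)) * remSq (f T)) :=
        mul_le_mul hκ2 h4 (integral3_nonneg fun _ _ _ => sq_nonneg _) (by positivity)
    _ ≤ (Cd ^ 2 * ν ^ 2) * (2 * (2 * π) ^ 5 * Λ ^ 2 * (1 + M)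
        * (102 / 100 * remSq f₀ * Real.exp (3 * Γ * Δ))) := by gcongr
    _ = _ := by rw [hΓ]; ring

/-- The bound of a pairing at times of order at least one: inviscid mixing and the Duhamel term. -/
theorem sq_pairing_le_of_one_le (S : ClassicalSolution Φ Ψ v κ ν f₀ f)
    (B : InfluenceBounds Φ Ψ Ψ' Λ) (hv : SpeedProfile v) (hv1 : ∀ t, 0 ≤ t → v t = 1)
    (hκ : 0 < κ) (hν : 0 < ν) (hν1 : ν ≤ 1)
    (hf₀ : InitialDatum f₀) {Cd Γ Δ T : ℝ} (hCd : 1 ≤ Cd) (hκν : κ ≤ Cd * ν)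
    (hΓ : Γ = 2 * (2 * π) ^ 5 * Λ ^ 2 * Cd ^ 2 * (1 + max (avgSq f₀) (4 * Cd * Λ)))
    (hT : 1 ≤ T) (hΔ : ν * T ^ 2 ≤ Δ) {φ : Fun3} (hφ : SmoothTorus φ) (hφ1 : normGrad φ ≤ 1) :
    |integral3 fun x₁ x₂ θ => rem (f T) x₁ x₂ θ * φ x₁ x₂ θ|
      ≤ √(700000 * Real.exp (10 * Δ) * (1 + Δ) * (2 * π) ^ 2 * (1 + 2 * Δ * Γ)
        * Real.exp (3 * Γ * Δ) * (1 / T * (remSq f₀ + remSq (dθ f₀)))) := by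
  have hT0 : 0 < T := by linarith
  have hΔ0 : 0 ≤ Δ := le_trans (by positivity) hΔ
  have hνT : ν * T ≤ Δ := by
    have : ν * T ≤ ν * T ^ 2 := by gcongr; nlinarith
    linarith
  have hM0 : 0 ≤ max (avgSq f₀) (4 * Cd * Λ) := (avgSq_nonneg _).trans (le_max_left _ _)
  have hΓ0 : 0 ≤ Γ := by rw [hΓ]; positivity
  have hR0 := remSq_nonneg f₀
  have hR0' := remSq_nonneg (dθ f₀)
  set W := 102 / 100 * remSq f₀ * Real.exp (3 * Γ * Δ) with hW
  have hW0 : 0 ≤ W := by positivity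
  have cQ : ∀ k, Continuous fun τ : ℝ => κ ^ 2 * modeSq (flux Φ Ψ (f (max τ 0))) k := fun k =>
    continuous_const.mul ((continuousOn_modeSq (S.contT.flux B) k).comp_continuous
      (f := fun τ : ℝ => max τ 0) (by fun_prop) (fun τ => mem_Ici.2 (le_max_right _ _)))
  refine abs_integral3_rem_mul_le (S.contT.cont3 (mem_Ici.2 hT0.le)) hφ hφ1
    (X := fun k => 700000 * Real.exp (10 * Δ) * (1 + Δ) * (1 / T * (modeSq f₀ k + modeSq (dθ f₀) k)
        + 1 / ν * ∫ τ in (0 : ℝ)..T, κ ^ 2 * modeSq (flux Φ Ψ (f (max τ 0))) k))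
    (fun k => ?_) (fun K hK => ?_) fun k hk => S.sq_modePairing_le B hv1 hν hf₀ hT hΔ hk hφ
  · have h1 : 0 ≤ ∫ τ in (0 : ℝ)..T, κ ^ 2 * modeSq (flux Φ Ψ (f (max τ 0))) k :=
      integral_nonneg_of_forall hT0.le fun τ => mul_nonneg (sq_nonneg _) (modeSq_nonneg _ _)
    have h2 := modeSq_nonneg f₀ k
    have h3 := modeSq_nonneg (dθ f₀) k
    positivity
  · rw [← Finset.mul_sum, Finset.sum_add_distrib, ← Finset.mul_sum, ← Finset.mul_sum,
      Finset.sum_add_distrib, ← intervalIntegral.integral_finsetSum fun k _ =>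
        (cQ k).intervalIntegrable _ _]
    have h1 := sum_modeSq_le_remSq hf₀.smooth.cont3 hK
    have h2 := sum_modeSq_le_remSq hf₀.smooth.cont3_dθ hK
    have h3 : ∫ τ in (0 : ℝ)..T, ∑ k ∈ K, κ ^ 2 * modeSq (flux Φ Ψ (f (max τ 0))) k
        ≤ ∫ _ in (0 : ℝ)..T, (2 * π) ^ 2 * (ν ^ 2 * (Γ * W)) := by
      refine intervalIntegral.integral_mono_on hT0.le
        ((continuous_finsetSum _ fun k _ => cQ k).intervalIntegrable _ _)
        (continuous_const.intervalIntegrable _ _) fun τ hτ => ?_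
      rw [max_eq_left hτ.1, ← Finset.mul_sum]
      have c := S.contT.cont3 (mem_Ici.2 hτ.1)
      have h4 : ∑ k ∈ K, modeSq (flux Φ Ψ (f τ)) k
          ≤ (2 * π) ^ 2 * integral3 fun x₁ x₂ θ => fluxRem Φ Ψ (f τ) x₁ x₂ θ ^ 2 := by
        rw [show ∑ k ∈ K, modeSq (flux Φ Ψ (f τ)) k = ∑ k ∈ K, modeSq (fluxRem Φ Ψ (f τ)) k from
          Finset.sum_congr rfl fun k hk => modeSq_flux B c (ne_of_mem_of_not_mem hk hK)]
        exact sum_le_hasSum K (fun k _ => modeSq_nonneg _ _) (hasSum_modeSq (c.fluxRem B))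
      have h5 := (S.remSq_le_of_coupling_le B hv hκ hν hν1 hf₀ hCd hκν hΓ hτ.1 (Δ := Δ)
        ((mul_le_mul_of_nonneg_left hτ.2 hν.le).trans hνT)).2
      calc _ ≤ κ ^ 2 * ((2 * π) ^ 2 * integral3 fun x₁ x₂ θ => fluxRem Φ Ψ (f τ) x₁ x₂ θ ^ 2) := by
            gcongr
        _ = (2 * π) ^ 2 * (κ ^ 2 * integral3 fun x₁ x₂ θ => fluxRem Φ Ψ (f τ) x₁ x₂ θ ^ 2) := by ring
        _ ≤ _ := by gcongr
    rw [intervalIntegral.integral_const, sub_zero, smul_eq_mul] at h3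
    -- the Duhamel term is of size `ν T ≤ Δ / T`
    have h6 : ν * T ≤ Δ * (1 / T) := by
      rw [mul_one_div, le_div_iff₀ hT0]; linarith
    have h7 : 1 / ν * (∫ τ in (0 : ℝ)..T, ∑ k ∈ K, κ ^ 2 * modeSq (flux Φ Ψ (f (max τ 0))) k)
        ≤ Δ * (1 / T) * ((2 * π) ^ 2 * (Γ * W)) := by
      calc _ ≤ 1 / ν * (T * ((2 * π) ^ 2 * (ν ^ 2 * (Γ * W)))) := by gcongr
        _ = ν * T * ((2 * π) ^ 2 * (Γ * W)) := by field_simp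
        _ ≤ _ := by gcongr
    set R := remSq f₀ + remSq (dθ f₀) with hR
    have h8 : W ≤ 2 * (R * Real.exp (3 * Γ * Δ)) := by
      have e1 : 102 / 100 * remSq f₀ ≤ 2 * R := by rw [hR]; linarith
      have e2 := mul_le_mul_of_nonneg_right e1 (Real.exp_pos (3 * Γ * Δ)).le
      rw [hW]; linarith
    have h9 : 1 ≤ Real.exp (3 * Γ * Δ) := Real.one_le_exp (by positivity)
    have hR0 : 0 ≤ R := by positivity
    have h10 : 1 / T * (∑ k ∈ K, modeSq f₀ k + ∑ k ∈ K, modeSq (dθ f₀) k)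
        ≤ 1 / T * ((2 * π) ^ 2 * (R * Real.exp (3 * Γ * Δ))) := by
      have e1 : R ≤ R * Real.exp (3 * Γ * Δ) := le_mul_of_one_le_right hR0 h9
      have e2 := mul_le_mul_of_nonneg_left e1 (by positivity : 0 ≤ (2 * π) ^ 2)
      gcongr
      rw [hR] at e2 ⊢
      linarith
    have h11 : Δ * (1 / T) * ((2 * π) ^ 2 * (Γ * W))
        ≤ Δ * (1 / T) * ((2 * π) ^ 2 * (Γ * (2 * (R * Real.exp (3 * Γ * Δ))))) := by gcongr
    have h12 := mul_le_mul_of_nonneg_left (add_le_add h10 (h7.trans h11))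
      (by positivity : 0 ≤ 700000 * Real.exp (10 * Δ) * (1 + Δ))
    refine h12.trans_eq ?_
    ring

/-- The `Ḣ⁻¹` norm of `f_≠` decays like `t^{-1/2}` up to times of order `ν^{-1/2}`. -/
theorem mixing (S : ClassicalSolution Φ Ψ v κ ν f₀ f)
    (B : InfluenceBounds Φ Ψ Ψ' Λ) (hv : SpeedProfile v) (hv1 : ∀ t, 0 ≤ t → v t = 1)
    (hκ : 0 < κ) (hν : 0 < ν) (hν1 : ν ≤ 1)
    (hf₀ : InitialDatum f₀) {Cd Γ Δ T : ℝ} (hCd : 1 ≤ Cd) (hκν : κ ≤ Cd * ν)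
    (hΓ : Γ = 2 * (2 * π) ^ 5 * Λ ^ 2 * Cd ^ 2 * (1 + max (avgSq f₀) (4 * Cd * Λ)))
    (hT : 0 < T) (hΔ1 : 1 ≤ Δ) (hΔ : ν * T ^ 2 ≤ Δ) :
    normHneg1 (rem (f T)) ≤ ENNReal.ofReal (√(700000 * Real.exp (10 * Δ) * (1 + Δ) * (2 * π) ^ 2
      * (1 + 2 * Δ * Γ) * Real.exp (3 * Γ * Δ)) * (normH1 (rem f₀) / √T)) := by
  refine iSup₂_le fun φ hφ => ENNReal.ofReal_le_ofReal ?_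
  have hM0 : 0 ≤ max (avgSq f₀) (4 * Cd * Λ) := (avgSq_nonneg _).trans (le_max_left _ _)
  have hΓ0 : 0 ≤ Γ := by rw [hΓ]; positivity
  set C := 700000 * Real.exp (10 * Δ) * (1 + Δ) * (2 * π) ^ 2
    * (1 + 2 * Δ * Γ) * Real.exp (3 * Γ * Δ) with hC
  have hC0 : 0 ≤ C := by positivity
  have hH := hf₀.smooth.remSq_add_remSq_dθ_le
  have hH0 : 0 ≤ normH1 (rem f₀) := Real.sqrt_nonneg _
  have hR0 := remSq_nonneg f₀
  have hR0' := remSq_nonneg (dθ f₀)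
  suffices h : |integral3 fun x₁ x₂ θ => rem (f T) x₁ x₂ θ * φ x₁ x₂ θ|
      ≤ √(C * (1 / T * (remSq f₀ + remSq (dθ f₀)))) by
    refine h.trans ?_
    rw [Real.sqrt_mul hC0]
    gcongr
    rw [Real.sqrt_le_left (by positivity), div_pow, Real.sq_sqrt hT.le, one_div_mul_eq_div]
    gcongr
  rcases le_total 1 T with h1 | h1
  · exact S.sq_pairing_le_of_one_le B hv hv1 hκ hν hν1 hf₀ hCd hκν hΓ h1 hΔ hφ.1 hφ.2
  · -- at short times it is enough that the `L²` norm is bounded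
    have c := S.contT.cont3 (mem_Ici.2 hT.le)
    have h2 := (S.remSq_le_of_coupling_le B hv hκ hν hν1 hf₀ hCd hκν hΓ hT.le (Δ := Δ)
      (by nlinarith)).1
    refine (abs_integral3_rem_mul_le c hφ.1 hφ.2 (X := modeSq (f T)) (fun k => modeSq_nonneg _ _)
      (fun K hK => sum_modeSq_le_remSq c hK) fun k _ => ?_).trans ?_
    · refine (Vicsek.sq_modePairing_le c hφ.1.cont3 k).trans ?_
      have e1 := modeSq_nonneg (dθ φ) k
      have e2 := modeSq_nonneg (f T) k
      gcongr
      linarith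
    · refine Real.sqrt_le_sqrt ?_
      have e1 : 1 ≤ 1 / T := by rw [le_div_iff₀ hT]; linarith
      have e2 : 1 ≤ Real.exp (10 * Δ) := Real.one_le_exp (by positivity)
      have e3 : remSq f₀ ≤ 1 / T * (remSq f₀ + remSq (dθ f₀)) := by
        calc remSq f₀ ≤ remSq f₀ + remSq (dθ f₀) := by linarith
          _ ≤ _ := le_mul_of_one_le_left (by positivity) e1
      set R := 1 / T * (remSq f₀ + remSq (dθ f₀)) with hR
      have hR1 : 0 ≤ R := hR0.trans e3
      calc (2 * π) ^ 2 * remSq (f T)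
          ≤ (2 * π) ^ 2 * (102 / 100 * R * Real.exp (3 * Γ * Δ)) := by
            refine mul_le_mul_of_nonneg_left (h2.trans ?_) (by positivity)
            gcongr
        _ = 102 / 100 * 1 * 1 * (2 * π) ^ 2 * 1 * Real.exp (3 * Γ * Δ) * R := by ring
        _ ≤ C * R := by
            rw [hC]
            gcongr
            · norm_num
            · linarith
            · have : 0 ≤ 2 * Δ * Γ := by positivity
              linarith

end ClassicalSolution

theorem sq_two_mul_sqrt_mul_exp {R : ℝ} (hR : 0 ≤ R) (x : ℝ) :
    (2 * √R * Real.exp (-x)) ^ 2 = 4 * R * Real.exp (-(2 * x)) := by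
  rw [mul_pow, mul_pow, Real.sq_sqrt hR, ← Real.exp_nat_mul]
  congr 2
  · norm_num
  · push_cast; ring

end Vicsek

theorem theorem1 :
    -- the universal constants
    ∃ C₁ δ : ℝ, 1 ≤ C₁ ∧ 0 < δ ∧ δ < 1 ∧
    ∀ (Φ : ℝ → ℝ → ℝ) (Ψ : ℝ → ℝ), Vicsek.SpatialInfluence Φ → Vicsek.AngularInfluence Ψ →
    -- the constants that depend on `Φ`, `Ψ` (and on the displayed arguments) only
    ∃ (C₂ : ℝ) (𝔞 : ℝ → ℝ) (C₃ : ℝ → ℝ → ℝ),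
      0 < C₂ ∧ (∀ r, 0 < 𝔞 r) ∧ (∀ c r, 0 < C₃ c r) ∧
    ∀ (v : ℝ → ℝ) (κ ν : ℝ) (f₀ : Vicsek.Fun3) (f : ℝ → Vicsek.Fun3),
      Vicsek.SpeedProfile v → 0 < κ → κ ≤ 1 → 0 < ν → ν ≤ 1 →
      Vicsek.InitialDatum f₀ → Vicsek.ClassicalSolution Φ Ψ v κ ν f₀ f →
      -- a) enhanced dissipation
      (∀ γ : ℝ, 0 < γ → κ ≤ ν ^ (5 / 6 + γ) → ν ^ (5 / 6 + γ) ≤ 𝔞 (Vicsek.normL2 f₀) →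
        ∀ t : ℝ, 0 ≤ t →
          Vicsek.normL2 (Vicsek.rem (f t))
              ≤ C₁ * Vicsek.normL2 (Vicsek.rem f₀) * Real.exp (-(δ * ν ^ (1 / 2 : ℝ) * t)) ∧
          Vicsek.normL2Angle (Vicsek.avg (f t))
              ≤ C₂ * (1 + Vicsek.normL2Angle (Vicsek.avg f₀))
                * (1 + κ ^ (1 / 2 : ℝ) / ν ^ (1 / 2 : ℝ))) ∧
      -- b) mixing
      ((∀ t : ℝ, 0 ≤ t → v t = 1) →
        ∀ Cd : ℝ, 1 ≤ Cd → κ ≤ Cd * ν →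
        ∀ t : ℝ, 0 < t → t ≤ δ⁻¹ * ν ^ (-(1 / 2) : ℝ) →
          Vicsek.normHneg1 (Vicsek.rem (f t))
            ≤ ENNReal.ofReal (C₃ Cd (Vicsek.normL2Angle (Vicsek.avg f₀))
                * (Vicsek.normH1 (Vicsek.rem f₀) / t ^ (1 / 2 : ℝ)))) := by
  refine ⟨2, 1 / 20000, by norm_num, by norm_num, by norm_num, fun Φ Ψ hΦ hΨ => ?_⟩
  obtain ⟨Ψ', Λ, B⟩ := Vicsek.exists_influenceBounds hΦ hΨ
  have hΛ := B.one_le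
  -- for `c ≥ 1`, the constants of `Vicsek.ClassicalSolution.mixing` at `νt² ≤ δ⁻² = 20000²`
  set Γ : ℝ → ℝ → ℝ := fun c r =>
    2 * (2 * π) ^ 5 * Λ ^ 2 * c ^ 2 * (1 + max (r ^ 2) (4 * c * Λ)) with hΓ
  have hΓ0 : ∀ c r, 0 ≤ Γ c r := fun c r => by
    have : 0 ≤ max (r ^ 2) (4 * c * Λ) := (sq_nonneg r).trans (le_max_left _ _)
    simp only [hΓ]
    positivity
  set Δ : ℝ := 20000 ^ 2 with hΔ
  refine ⟨4 * Λ, fun r => (1 / (1200000 * (2 * π) ^ 5 * Λ ^ 3 * (1 + r ^ 2) ^ 2)) ^ 10,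
    fun c r => √(700000 * Real.exp (10 * Δ) * (1 + Δ) * (2 * π) ^ 2
      * (1 + 2 * Δ * Γ c r) * Real.exp (3 * Γ c r * Δ)), by positivity, fun r => by positivity,
    fun c r => ?_, fun v κ ν f₀ f hv hκ hκ1 hν hν1 hf₀ S => ⟨?_, ?_⟩⟩
  · have := hΓ0 c r
    positivity
  · intro γ hγ h1 h2 t ht
    have h3 : κ ^ 6 ≤ ν ^ 5 := by
      have e1 : κ ≤ ν ^ (5 / 6 : ℝ) :=
        h1.trans (Real.rpow_le_rpow_of_exponent_ge hν hν1 (by linarith))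
      calc κ ^ 6 ≤ (ν ^ (5 / 6 : ℝ)) ^ 6 := by gcongr
        _ = ν ^ 5 := by
          rw [← Real.rpow_natCast, ← Real.rpow_mul hν.le, ← Real.rpow_natCast]
          norm_num
    obtain ⟨hA, hR⟩ := S.enhanced_dissipation B hv hκ hν hν1 hf₀ rfl h3 (h1.trans h2) ht
    rw [← Real.sqrt_eq_rpow, ← Real.sqrt_eq_rpow, ← Real.sqrt_div hκ.le]
    have hR0 := Vicsek.remSq_nonneg f₀
    constructor
    · change √(Vicsek.remSq (f t)) ≤ 2 * √(Vicsek.remSq f₀) * _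
      rw [Real.sqrt_le_left (by positivity), Vicsek.sq_two_mul_sqrt_mul_exp hR0]
      refine hR.trans ?_
      rw [show √ν / 10000 * t = 2 * (1 / 20000 * √ν * t) by ring]
      gcongr
      norm_num
    · change √(Vicsek.avgSq (f t)) ≤ 4 * Λ * (1 + √(Vicsek.avgSq f₀)) * (1 + √(κ / ν))
      rw [Real.sqrt_le_left (by positivity)]
      refine hA.trans ?_
      have ha := Real.sq_sqrt (Vicsek.avgSq_nonneg f₀)
      have ha0 := Real.sqrt_nonneg (Vicsek.avgSq f₀)
      have hx0 := Real.sqrt_nonneg (κ / ν)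
      set a := √(Vicsek.avgSq f₀)
      set x := √(κ / ν)
      rw [← ha]
      have e1 : 1 + a ^ 2 ≤ (1 + a) ^ 2 := by nlinarith
      have e2 : 1 + x ≤ (1 + x) ^ 2 := by nlinarith
      have e3 : Λ ≤ Λ ^ 2 := by nlinarith
      calc 3 + a ^ 2 + 4 * Λ * x ≤ 16 * Λ * (1 + a ^ 2) * (1 + x) := by
            nlinarith [mul_nonneg (by linarith : 0 ≤ Λ) hx0, sq_nonneg a,
              mul_nonneg (mul_nonneg (by linarith : 0 ≤ Λ) (sq_nonneg a)) hx0,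
              mul_le_mul_of_nonneg_right hΛ (sq_nonneg a)]
        _ ≤ 16 * Λ ^ 2 * (1 + a) ^ 2 * (1 + x) ^ 2 := by gcongr
        _ = _ := by ring
  · intro hv1 Cd hCd hκν t ht htν
    have hr : Vicsek.normL2Angle (Vicsek.avg f₀) ^ 2 = Vicsek.avgSq f₀ :=
      Real.sq_sqrt (Vicsek.avgSq_nonneg f₀)
    rw [← Real.sqrt_eq_rpow]
    refine S.mixing B hv hv1 hκ hν hν1 hf₀ hCd hκν (by simp only [hΓ, hr]) ht (by norm_num [hΔ]) ?_
    have e2 : (ν ^ (-(1 / 2) : ℝ)) ^ 2 = ν⁻¹ := by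
      rw [← Real.rpow_natCast, ← Real.rpow_mul hν.le, ← Real.rpow_neg_one]
      norm_num
    calc ν * t ^ 2 ≤ ν * ((1 / 20000)⁻¹ * ν ^ (-(1 / 2) : ℝ)) ^ 2 := by gcongr
      _ = Δ := by
        rw [mul_pow, e2, hΔ]
        field_simp
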